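/- Let $S^1=\mathbb R/2\pi\mathbb Z$ and let $g\in C^\infty(S^1;\mathbb C)$ be such that $\operatorname{Im} g$ has exactly two critical points, a minimum at $a$ and a maximum at $b$, with $a<b<a+2\pi$, $\operatorname{Im} g(a)<\operatorname{Im} g(b)$, both non-degenerate ($\operatorname{Im} g''(a)\neq0\neq\operatorname{Im} g''(b)$). For $h>0$ let $P_h=hD_x+g(x)$, $D_x=\frac1i\frac{d}{dx}$, be the unbounded operator on $L^2(S^1)$ with domain $H^1(S^1)$, with principal symbol $p(x,\xi)=\xi+g(x)$. Put $\Sigma=\overline{p(T^*S^1)}$, $d(z)=\operatorname{dist}(z,\partial\Sigma)$, $\langle \operatorname{Im} g\rangle=\frac1{2\pi}\int_{S^1}\operatorname{Im} g\,dx$ and $\{q,r\}=q'_\xi r'_x-q'_x r'_\xi$. For $z$ in the interior of $\Sigma$ let $\rho_\pm(z)=(x_\pm,\xi_\pm)$ be the two solutions of $p(x,\xi)=z$, labelled so that $\operatorname{Im} g(x_\pm)=\operatorname{Im} z$, $\pm\operatorname{Im} g'(x_\pm)<0$, $\xi_\pm=\operatorname{Re} z-\operatorname{Re} g(x_\pm)$,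 with real representatives $x_--2\pi<x_+<x_-$, and let $$S(z)=\min\Big(\operatorname{Im}\int_{x_+}^{x_-}(z-g(y))\,dy,\ \operatorname{Im}\int_{x_+}^{x_--2\pi}(z-g(y))\,dy\Big).$$ Let $Q(z)=(P_h-z)^*(P_h-z)$ and $\widetilde Q(z)=(P_h-z)(P_h-z)^*$, let $t_0^2(z)$ be the smallest eigenvalue of $Q(z)$, and let $e_0=e_0(z;h)$ and $f_0=f_0(z;h)$ be $L^2$-normalized eigenvectors of $Q(z)$ and $\widetilde Q(z)$, respectively, with eigenvalue $t_0^2(z)$. Let $\Omega\subset\Sigma$ be open and bounded and let $C>0$. Then there are constants $A>0$ and $h_0>0$ and a real function $K(z;h)$ such that, for all $0<h<h_0$ and for all $z$ in the open set $$\Omega_h=\{z\in\Omega:\ d(z)>A\,h^{2/3},\ |\operatorname{Im} z-\langle\operatorname{Im} g\rangle|>1/C\},$$ such $e_0,f_0$ exist and every choice of them satisfies $$|(e_0|f_0)|=\frac{\left(\frac i2\{p,\overline p\}(\rho_+)\,\frac i2\{\overline p,p\}(\rho_-)\right)^{1/4}}{\sqrt{\pi h}}\;|\partial_{\operatorname{Im}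 z}S(z)|\,\bigl(1+K(z;h)\bigr)\,e^{-S(z)/h}.$$ Moreover $K(\cdot;h)$ is $C^\infty$ on $\Omega_h$, and for every $\beta=(\beta_1,\beta_2)\in\mathbb N^2$ there is a constant $B_\beta$ such that for all $0<h<h_0$ and $z\in\Omega_h$ $$|\partial_z^{\beta_1}\partial_{\overline z}^{\beta_2}K(z;h)|\le B_\beta\, d(z)^{\frac{|\beta|}2-\frac34}\,h^{-|\beta|+\frac12}.$$ -/

import Mathlib

open MeasureTheory
open scoped ContDiff

noncomputable section

namespace Hager

instance factTwoPi : Fact (0 < 2 * Real.pi) := ⟨Real.two_pi_pos⟩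

/-- The circle `S¹ = ℝ / 2πℤ`. -/
abbrev S1 : Type := AddCircle (2 * Real.pi)

/-- `L²(S¹)` with respect to Lebesgue measure (total mass `2π`). -/
abbrev L2S1 : Type := Lp ℂ 2 (volume : Measure S1)

/-- The lift to `ℝ` (as a `2π`-periodic function) of `Im g`. -/
def imLift (g : S1 → ℂ) (x : ℝ) : ℝ := (g (x : S1)).im

/-- Admissible potentials `g ∈ C^∞(S¹; ℂ)`: `Im g` has exactly two critical points on the circle,
the minimum `a` and the maximum `b`, and both are non-degenerate. -/
structure IsPotential (g : S1 → ℂ) (a b : ℝ) : Prop where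
  smooth : ContDiff ℝ ∞ (fun x : ℝ => g (x : S1))
  lt_ab : a < b
  lt_ba : b < a + 2 * Real.pi
  critical_iff : ∀ x : ℝ, deriv (imLift g) x = 0 ↔ ((x : S1) = (a : S1) ∨ (x : S1) = (b : S1))
  min_lt_max : imLift g a < imLift g b
  nondegenerate_min : deriv (deriv (imLift g)) a ≠ 0
  nondegenerate_max : deriv (deriv (imLift g)) b ≠ 0

/-- The mean `⟨Im g⟩ = (2π)⁻¹ ∫_{S¹} Im g`. -/
def meanIm (g : S1 → ℂ) : ℝ := (2 * Real.pi)⁻¹ * ∫ y in (0 : ℝ)..(2 * Real.pi), imLift g y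

/-! ### The operator `P_h = h D_x + g` -/

/-- `v` is the weak (distributional) derivative of `u` on the circle. -/
def HasWeakDeriv (u v : L2S1) : Prop :=
  ∀ φ : ℝ → ℂ, ContDiff ℝ ∞ φ → Function.Periodic φ (2 * Real.pi) →
    ∫ x in (0 : ℝ)..(2 * Real.pi), u (x : S1) * deriv φ x
      = -∫ x in (0 : ℝ)..(2 * Real.pi), v (x : S1) * φ x

theorem ae_lift {p : S1 → Prop} (hp : ∀ᵐ x : S1, p x) :
    ∀ᵐ x : ℝ ∂(volume.restrict (Set.uIoc 0 (2 * Real.pi))), p (x : S1) := by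
  have h := (AddCircle.measurePreserving_mk (2 * Real.pi) 0).quasiMeasurePreserving.ae hp
  rw [Set.uIoc_of_le Real.two_pi_pos.le]
  simpa using h

theorem intervalIntegrable_mul (u : L2S1) (φ : ℝ → ℂ) (hφ : Continuous φ) :
    IntervalIntegrable (fun x : ℝ => u (x : S1) * φ x) volume 0 (2 * Real.pi) := by
  have hu : Integrable (fun x : S1 => u x) := (Lp.memLp u).integrable (by norm_num)
  have h := (AddCircle.measurePreserving_mk (2 * Real.pi) 0).integrable_comp_of_integrable hu
  have h2 : IntervalIntegrable (fun x : ℝ => u (x : S1)) volume 0 (2 * Real.pi) := by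
    rw [intervalIntegrable_iff_integrableOn_Ioc_of_le Real.two_pi_pos.le]
    simpa [IntegrableOn, Function.comp_def] using h
  exact h2.mul_continuousOn hφ.continuousOn

theorem integral_add_mul (u v : L2S1) (φ : ℝ → ℂ) (hφ : Continuous φ) :
    ∫ x in (0 : ℝ)..(2 * Real.pi), (u + v : L2S1) (x : S1) * φ x
      = (∫ x in (0 : ℝ)..(2 * Real.pi), u (x : S1) * φ x)
        + ∫ x in (0 : ℝ)..(2 * Real.pi), v (x : S1) * φ x := by
  rw [← intervalIntegral.integral_add (intervalIntegrable_mul u φ hφ)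
    (intervalIntegrable_mul v φ hφ)]
  refine intervalIntegral.integral_congr_ae_restrict ?_
  filter_upwards [ae_lift (Lp.coeFn_add u v)] with x hx
  rw [hx, Pi.add_apply, add_mul]

theorem integral_smul_mul (c : ℂ) (u : L2S1) (φ : ℝ → ℂ) :
    ∫ x in (0 : ℝ)..(2 * Real.pi), (c • u : L2S1) (x : S1) * φ x
      = c * ∫ x in (0 : ℝ)..(2 * Real.pi), u (x : S1) * φ x := by
  rw [← intervalIntegral.integral_const_mul]
  refine intervalIntegral.integral_congr_ae_restrict ?_
  filter_upwards [ae_lift (Lp.coeFn_smul c u)] with x hx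
  rw [hx, Pi.smul_apply, smul_eq_mul, mul_assoc]

theorem HasWeakDeriv.add {u v u' v' : L2S1} (h : HasWeakDeriv u v) (h' : HasWeakDeriv u' v') :
    HasWeakDeriv (u + u') (v + v') := by
  intro φ hφ hp
  rw [integral_add_mul _ _ _ (hφ.continuous_deriv (by simp)),
    integral_add_mul _ _ _ hφ.continuous, h φ hφ hp, h' φ hφ hp]
  ring

theorem HasWeakDeriv.smul (c : ℂ) {u v : L2S1} (h : HasWeakDeriv u v) :
    HasWeakDeriv (c • u) (c • v) := by
  intro φ hφ hp
  rw [integral_smul_mul, integral_smul_mul, h φ hφ hp]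
  ring

theorem HasWeakDeriv.zero : HasWeakDeriv 0 0 := by
  have h : HasWeakDeriv ((0 : ℂ) • (0 : L2S1)) ((0 : ℂ) • (0 : L2S1)) := by
    intro φ _ _
    rw [integral_smul_mul, integral_smul_mul]
    simp
  simpa using h

/-- Weak derivatives are unique. -/
theorem HasWeakDeriv.eq_zero {v : L2S1} (h : HasWeakDeriv 0 v) : v = 0 := by
  have hcoef : ∀ n : ℤ, fourierCoeff (fun x : S1 => v x) n = 0 := by
    intro n
    have hper : Function.Periodic (fun x : ℝ => fourier (T := 2 * Real.pi) (-n) (x : S1))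
        (2 * Real.pi) := by
      intro x
      simp only [AddCircle.coe_add_period]
    have hsm : ContDiff ℝ ∞ (fun x : ℝ => fourier (T := 2 * Real.pi) (-n) (x : S1)) := by
      simp only [fourier_coe_apply]
      exact (ContDiff.cexp (by
        refine ContDiff.div_const ?_ _
        exact contDiff_const.mul Complex.ofRealCLM.contDiff))
    have h1 := h _ hsm hper
    have h0 : ∫ x in (0 : ℝ)..(2 * Real.pi), (0 : L2S1) (x : S1) *
        deriv (fun x : ℝ => fourier (T := 2 * Real.pi) (-n) (x : S1)) x = 0 := by
      have h3 := integral_smul_mul 0 0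
        (deriv (fun x : ℝ => fourier (T := 2 * Real.pi) (-n) (x : S1)))
      rwa [zero_smul, zero_mul] at h3
    rw [h0] at h1
    rw [fourierCoeff_eq_intervalIntegral _ n 0, zero_add]
    have h2 : ∫ x in (0 : ℝ)..(2 * Real.pi), fourier (T := 2 * Real.pi) (-n) (x : S1) • v (x : S1)
        = 0 := by
      rw [← neg_eq_zero, h1]
      congr 1
      refine intervalIntegral.integral_congr fun x _ => ?_
      simp only [smul_eq_mul]
      ring
    rw [h2, smul_zero]
  have hac' : (volume : Measure S1) ≪ AddCircle.haarAddCircle := by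
    rw [AddCircle.volume_eq_smul_haarAddCircle]
    exact Measure.smul_absolutelyContinuous
  have hmem : MemLp (fun x : S1 => v x) 2 AddCircle.haarAddCircle := by
    have h1 : (AddCircle.haarAddCircle : Measure S1)
        = (ENNReal.ofReal (2 * Real.pi))⁻¹ • (volume : Measure S1) := by
      rw [AddCircle.volume_eq_smul_haarAddCircle, smul_smul,
        ENNReal.inv_mul_cancel (by simpa using Real.pi_pos) ENNReal.ofReal_ne_top, one_smul]
    rw [h1]
    exact (Lp.memLp v).smul_measure (by simpa using Real.pi_pos)
  have hz : hmem.toLp = 0 := by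
    apply fourierBasis.repr.injective
    ext n
    rw [fourierBasis_repr, map_zero]
    have : fourierCoeff (hmem.toLp : S1 → ℂ) n = fourierCoeff (fun x : S1 => v x) n := by
      unfold fourierCoeff
      refine integral_congr_ae ?_
      filter_upwards [hmem.coeFn_toLp] with x hx
      rw [hx]
    rw [this, hcoef n]
    rfl
  rw [Lp.eq_zero_iff_ae_eq_zero]
  have h3 : (fun x : S1 => v x) =ᵐ[AddCircle.haarAddCircle] 0 := by
    have h4 := hmem.coeFn_toLp
    rw [hz] at h4
    exact h4.symm.trans (Lp.coeFn_zero _ _ _)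
  exact hac'.ae_le h3

/-- The graph of `P_h = (h/i) d/dx + g` with domain `H¹(S¹)`: pairs `(u, w)` such that `u` has a
weak derivative `v ∈ L²` and `w = (h/i) v + g u`. -/
def graphP (g : S1 → ℂ) (h : ℝ) : Submodule ℂ (L2S1 × L2S1) where
  carrier := {q | ∃ v : L2S1, HasWeakDeriv q.1 v ∧
    ∀ᵐ x : S1, q.2 x = (h : ℂ) / Complex.I * v x + g x * q.1 x}
  zero_mem' := by
    refine ⟨0, HasWeakDeriv.zero, ?_⟩
    filter_upwards [Lp.coeFn_zero (E := ℂ) (p := 2) (μ := (volume : Measure S1))] with x hx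
    simp
  add_mem' := by
    rintro ⟨u, w⟩ ⟨u', w'⟩ ⟨v, hv, hw⟩ ⟨v', hv', hw'⟩
    refine ⟨v + v', hv.add hv', ?_⟩
    filter_upwards [hw, hw', Lp.coeFn_add u u', Lp.coeFn_add w w', Lp.coeFn_add v v']
      with x h1 h2 h3 h4 h5
    simp only [Prod.fst_add, Prod.snd_add] at *
    rw [h3, h4, h5, Pi.add_apply, Pi.add_apply, Pi.add_apply, h1, h2]
    ring
  smul_mem' := by
    rintro c ⟨u, w⟩ ⟨v, hv, hw⟩
    refine ⟨c • v, hv.smul c, ?_⟩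
    filter_upwards [hw, Lp.coeFn_smul c u, Lp.coeFn_smul c w, Lp.coeFn_smul c v] with x h1 h3 h4 h5
    simp only [Prod.smul_fst, Prod.smul_snd] at *
    rw [h3, h4, h5, Pi.smul_apply, Pi.smul_apply, Pi.smul_apply, h1]
    simp only [smul_eq_mul]
    ring

/-- The graph is single valued, so `opP` below really is the operator with this graph. -/
theorem graphP_single (g : S1 → ℂ) (h : ℝ) (q : L2S1 × L2S1) (hq : q ∈ graphP g h)
    (h0 : q.1 = 0) : q.2 = 0 := by
  obtain ⟨v, hv, hw⟩ := hq
  rw [h0] at hv hw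
  rw [hv.eq_zero] at hw
  rw [Lp.eq_zero_iff_ae_eq_zero]
  filter_upwards [hw, Lp.coeFn_zero ℂ 2 (volume : Measure S1)] with x h1 h2
  rw [h1, h2]
  simp

/-- The unbounded operator `P_h = h D_x + g` on `L²(S¹)` with domain `H¹(S¹)`. -/
def opP (g : S1 → ℂ) (h : ℝ) : L2S1 →ₗ.[ℂ] L2S1 := (graphP g h).toLinearPMap

/-- `P_h - z`, with the same domain. -/
def opPsub (g : S1 → ℂ) (h : ℝ) (z : ℂ) : L2S1 →ₗ.[ℂ] L2S1 :=
  (-(z • (LinearMap.id : L2S1 →ₗ[ℂ] L2S1))) +ᵥ opP g h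

/-- The product `A B` of two unbounded operators, with its natural domain
`{u ∈ D(B) : B u ∈ D(A)}`. -/
def opMul (A B : L2S1 →ₗ.[ℂ] L2S1) : L2S1 →ₗ.[ℂ] L2S1 where
  domain := (A.domain.comap B.toFun).map B.domain.subtype
  toFun :=
    { toFun := fun u => A ⟨B ⟨u, by
          obtain ⟨y, _, hy⟩ := u.2
          exact hy ▸ y.2⟩, by
          obtain ⟨u, y, hyA, rfl⟩ := u
          exact hyA⟩
      map_add' := by
        intro u v
        rw [← LinearPMap.map_add]
        congr 1
        apply Subtype.ext
        simp only [Submodule.coe_add]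
        rw [← LinearPMap.map_add]
        rfl
      map_smul' := by
        intro c u
        simp only [RingHom.id_apply]
        rw [← LinearPMap.map_smul]
        congr 1
        apply Subtype.ext
        simp only [Submodule.coe_smul]
        rw [← LinearPMap.map_smul]
        rfl }

/-- `Q(z) = (P_h - z)^* (P_h - z)`. -/
def opQ (g : S1 → ℂ) (h : ℝ) (z : ℂ) : L2S1 →ₗ.[ℂ] L2S1 :=
  opMul (opPsub g h z).adjoint (opPsub g h z)

/-- `Q̃(z) = (P_h - z) (P_h - z)^*`. -/
def opQtilde (g : S1 → ℂ) (h : ℝ) (z : ℂ) : L2S1 →ₗ.[ℂ] L2S1 :=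
  opMul (opPsub g h z) (opPsub g h z).adjoint

/-- `u` is a normalized eigenvector of the unbounded operator `A` with eigenvalue `μ`. -/
def IsUnitEigenvector (A : L2S1 →ₗ.[ℂ] L2S1) (μ : ℝ) (u : L2S1) : Prop :=
  ‖u‖ = 1 ∧ ∃ hu : u ∈ A.domain, A ⟨u, hu⟩ = (μ : ℂ) • u

/-- `e₀` and `f₀` are normalized eigenvectors of `Q(z)` and of `Q̃(z)` for the smallest
eigenvalue `t₀²` of `Q(z)`. -/
def IsLowestPair (g : S1 → ℂ) (h : ℝ) (z : ℂ) (e₀ f₀ : L2S1) : Prop :=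
  ∃ t₀sq : ℝ, IsLeast {μ : ℝ | ∃ u, IsUnitEigenvector (opQ g h z) μ u} t₀sq ∧
    IsUnitEigenvector (opQ g h z) t₀sq e₀ ∧ IsUnitEigenvector (opQtilde g h z) t₀sq f₀

/-! ### Classical objects -/

/-- The principal symbol `p(x, ξ) = ξ + g(x)`, as a function that is `2π`-periodic in `x`. -/
def symbol (g : S1 → ℂ) (x ξ : ℝ) : ℂ := (ξ : ℂ) + g (x : S1)

/-- The complex conjugate of the principal symbol. -/
def symbolConj (g : S1 → ℂ) (x ξ : ℝ) : ℂ := starRingEnd ℂ (symbol g x ξ)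

/-- The Poisson bracket `{q, r} = q'_ξ r'_x - q'_x r'_ξ` at `(x, ξ)`. -/
def poisson (q r : ℝ → ℝ → ℂ) (x ξ : ℝ) : ℂ :=
  deriv (fun t => q x t) ξ * deriv (fun s => r s ξ) x
    - deriv (fun s => q s ξ) x * deriv (fun t => r x t) ξ

/-- `Σ`, the closure of the range of the principal symbol. -/
def sigmaSet (g : S1 → ℂ) : Set ℂ :=
  closure (Set.range fun q : ℝ × ℝ => symbol g q.1 q.2)

/-- `d(z) = dist(z, ∂Σ)`. -/
def bdDist (g : S1 → ℂ) (z : ℂ) : ℝ := Metric.infDist z (frontier (sigmaSet g))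

/-- `x₊`, `x₋` are the (real representatives of the) base points of the two solutions
`ρ_± = (x_±, ξ_±)` of `p(x, ξ) = z`. -/
structure IsTurningPair (g : S1 → ℂ) (z : ℂ) (xp xm : ℝ) : Prop where
  im_xp : imLift g xp = z.im
  im_xm : imLift g xm = z.im
  deriv_xp : deriv (imLift g) xp < 0
  deriv_xm : 0 < deriv (imLift g) xm
  lt_xp : xm - 2 * Real.pi < xp
  xp_lt : xp < xm

/-- The fibre coordinate `ξ = Re z - Re g(x)` of a solution of `p(x, ξ) = z`. -/
def fibre (g : S1 → ℂ) (z : ℂ) (x : ℝ) : ℝ := z.re - (g (x : S1)).re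

/-- `S(z) = min (Im ∫_{x₊}^{x₋} (z - g), Im ∫_{x₊}^{x₋ - 2π} (z - g))`. -/
def action (g : S1 → ℂ) (xp xm : ℂ → ℝ) (z : ℂ) : ℝ :=
  min (∫ y in (xp z)..(xm z), (z - g (y : S1))).im
    (∫ y in (xp z)..(xm z - 2 * Real.pi), (z - g (y : S1))).im

/-- `∂_{Im z} S`. -/
def dImAction (g : S1 → ℂ) (xp xm : ℂ → ℝ) (z : ℂ) : ℝ :=
  deriv (fun t : ℝ => action g xp xm ((z.re : ℂ) + (t : ℂ) * Complex.I)) z.im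

/-- `(i/2) {p, p̄}(ρ₊) · (i/2) {p̄, p}(ρ₋)`; this complex number is real and positive when `x_±`
are the two turning points. -/
def bracketProd (g : S1 → ℂ) (z : ℂ) (xp xm : ℝ) : ℂ :=
  (Complex.I / 2 * poisson (symbol g) (symbolConj g) xp (fibre g z xp))
    * (Complex.I / 2 * poisson (symbolConj g) (symbol g) xm (fibre g z xm))

/-- The leading term of the overlap,
`(πh)^{-1/2} ((i/2){p,p̄}(ρ₊) (i/2){p̄,p}(ρ₋))^{1/4} |∂_{Im z} S|`. -/
def leadingCoeff (g : S1 → ℂ) (xp xm : ℂ → ℝ) (h : ℝ) (z : ℂ) : ℝ :=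
  (bracketProd g z (xp z) (xm z)).re ^ (1 / 4 : ℝ) / Real.sqrt (Real.pi * h)
    * |dImAction g xp xm z|

/-! ### Wirtinger derivatives -/

/-- `∂_z = (∂_{Re z} - i ∂_{Im z}) / 2`. -/
def dz (f : ℂ → ℂ) (z : ℂ) : ℂ := (fderiv ℝ f z 1 - Complex.I * fderiv ℝ f z Complex.I) / 2

/-- `∂_{z̄} = (∂_{Re z} + i ∂_{Im z}) / 2`. -/
def dzbar (f : ℂ → ℂ) (z : ℂ) : ℂ := (fderiv ℝ f z 1 + Complex.I * fderiv ℝ f z Complex.I) / 2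

/-- `∂_z^m ∂_{z̄}^n f`. -/
def wirtinger (m n : ℕ) (f : ℂ → ℂ) : ℂ → ℂ := dz^[m] (dzbar^[n] f)

/-- The points `z ∈ Ω` with `d(z) > A h^{2/3}` and `|Im z - ⟨Im g⟩| > 1/C`. -/
def region (g : S1 → ℂ) (Ω : Set ℂ) (C A h : ℝ) : Set ℂ :=
  {z | z ∈ Ω ∧ A * h ^ (2 / 3 : ℝ) < bdDist g z ∧ 1 / C < |z.im - meanIm g|}

end Hager

end

open MeasureTheory
open scoped ContDiff

noncomputable section

namespace Hager

open Set Filter Topology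

/-! ### Uniform bounds for jets of families of smooth functions -/

section Jets

variable {ι : Type*} {G E F H : Type*}
  [NormedAddCommGroup G] [NormedSpace ℝ G] [NormedAddCommGroup E] [NormedSpace ℝ E]
  [NormedAddCommGroup F] [NormedSpace ℝ F] [NormedAddCommGroup H] [NormedSpace ℝ H]

/-! Let `R = (P_h - z)⁻¹`. The eigenvalue equations of `Q` and `Q̃` read `u = μ R R* u` and `u = μ
R* R u`. Hence `t₀ = 1/‖R‖`, `f₀` is a unit vector `f` with `‖R f‖ = ‖R‖`, and `e₀ = R f/‖R‖`, up to
phases, so that the overlap is `|(f|R f)|/‖R‖` (`isLowestPair_of_isResolvent`). The family `R(z)` is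
holomorphic with derivative `R²`, and first order perturbation theory gives `|∇‖R‖²| = 2‖R‖² |(f|R
f)|` (`norm_fderiv_sq_norm`). The overlap is therefore `|∇‖R‖²| / (2‖R‖³)`: no quasimodes are
constructed, and everything reduces to the asymptotics of `‖R(z)‖²` together with its derivatives.

Take `Im z` below the mean and put `δ = Im z - Im g(a)`, `η = h/δ^{3/2}`. The equation on the circle
is solved explicitly. On the rectangle `x < a < y` the kernel of `R` has rank one and norm squared
`Z_L Z_R / h²`, up to the factor coming from the multiplier over a period, which is exponentially
close to one; `Z_L`, `Z_R` are Laplace integrals over the two half wells of `Im g` at its minimum.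
The rest of the Hilbert–Schmidt norm is smaller by a factor `O(η^N)` for every `N`
(`exists_double_le`). A test function gives the matching lower bound, so `‖R‖² h² = Z_L Z_R (1 +
O(η^∞))` (`exists_norm_resOp`). The same estimate gives a spectral gap, expressed by `PairBound`:
the squares of the two top singular values add up to at most 3/2 of the larger one. Hence maximizing
vectors exist, are unique up to phase, and `‖R‖²` is smooth. Laplace's method gives `Z ≈ √(πh/α)
e^{2P/h}` with relative error `√η`. Here `P_L + P_R = S`, the sum of the turning points `X_L + X_R`
is `∂S/∂Im z`, and the slopes `α` are the Poisson brackets up to sign; the leading term is read off.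

The derivative bounds are organised by `JetBound`: a family has jets of weight `w` at scale `r` when
its `k`-th derivatives are `O(w r^{-k})`. The natural scale is `r = h/√δ`, and the required bound
`d^{k/2-3/4} h^{1/2-k}` is `√η r^{-k}`. For the Laplace integrals the derivatives are moments. For
the factor `1 + O(η^∞)`, Cauchy estimates for `R` and the implicit function theorem for the simple
top eigenvalue of `R* R` first give crude jets of weight one (`JetBound.sq_norm`). Interpolation
between these and the smallness of the function (`JetBound.of_small`) then makes all derivatives
small. Finally `K` is a smooth function of the relative error of `‖R‖²` and of its rescaled
gradient.

Energies above the mean are reduced to energies below it by the reflection `x ↦ -x`, which replaces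
`g(x)` by `-g(-x)` and `z` by `-z`. -/

theorem exists_isOpen_contDiffOn {f : G → E} {x : G} (hf : ContDiffAt ℝ ∞ f x) (n : ℕ) :
    ∃ u : Set G, IsOpen u ∧ x ∈ u ∧ ContDiffOn ℝ n f u := by
  have hn : ContDiffAt ℝ n f x := hf.of_le (by exact_mod_cast le_top)
  obtain ⟨u, hu, hfu⟩ := hn.contDiffOn le_rfl (by simp)
  obtain ⟨v, hvu, hv, hxv⟩ := mem_nhds_iff.1 hu
  exact ⟨v, hv, hxv, hfu.mono (hvu.trans (by simp))⟩

/-- Leibniz' rule at one point. Smoothness at `x` gives, for each order, an open neighbourhood on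
which both factors have that order of smoothness, and on open sets derivatives within the set are
the ordinary ones. -/
theorem norm_iteratedFDeriv_bilinear_le (L : E →L[ℝ] F →L[ℝ] H) {f : G → E} {g : G → F} {x : G}
    (hf : ContDiffAt ℝ ∞ f x) (hg : ContDiffAt ℝ ∞ g x) (n : ℕ) :
    ‖iteratedFDeriv ℝ n (fun y => L (f y) (g y)) x‖ ≤
      ‖L‖ * ∑ i ∈ Finset.range (n + 1), (n.choose i : ℝ) * ‖iteratedFDeriv ℝ i f x‖ *
        ‖iteratedFDeriv ℝ (n - i) g x‖ := by
  obtain ⟨u, hu, hxu, hfu⟩ := exists_isOpen_contDiffOn hf n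
  obtain ⟨v, hv, hxv, hgv⟩ := exists_isOpen_contDiffOn hg n
  have h := L.norm_iteratedFDerivWithin_le_of_bilinear (hfu.mono (inter_subset_left (t := v)))
    (hgv.mono (inter_subset_right (s := u))) (hu.inter hv).uniqueDiffOn ⟨hxu, hxv⟩
    (n := n) le_rfl
  simp only [iteratedFDerivWithin_of_isOpen _ (hu.inter hv) (show x ∈ u ∩ v from ⟨hxu, hxv⟩)] at h
  exact h

theorem norm_iteratedFDeriv_comp_at_le {g : E → F} {f : G → E} {x : G}
    (hg : ContDiffAt ℝ ∞ g (f x)) (hf : ContDiffAt ℝ ∞ f x) (n : ℕ) {C D : ℝ}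
    (hC : ∀ i, i ≤ n → ‖iteratedFDeriv ℝ i g (f x)‖ ≤ C)
    (hD : ∀ i, 1 ≤ i → i ≤ n → ‖iteratedFDeriv ℝ i f x‖ ≤ D ^ i) :
    ‖iteratedFDeriv ℝ n (fun y => g (f y)) x‖ ≤ n.factorial * C * D ^ n := by
  obtain ⟨u, hu, hxu, hfu⟩ := exists_isOpen_contDiffOn hf n
  obtain ⟨v, hv, hxv, hgv⟩ := exists_isOpen_contDiffOn hg n
  have ho : IsOpen (u ∩ f ⁻¹' v) := hfu.continuousOn.isOpen_inter_preimage hu hv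
  have hx : x ∈ u ∩ f ⁻¹' v := ⟨hxu, hxv⟩
  have h := norm_iteratedFDerivWithin_comp_le hgv (hfu.mono (inter_subset_left (t := f ⁻¹' v)))
    (n := n) le_rfl hv.uniqueDiffOn ho.uniqueDiffOn (fun y hy => hy.2) hx (C := C) (D := D)
    (by simpa only [iteratedFDerivWithin_of_isOpen _ hv hxv] using hC)
    (by simpa only [iteratedFDerivWithin_of_isOpen _ ho hx] using hD)
  rw [iteratedFDerivWithin_of_isOpen _ ho hx] at h
  exact h

/-- The family `f i` is smooth at `x i` and, for `k ≤ n`, its `k`-th derivative there is bounded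
by a uniform multiple of `w i * (r i) ^ (-k)`. -/
def JetBound (n : ℕ) (f : ι → G → E) (x : ι → G) (r w : ι → ℝ) : Prop :=
  (∀ i, ContDiffAt ℝ ∞ (f i) (x i)) ∧
    ∀ k ≤ n, ∃ B : ℝ, ∀ i, ‖iteratedFDeriv ℝ k (f i) (x i)‖ * r i ^ k ≤ B * w i

namespace JetBound

variable {n : ℕ} {f f' : ι → G → E} {x : ι → G} {r r' w w' : ι → ℝ}

theorem exists_nonneg (h : JetBound n f x r w) (hw : ∀ i, 0 ≤ w i) :
    ∃ B : ℝ, 0 ≤ B ∧ ∀ k ≤ n, ∀ i, ‖iteratedFDeriv ℝ k (f i) (x i)‖ * r i ^ k ≤ B * w i := by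
  choose! B hB using h.2
  refine ⟨∑ k ∈ Finset.range (n + 1), |B k|, Finset.sum_nonneg fun _ _ => abs_nonneg _,
    fun k hk i => (hB k hk i).trans ?_⟩
  refine mul_le_mul_of_nonneg_right ((le_abs_self _).trans ?_) (hw i)
  exact Finset.single_le_sum (f := fun k => |B k|) (fun _ _ => abs_nonneg _)
    (Finset.mem_range.2 (by omega))

theorem of_le {m : ℕ} (h : JetBound n f x r w) (hm : m ≤ n) : JetBound m f x r w :=
  ⟨h.1, fun k hk => h.2 k (hk.trans hm)⟩

theorem congr (h : JetBound n f x r w) (hf : ∀ i, f' i =ᶠ[𝓝 (x i)] f i) :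
    JetBound n f' x r w := by
  refine ⟨fun i => (h.1 i).congr_of_eventuallyEq (hf i), fun k hk => ?_⟩
  obtain ⟨B, hB⟩ := h.2 k hk
  exact ⟨B, fun i => by rw [((hf i).iteratedFDeriv ℝ k).eq_of_nhds]; exact hB i⟩

theorem weight (h : JetBound n f x r w) (hw : ∀ i, 0 ≤ w i) (C : ℝ)
    (hC : ∀ i, w i ≤ C * w' i) : JetBound n f x r w' := by
  refine ⟨h.1, fun k hk => ?_⟩
  obtain ⟨B, hB⟩ := h.2 k hk
  refine ⟨|B| * C, fun i => (hB i).trans ?_⟩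
  calc B * w i ≤ |B| * w i := mul_le_mul_of_nonneg_right (le_abs_self _) (hw i)
    _ ≤ |B| * (C * w' i) := mul_le_mul_of_nonneg_left (hC i) (abs_nonneg _)
    _ = _ := by ring

theorem scale (h : JetBound n f x r w) (hr : ∀ i, 0 ≤ r' i) (hrr : ∀ i, r' i ≤ r i) :
    JetBound n f x r' w := by
  refine ⟨h.1, fun k hk => ?_⟩
  obtain ⟨B, hB⟩ := h.2 k hk
  refine ⟨B, fun i => le_trans ?_ (hB i)⟩
  gcongr
  exacts [hr i, hrr i]

theorem reindex {κ : Type*} (h : JetBound n f x r w) (e : κ → ι) :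
    JetBound n (fun j => f (e j)) (fun j => x (e j)) (fun j => r (e j)) (fun j => w (e j)) :=
  ⟨fun j => h.1 (e j), fun k hk => (h.2 k hk).imp fun _ hB j => hB (e j)⟩

theorem clm (h : JetBound n f x r w) (L : E →L[ℝ] F) (hr : ∀ i, 0 ≤ r i) :
    JetBound n (fun i y => L (f i y)) x r w := by
  refine ⟨fun i => L.contDiff.contDiffAt.comp _ (h.1 i), fun k hk => ?_⟩
  obtain ⟨B, hB⟩ := h.2 k hk
  refine ⟨‖L‖ * B, fun i => ?_⟩
  have h1 := L.norm_iteratedFDeriv_comp_left (f := f i) (x := x i) (n := k) (h.1 i)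
    (by exact_mod_cast le_top)
  calc _ ≤ (‖L‖ * ‖iteratedFDeriv ℝ k (f i) (x i)‖) * r i ^ k :=
        mul_le_mul_of_nonneg_right h1 (pow_nonneg (hr i) k)
    _ = ‖L‖ * (‖iteratedFDeriv ℝ k (f i) (x i)‖ * r i ^ k) := by ring
    _ ≤ ‖L‖ * (B * w i) := mul_le_mul_of_nonneg_left (hB i) (by positivity)
    _ = _ := by ring

theorem clm_family (h : JetBound n f x r w) (L : ι → E →L[ℝ] F) {C : ℝ} (hC : ∀ i, ‖L i‖ ≤ C)
    (hr : ∀ i, 0 ≤ r i) (hw : ∀ i, 0 ≤ w i) :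
    JetBound n (fun i y => L i (f i y)) x r w := by
  refine ⟨fun i => (L i).contDiff.contDiffAt.comp _ (h.1 i), fun k hk => ?_⟩
  obtain ⟨B, hB0, hB⟩ := h.exists_nonneg hw
  refine ⟨C * B, fun i => ?_⟩
  have h1 := (L i).norm_iteratedFDeriv_comp_left (f := f i) (x := x i) (n := k) (h.1 i)
    (by exact_mod_cast le_top)
  have := hw i
  calc _ ≤ (‖L i‖ * ‖iteratedFDeriv ℝ k (f i) (x i)‖) * r i ^ k :=
        mul_le_mul_of_nonneg_right h1 (pow_nonneg (hr i) k)
    _ = ‖L i‖ * (‖iteratedFDeriv ℝ k (f i) (x i)‖ * r i ^ k) := by ring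
    _ ≤ C * (B * w i) := mul_le_mul (hC i) (hB k hk i)
        (mul_nonneg (norm_nonneg _) (pow_nonneg (hr i) k)) ((norm_nonneg _).trans (hC i))
    _ = _ := by ring

theorem add (h : JetBound n f x r w) (h' : JetBound n f' x r w) (hr : ∀ i, 0 ≤ r i) :
    JetBound n (fun i y => f i y + f' i y) x r w := by
  refine ⟨fun i => (h.1 i).add (h'.1 i), fun k hk => ?_⟩
  obtain ⟨B, hB⟩ := h.2 k hk
  obtain ⟨B', hB'⟩ := h'.2 k hk
  refine ⟨B + B', fun i => ?_⟩
  have h1 : iteratedFDeriv ℝ k (fun y => f i y + f' i y) (x i)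
      = iteratedFDeriv ℝ k (f i) (x i) + iteratedFDeriv ℝ k (f' i) (x i) :=
    iteratedFDeriv_add_apply ((h.1 i).of_le (by exact_mod_cast le_top))
      ((h'.1 i).of_le (by exact_mod_cast le_top))
  rw [h1, add_mul]
  calc _ ≤ (‖iteratedFDeriv ℝ k (f i) (x i)‖ + ‖iteratedFDeriv ℝ k (f' i) (x i)‖) * r i ^ k := by
        gcongr
        exacts [pow_nonneg (hr i) k, norm_add_le _ _]
    _ ≤ _ := by rw [add_mul]; exact add_le_add (hB i) (hB' i)

theorem neg (h : JetBound n f x r w) : JetBound n (fun i y => -f i y) x r w := by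
  refine ⟨fun i => (h.1 i).neg, fun k hk => ?_⟩
  obtain ⟨B, hB⟩ := h.2 k hk
  refine ⟨B, fun i => ?_⟩
  have h1 : iteratedFDeriv ℝ k (fun y => -f i y) (x i) = -iteratedFDeriv ℝ k (f i) (x i) :=
    iteratedFDeriv_neg_apply
  rw [h1, norm_neg]
  exact hB i

theorem sub (h : JetBound n f x r w) (h' : JetBound n f' x r w) (hr : ∀ i, 0 ≤ r i) :
    JetBound n (fun i y => f i y - f' i y) x r w := by
  simpa only [sub_eq_add_neg] using h.add h'.neg hr

theorem const (c : ι → E) {C : ℝ} (hC : ∀ i, ‖c i‖ ≤ C * w i) (hw : ∀ i, 0 ≤ w i) :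
    JetBound n (fun i (_ : G) => c i) x r w := by
  refine ⟨fun i => contDiffAt_const, fun k _ => ⟨|C|, fun i => ?_⟩⟩
  rcases Nat.eq_zero_or_pos k with rfl | hk
  · simpa using (hC i).trans (mul_le_mul_of_nonneg_right (le_abs_self _) (hw i))
  · rw [iteratedFDeriv_const_of_ne hk.ne']
    simpa using mul_nonneg (abs_nonneg C) (hw i)

/-- By Leibniz' rule, weights multiply at a common scale, because `r^k = r^j r^(k-j)` distributes
over the terms. -/
theorem bilin {g : ι → G → F} (h : JetBound n f x r w) (h' : JetBound n g x r w')
    (L : E →L[ℝ] F →L[ℝ] H) (hr : ∀ i, 0 ≤ r i) (hw : ∀ i, 0 ≤ w i) (hw' : ∀ i, 0 ≤ w' i) :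
    JetBound n (fun i y => L (f i y) (g i y)) x r (fun i => w i * w' i) := by
  refine ⟨fun i => (L.isBoundedBilinearMap.contDiff.contDiffAt).comp (x i)
    ((h.1 i).prodMk (h'.1 i)), fun k hk => ?_⟩
  obtain ⟨B, hB0, hB⟩ := h.exists_nonneg hw
  obtain ⟨B', hB0', hB'⟩ := h'.exists_nonneg hw'
  refine ⟨‖L‖ * ∑ j ∈ Finset.range (k + 1), (k.choose j : ℝ) * B * B', fun i => ?_⟩
  have h1 := norm_iteratedFDeriv_bilinear_le L (h.1 i) (h'.1 i) k
  have hrk := pow_nonneg (hr i) k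
  have := hw i
  have := hw' i
  calc _ ≤ (‖L‖ * ∑ j ∈ Finset.range (k + 1), (k.choose j : ℝ) *
        ‖iteratedFDeriv ℝ j (f i) (x i)‖ * ‖iteratedFDeriv ℝ (k - j) (g i) (x i)‖) * r i ^ k := by
        gcongr
    _ = ‖L‖ * ∑ j ∈ Finset.range (k + 1), (k.choose j : ℝ) *
        (‖iteratedFDeriv ℝ j (f i) (x i)‖ * r i ^ j) *
          (‖iteratedFDeriv ℝ (k - j) (g i) (x i)‖ * r i ^ (k - j)) := by
        rw [mul_assoc, Finset.sum_mul]
        congr 1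
        refine Finset.sum_congr rfl fun j hj => ?_
        have : r i ^ k = r i ^ j * r i ^ (k - j) := by
          rw [← pow_add]; congr 1; have := Finset.mem_range.1 hj; omega
        rw [this]; ring
    _ ≤ ‖L‖ * ∑ j ∈ Finset.range (k + 1), (k.choose j : ℝ) * (B * w i) * (B' * w' i) := by
        refine mul_le_mul_of_nonneg_left (Finset.sum_le_sum fun j hj => ?_) (norm_nonneg L)
        have hri := hr i
        refine mul_le_mul (mul_le_mul_of_nonneg_left
          (hB j (by have := Finset.mem_range.1 hj; omega) i) (by positivity))
          (hB' (k - j) (by omega) i) (by positivity) (by positivity)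
    _ = _ := by
        rw [mul_assoc, Finset.sum_mul]
        congr 1
        exact Finset.sum_congr rfl fun j _ => by ring

theorem mul {f g : ι → G → ℝ} (h : JetBound n f x r w) (h' : JetBound n g x r w')
    (hr : ∀ i, 0 ≤ r i) (hw : ∀ i, 0 ≤ w i) (hw' : ∀ i, 0 ≤ w' i) :
    JetBound n (fun i y => f i y * g i y) x r (fun i => w i * w' i) :=
  h.bilin h' (ContinuousLinearMap.mul ℝ ℝ) hr hw hw'

theorem mul_one {f g : ι → G → ℝ} (h : JetBound n f x r w) (h' : JetBound n g x r 1)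
    (hr : ∀ i, 0 ≤ r i) (hw : ∀ i, 0 ≤ w i) :
    JetBound n (fun i y => f i y * g i y) x r w := by
  have := h.mul h' hr hw (fun _ => zero_le_one)
  simpa using this

theorem const_mul {f : ι → G → ℝ} (h : JetBound n f x r w) (c : ι → ℝ) (hr : ∀ i, 0 ≤ r i)
    (hw : ∀ i, 0 ≤ w i) : JetBound n (fun i y => c i * f i y) x r (fun i => |c i| * w i) :=
  (JetBound.const (w := fun i => |c i|) c (C := 1) (by simp) fun i => abs_nonneg _).mul h hr
    (fun i => abs_nonneg _) hw

theorem comp {g : ι → E → F} (hg : JetBound n g (fun i => f i (x i)) 1 w')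
    (h : JetBound n f x r 1) (hr : ∀ i, 0 < r i) (hw' : ∀ i, 0 ≤ w' i) :
    JetBound n (fun i y => g i (f i y)) x r w' := by
  refine ⟨fun i => (hg.1 i).comp _ (h.1 i), fun k hk => ?_⟩
  obtain ⟨B, hB0, hB⟩ := hg.exists_nonneg hw'
  obtain ⟨D, hD0, hD⟩ := h.exists_nonneg (fun _ => zero_le_one)
  refine ⟨k.factorial * B * (D + 1) ^ k, fun i => ?_⟩
  have hri := hr i
  -- The composition estimate wants the `j`-th derivative below the `j`-th power of one base. Since
  -- `D + 1 ≥ 1`, the base `(D + 1) / r` serves for all `j ≥ 1`.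
  have h1 := norm_iteratedFDeriv_comp_at_le (hg.1 i) (h.1 i) k (C := B * w' i)
    (D := (D + 1) / r i)
    (fun j hj => by simpa using hB j (hj.trans hk) i) (fun j hj1 hj => by
      rw [div_pow, le_div_iff₀ (by positivity)]
      have h2 := hD j (hj.trans hk) i
      simp only [Pi.one_apply, _root_.mul_one] at h2
      refine h2.trans ((le_add_of_nonneg_right zero_le_one).trans ?_)
      exact le_self_pow₀ (by linarith) (by omega))
  calc _ ≤ (k.factorial * (B * w' i) * ((D + 1) / r i) ^ k) * r i ^ k := by gcongr
    _ = _ := by rw [div_pow]; field_simp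

/-- The fixed function of several variables is smooth near a compact set of values. -/
theorem of_compact {g : E → F} {O K : Set E} (hO : IsOpen O) (hg : ContDiffOn ℝ ∞ g O)
    (hK : IsCompact K) (hKO : K ⊆ O) {y : ι → E} (hy : ∀ i, y i ∈ K) :
    JetBound n (fun _ : ι => g) y 1 1 := by
  refine ⟨fun i => hg.contDiffAt (hO.mem_nhds (hKO (hy i))), fun k _ => ?_⟩
  have hc : ContinuousOn (fun z => ‖iteratedFDeriv ℝ k g z‖) K := by
    have h1 := (hg.continuousOn_iteratedFDerivWithin (m := k) (by exact_mod_cast le_top)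
      hO.uniqueDiffOn).mono hKO
    refine (h1.congr fun z hz => ?_).norm
    rw [iteratedFDerivWithin_of_isOpen _ hO (hKO hz)]
  obtain ⟨B, hB⟩ := hK.exists_bound_of_continuousOn hc
  exact ⟨B, fun i => by simpa using hB _ (hy i)⟩

theorem comp_compact {g : E → F} {O K : Set E} (h : JetBound n f x r 1) (hO : IsOpen O)
    (hg : ContDiffOn ℝ ∞ g O) (hK : IsCompact K) (hKO : K ⊆ O) (hy : ∀ i, f i (x i) ∈ K)
    (hr : ∀ i, 0 < r i) : JetBound n (fun i y => g (f i y)) x r 1 :=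
  (of_compact hO hg hK hKO hy).comp h hr (fun _ => zero_le_one)

theorem fderiv (h : JetBound (n + 1) f x r w) (hr : ∀ i, 0 < r i) :
    JetBound n (fun i => fderiv ℝ (f i)) x r (fun i => w i / r i) := by
  refine ⟨fun i => (h.1 i).fderiv_right (m := ∞) (by simp), fun k hk => ?_⟩
  obtain ⟨B, hB⟩ := h.2 (k + 1) (by omega)
  refine ⟨B, fun i => ?_⟩
  have := hr i
  rw [norm_iteratedFDeriv_fderiv, ← mul_div_assoc, le_div_iff₀ this]
  calc _ = ‖iteratedFDeriv ℝ (k + 1) (f i) (x i)‖ * r i ^ (k + 1) := by ring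
    _ ≤ _ := hB i

/-- Raises the order by one: order zero comes from the pointwise bound, the others from the
derivative, for which one power of `r` is paid. It drives the inductions on the order below. -/
theorem of_fderiv (hs : ∀ i, ContDiffAt ℝ ∞ (f i) (x i)) {C : ℝ} (h0 : ∀ i, ‖f i (x i)‖ ≤ C * w i)
    (h : JetBound n (fun i => _root_.fderiv ℝ (f i)) x r (fun i => w i / r i))
    (hr : ∀ i, 0 < r i) : JetBound (n + 1) f x r w := by
  refine ⟨hs, fun k hk => ?_⟩
  rcases k with _ | k
  · exact ⟨C, fun i => by simpa using h0 i⟩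
  · obtain ⟨B, hB⟩ := h.2 k (by omega)
    refine ⟨B, fun i => ?_⟩
    have := hr i
    have h1 := hB i
    rw [norm_iteratedFDeriv_fderiv, ← mul_div_assoc, le_div_iff₀ this] at h1
    calc _ = ‖iteratedFDeriv ℝ (k + 1) (f i) (x i)‖ * r i ^ k * r i := by ring
    _ ≤ _ := h1

theorem norm_le (h : JetBound n f x r w) : ∃ B : ℝ, ∀ i, ‖f i (x i)‖ ≤ B * w i := by
  obtain ⟨B, hB⟩ := h.2 0 (Nat.zero_le _)
  exact ⟨B, fun i => by simpa using hB i⟩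

theorem zero (hs : ∀ i, ContDiffAt ℝ ∞ (f i) (x i)) {C : ℝ} (h0 : ∀ i, ‖f i (x i)‖ ≤ C * w i) :
    JetBound 0 f x r w :=
  ⟨hs, fun k hk => ⟨C, fun i => by obtain rfl : k = 0 := by omega
                                   simpa using h0 i⟩⟩

theorem prodMk {g : ι → G → F} (h : JetBound n f x r w) (h' : JetBound n g x r w)
    (hr : ∀ i, 0 ≤ r i) : JetBound n (fun i y => (f i y, g i y)) x r w := by
  have h1 := h.clm (ContinuousLinearMap.inl ℝ E F) hr
  have h2 := h'.clm (ContinuousLinearMap.inr ℝ E F) hr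
  simpa using h1.add h2 hr

/-- A differential equation `f' = H ∘ f` propagates bounds to all derivatives. -/
theorem of_ode {V : ι → E → G →L[ℝ] E} (hs : ∀ i, ContDiffAt ℝ ∞ (f i) (x i))
    {C : ℝ} (h0 : ∀ i, ‖f i (x i)‖ ≤ C) (hr : ∀ i, 0 < r i)
    (hV : ∀ m, JetBound m V (fun i => f i (x i)) 1 1)
    (hd : ∀ i, ∀ᶠ y in 𝓝 (x i), _root_.fderiv ℝ (f i) y = (r i)⁻¹ • V i (f i y)) (m : ℕ) :
    JetBound m f x r 1 := by
  induction m with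
  | zero => exact JetBound.zero (w := 1) hs (C := C) (by simpa using h0)
  | succ m ih =>
    refine of_fderiv (w := 1) hs (C := C) (by simpa using h0) ?_ hr
    -- Bootstrap: jets of order `m` of `f` give those of `V ∘ f`, and through the equation those of
    -- order `m + 1` of `f`.
    have h1 := (hV m).comp ih hr (fun _ => zero_le_one)
    have h2 := (JetBound.const (G := G) (x := x) (r := r) (n := m) (w := fun i => (r i)⁻¹)
      (fun i => (r i)⁻¹) (C := 1) (fun i => by simp [abs_of_pos (hr i)])
      (fun i => (inv_pos.2 (hr i)).le)).bilin h1
      (ContinuousLinearMap.lsmul ℝ ℝ (E := G →L[ℝ] E)) (fun i => (hr i).le)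
      (fun i => (inv_pos.2 (hr i)).le) (fun _ => zero_le_one)
    have h3 := h2.congr (f' := fun i => _root_.fderiv ℝ (f i)) (fun i => by
      filter_upwards [hd i] with y hy
      rw [hy]; rfl)
    simpa [div_eq_mul_inv] using h3

/-- Inverses in a Banach algebra. -/
theorem ringInverse {A : Type*} [NormedRing A] [NormedAlgebra ℝ A] [CompleteSpace A]
    {a : ι → G → A} (h : JetBound n a x r 1) (hu : ∀ i, IsUnit (a i (x i)))
    {C : ℝ} (hC : ∀ i, ‖Ring.inverse (a i (x i))‖ ≤ C) (hr : ∀ i, 0 < r i) :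
    JetBound n (fun i y => Ring.inverse (a i y)) x r 1 := by
  have hs : ∀ i, ContDiffAt ℝ ∞ (fun y => Ring.inverse (a i y)) (x i) := fun i => by
    obtain ⟨u, hu'⟩ := hu i
    exact ContDiffAt.comp (x i) (by rw [← hu']; exact contDiffAt_ringInverse ℝ u) (h.1 i)
  induction n with
  | zero => exact JetBound.zero (w := 1) hs (C := C) (by simpa using hC)
  | succ n ih =>
    refine of_fderiv (w := 1) hs (C := C) (by simpa using hC) ?_ hr
    -- Since `D(a⁻¹) = -a⁻¹ (Da) a⁻¹`, the order `n + 1` of the inverse only uses the order `n` of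
    -- the inverse.
    have h1 := ih (h.of_le (Nat.le_succ n))
    have h2 := h.fderiv hr
    have hr' : ∀ i, 0 ≤ r i := fun i => (hr i).le
    have h3 := h1.bilin h1 (ContinuousLinearMap.mulLeftRight ℝ A) hr' (fun _ => zero_le_one)
      (fun _ => zero_le_one)
    have h4 := h3.bilin h2 (ContinuousLinearMap.compL ℝ G A A) hr'
      (fun _ => by simp) (fun i => by have := hr i; simp; positivity)
    refine ((h4.neg).congr (f' := fun i => _root_.fderiv ℝ (fun y => Ring.inverse (a i y)))
      (fun i => ?_)).weight (fun i => by have := hr i; simp; positivity) 1 (fun i => by simp)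
    have hau : ∀ᶠ y in 𝓝 (x i), IsUnit (a i y) :=
      (h.1 i).continuousAt.eventually (Units.isOpen.mem_nhds (hu i))
    have had : ∀ᶠ y in 𝓝 (x i), ContDiffAt ℝ 1 (a i) y :=
      ((h.1 i).of_le (m := 1) (by exact_mod_cast le_top)).eventually (by simp)
    filter_upwards [hau, had] with y hy hy'
    obtain ⟨u, hu'⟩ := hy
    have h5 : HasFDerivAt Ring.inverse (-ContinuousLinearMap.mulLeftRight ℝ A ↑u⁻¹ ↑u⁻¹) (a i y) := by
      rw [← hu']; exact hasFDerivAt_ringInverse u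
    have h6 := (h5.comp y (hy'.differentiableAt (by simp)).hasFDerivAt).fderiv
    have h7 : Ring.inverse (a i y) = ↑u⁻¹ := by rw [← hu', Ring.inverse_unit]
    rw [h7]
    refine h6.trans ?_
    ext v
    simp

/-- An affine substitution whose linear part has norm at most one costs nothing. It is used to pull
functions of the depth back along `z ↦ Im z - m`. -/
theorem comp_clm_right {G' : Type*} [NormedAddCommGroup G'] [NormedSpace ℝ G']
    (L : G' →L[ℝ] G) (hL : ‖L‖ ≤ 1) (c : G) {x' : ι → G'} (hx : ∀ i, L (x' i) + c = x i)
    (h : JetBound n f x r w) (hr : ∀ i, 0 ≤ r i) :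
    JetBound n (fun i y => f i (L y + c)) x' r w := by
  have hf : ∀ i, ContDiffAt ℝ ∞ (fun y => f i (y + c)) (L (x' i)) := fun i => by
    refine ContDiffAt.comp (L (x' i)) (by rw [hx i]; exact h.1 i) ?_
    exact (contDiff_id.add contDiff_const).contDiffAt
  refine ⟨fun i => (hf i).comp (x' i) L.contDiff.contDiffAt, fun k hk => ?_⟩
  obtain ⟨B, hB⟩ := h.2 k hk
  refine ⟨B, fun i => le_trans ?_ (hB i)⟩
  obtain ⟨u, hu, hxu, hfu⟩ := exists_isOpen_contDiffOn (hf i) k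
  have h1 := L.iteratedFDerivWithin_comp_right (f := fun y => f i (y + c)) hfu hu.uniqueDiffOn
    (hu.preimage L.continuous).uniqueDiffOn (x := x' i) hxu (i := k) le_rfl
  rw [iteratedFDerivWithin_of_isOpen _ hu hxu,
    iteratedFDerivWithin_of_isOpen _ (hu.preimage L.continuous) hxu] at h1
  have h2 : iteratedFDeriv ℝ k (fun y => f i (y + c)) (L (x' i))
      = iteratedFDeriv ℝ k (f i) (x i) := by
    rw [iteratedFDeriv_comp_add_right, hx i]
  have h3 : iteratedFDeriv ℝ k (fun y => f i (L y + c)) (x' i)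
      = (iteratedFDeriv ℝ k (f i) (x i)).compContinuousLinearMap fun _ => L := by
    rw [← h2]; exact h1
  rw [h3]
  refine mul_le_mul_of_nonneg_right ?_ (pow_nonneg (hr i) k)
  refine (ContinuousMultilinearMap.norm_compContinuousLinearMap_le _ _).trans ?_
  refine mul_le_of_le_one_right (norm_nonneg _) ?_
  exact Finset.prod_le_one (fun _ _ => norm_nonneg _) (fun _ _ => hL)

end JetBound

/-- A first derivative is controlled by the size of the function and the oscillation of the
derivative. -/
theorem norm_fderiv_le_of_norm_le {f : G → E} {x : G} {τ δ M : ℝ} (hτ : 0 < τ)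
    (hd : ∀ y ∈ Metric.closedBall x τ, DifferentiableAt ℝ f y)
    (hδ : ∀ y ∈ Metric.closedBall x τ, ‖f y‖ ≤ δ)
    (hM : ∀ y ∈ Metric.closedBall x τ, ‖fderiv ℝ f y - fderiv ℝ f x‖ ≤ M) :
    ‖fderiv ℝ f x‖ ≤ 2 * δ / τ + M := by
  have hx : x ∈ Metric.closedBall x τ := Metric.mem_closedBall_self hτ.le
  have hδ0 : 0 ≤ δ := (norm_nonneg _).trans (hδ x hx)
  have hM0 : 0 ≤ M := (norm_nonneg _).trans (hM x hx)
  refine ContinuousLinearMap.opNorm_le_of_unit_norm (𝕜 := ℝ) (by positivity) fun v hv => ?_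
  have hy : x + τ • v ∈ Metric.closedBall x τ := by
    simp [norm_smul, abs_of_pos hτ, hv]
  have h1 := (convex_closedBall x τ).norm_image_sub_le_of_norm_hasFDerivWithin_le'
    (f' := fderiv ℝ f) (φ := fderiv ℝ f x) (C := M)
    (fun y hy => (hd y hy).hasFDerivAt.hasFDerivWithinAt) hM hx hy
  simp only [add_sub_cancel_left, map_smul, norm_smul, Real.norm_eq_abs, abs_of_pos hτ, hv,
    mul_one] at h1
  have h2 : τ * ‖fderiv ℝ f x v‖ ≤ 2 * δ + M * τ := by
    have h3 : ‖τ • fderiv ℝ f x v‖ ≤ ‖f (x + τ • v) - f x‖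
        + ‖f (x + τ • v) - f x - τ • fderiv ℝ f x v‖ := by
      have := norm_sub_le (f (x + τ • v) - f x) (f (x + τ • v) - f x - τ • fderiv ℝ f x v)
      simpa using this
    rw [norm_smul, Real.norm_eq_abs, abs_of_pos hτ] at h3
    have h4 := norm_sub_le (f (x + τ • v)) (f x)
    linarith [hδ _ hy, hδ _ hx]
  rw [div_add' _ _ _ hτ.ne', le_div_iff₀ hτ]
  linarith

/-- Interpolation of Landau–Kolmogorov type: a function smaller than every power of `η`, whose
derivatives are merely bounded at scale `r`, has all derivatives smaller than every power of `η`.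
One passes from order `k` to `k + 1` by a difference quotient, at the price of halving the power of
`η` and the radius of the ball. -/
theorem JetBound.of_small {f : ι → G → E} {x : ι → G} {r η : ι → ℝ} (hr : ∀ i, 0 < r i)
    (hη : ∀ i, 0 < η i) (hη1 : ∀ i, η i ≤ 1)
    (hs : ∀ i, ∀ y ∈ Metric.ball (x i) (r i), ContDiffAt ℝ ∞ (f i) y)
    (hB : ∀ k : ℕ, ∃ B : ℝ, ∀ i, ∀ y ∈ Metric.ball (x i) (r i),
      ‖iteratedFDeriv ℝ k (f i) y‖ * r i ^ k ≤ B)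
    (hC : ∀ N : ℕ, ∃ C : ℝ, ∀ i, ∀ y ∈ Metric.ball (x i) (r i), ‖f i y‖ ≤ C * η i ^ N)
    (n N : ℕ) : JetBound n f x r (fun i => η i ^ N) := by
  have key : ∀ k N : ℕ, ∃ C : ℝ, ∀ i, ∀ y ∈ Metric.ball (x i) (r i / 2 ^ k),
      ‖iteratedFDeriv ℝ k (f i) y‖ * r i ^ k ≤ C * η i ^ N := by
    intro k
    induction k with
    | zero => simpa using hC
    | succ k ih =>
      intro N
      obtain ⟨C, hC'⟩ := ih (2 * N)
      obtain ⟨B, hB'⟩ := hB (k + 2)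
      refine ⟨2 * C * 2 ^ (k + 1) + B, fun i y hy => ?_⟩
      have hri := hr i
      have hηi := hη i
      have hηN : η i ^ N ≤ 1 := pow_le_one₀ hηi.le (hη1 i)
      -- The step of the difference quotient balances both errors: the quotient of size `η^(2N) / τ`
      -- and the oscillation of size `τ` are then both of order `η^N`. This is why the exponent `2 *
      -- N` was asked for at the previous order.
      set τ := r i / 2 ^ (k + 1) * η i ^ N with hτ
      have hτ0 : 0 < τ := by positivity
      have hτ1 : τ ≤ r i / 2 ^ (k + 1) := mul_le_of_le_one_right (by positivity) hηN
      have hτr : τ ≤ r i * η i ^ N :=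
        mul_le_mul_of_nonneg_right (div_le_self hri.le (one_le_pow₀ one_le_two)) (by positivity)
      have hsub : ∀ y' ∈ Metric.closedBall y τ, y' ∈ Metric.ball (x i) (r i / 2 ^ k) := by
        intro y' hy'
        have h1 := dist_triangle y' y (x i)
        have h2 := Metric.mem_ball.1 hy
        have h3 := Metric.mem_closedBall.1 hy'
        rw [Metric.mem_ball]
        have : r i / 2 ^ k = r i / 2 ^ (k + 1) + r i / 2 ^ (k + 1) := by
          rw [pow_succ]; field_simp; norm_num
        linarith
      have hsub' : ∀ y' ∈ Metric.closedBall y τ, y' ∈ Metric.ball (x i) (r i) := fun y' hy' =>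
        Metric.ball_subset_ball (div_le_self hri.le (one_le_pow₀ one_le_two)) (hsub y' hy')
      have hdiff : ∀ j : ℕ, ∀ y' ∈ Metric.closedBall y τ,
          DifferentiableAt ℝ (iteratedFDeriv ℝ j (f i)) y' := fun j y' hy' =>
        (hs i y' (hsub' y' hy')).differentiableAt_iteratedFDeriv (by exact_mod_cast WithTop.coe_lt_top _)
      have h1 := norm_fderiv_le_of_norm_le (f := iteratedFDeriv ℝ k (f i)) (x := y) (τ := τ)
        (δ := C * η i ^ (2 * N) / r i ^ k) (M := B / r i ^ (k + 2) * τ) hτ0 (hdiff k)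
        (fun y' hy' => by
          rw [le_div_iff₀ (by positivity)]
          exact hC' i y' (hsub y' hy'))
        (fun y' hy' => by
          have h2 := (convex_closedBall y τ).norm_image_sub_le_of_norm_fderiv_le (𝕜 := ℝ)
            (C := B / r i ^ (k + 2)) (hdiff (k + 1)) (fun y'' hy'' => by
              rw [norm_fderiv_iteratedFDeriv, le_div_iff₀ (by positivity)]
              exact hB' i y'' (hsub' y'' hy'')) (Metric.mem_closedBall_self hτ0.le) hy'
          have h3 : ‖_root_.fderiv ℝ (iteratedFDeriv ℝ k (f i)) y'
              - _root_.fderiv ℝ (iteratedFDeriv ℝ k (f i)) y‖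
              = ‖iteratedFDeriv ℝ (k + 1) (f i) y' - iteratedFDeriv ℝ (k + 1) (f i) y‖ := by
            rw [fderiv_iteratedFDeriv]
            let e := continuousMultilinearCurryLeftEquiv ℝ (fun _ : Fin (k + 1) => G) E
            exact (congrArg norm (e.toLinearEquiv.map_sub _ _).symm).trans (e.norm_map _)
          refine (h3.le.trans h2).trans ?_
          have hB0 : 0 ≤ B / r i ^ (k + 2) := by
            have := (hB' i y (hsub' y (Metric.mem_closedBall_self hτ0.le)))
            have h0 : 0 ≤ B := le_trans (by positivity) this
            positivity
          refine mul_le_mul_of_nonneg_left ?_ hB0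
          rw [← dist_eq_norm]
          exact Metric.mem_closedBall.1 hy')
      rw [norm_fderiv_iteratedFDeriv] at h1
      calc ‖iteratedFDeriv ℝ (k + 1) (f i) y‖ * r i ^ (k + 1)
          ≤ (2 * (C * η i ^ (2 * N) / r i ^ k) / τ + B / r i ^ (k + 2) * τ) * r i ^ (k + 1) := by
            gcongr
        _ = 2 * C * 2 ^ (k + 1) * η i ^ N + B * (τ / r i) := by
            rw [hτ]; field_simp; ring
        _ ≤ 2 * C * 2 ^ (k + 1) * η i ^ N + B * η i ^ N := by
            have hB0 : 0 ≤ B := le_trans (by positivity)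
              (hB' i y (hsub' y (Metric.mem_closedBall_self hτ0.le)))
            have : τ / r i ≤ η i ^ N := by rw [div_le_iff₀ hri]; linarith
            nlinarith [mul_le_mul_of_nonneg_left this hB0]
        _ = _ := by ring
  refine ⟨fun i => hs i _ (Metric.mem_ball_self (hr i)), fun k _ => ?_⟩
  obtain ⟨C, hC'⟩ := key k N
  exact ⟨C, fun i => hC' i _ (Metric.mem_ball_self (by have := hr i; positivity))⟩

end Jets

/-! ### Wirtinger derivatives -/

/-- `φ ↦ (φ 1 + c φ(i)) / 2`. -/
def wirtingerCLM (c : ℂ) : (ℂ →L[ℝ] ℂ) →L[ℝ] ℂ :=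
  (2⁻¹ : ℝ) • (ContinuousLinearMap.apply ℝ ℂ (1 : ℂ)
    + (ContinuousLinearMap.mul ℝ ℂ c).comp (ContinuousLinearMap.apply ℝ ℂ Complex.I))

theorem wirtingerCLM_norm_le {c : ℂ} (hc : ‖c‖ = 1) : ‖wirtingerCLM c‖ ≤ 1 := by
  refine ContinuousLinearMap.opNorm_le_bound _ zero_le_one fun φ => ?_
  have h1 := φ.le_opNorm 1
  have h2 := φ.le_opNorm Complex.I
  simp only [norm_one, mul_one, Complex.norm_I] at h1 h2
  have h3 : ‖φ 1 + c * φ Complex.I‖ ≤ ‖φ 1‖ + ‖φ Complex.I‖ := by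
    refine (norm_add_le _ _).trans ?_
    simp [hc]
  have h4 : wirtingerCLM c φ = (2⁻¹ : ℝ) • (φ 1 + c * φ Complex.I) := by simp [wirtingerCLM]
  rw [h4, norm_smul]
  norm_num
  linarith

theorem dz_eq (f : ℂ → ℂ) : dz f = fun z => wirtingerCLM (-Complex.I) (fderiv ℝ f z) := by
  ext z
  simp [dz, wirtingerCLM]
  ring

theorem dzbar_eq (f : ℂ → ℂ) : dzbar f = fun z => wirtingerCLM Complex.I (fderiv ℝ f z) := by
  ext z
  simp [dzbar, wirtingerCLM]
  ring

theorem wirtingerCLM_fderiv_bound {c : ℂ} (hc : ‖c‖ = 1) {f : ℂ → ℂ} {z : ℂ}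
    (hf : ContDiffAt ℝ ∞ f z) :
    ContDiffAt ℝ ∞ (fun z => wirtingerCLM c (fderiv ℝ f z)) z ∧
      ∀ k, ‖iteratedFDeriv ℝ k (fun z => wirtingerCLM c (fderiv ℝ f z)) z‖
        ≤ ‖iteratedFDeriv ℝ (k + 1) f z‖ := by
  have h1 : ContDiffAt ℝ ∞ (fderiv ℝ f) z := hf.fderiv_right (m := ∞) (by simp)
  refine ⟨(wirtingerCLM c).contDiff.contDiffAt.comp z h1, fun k => ?_⟩
  refine ((wirtingerCLM c).norm_iteratedFDeriv_comp_left h1 (n := k)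
    (by exact_mod_cast le_top)).trans ?_
  rw [norm_iteratedFDeriv_fderiv]
  exact mul_le_of_le_one_left (norm_nonneg _) (wirtingerCLM_norm_le hc)

theorem norm_wirtinger_le {f : ℂ → ℂ} {z : ℂ} (hf : ContDiffAt ℝ ∞ f z) (m n : ℕ) :
    ‖wirtinger m n f z‖ ≤ ‖iteratedFDeriv ℝ (m + n) f z‖ := by
  have hbar : ∀ n : ℕ, ContDiffAt ℝ ∞ (dzbar^[n] f) z ∧
      ∀ k, ‖iteratedFDeriv ℝ k (dzbar^[n] f) z‖ ≤ ‖iteratedFDeriv ℝ (k + n) f z‖ := by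
    intro n
    induction n with
    | zero => exact ⟨hf, fun k => le_rfl⟩
    | succ n ih =>
      rw [Function.iterate_succ_apply', dzbar_eq]
      have h := wirtingerCLM_fderiv_bound (c := Complex.I) (by simp) ih.1
      refine ⟨h.1, fun k => (h.2 k).trans ((ih.2 _).trans (le_of_eq ?_))⟩
      rw [show k + 1 + n = k + (n + 1) by ring]
  have hall : ∀ m : ℕ, ContDiffAt ℝ ∞ (wirtinger m n f) z ∧
      ∀ k, ‖iteratedFDeriv ℝ k (wirtinger m n f) z‖ ≤ ‖iteratedFDeriv ℝ (k + m + n) f z‖ := by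
    intro m
    induction m with
    | zero => exact hbar n
    | succ m ih =>
      have : wirtinger (m + 1) n f = dz (wirtinger m n f) := by
        simp only [wirtinger, Function.iterate_succ_apply']
      rw [this, dz_eq]
      have h := wirtingerCLM_fderiv_bound (c := -Complex.I) (by simp) ih.1
      refine ⟨h.1, fun k => (h.2 k).trans ((ih.2 _).trans (le_of_eq ?_))⟩
      rw [show k + 1 + m + n = k + (m + 1) + n by ring]
  have h := (hall m).2 0
  rwa [norm_iteratedFDeriv_zero, zero_add] at h

/-! ### One side of a non-degenerate potential well -/

/-- `φ` is smooth, vanishes to second order at `0`, and increases on `[0, ℓ]`. -/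
structure HalfWell (φ : ℝ → ℝ) (ℓ : ℝ) : Prop where
  smooth : ContDiff ℝ ∞ φ
  pos : 0 < ℓ
  zero : φ 0 = 0
  deriv_zero : deriv φ 0 = 0
  deriv_pos : ∀ s ∈ Ioo 0 ℓ, 0 < deriv φ s
  deriv2_pos : 0 < deriv (deriv φ) 0

open Classical in
/-- The solution `X ∈ (0, ℓ)` of `φ X = δ`. -/
def wellX (φ : ℝ → ℝ) (ℓ δ : ℝ) : ℝ :=
  if h : ∃ s ∈ Ioo 0 ℓ, φ s = δ then h.choose else 0

/-- Quantitative information about the turning point of a half well, for energies in `(0, δ₁]`. -/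
structure WellBounds (φ : ℝ → ℝ) (ℓ δ₁ c C : ℝ) : Prop where
  c_pos : 0 < c
  C_pos : 0 < C
  X_ge : ∀ δ ∈ Ioc 0 δ₁, c * √δ ≤ wellX φ ℓ δ
  X_le : ∀ δ ∈ Ioc 0 δ₁, wellX φ ℓ δ ≤ C * √δ
  deriv_ge : ∀ δ ∈ Ioc 0 δ₁, c * √δ ≤ deriv φ (wellX φ ℓ δ)
  deriv_le : ∀ δ ∈ Ioc 0 δ₁, deriv φ (wellX φ ℓ δ) ≤ C * √δ
  right_lin : ∀ δ ∈ Ioc 0 δ₁, ∀ s ∈ Icc 0 ℓ, wellX φ ℓ δ ≤ s →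
    c * √δ * (s - wellX φ ℓ δ) ≤ φ s - δ
  right_sq : ∀ δ ∈ Ioc 0 δ₁, ∀ s ∈ Icc 0 ℓ, wellX φ ℓ δ ≤ s →
    c * (s - wellX φ ℓ δ) ^ 2 ≤ φ s - δ
  left_lin : ∀ δ ∈ Ioc 0 δ₁, ∀ s ∈ Icc 0 ℓ, s ≤ wellX φ ℓ δ →
    c * √δ * (wellX φ ℓ δ - s) ≤ δ - φ s
  taylor : ∀ δ ∈ Ioc 0 δ₁, ∀ s ∈ Icc 0 ℓ,
    |φ s - δ - deriv φ (wellX φ ℓ δ) * (s - wellX φ ℓ δ)| ≤ C * (s - wellX φ ℓ δ) ^ 2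
  room : ∀ δ ∈ Ioc 0 δ₁, c * √δ ≤ ℓ - wellX φ ℓ δ

namespace HalfWell

variable {φ : ℝ → ℝ} {ℓ δ₁ : ℝ}

theorem differentiable (hW : HalfWell φ ℓ) : Differentiable ℝ φ :=
  hW.smooth.differentiable (by simp)

theorem smooth_deriv (hW : HalfWell φ ℓ) : ContDiff ℝ ∞ (deriv φ) :=
  ((contDiff_infty_iff_deriv (𝕜 := ℝ)).1 hW.smooth).2

theorem strictMonoOn (hW : HalfWell φ ℓ) : StrictMonoOn φ (Icc 0 ℓ) :=
  strictMonoOn_of_deriv_pos (convex_Icc 0 ℓ) hW.smooth.continuous.continuousOn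
    (by simpa using hW.deriv_pos)

theorem wellX_spec (hW : HalfWell φ ℓ) {δ : ℝ} (hδ : 0 < δ) (hδ1 : δ < φ ℓ) :
    wellX φ ℓ δ ∈ Ioo 0 ℓ ∧ φ (wellX φ ℓ δ) = δ := by
  have h : ∃ s ∈ Ioo 0 ℓ, φ s = δ := by
    have := intermediate_value_Ioo hW.pos.le hW.smooth.continuous.continuousOn
      (show δ ∈ Ioo (φ 0) (φ ℓ) by rw [hW.zero]; exact ⟨hδ, hδ1⟩)
    exact this
  rw [wellX, dif_pos h]
  exact h.choose_spec

theorem wellX_eq (hW : HalfWell φ ℓ) {s : ℝ} (hs : s ∈ Ioo 0 ℓ) : wellX φ ℓ (φ s) = s := by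
  have h : ∃ s' ∈ Ioo 0 ℓ, φ s' = φ s := ⟨s, hs, rfl⟩
  rw [wellX, dif_pos h]
  exact hW.strictMonoOn.injOn (Ioo_subset_Icc_self h.choose_spec.1) (Ioo_subset_Icc_self hs)
    h.choose_spec.2

/-- The quotient `φ'(s)/s` extends continuously to `0` with the value `φ''(0) > 0`, so it is bounded
above and below on a compact interval. One stays below `ℓ` because `φ'` may vanish there. -/
theorem exists_deriv_bounds (hW : HalfWell φ ℓ) {ℓ' : ℝ} (h0 : 0 < ℓ') (h1 : ℓ' < ℓ) :
    ∃ c C : ℝ, 0 < c ∧ 0 < C ∧ ∀ s ∈ Icc 0 ℓ', c * s ≤ deriv φ s ∧ deriv φ s ≤ C * s := by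
  have hd : Differentiable ℝ (deriv φ) := hW.smooth_deriv.differentiable (by simp)
  have hcont : ContinuousOn (dslope (deriv φ) 0) (Icc 0 ℓ') := by
    have : ContinuousOn (dslope (deriv φ) 0) univ :=
      (continuousOn_dslope univ_mem).2 ⟨hd.continuous.continuousOn, hd 0⟩
    exact this.mono (subset_univ _)
  have hpos : ∀ s ∈ Icc 0 ℓ', 0 < dslope (deriv φ) 0 s := by
    intro s hs
    rcases hs.1.eq_or_lt with rfl | hs0
    · rw [dslope_same]; exact hW.deriv2_pos
    · rw [dslope_of_ne _ hs0.ne', slope_def_field, hW.deriv_zero]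
      have := hW.deriv_pos s ⟨hs0, hs.2.trans_lt h1⟩
      simp only [sub_zero]
      positivity
  have hval : ∀ s ∈ Icc 0 ℓ', deriv φ s = dslope (deriv φ) 0 s * s := by
    intro s hs
    have := sub_smul_dslope (deriv φ) 0 s
    rw [hW.deriv_zero, smul_eq_mul] at this
    linarith
  have hne : (Icc 0 ℓ').Nonempty := ⟨0, le_rfl, h0.le⟩
  obtain ⟨s₁, hs₁, hmin⟩ := isCompact_Icc.exists_isMinOn hne hcont
  obtain ⟨s₂, hs₂, hmax⟩ := isCompact_Icc.exists_isMaxOn hne hcont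
  refine ⟨dslope (deriv φ) 0 s₁, dslope (deriv φ) 0 s₂, hpos _ hs₁, hpos _ hs₂, fun s hs => ?_⟩
  rw [hval s hs]
  exact ⟨mul_le_mul_of_nonneg_right (hmin hs) hs.1, mul_le_mul_of_nonneg_right (hmax hs) hs.1⟩

-- Near the minimum all bounds follow from `φ'(s)` being comparable with `s`, hence `φ(s)` with
-- `s²`, up to a point beyond the largest turning point. Further out `φ` exceeds the level by a
-- fixed amount, and a small constant suffices because all lengths are at most `ℓ`.
set_option maxHeartbeats 1000000 in
theorem exists_bounds (hW : HalfWell φ ℓ) (h0 : 0 < δ₁) (h1 : δ₁ < φ ℓ) :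
    ∃ c C : ℝ, WellBounds φ ℓ δ₁ c C := by
  obtain ⟨hX1, hφ1⟩ := hW.wellX_spec h0 h1
  set ℓ₁ := wellX φ ℓ δ₁ with hℓ₁
  -- The point `ℓ₂` separates the two regimes: up to it the quadratic comparison holds, beyond it
  -- `φ` is above every admissible level by at least `κ`.
  set ℓ₂ := (ℓ₁ + ℓ) / 2 with hℓ₂
  have h12 : ℓ₁ < ℓ₂ := by rw [hℓ₂]; linarith [hX1.2]
  have h2 : ℓ₂ < ℓ := by rw [hℓ₂]; linarith [hX1.2]
  have h20 : 0 < ℓ₂ := hX1.1.trans h12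
  obtain ⟨c₀, C₀, hc₀, hC₀, hcC⟩ := hW.exists_deriv_bounds h20 h2
  have hℓ := hW.pos
  have hder : ∀ s, HasDerivAt φ (deriv φ s) s := fun s => (hW.differentiable s).hasDerivAt
  have hquad : ∀ (k s : ℝ), HasDerivAt (fun y => k / 2 * y ^ 2) (k * s) s := fun k s => by
    have := ((hasDerivAt_id s).pow 2).const_mul (k / 2)
    simp only [id_eq] at this
    refine this.congr_deriv ?_
    norm_num
    ring
  have hlow : ∀ s ∈ Icc 0 ℓ₂, ∀ s' ∈ Icc 0 ℓ₂, s ≤ s' →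
      c₀ / 2 * (s' ^ 2 - s ^ 2) ≤ φ s' - φ s := by
    intro s hs s' hs' hss
    have hm : MonotoneOn (fun y => φ y - c₀ / 2 * y ^ 2) (Icc 0 ℓ₂) := by
      refine monotoneOn_of_deriv_nonneg (convex_Icc _ _)
        (by have := hW.smooth.continuous; fun_prop) (fun y _ =>
        ((hder y).fun_sub (hquad c₀ y)).differentiableAt.differentiableWithinAt) fun y hy => ?_
      rw [interior_Icc] at hy
      rw [((hder y).fun_sub (hquad c₀ y)).deriv]
      linarith [(hcC y (Ioo_subset_Icc_self hy)).1]
    have := hm hs hs' hss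
    simp only at this
    linarith
  have hupp : ∀ s ∈ Icc 0 ℓ₂, φ s ≤ C₀ / 2 * s ^ 2 := by
    intro s hs
    have hm : MonotoneOn (fun y => C₀ / 2 * y ^ 2 - φ y) (Icc 0 ℓ₂) := by
      refine monotoneOn_of_deriv_nonneg (convex_Icc _ _)
        (by have := hW.smooth.continuous; fun_prop) (fun y _ =>
        ((hquad C₀ y).fun_sub (hder y)).differentiableAt.differentiableWithinAt) fun y hy => ?_
      rw [interior_Icc] at hy
      rw [((hquad C₀ y).fun_sub (hder y)).deriv]
      linarith [(hcC y (Ioo_subset_Icc_self hy)).2]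
    have := hm (left_mem_Icc.2 h20.le) hs hs.1
    simp only [hW.zero] at this
    linarith
  -- the second derivative is bounded
  have hd2 : Continuous (deriv (deriv φ)) := hW.smooth_deriv.continuous_deriv (by simp)
  obtain ⟨M, hM⟩ := isCompact_Icc (a := (0 : ℝ)) (b := ℓ) |>.exists_bound_of_continuousOn
    hd2.continuousOn
  have hM0 : 0 ≤ M := (norm_nonneg _).trans (hM 0 ⟨le_rfl, hℓ.le⟩)
  have hdlip : ∀ s ∈ Icc 0 ℓ, ∀ s' ∈ Icc 0 ℓ, |deriv φ s' - deriv φ s| ≤ M * |s' - s| :=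
    fun s hs s' hs' => (convex_Icc 0 ℓ).norm_image_sub_le_of_norm_deriv_le (𝕜 := ℝ)
      (fun y _ => (hW.smooth_deriv.differentiable (by simp)) y) hM hs hs'
  set κ := c₀ / 2 * (ℓ₂ ^ 2 - ℓ₁ ^ 2) with hκ
  have hκ0 : 0 < κ := by
    have : ℓ₁ ^ 2 < ℓ₂ ^ 2 := pow_lt_pow_left₀ h12 hX1.1.le two_ne_zero
    rw [hκ]; have : 0 < ℓ₂ ^ 2 - ℓ₁ ^ 2 := by linarith
    positivity
  set c₁ := min (c₀ / 2) (κ / ℓ ^ 2) with hc₁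
  have hc₁0 : 0 < c₁ := by rw [hc₁]; positivity
  have hc₁a : c₁ ≤ c₀ / 2 := min_le_left _ _
  have hc₁b : c₁ * ℓ ^ 2 ≤ κ := by
    have : c₁ ≤ κ / ℓ ^ 2 := min_le_right _ _
    rwa [le_div_iff₀ (by positivity)] at this
  set u := √(2 / C₀) with hu
  set v := √(2 / c₀) with hv
  have hu0 : 0 < u := by rw [hu]; positivity
  have hv0 : 0 < v := by rw [hv]; positivity
  have hXs : ∀ δ ∈ Ioc 0 δ₁, wellX φ ℓ δ ∈ Ioc 0 ℓ₁ ∧ φ (wellX φ ℓ δ) = δ ∧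
      u * √δ ≤ wellX φ ℓ δ ∧ wellX φ ℓ δ ≤ v * √δ := by
    intro δ hδ
    obtain ⟨hX, hφ⟩ := hW.wellX_spec hδ.1 (hδ.2.trans_lt h1)
    have hXle : wellX φ ℓ δ ≤ ℓ₁ := by
      by_contra hcon
      have := hW.strictMonoOn (Ioo_subset_Icc_self hX1) (Ioo_subset_Icc_self hX) (not_le.1 hcon)
      rw [hφ, hφ1] at this
      linarith [hδ.2]
    have hX2 : wellX φ ℓ δ ∈ Icc 0 ℓ₂ := ⟨hX.1.le, hXle.trans h12.le⟩
    refine ⟨⟨hX.1, hXle⟩, hφ, ?_, ?_⟩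
    · have h3 := hupp _ hX2
      rw [hφ] at h3
      rw [hu, ← Real.sqrt_mul (by positivity)]
      refine Real.sqrt_le_iff.2 ⟨hX.1.le, ?_⟩
      rw [div_mul_eq_mul_div, div_le_iff₀ hC₀]
      linarith
    · have h3 := hlow 0 ⟨le_rfl, h20.le⟩ _ hX2 hX.1.le
      rw [hφ, hW.zero] at h3
      rw [hv, ← Real.sqrt_mul (by positivity)]
      refine Real.le_sqrt_of_sq_le ?_
      rw [div_mul_eq_mul_div, le_div_iff₀ hc₀]
      linarith
  set D := (ℓ - ℓ₁) / √δ₁ with hD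
  have hδ₁s : 0 < √δ₁ := Real.sqrt_pos.2 h0
  have hD0 : 0 < D := div_pos (by linarith [hX1.2]) hδ₁s
  set c := min u (min (c₀ * u) (min (c₁ * u) (min c₁ D))) with hc
  have hcu : c ≤ u := min_le_left _ _
  have hcc₀ : c ≤ c₀ * u := (min_le_right _ _).trans (min_le_left _ _)
  have hcc₁ : c ≤ c₁ * u := (min_le_right _ _).trans ((min_le_right _ _).trans (min_le_left _ _))
  have hcc : c ≤ c₁ := (min_le_right _ _).trans ((min_le_right _ _).trans
    ((min_le_right _ _).trans (min_le_left _ _)))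
  have hcD : c ≤ D := (min_le_right _ _).trans ((min_le_right _ _).trans
    ((min_le_right _ _).trans (min_le_right _ _)))
  have hc0 : 0 < c := by rw [hc]; positivity
  have hright : ∀ δ ∈ Ioc 0 δ₁, ∀ s ∈ Icc 0 ℓ, wellX φ ℓ δ ≤ s →
      c₁ * wellX φ ℓ δ * (s - wellX φ ℓ δ) ≤ φ s - δ ∧ c₁ * (s - wellX φ ℓ δ) ^ 2 ≤ φ s - δ := by
    intro δ hδ s hs hXs'
    obtain ⟨hX, hφ, -, -⟩ := hXs δ hδ
    set X := wellX φ ℓ δ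
    have hX2 : X ∈ Icc 0 ℓ₂ := ⟨hX.1.le, hX.2.trans h12.le⟩
    have hX0 := hX.1
    have hd0 : 0 ≤ s - X := by linarith
    by_cases hs2 : s ≤ ℓ₂
    · have h3 := hlow X hX2 s ⟨hs.1, hs2⟩ hXs'
      rw [hφ] at h3
      have h4 : c₁ * (s ^ 2 - X ^ 2) ≤ c₀ / 2 * (s ^ 2 - X ^ 2) :=
        mul_le_mul_of_nonneg_right hc₁a (by linarith [pow_le_pow_left₀ hX0.le hXs' 2])
      constructor
      · have : c₁ * X * (s - X) ≤ c₁ * (s ^ 2 - X ^ 2) := by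
          have h5 : 0 ≤ c₁ * (s * (s - X)) := by have := hs.1; positivity
          have h6 : c₁ * (s ^ 2 - X ^ 2) = c₁ * X * (s - X) + c₁ * (s * (s - X)) := by ring
          linarith
        linarith
      · have : c₁ * (s - X) ^ 2 ≤ c₁ * (s ^ 2 - X ^ 2) := by
          have h5 : 0 ≤ c₁ * (2 * X * (s - X)) := by positivity
          have h6 : c₁ * (s ^ 2 - X ^ 2) = c₁ * (s - X) ^ 2 + c₁ * (2 * X * (s - X)) := by ring
          linarith
        linarith
    · have h3 := hlow X hX2 ℓ₂ ⟨h20.le, le_rfl⟩ hX2.2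
      rw [hφ] at h3
      have h4 : φ ℓ₂ ≤ φ s := hW.strictMonoOn.monotoneOn ⟨h20.le, h2.le⟩ hs (not_le.1 hs2).le
      have h5 : κ ≤ c₀ / 2 * (ℓ₂ ^ 2 - X ^ 2) := by
        rw [hκ]
        refine mul_le_mul_of_nonneg_left ?_ (by positivity)
        linarith [pow_le_pow_left₀ hX0.le hX.2 2]
      have h6 : s - X ≤ ℓ := by linarith [hs.2]
      have h7 : X ≤ ℓ := by linarith [hX.2, hX1.2]
      constructor
      · have : c₁ * X * (s - X) ≤ c₁ * ℓ ^ 2 := by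
          rw [mul_assoc, sq]
          exact mul_le_mul_of_nonneg_left (mul_le_mul h7 h6 hd0 hℓ.le) hc₁0.le
        linarith
      · have : c₁ * (s - X) ^ 2 ≤ c₁ * ℓ ^ 2 :=
          mul_le_mul_of_nonneg_left (pow_le_pow_left₀ hd0 h6 2) hc₁0.le
        linarith
  refine ⟨c, v + C₀ * v + M, hc0, by positivity, fun δ hδ => ?_, fun δ hδ => ?_, fun δ hδ => ?_,
    fun δ hδ => ?_, fun δ hδ s hs hXs' => ?_, fun δ hδ s hs hXs' => ?_, fun δ hδ s hs hXs' => ?_,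
    fun δ hδ s hs => ?_, fun δ hδ => ?_⟩
  all_goals
    obtain ⟨hX, hφ, hXu, hXv⟩ := hXs δ hδ
    have hδs : 0 < √δ := Real.sqrt_pos.2 hδ.1
    have hX2 : wellX φ ℓ δ ∈ Icc 0 ℓ₂ := ⟨hX.1.le, hX.2.trans h12.le⟩
    have hX0 := hX.1
  · exact (mul_le_mul_of_nonneg_right hcu hδs.le).trans hXu
  · refine hXv.trans (mul_le_mul_of_nonneg_right ?_ hδs.le)
    have : 0 ≤ C₀ * v := by positivity
    linarith
  · refine le_trans ?_ (hcC _ hX2).1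
    calc c * √δ ≤ c₀ * u * √δ := mul_le_mul_of_nonneg_right hcc₀ hδs.le
      _ = c₀ * (u * √δ) := by ring
      _ ≤ _ := mul_le_mul_of_nonneg_left hXu hc₀.le
  · refine (hcC _ hX2).2.trans ?_
    calc C₀ * wellX φ ℓ δ ≤ C₀ * (v * √δ) := mul_le_mul_of_nonneg_left hXv hC₀.le
      _ = C₀ * v * √δ := by ring
      _ ≤ _ := mul_le_mul_of_nonneg_right (by linarith) hδs.le
  · refine le_trans ?_ (hright δ hδ s hs hXs').1
    refine mul_le_mul_of_nonneg_right ?_ (by linarith)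
    calc c * √δ ≤ c₁ * u * √δ := mul_le_mul_of_nonneg_right hcc₁ hδs.le
      _ = c₁ * (u * √δ) := by ring
      _ ≤ _ := mul_le_mul_of_nonneg_left hXu hc₁0.le
  · exact (mul_le_mul_of_nonneg_right hcc (sq_nonneg _)).trans (hright δ hδ s hs hXs').2
  · have h3 := hlow s ⟨hs.1, hXs'.trans hX2.2⟩ _ hX2 hXs'
    rw [hφ] at h3
    have hd0 : 0 ≤ wellX φ ℓ δ - s := by linarith
    have h4 : c * √δ ≤ c₁ * wellX φ ℓ δ := by
      calc c * √δ ≤ c₁ * u * √δ := mul_le_mul_of_nonneg_right hcc₁ hδs.le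
        _ = c₁ * (u * √δ) := by ring
        _ ≤ _ := mul_le_mul_of_nonneg_left hXu hc₁0.le
    have h5 : c₁ * wellX φ ℓ δ ≤ c₀ / 2 * (wellX φ ℓ δ + s) :=
      mul_le_mul hc₁a (by linarith [hs.1]) hX0.le (by positivity)
    have h6 := mul_le_mul_of_nonneg_right (h4.trans h5) hd0
    have h7 : c₀ / 2 * (wellX φ ℓ δ + s) * (wellX φ ℓ δ - s)
        = c₀ / 2 * (wellX φ ℓ δ ^ 2 - s ^ 2) := by ring
    linarith
  · set X := wellX φ ℓ δ
    have hXI : X ∈ Icc 0 ℓ := ⟨hX0.le, hX2.2.trans h2.le⟩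
    have hsub : uIcc X s ⊆ Icc 0 ℓ := uIcc_subset_Icc hXI hs
    have h3 := (convex_uIcc X s).norm_image_sub_le_of_norm_hasDerivWithin_le (𝕜 := ℝ)
      (f := fun y => φ y - deriv φ X * y) (f' := fun y => deriv φ y - deriv φ X)
      (C := M * |s - X|) (fun y _ => by
        have := (hder y).fun_sub ((hasDerivAt_id y).const_mul (deriv φ X))
        simpa using this.hasDerivWithinAt) (fun y hy => by
        refine (hdlip X hXI y (hsub hy)).trans (mul_le_mul_of_nonneg_left ?_ hM0)
        exact abs_sub_left_of_mem_uIcc hy) left_mem_uIcc right_mem_uIcc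
    simp only [Real.norm_eq_abs] at h3
    have h4 : φ s - deriv φ X * s - (φ X - deriv φ X * X) = φ s - δ - deriv φ X * (s - X) := by
      rw [hφ]; ring
    rw [h4, mul_assoc, ← sq, sq_abs] at h3
    refine h3.trans (mul_le_mul_of_nonneg_right ?_ (sq_nonneg _))
    have : 0 ≤ C₀ * v := by positivity
    linarith
  · have h3 : c * √δ ≤ D * √δ₁ :=
      mul_le_mul hcD (Real.sqrt_le_sqrt hδ.2) hδs.le hD0.le
    rw [hD, div_mul_cancel₀ _ hδ₁s.ne'] at h3
    linarith [hX.2]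

end HalfWell

/-! ### Families vanishing at the base points, and smooth functions of small families. -/

namespace JetBound

variable {ι : Type*} {G E F : Type*}
  [NormedAddCommGroup G] [NormedSpace ℝ G] [NormedAddCommGroup E] [NormedSpace ℝ E]
  [NormedAddCommGroup F] [NormedSpace ℝ F]
  {n : ℕ} {f : ι → G → E} {x : ι → G} {r r' w : ι → ℝ}

/-- A family vanishing at the base points gains a factor when the scale is reduced. -/
theorem vanish (h : JetBound n f x r w) (h0 : ∀ i, f i (x i) = 0) (hr : ∀ i, 0 < r i)
    (hr' : ∀ i, 0 < r' i) (hrr : ∀ i, r' i ≤ r i) (hw : ∀ i, 0 ≤ w i) :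
    JetBound n f x r' (fun i => w i * (r' i / r i)) := by
  refine ⟨h.1, fun k hk => ?_⟩
  obtain ⟨B, hB0, hB⟩ := h.exists_nonneg hw
  refine ⟨B, fun i => ?_⟩
  have h1 := hr i
  have h2 := hr' i
  have h3 := hw i
  rcases k with _ | k
  · rw [norm_iteratedFDeriv_zero, h0 i]
    simp only [norm_zero, zero_mul]
    positivity
  · have h4 := hB (k + 1) hk i
    calc ‖iteratedFDeriv ℝ (k + 1) (f i) (x i)‖ * r' i ^ (k + 1)
        = ‖iteratedFDeriv ℝ (k + 1) (f i) (x i)‖ * r i ^ (k + 1) * (r' i / r i) ^ (k + 1) := by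
          rw [div_pow]; field_simp
      _ ≤ (B * w i) * (r' i / r i) := by
          refine mul_le_mul h4 ?_ (by positivity) (by positivity)
          exact pow_le_of_le_one (by positivity) ((div_le_one h1).2 (hrr i)) (by omega)
      _ = _ := by ring

/-- Composition with a function that is smooth near a compact convex set, minus its value at a
base value. -/
theorem comp_sub {g : E → F} {O K : Set E} (h : JetBound n f x r w) (hw : ∀ i, 0 ≤ w i)
    {C : ℝ} (hwC : ∀ i, w i ≤ C) (hO : IsOpen O) (hg : ContDiffOn ℝ ∞ g O)
    (hK : IsCompact K) (hKc : Convex ℝ K) (hKO : K ⊆ O) (h0 : (0 : E) ∈ K)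
    (hy : ∀ i, f i (x i) ∈ K) (hr : ∀ i, 0 < r i) :
    JetBound n (fun i y => g (f i y) - g 0) x r w := by
  have hr' : ∀ i, 0 ≤ r i := fun i => (hr i).le
  have hs : ∀ i, ContDiffAt ℝ ∞ (fun y => g (f i y) - g 0) (x i) := fun i =>
    ((hg.contDiffAt (hO.mem_nhds (hKO (hy i)))).comp (x i) (h.1 i)).sub contDiffAt_const
  have hd : ContDiffOn ℝ ∞ (_root_.fderiv ℝ g) O := hg.fderiv_of_isOpen hO (by simp)
  obtain ⟨L, hL⟩ := hK.exists_bound_of_continuousOn (hd.continuousOn.mono hKO)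
  obtain ⟨B, hB⟩ := h.norm_le
  have h0' : ∀ i, ‖g (f i (x i)) - g 0‖ ≤ (|L| * B) * w i := fun i => by
    have := hKc.norm_image_sub_le_of_norm_fderiv_le (𝕜 := ℝ) (C := |L|)
      (fun y hy => ((hg.contDiffAt (hO.mem_nhds (hKO hy))).differentiableAt (by simp)))
      (fun y hy => (hL y hy).trans (le_abs_self L)) h0 (hy i)
    rw [sub_zero] at this
    refine this.trans ?_
    rw [mul_assoc]
    exact mul_le_mul_of_nonneg_left (hB i) (abs_nonneg _)
  rcases n with _ | n
  · exact JetBound.zero hs h0'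
  · refine of_fderiv hs h0' ?_ hr
    have h1 : JetBound n f x r 1 :=
      (h.of_le (Nat.le_succ n)).weight hw C (fun i => by simpa using hwC i)
    have h2 := h1.comp_compact hO hd hK hKO hy hr
    have h3 := h.fderiv hr
    have h4 := h2.bilin h3 (ContinuousLinearMap.compL ℝ G E F) hr' (fun _ => zero_le_one)
      (fun i => div_nonneg (hw i) (hr' i))
    refine (h4.congr (f' := fun i => _root_.fderiv ℝ (fun y => g (f i y) - g 0))
      (fun i => ?_)).weight (fun i => by
        simpa using div_nonneg (hw i) (hr' i)) 1 (fun i => by simp)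
    have h5 : ∀ᶠ y in 𝓝 (x i), f i y ∈ O :=
      (h.1 i).continuousAt.eventually (hO.mem_nhds (hKO (hy i)))
    have h6 : ∀ᶠ y in 𝓝 (x i), ContDiffAt ℝ 1 (f i) y :=
      ((h.1 i).of_le (m := 1) (by exact_mod_cast le_top)).eventually (by simp)
    filter_upwards [h5, h6] with y hy5 hy6
    rw [fderiv_sub_const]
    exact fderiv_fun_comp y ((hg.contDiffAt (hO.mem_nhds hy5)).differentiableAt (by simp))
      (hy6.differentiableAt (by simp))

end JetBound

/-! ### Smooth dependence of the turning point and of the slope on the energy. -/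

namespace HalfWell

variable {φ : ℝ → ℝ} {ℓ δ₁ c C : ℝ}

/-- The turning point is defined by a choice. Injectivity of `φ` on the half well identifies it near
`δ` with the local inverse of the inverse function theorem. -/
theorem wellX_contDiffAt (hW : HalfWell φ ℓ) {δ : ℝ} (hδ : 0 < δ) (hδ1 : δ < φ ℓ) :
    ContDiffAt ℝ ∞ (wellX φ ℓ) δ ∧ HasDerivAt (wellX φ ℓ) (deriv φ (wellX φ ℓ δ))⁻¹ δ := by
  obtain ⟨hX, hφ⟩ := hW.wellX_spec hδ hδ1
  set X := wellX φ ℓ δ with hXdef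
  have hα : deriv φ X ≠ 0 := (hW.deriv_pos X hX).ne'
  have hd : HasDerivAt φ (deriv φ X) X := (hW.differentiable X).hasDerivAt
  have hcd : ContDiffAt ℝ ∞ φ X := hW.smooth.contDiffAt
  have hf' := hd.hasFDerivAt_equiv hα
  have hn : (∞ : WithTop ℕ∞) ≠ 0 := by simp
  set g := hcd.localInverse hf' hn with hg
  have hg0 : g δ = X := by rw [← hφ]; exact hcd.localInverse_apply_image hf' hn
  have hgc : ContDiffAt ℝ ∞ g δ := by
    have := hcd.to_localInverse hf' hn
    rwa [hφ] at this
  have hgr : ∀ᶠ y in 𝓝 δ, φ (g y) = y := by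
    have := (hcd.hasStrictFDerivAt' hf' hn).eventually_right_inverse
    rw [hφ] at this
    exact this
  have hgI : ∀ᶠ y in 𝓝 δ, g y ∈ Ioo 0 ℓ :=
    hgc.continuousAt.eventually (isOpen_Ioo.mem_nhds (by rw [hg0]; exact hX))
  have heq : wellX φ ℓ =ᶠ[𝓝 δ] g := by
    filter_upwards [hgr, hgI] with y h1 h2
    rw [← hW.wellX_eq h2, h1]
  have hc : ContDiffAt ℝ ∞ (wellX φ ℓ) δ := hgc.congr_of_eventuallyEq heq
  refine ⟨hc, ?_⟩
  have hr : ∀ᶠ y in 𝓝 δ, φ (wellX φ ℓ y) = y := by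
    filter_upwards [hgr, heq] with y h1 h2
    rw [h2, h1]
  exact HasDerivAt.of_local_left_inverse hc.continuousAt hd hα hr

/-- The slope `φ'(X(δ))` at the turning point. -/
def slope (φ : ℝ → ℝ) (ℓ δ : ℝ) : ℝ := deriv φ (wellX φ ℓ δ)

theorem slope_contDiffAt (hW : HalfWell φ ℓ) {δ : ℝ} (hδ : 0 < δ) (hδ1 : δ < φ ℓ) :
    ContDiffAt ℝ ∞ (HalfWell.slope φ ℓ) δ ∧
      HasDerivAt (HalfWell.slope φ ℓ) (deriv (deriv φ) (wellX φ ℓ δ) / HalfWell.slope φ ℓ δ) δ := by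
  obtain ⟨h1, h2⟩ := hW.wellX_contDiffAt hδ hδ1
  refine ⟨hW.smooth_deriv.contDiffAt.comp δ h1, ?_⟩
  exact ((hW.smooth_deriv.differentiable (by simp)) _).hasDerivAt.comp δ h2

theorem slope_pos (hW : HalfWell φ ℓ) {δ : ℝ} (hδ : 0 < δ) (hδ1 : δ < φ ℓ) :
    0 < HalfWell.slope φ ℓ δ :=
  hW.deriv_pos _ (hW.wellX_spec hδ hδ1).1

/-- Jets of the turning point and of the slope, at scale `δ`. -/
theorem jets (hW : HalfWell φ ℓ) (h1 : δ₁ < φ ℓ) (hb : WellBounds φ ℓ δ₁ c C) (n : ℕ) :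
    JetBound n (fun _ : Ioc 0 δ₁ => wellX φ ℓ) (fun i => (i : ℝ)) (fun i => (i : ℝ))
      (fun i => √(i : ℝ)) ∧
    JetBound n (fun _ : Ioc 0 δ₁ => HalfWell.slope φ ℓ) (fun i => (i : ℝ)) (fun i => (i : ℝ))
      (fun i => √(i : ℝ)) := by
  have hc := hb.c_pos
  have hlt : ∀ i : Ioc 0 δ₁, (i : ℝ) < φ ℓ := fun i => i.2.2.trans_lt h1
  have hi0 : ∀ i : Ioc 0 δ₁, 0 < (i : ℝ) := fun i => i.2.1
  have hi0' : ∀ i : Ioc 0 δ₁, 0 ≤ (i : ℝ) := fun i => i.2.1.le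
  have hsq : ∀ i : Ioc 0 δ₁, 0 < √(i : ℝ) := fun i => Real.sqrt_pos.2 i.2.1
  -- With `δ` the base energy, the pair `(X, α/√δ)` takes values in a compact set at the base point
  -- and solves `Y' = δ⁻¹ V(Y)` with `V(p) = (√δ / p₂, φ''(p₁) / p₂)`, so `of_ode` applies at scale
  -- `δ`.
  let Y : Ioc 0 δ₁ → ℝ → ℝ × ℝ := fun i y => (wellX φ ℓ y, (√(i : ℝ))⁻¹ * HalfWell.slope φ ℓ y)
  let K : Set (ℝ × ℝ) := Icc 0 ℓ ×ˢ Icc c C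
  let O : Set (ℝ × ℝ) := {p | p.2 ≠ 0}
  have hO : IsOpen O := isOpen_ne_fun continuous_snd continuous_const
  have hK : IsCompact K := isCompact_Icc.prod isCompact_Icc
  have hKO : K ⊆ O := fun p hp => (hc.trans_le hp.2.1).ne'
  have hYK : ∀ i, Y i i ∈ K := fun i => by
    refine ⟨Ioo_subset_Icc_self (hW.wellX_spec (hi0 i) (hlt i)).1, ?_, ?_⟩
    · have := hb.deriv_ge i i.2
      change c ≤ (√(i : ℝ))⁻¹ * deriv φ (wellX φ ℓ i)
      rw [← div_eq_inv_mul, le_div_iff₀ (hsq i)]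
      exact this
    · have := hb.deriv_le i i.2
      change (√(i : ℝ))⁻¹ * deriv φ (wellX φ ℓ i) ≤ C
      rw [← div_eq_inv_mul, div_le_iff₀ (hsq i)]
      exact this
  have hinv : ContDiffOn ℝ ∞ (fun p : ℝ × ℝ => (p.2)⁻¹) O :=
    contDiff_snd.contDiffOn.inv fun p hp => hp
  let Λ : (ℝ × ℝ) →L[ℝ] (ℝ →L[ℝ] ℝ × ℝ) :=
    ContinuousLinearMap.smulRightL ℝ ℝ (ℝ × ℝ) (1 : ℝ →L[ℝ] ℝ)
  let V1 : ℝ × ℝ → (ℝ →L[ℝ] ℝ × ℝ) := fun p => Λ ((p.2)⁻¹, 0)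
  let V2 : ℝ × ℝ → (ℝ →L[ℝ] ℝ × ℝ) := fun p => Λ (0, deriv (deriv φ) p.1 * (p.2)⁻¹)
  have hV1 : ContDiffOn ℝ ∞ V1 O := Λ.contDiff.comp_contDiffOn (hinv.prodMk contDiffOn_const)
  have hdd : ContDiff ℝ ∞ (deriv (deriv φ)) :=
    ((contDiff_infty_iff_deriv (𝕜 := ℝ)).1 hW.smooth_deriv).2
  have hV2 : ContDiffOn ℝ ∞ V2 O :=
    Λ.contDiff.comp_contDiffOn (contDiffOn_const.prodMk
      ((hdd.comp contDiff_fst).contDiffOn.mul hinv))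
  have hYs : ∀ i, ContDiffAt ℝ ∞ (Y i) i := fun i =>
    (hW.wellX_contDiffAt (hi0 i) (hlt i)).1.prodMk
      (contDiffAt_const.mul (hW.slope_contDiffAt (hi0 i) (hlt i)).1)
  obtain ⟨D, hD⟩ := hK.isBounded.exists_norm_le
  have hY : ∀ m, JetBound m Y (fun i => (i : ℝ)) (fun i => (i : ℝ)) 1 := by
    refine JetBound.of_ode (V := fun i p => √(i : ℝ) • V1 p + V2 p) hYs
      (fun i => hD _ (hYK i)) hi0 (fun m => ?_) (fun i => ?_)
    · have e1 := JetBound.of_compact (n := m) hO hV1 hK hKO hYK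
      have e2 := JetBound.of_compact (n := m) hO hV2 hK hKO hYK
      have e3 := e1.clm_family (fun i => √(i : ℝ) • ContinuousLinearMap.id ℝ _) (C := √δ₁)
        (fun i => by
          rw [norm_smul, Real.norm_eq_abs, abs_of_pos (hsq i)]
          calc √(i : ℝ) * _ ≤ √(i : ℝ) * 1 := mul_le_mul_of_nonneg_left
                ContinuousLinearMap.norm_id_le (hsq i).le
            _ ≤ √δ₁ := by rw [mul_one]; exact Real.sqrt_le_sqrt i.2.2)
        (fun _ => zero_le_one) (fun _ => zero_le_one)
      exact e3.add e2 (fun _ => zero_le_one)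
    · have hnb : ∀ᶠ y in 𝓝 (i : ℝ), y ∈ Ioo 0 (φ ℓ) := isOpen_Ioo.mem_nhds ⟨hi0 i, hlt i⟩
      filter_upwards [hnb] with y hy
      have d1 := (hW.wellX_contDiffAt hy.1 hy.2).2
      have d2 := ((hW.slope_contDiffAt hy.1 hy.2).2).const_mul (√(i : ℝ))⁻¹
      have hsl := (hW.slope_pos hy.1 hy.2).ne'
      rw [(d1.prodMk d2).hasFDerivAt.fderiv]
      ext
      all_goals
        have hs2 : √(i : ℝ) * √(i : ℝ) = i := Real.mul_self_sqrt (hi0' i)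
        have hsi := (hsq i).ne'
        have hii := (hi0 i).ne'
        simp [V1, V2, Λ, Y]
      · change (HalfWell.slope φ ℓ y)⁻¹ = _
        rw [← hs2]
        field_simp
        rw [Real.sqrt_sq (hsq i).le]
      · rw [← hs2]
        field_simp
        rw [Real.sqrt_sq (hsq i).le]
  have hα : ∀ m, JetBound m (fun _ : Ioc 0 δ₁ => HalfWell.slope φ ℓ) (fun i => (i : ℝ))
      (fun i => (i : ℝ)) (fun i => √(i : ℝ)) := fun m => by
    have e1 := (hY m).clm (ContinuousLinearMap.snd ℝ ℝ ℝ) hi0'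
    have e2 := e1.const_mul (fun i => √(i : ℝ)) hi0' (fun _ => zero_le_one)
    refine (e2.congr (fun i => Eventually.of_forall fun y => ?_)).weight (fun i => ?_) 1
      (fun i => ?_)
    · have := (hsq i).ne'
      simp [Y]
      field_simp
    · simp
    · simp [abs_of_pos (hsq i)]
  refine ⟨?_, hα n⟩
  have hXs : ∀ i : Ioc 0 δ₁, ContDiffAt ℝ ∞ (wellX φ ℓ) i := fun i =>
    (hW.wellX_contDiffAt (hi0 i) (hlt i)).1
  have hX0 : ∀ i : Ioc 0 δ₁, ‖wellX φ ℓ i‖ ≤ C * √(i : ℝ) := fun i => by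
    rw [Real.norm_eq_abs, abs_of_pos (hW.wellX_spec (hi0 i) (hlt i)).1.1]
    exact hb.X_le i i.2
  -- The differential equation only gives weight one for `X`. The sharper weight `√δ` comes from `X'
  -- = 1/α`, which has weight `1/√δ = √δ/δ`.
  rcases n with _ | n
  · exact JetBound.zero hXs hX0
  · refine JetBound.of_fderiv hXs hX0 ?_ hi0
    have e1 := (hY n).comp_compact hO hinv hK hKO hYK hi0
    have e2 := e1.const_mul (fun i => (√(i : ℝ))⁻¹) hi0' (fun _ => zero_le_one)
    have e3 := e2.clm (ContinuousLinearMap.smulRightL ℝ ℝ ℝ (1 : ℝ →L[ℝ] ℝ)) hi0'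
    refine (e3.congr (f' := fun _ => fderiv ℝ (wellX φ ℓ)) (fun i => ?_)).weight (fun i => ?_) 1
      (fun i => ?_)
    · have hnb : ∀ᶠ y in 𝓝 (i : ℝ), y ∈ Ioo 0 (φ ℓ) := isOpen_Ioo.mem_nhds ⟨hi0 i, hlt i⟩
      filter_upwards [hnb] with y hy
      rw [(hW.wellX_contDiffAt hy.1 hy.2).2.hasFDerivAt.fderiv]
      have hsl := (hW.slope_pos hy.1 hy.2).ne'
      have hsi := (hsq i).ne'
      ext
      simp [Y]
      change (HalfWell.slope φ ℓ y)⁻¹ = _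
      field_simp
    · simp
    · have := hsq i
      simp only [Pi.one_apply, mul_one, one_mul, abs_inv, abs_of_pos this]
      rw [inv_eq_one_div, div_le_div_iff₀ this (hi0 i), Real.mul_self_sqrt (hi0' i), one_mul]

end HalfWell

/-! ### Laplace integrals over a half well -/

theorem integrable_abs_pow_mul_exp (k : ℕ) {b : ℝ} (hb : 0 < b) :
    Integrable fun u : ℝ => |u| ^ k * Real.exp (-(b * u ^ 2)) := by
  have h := (integrable_rpow_mul_exp_neg_mul_sq hb (s := (k : ℝ))
    (by have : (0 : ℝ) ≤ k := by positivity
        linarith)).norm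
  refine h.congr (Eventually.of_forall fun u => ?_)
  simp

/-- The absolute Gaussian moments `∫ |u|^k e^{-u²}`. -/
def gaussMoment (k : ℕ) : ℝ := ∫ u : ℝ, |u| ^ k * Real.exp (-(u ^ 2))

theorem gaussMoment_nonneg (k : ℕ) : 0 ≤ gaussMoment k :=
  integral_nonneg fun u => by positivity

theorem integral_abs_pow_mul_exp (k : ℕ) {b : ℝ} (hb : 0 < b) :
    ∫ u : ℝ, |u| ^ k * Real.exp (-(b * u ^ 2)) = gaussMoment k * (√b)⁻¹ ^ (k + 1) := by
  have hs : 0 < √b := Real.sqrt_pos.2 hb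
  have h := Measure.integral_comp_mul_left (fun u : ℝ => |u| ^ k * Real.exp (-(u ^ 2))) (√b)
  have h1 : ∀ u : ℝ, |√b * u| ^ k * Real.exp (-((√b * u) ^ 2))
      = √b ^ k * (|u| ^ k * Real.exp (-(b * u ^ 2))) := fun u => by
    rw [abs_mul, abs_of_pos hs, mul_pow, mul_pow, Real.sq_sqrt hb.le]; ring
  simp only [h1] at h
  rw [integral_const_mul, smul_eq_mul, abs_of_pos (inv_pos.2 hs)] at h
  have h2 : √b ^ k ≠ 0 := by positivity
  refine mul_left_cancel₀ h2 (h.trans ?_)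
  rw [gaussMoment, pow_succ, inv_pow]
  field_simp

theorem abs_exp_neg_sub_exp_neg_le {A B m : ℝ} (hA : m ≤ A) (hB : m ≤ B) :
    |Real.exp (-A) - Real.exp (-B)| ≤ |A - B| * Real.exp (-m) := by
  wlog h : A ≤ B generalizing A B
  · rw [abs_sub_comm, abs_sub_comm A B]
    exact this hB hA (le_of_not_ge h)
  have h1 : Real.exp (-B) ≤ Real.exp (-A) := Real.exp_le_exp.2 (by linarith)
  rw [abs_of_nonneg (by linarith), abs_sub_comm, abs_of_nonneg (by linarith)]
  have h2 : Real.exp (-B) = Real.exp (-A) * Real.exp (-(B - A)) := by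
    rw [← Real.exp_add]; congr 1; ring
  have h3 : 1 - (B - A) ≤ Real.exp (-(B - A)) := by
    have := Real.add_one_le_exp (-(B - A)); linarith
  have h4 : Real.exp (-A) ≤ Real.exp (-m) := Real.exp_le_exp.2 (by linarith)
  calc Real.exp (-A) - Real.exp (-B) = Real.exp (-A) * (1 - Real.exp (-(B - A))) := by
        rw [h2]; ring
    _ ≤ Real.exp (-A) * (B - A) :=
        mul_le_mul_of_nonneg_left (by linarith) (Real.exp_pos _).le
    _ ≤ Real.exp (-m) * (B - A) := by
        refine mul_le_mul_of_nonneg_right h4 (by linarith)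
    _ = _ := by ring

/-- The Laplace integral `∫₀^ℓ exp ((2/h) (δ x - ∫₀ˣ φ)) dx`. -/
def wellZ (φ : ℝ → ℝ) (ℓ h δ : ℝ) : ℝ :=
  ∫ x in (0 : ℝ)..ℓ, Real.exp (2 / h * (δ * x - ∫ y in (0 : ℝ)..x, φ y))

/-- The action `∫₀^X (δ - φ)`. -/
def wellP (φ : ℝ → ℝ) (ℓ δ : ℝ) : ℝ := δ * wellX φ ℓ δ - ∫ y in (0 : ℝ)..wellX φ ℓ δ, φ y

/-- `∫_X^x (φ - δ)`. -/
def wellPsi (φ : ℝ → ℝ) (ℓ δ x : ℝ) : ℝ := ∫ y in wellX φ ℓ δ..x, (φ y - δ)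

namespace HalfWell

variable {φ : ℝ → ℝ} {ℓ δ₁ c C : ℝ}

/-- Recentres the exponent of the Laplace integral at the turning point, where its critical value is
`wellP`. -/
theorem exponent_eq (hW : HalfWell φ ℓ) (δ x : ℝ) :
    δ * x - ∫ y in (0 : ℝ)..x, φ y = wellP φ ℓ δ - wellPsi φ ℓ δ x := by
  have hi : ∀ u v : ℝ, IntervalIntegrable φ volume u v := fun u v =>
    hW.smooth.continuous.intervalIntegrable u v
  have h1 := intervalIntegral.integral_interval_sub_left (hi 0 x) (hi 0 (wellX φ ℓ δ))
  rw [wellP, wellPsi, intervalIntegral.integral_sub (hi _ _) (by simp), ← h1]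
  simp
  ring

theorem wellPsi_continuous (hW : HalfWell φ ℓ) (δ : ℝ) : Continuous (wellPsi φ ℓ δ) := by
  unfold wellPsi
  exact intervalIntegral.continuous_primitive
    (fun u v => (hW.smooth.continuous.sub continuous_const).intervalIntegrable u v) _

/-- Envelope rule: the motion of the endpoint contributes `(δ - φ(X)) X' = 0`. -/
theorem wellP_hasDerivAt (hW : HalfWell φ ℓ) {δ : ℝ} (hδ : 0 < δ) (hδ1 : δ < φ ℓ) :
    HasDerivAt (wellP φ ℓ) (wellX φ ℓ δ) δ := by
  have h1 := (hW.wellX_contDiffAt hδ hδ1).2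
  have h2 : HasDerivAt (fun x => ∫ y in (0 : ℝ)..x, φ y) (φ (wellX φ ℓ δ)) (wellX φ ℓ δ) :=
    intervalIntegral.integral_hasDerivAt_right (hW.smooth.continuous.intervalIntegrable _ _)
      (hW.smooth.continuous.stronglyMeasurableAtFilter _ _) hW.smooth.continuous.continuousAt
  have h3 := ((hasDerivAt_id δ).mul h1).sub (h2.comp δ h1)
  refine h3.congr_deriv ?_
  rw [(hW.wellX_spec hδ hδ1).2]
  simp

theorem integral_sub_const_mul (k X x : ℝ) :
    ∫ y in X..x, k * (y - X) = k / 2 * (x - X) ^ 2 := by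
  have : ∀ y ∈ uIcc X x, HasDerivAt (fun y => k / 2 * (y - X) ^ 2) (k * (y - X)) y := fun y _ => by
    have := (((hasDerivAt_id y).sub_const X).pow 2).const_mul (k / 2)
    refine this.congr_deriv ?_
    simp
    ring
  rw [intervalIntegral.integral_eq_sub_of_hasDerivAt this
    ((by fun_prop : Continuous fun y => k * (y - X)).intervalIntegrable _ _)]
  simp

theorem wellPsi_ge (hW : HalfWell φ ℓ) (h1 : δ₁ < φ ℓ) (hb : WellBounds φ ℓ δ₁ c C) {δ : ℝ}
    (hδ : δ ∈ Ioc 0 δ₁) {x : ℝ} (hx : x ∈ Icc 0 ℓ) :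
    c * √δ / 2 * (x - wellX φ ℓ δ) ^ 2 ≤ wellPsi φ ℓ δ x := by
  have hX := (hW.wellX_spec hδ.1 (hδ.2.trans_lt h1)).1
  set X := wellX φ ℓ δ with hXdef
  have hi : ∀ u v : ℝ, IntervalIntegrable (fun y => φ y - δ) volume u v := fun u v =>
    (hW.smooth.continuous.sub continuous_const).intervalIntegrable u v
  have hi' : ∀ u v : ℝ, IntervalIntegrable (fun y => c * √δ * (y - X)) volume u v := fun u v =>
    (by fun_prop : Continuous fun y => c * √δ * (y - X)).intervalIntegrable u v
  rw [← integral_sub_const_mul, wellPsi]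
  rcases le_total X x with hXx | hxX
  · refine intervalIntegral.integral_mono_on hXx (hi' _ _) (hi _ _) fun y hy => ?_
    exact hb.right_lin δ hδ y ⟨hX.1.le.trans hy.1, hy.2.trans hx.2⟩ hy.1
  · rw [← hXdef, intervalIntegral.integral_symm x X, intervalIntegral.integral_symm x X]
    refine neg_le_neg ?_
    refine intervalIntegral.integral_mono_on hxX (hi _ _) (hi' _ _) fun y hy => ?_
    have := hb.left_lin δ hδ y ⟨hx.1.trans hy.1, hy.2.trans hX.2.le⟩ hy.2
    rw [← hXdef] at this
    linarith

theorem wellPsi_taylor (hW : HalfWell φ ℓ) (h1 : δ₁ < φ ℓ) (hb : WellBounds φ ℓ δ₁ c C) {δ : ℝ}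
    (hδ : δ ∈ Ioc 0 δ₁) {x : ℝ} (hx : x ∈ Icc 0 ℓ) :
    |wellPsi φ ℓ δ x - HalfWell.slope φ ℓ δ / 2 * (x - wellX φ ℓ δ) ^ 2|
      ≤ C * |x - wellX φ ℓ δ| ^ 3 := by
  have hX := (hW.wellX_spec hδ.1 (hδ.2.trans_lt h1)).1
  have hcφ := hW.smooth.continuous
  rw [← integral_sub_const_mul, wellPsi, ← intervalIntegral.integral_sub
    ((by fun_prop : Continuous fun y => φ y - δ).intervalIntegrable _ _)
    ((by fun_prop : Continuous fun y => HalfWell.slope φ ℓ δ *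
      (y - wellX φ ℓ δ)).intervalIntegrable _ _)]
  have h2 := intervalIntegral.norm_integral_le_of_norm_le_const (a := wellX φ ℓ δ) (b := x)
    (f := fun y => φ y - δ - HalfWell.slope φ ℓ δ * (y - wellX φ ℓ δ))
    (C := C * |x - wellX φ ℓ δ| ^ 2) (fun y hy => by
      have hy' : y ∈ uIcc (wellX φ ℓ δ) x := uIoc_subset_uIcc hy
      refine (hb.taylor δ hδ y (uIcc_subset_Icc (Ioo_subset_Icc_self hX) hx hy')).trans ?_
      refine mul_le_mul_of_nonneg_left ?_ hb.C_pos.le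
      rw [← sq_abs]
      exact pow_le_pow_left₀ (abs_nonneg _) (abs_sub_left_of_mem_uIcc hy') 2)
  refine h2.trans (le_of_eq ?_)
  ring

/-- The width `√(h/√δ)` of the Gaussian peak at the turning point. -/
def width (h δ : ℝ) : ℝ := √(h / √δ)

theorem width_sq {h δ : ℝ} (hh : 0 < h) : width h δ ^ 2 = h / √δ := by
  rw [width, Real.sq_sqrt (by positivity)]

theorem exp_wellPsi_le (hW : HalfWell φ ℓ) (h1 : δ₁ < φ ℓ) (hb : WellBounds φ ℓ δ₁ c C) {δ h : ℝ}
    (hh : 0 < h) (hδ : δ ∈ Ioc 0 δ₁) {x : ℝ} (hx : x ∈ Icc 0 ℓ) :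
    Real.exp (-(2 / h * wellPsi φ ℓ δ x))
      ≤ Real.exp (-(c * √δ / h * (x - wellX φ ℓ δ) ^ 2)) := by
  refine Real.exp_le_exp.2 (neg_le_neg ?_)
  have := mul_le_mul_of_nonneg_left (hW.wellPsi_ge h1 hb hδ hx) (by positivity : 0 ≤ 2 / h)
  refine le_trans (le_of_eq ?_) this
  ring

theorem setIntegral_le_gauss (k : ℕ) {b X : ℝ} (hb : 0 < b) {s : Set ℝ} :
    ∫ x in s, |x - X| ^ k * Real.exp (-(b * (x - X) ^ 2))
      ≤ gaussMoment k * (√b)⁻¹ ^ (k + 1) := by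
  have hi := (integrable_abs_pow_mul_exp k hb).comp_sub_right X
  rw [← integral_abs_pow_mul_exp k hb,
    ← integral_sub_right_eq_self (fun u : ℝ => |u| ^ k * Real.exp (-(b * u ^ 2))) X]
  exact setIntegral_le_integral hi (Eventually.of_forall fun x => by positivity)

theorem inv_sqrt_eq_width {h δ : ℝ} (hc : 0 < c) :
    (√(c * √δ / h))⁻¹ = (√c)⁻¹ * width h δ := by
  rw [width, mul_div_assoc, Real.sqrt_mul hc.le, mul_inv, ← Real.sqrt_inv (√δ / h), inv_div]

theorem moment_le (hW : HalfWell φ ℓ) (h1 : δ₁ < φ ℓ) (hb : WellBounds φ ℓ δ₁ c C) {δ h : ℝ}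
    (hh : 0 < h) (hδ : δ ∈ Ioc 0 δ₁) (k : ℕ) :
    ∫ x in (0 : ℝ)..ℓ, |x - wellX φ ℓ δ| ^ k * Real.exp (-(2 / h * wellPsi φ ℓ δ x))
      ≤ gaussMoment k * ((√c)⁻¹ * width h δ) ^ (k + 1) := by
  have hc := hb.c_pos
  have hsδ : 0 < √δ := Real.sqrt_pos.2 hδ.1
  have hbp : 0 < c * √δ / h := by positivity
  rw [← inv_sqrt_eq_width hc]
  refine le_trans ?_ (setIntegral_le_gauss k (X := wellX φ ℓ δ) hbp (s := Ioc 0 ℓ))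
  rw [intervalIntegral.integral_of_le hW.pos.le]
  have hcont := hW.wellPsi_continuous δ
  refine setIntegral_mono_on ?_ ?_ measurableSet_Ioc fun x hx => ?_
  · exact (Continuous.integrableOn_Icc (by fun_prop)).mono_set Ioc_subset_Icc_self
  · exact (Continuous.integrableOn_Icc (by fun_prop)).mono_set Ioc_subset_Icc_self
  · exact mul_le_mul_of_nonneg_left
      (hW.exp_wellPsi_le h1 hb hh hδ (Ioc_subset_Icc_self hx)) (by positivity)

/-- Leading term of the Laplace integral. -/
theorem exists_laplace (hW : HalfWell φ ℓ) (h1 : δ₁ < φ ℓ) (hb : WellBounds φ ℓ δ₁ c C) :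
    ∃ D : ℝ, ∀ δ ∈ Ioc 0 δ₁, ∀ h : ℝ, 0 < h →
      |(∫ x in (0 : ℝ)..ℓ, Real.exp (-(2 / h * wellPsi φ ℓ δ x)))
        - √(Real.pi * h / HalfWell.slope φ ℓ δ)| ≤ D * (h / δ) := by
  have hc := hb.c_pos
  have hC := hb.C_pos
  refine ⟨2 * C * gaussMoment 3 * (√c)⁻¹ ^ 4 + c⁻¹ * gaussMoment 1 * (√c)⁻¹ ^ 2,
    fun δ hδ h hh => ?_⟩
  have hX := (hW.wellX_spec hδ.1 (hδ.2.trans_lt h1)).1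
  have hα : c * √δ ≤ HalfWell.slope φ ℓ δ := hb.deriv_ge δ hδ
  have hroom := hb.room δ hδ
  have hXge := hb.X_ge δ hδ
  set X := wellX φ ℓ δ with hXdef
  set α := HalfWell.slope φ ℓ δ with hαdef
  have hδ0 := hδ.1
  have hsδ : 0 < √δ := Real.sqrt_pos.2 hδ.1
  have hα0 : 0 < α := lt_of_lt_of_le (by positivity) hα
  set b := c * √δ / h with hbdef
  have hbp : 0 < b := by positivity
  have hbα : b ≤ α / h := by rw [hbdef]; gcongr
  set Gs : ℝ → ℝ := fun x => Real.exp (-(α / h * (x - X) ^ 2)) with hGs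
  have hGint : Integrable Gs := by
    have := (integrable_abs_pow_mul_exp 0 (b := α / h) (by positivity)).comp_sub_right X
    simpa using this
  have hGtot : ∫ x, Gs x = √(Real.pi * h / α) := by
    have h2 := integral_gaussian (α / h)
    rw [← integral_sub_right_eq_self _ X] at h2
    rw [hGs, div_div_eq_mul_div] at *
    rw [← h2]
    simp only [neg_mul]
  have hGb : ∀ x, Gs x ≤ Real.exp (-(b * (x - X) ^ 2)) := fun x =>
    Real.exp_le_exp.2 (neg_le_neg (mul_le_mul_of_nonneg_right hbα (sq_nonneg _)))
  have hcont := hW.wellPsi_continuous δ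
  have hw4 : (√b)⁻¹ ^ 4 = (√c)⁻¹ ^ 4 * (h / δ * h) := by
    rw [hbdef, inv_sqrt_eq_width hc, mul_pow, show (4 : ℕ) = 2 * 2 by norm_num,
      pow_mul (width h δ), width_sq hh, div_pow, Real.sq_sqrt hδ0.le]
    ring
  have hw2 : (√b)⁻¹ ^ 2 = (√c)⁻¹ ^ 2 * (h / √δ) := by
    rw [hbdef, inv_sqrt_eq_width hc, mul_pow, width_sq hh]
  -- Inside the well the exponent is replaced by its quadratic part. The cubic error divided by `h`,
  -- integrated against a Gaussian of width `w = √(h/√δ)`, is of size `w⁴/h = h/δ`.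
  have hin : |(∫ x in (0 : ℝ)..ℓ, Real.exp (-(2 / h * wellPsi φ ℓ δ x))) - ∫ x in Ioc 0 ℓ, Gs x|
      ≤ 2 * C / h * (gaussMoment 3 * (√b)⁻¹ ^ 4) := by
    have hEc : Continuous fun x => Real.exp (-(2 / h * wellPsi φ ℓ δ x)) := by fun_prop
    have hEi : IntegrableOn (fun x => Real.exp (-(2 / h * wellPsi φ ℓ δ x))) (Ioc 0 ℓ) :=
      hEc.integrableOn_Ioc
    rw [intervalIntegral.integral_of_le hW.pos.le, ← integral_sub hEi hGint.integrableOn,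
      ← Real.norm_eq_abs]
    refine (norm_integral_le_integral_norm _).trans ?_
    refine le_trans ?_ (mul_le_mul_of_nonneg_left
      (setIntegral_le_gauss 3 (X := X) hbp (s := Ioc 0 ℓ)) (by positivity))
    rw [← integral_const_mul]
    refine setIntegral_mono_on ?_ ?_ measurableSet_Ioc fun x hx => ?_
    · exact (Continuous.integrableOn_Icc (by simp only [hGs]; fun_prop)).mono_set
        Ioc_subset_Icc_self
    · exact (Continuous.integrableOn_Icc (by fun_prop)).mono_set Ioc_subset_Icc_self
    · have hx' := Ioc_subset_Icc_self hx
      have e1 := hW.wellPsi_ge h1 hb hδ hx'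
      have e2 := hW.wellPsi_taylor h1 hb hδ hx'
      rw [← hXdef] at e1 e2
      have e3 : b * (x - X) ^ 2 ≤ 2 / h * wellPsi φ ℓ δ x := by
        have := mul_le_mul_of_nonneg_left e1 (by positivity : 0 ≤ 2 / h)
        refine le_trans (le_of_eq ?_) this
        rw [hbdef]; ring
      have e4 := abs_exp_neg_sub_exp_neg_le e3
        (mul_le_mul_of_nonneg_right hbα (sq_nonneg (x - X)))
      refine e4.trans ?_
      have e5 : |2 / h * wellPsi φ ℓ δ x - α / h * (x - X) ^ 2| ≤ 2 / h * (C * |x - X| ^ 3) := by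
        have : 2 / h * wellPsi φ ℓ δ x - α / h * (x - X) ^ 2
            = 2 / h * (wellPsi φ ℓ δ x - α / 2 * (x - X) ^ 2) := by ring
        rw [this, abs_mul, abs_of_pos (by positivity)]
        exact mul_le_mul_of_nonneg_left e2 (by positivity)
      calc _ ≤ 2 / h * (C * |x - X| ^ 3) * Real.exp (-(b * (x - X) ^ 2)) :=
            mul_le_mul_of_nonneg_right e5 (Real.exp_pos _).le
        _ = _ := by ring
  -- Outside `[0, ℓ]` the distance to the turning point is at least `c√δ`, so `1 ≤ |x - X| / (c√δ)`,
  -- and the first moment gives `w²/√δ = h/δ` again.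
  have hout : |(∫ x in Ioc 0 ℓ, Gs x) - ∫ x, Gs x|
      ≤ (c * √δ)⁻¹ * (gaussMoment 1 * (√b)⁻¹ ^ 2) := by
    rw [← integral_add_compl measurableSet_Ioc hGint (s := Ioc 0 ℓ), sub_add_cancel_left, abs_neg,
      abs_of_nonneg (integral_nonneg fun x => (Real.exp_pos _).le)]
    refine le_trans ?_ (mul_le_mul_of_nonneg_left
      (setIntegral_le_gauss 1 (X := X) hbp (s := (Ioc 0 ℓ)ᶜ)) (by positivity))
    rw [← integral_const_mul]
    refine setIntegral_mono_on hGint.integrableOn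
      (((integrable_abs_pow_mul_exp 1 hbp).comp_sub_right X).const_mul _).integrableOn
      measurableSet_Ioc.compl fun x hx => ?_
    have hfar : c * √δ ≤ |x - X| := by
      by_cases hx0 : x ≤ 0
      · rw [abs_of_nonpos (by linarith [hX.1])]; linarith
      · have : ℓ < x := by
          by_contra hcon
          exact hx ⟨not_le.1 hx0, not_lt.1 hcon⟩
        rw [abs_of_nonneg (by linarith [hX.2])]; linarith
    have hone : 1 ≤ (c * √δ)⁻¹ * |x - X| := by
      rw [← div_eq_inv_mul, le_div_iff₀ (by positivity), one_mul]; exact hfar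
    calc Gs x ≤ 1 * Real.exp (-(b * (x - X) ^ 2)) := by rw [one_mul]; exact hGb x
      _ ≤ (c * √δ)⁻¹ * |x - X| * Real.exp (-(b * (x - X) ^ 2)) :=
          mul_le_mul_of_nonneg_right hone (Real.exp_pos _).le
      _ = _ := by rw [pow_one, mul_assoc]
  rw [← hGtot]
  have h3 := abs_sub_le (∫ x in (0 : ℝ)..ℓ, Real.exp (-(2 / h * wellPsi φ ℓ δ x)))
    (∫ x in Ioc 0 ℓ, Gs x) (∫ x, Gs x)
  refine h3.trans ((add_le_add hin hout).trans (le_of_eq ?_))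
  rw [hw4, hw2]
  have hss : √δ * √δ = δ := Real.mul_self_sqrt hδ0.le
  have : (c * √δ)⁻¹ * (gaussMoment 1 * ((√c)⁻¹ ^ 2 * (h / √δ)))
      = c⁻¹ * gaussMoment 1 * (√c)⁻¹ ^ 2 * (h / δ) := by
    rw [show h / δ = h / √δ / √δ by rw [div_div, hss]]
    field_simp
  rw [this]
  field_simp

end HalfWell

/-! ### Derivatives of the Laplace integral -/

/-- Exponential integrals over a bounded interval are smooth, with the moments as derivatives. -/
theorem iteratedDeriv_expIntegral {u v : ℝ → ℝ} (hu : Continuous u) (hv : Continuous v) {ℓ : ℝ}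
    (hℓ : 0 ≤ ℓ) :
    ContDiff ℝ ∞ (fun y : ℝ => ∫ x in (0 : ℝ)..ℓ, Real.exp (y * u x - v x)) ∧
      ∀ k y, iteratedDeriv k (fun y : ℝ => ∫ x in (0 : ℝ)..ℓ, Real.exp (y * u x - v x)) y
        = ∫ x in (0 : ℝ)..ℓ, u x ^ k * Real.exp (y * u x - v x) := by
  -- The integral is the moment generating function of `u` under the finite measure `e^{-v} dx`,
  -- which is analytic with the moments as derivatives.
  set μ : Measure ℝ := (volume.restrict (Ioc 0 ℓ)).withDensity
    (fun x => ENNReal.ofReal (Real.exp (-v x))) with hμ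
  have hm : Measurable fun x => ENNReal.ofReal (Real.exp (-v x)) := by fun_prop
  have hint : ∀ F : ℝ → ℝ, ∫ x, F x ∂μ = ∫ x in (0 : ℝ)..ℓ, F x * Real.exp (-v x) := fun F => by
    rw [hμ, integral_withDensity_eq_integral_toReal_smul hm (by simp),
      intervalIntegral.integral_of_le hℓ]
    refine integral_congr_ae (Eventually.of_forall fun x => ?_)
    simp only [smul_eq_mul]
    rw [ENNReal.toReal_ofReal (Real.exp_pos _).le, mul_comm]
  have hexp : ∀ y x, Real.exp (y * u x) * Real.exp (-v x) = Real.exp (y * u x - v x) :=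
    fun y x => by rw [← Real.exp_add]; rfl
  have hset : ProbabilityTheory.integrableExpSet u μ = univ := by
    refine eq_univ_of_forall fun t => ?_
    change Integrable (fun x => Real.exp (t * u x)) μ
    rw [hμ, integrable_withDensity_iff hm (by simp)]
    have : Continuous fun x => Real.exp (t * u x) * Real.exp (-v x) := by fun_prop
    refine (this.integrableOn_Ioc (a := 0) (b := ℓ)).congr (Eventually.of_forall fun x => ?_)
    simp only
    rw [ENNReal.toReal_ofReal (Real.exp_pos _).le]
  have hmem : ∀ t, t ∈ interior (ProbabilityTheory.integrableExpSet u μ) := fun t => by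
    rw [hset]; simp
  have hmgf : (fun y : ℝ => ∫ x in (0 : ℝ)..ℓ, Real.exp (y * u x - v x))
      = ProbabilityTheory.mgf u μ := by
    ext y
    rw [ProbabilityTheory.mgf, hint]
    simp only [hexp]
  rw [hmgf]
  refine ⟨contDiff_iff_contDiffAt.2 fun y =>
    (ProbabilityTheory.analyticAt_mgf (hmem y)).contDiffAt, fun k y => ?_⟩
  rw [ProbabilityTheory.iteratedDeriv_mgf (hmem y), hint]
  simp only [mul_assoc, hexp]

namespace JetBound

variable {ι : Type*} {G : Type*} [NormedAddCommGroup G] [NormedSpace ℝ G]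
  {n : ℕ} {x : ι → G} {r w : ι → ℝ}

/-- Products of families close to `1`. -/
theorem one_add_mul {f g : ι → G → ℝ} (h : JetBound n (fun i y => f i y - 1) x r w)
    (h' : JetBound n (fun i y => g i y - 1) x r w) (hr : ∀ i, 0 ≤ r i) (hw : ∀ i, 0 ≤ w i)
    {C : ℝ} (hwC : ∀ i, w i ≤ C) : JetBound n (fun i y => f i y * g i y - 1) x r w := by
  have h1 := (h.mul h' hr hw hw).weight (w' := w) (fun i => mul_nonneg (hw i) (hw i)) C
    (fun i => mul_le_mul_of_nonneg_right (hwC i) (hw i))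
  refine ((h1.add h hr).add h' hr).congr fun i => Eventually.of_forall fun y => ?_
  ring

end JetBound

/-- The relative error of the Laplace approximation. -/
def wellQuot (φ : ℝ → ℝ) (ℓ h δ : ℝ) : ℝ :=
  wellZ φ ℓ h δ * Real.exp (-(2 / h * wellP φ ℓ δ)) * √(HalfWell.slope φ ℓ δ / (Real.pi * h))

namespace HalfWell

variable {φ : ℝ → ℝ} {ℓ δ₁ c C : ℝ}

/-- The Laplace integral, recentred at a fixed energy. -/
def tilted (φ : ℝ → ℝ) (ℓ h δ y : ℝ) : ℝ :=
  ∫ x in (0 : ℝ)..ℓ, Real.exp (y * (2 / h * (x - wellX φ ℓ δ))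
    - (δ * (2 / h * (x - wellX φ ℓ δ)) + 2 / h * wellPsi φ ℓ δ x))

/-- The exponential of the tangent line to the action at `δ` carries the rapid growth in `y`; the
remaining factor varies only on the scale `h/√δ`. -/
theorem wellZ_eq_tilted (hW : HalfWell φ ℓ) {h : ℝ} (δ y : ℝ) :
    wellZ φ ℓ h y = Real.exp (2 / h * (wellP φ ℓ δ + wellX φ ℓ δ * (y - δ)))
      * tilted φ ℓ h δ y := by
  rw [wellZ, tilted, ← intervalIntegral.integral_const_mul]
  refine intervalIntegral.integral_congr fun x _ => ?_
  rw [← Real.exp_add]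
  congr 1
  have := hW.exponent_eq δ x
  rw [show y * x - ∫ y in (0 : ℝ)..x, φ y = (δ * x - ∫ y in (0 : ℝ)..x, φ y) + (y - δ) * x by ring,
    this]
  ring

section Family

variable {ι : Type*} {hp d : ι → ℝ}

theorem sqrt_eta_eq {h δ : ℝ} (hδ : 0 < δ) : √(h / (δ * √δ)) = width h δ / √δ := by
  have hs := Real.sqrt_pos.2 hδ
  rw [width, ← Real.sqrt_div' _ hδ.le]
  congr 1
  field_simp

theorem sqrt_slope_le (hb : WellBounds φ ℓ δ₁ c C) {h δ : ℝ}
    (hh : 0 < h) (hδ : δ ∈ Ioc 0 δ₁) :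
    √(HalfWell.slope φ ℓ δ / (Real.pi * h)) ≤ √C * (width h δ)⁻¹ := by
  have hs := Real.sqrt_pos.2 hδ.1
  have hC := hb.C_pos
  rw [width, ← Real.sqrt_inv, ← Real.sqrt_mul hC.le]
  refine Real.sqrt_le_sqrt ?_
  have h2 : HalfWell.slope φ ℓ δ ≤ C * √δ := hb.deriv_le δ hδ
  rw [inv_div, ← mul_div_assoc]
  refine div_le_div₀ (by positivity) h2 hh ?_
  have := Real.pi_gt_three
  nlinarith

/-- Order zero is the Laplace approximation. A derivative in the energy brings down `(2/h)(x - X)`,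
of size `w/h` with `w` the width of the peak. At scale `h/√δ` this is a factor `w/√δ = √η`, and `√η
≤ 1`, so every order `k ≥ 1` is bounded by `√η`. -/
theorem jets_tilted (hW : HalfWell φ ℓ) (h1 : δ₁ < φ ℓ) (hb : WellBounds φ ℓ δ₁ c C)
    (hp0 : ∀ i, 0 < hp i) (hd : ∀ i, d i ∈ Ioc 0 δ₁) (hη : ∀ i, hp i ≤ d i * √(d i)) (n : ℕ) :
    JetBound n (fun i y => tilted φ ℓ (hp i) (d i) y
        * √(HalfWell.slope φ ℓ (d i) / (Real.pi * hp i)) - 1)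
      d (fun i => hp i / √(d i)) (fun i => √(hp i / (d i * √(d i)))) := by
  have hc := hb.c_pos
  obtain ⟨D, hD⟩ := hW.exists_laplace h1 hb
  have hu : ∀ i, Continuous fun x => 2 / hp i * (x - wellX φ ℓ (d i)) := fun i => by fun_prop
  have hv : ∀ i, Continuous fun x => d i * (2 / hp i * (x - wellX φ ℓ (d i)))
      + 2 / hp i * wellPsi φ ℓ (d i) x := fun i => by
    have := hW.wellPsi_continuous (d i)
    fun_prop
  have hder := fun i => iteratedDeriv_expIntegral (hu i) (hv i) hW.pos.le
  have hfac : ∀ i, 0 ≤ √(HalfWell.slope φ ℓ (d i) / (Real.pi * hp i)) := fun i =>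
    Real.sqrt_nonneg _
  have hds : ∀ i, 0 < √(d i) := fun i => Real.sqrt_pos.2 (hd i).1
  have hwd : ∀ i, 0 < width (hp i) (d i) := fun i =>
    Real.sqrt_pos.2 (div_pos (hp0 i) (hds i))
  have hsm : ∀ i, ContDiffAt ℝ ∞ (fun y => tilted φ ℓ (hp i) (d i) y
        * √(HalfWell.slope φ ℓ (d i) / (Real.pi * hp i)) - 1) (d i) := fun i =>
    (((hder i).1.mul contDiff_const).sub contDiff_const).contDiffAt
  have hε1 : ∀ i, width (hp i) (d i) / √(d i) ≤ 1 := fun i => by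
    rw [← sqrt_eta_eq (hd i).1, Real.sqrt_le_one]
    have := (hd i).1
    have := hds i
    rw [div_le_one (by positivity)]
    exact hη i
  have hexp : ∀ i x, d i * (2 / hp i * (x - wellX φ ℓ (d i)))
      - (d i * (2 / hp i * (x - wellX φ ℓ (d i))) + 2 / hp i * wellPsi φ ℓ (d i) x)
      = -(2 / hp i * wellPsi φ ℓ (d i) x) := fun i x => by ring
  refine ⟨hsm, fun k hk => ?_⟩
  rcases k with _ | k
  · refine ⟨√C * |D|, fun i => ?_⟩
    have hdi := (hd i).1
    have hpi := hp0 i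
    have hsi := hds i
    have hwi := hwd i
    beta_reduce
    rw [norm_iteratedFDeriv_zero, pow_zero, mul_one, sqrt_eta_eq hdi, Real.norm_eq_abs]
    have hα := hW.slope_pos hdi ((hd i).2.trans_lt h1)
    have e1 := hD (d i) (hd i) (hp i) hpi
    simp only [tilted, hexp]
    set I := ∫ x in (0 : ℝ)..ℓ, Real.exp (-(2 / hp i * wellPsi φ ℓ (d i) x)) with hI
    set q := √(HalfWell.slope φ ℓ (d i) / (Real.pi * hp i)) with hq
    have e2 : √(Real.pi * hp i / HalfWell.slope φ ℓ (d i)) * q = 1 := by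
      rw [hq, ← Real.sqrt_mul (by positivity), div_mul_div_comm, mul_comm, div_self, Real.sqrt_one]
      have := Real.pi_pos
      positivity
    have e3 : I * q - 1 = (I - √(Real.pi * hp i / HalfWell.slope φ ℓ (d i))) * q := by
      rw [sub_mul, e2]
    rw [e3, abs_mul, abs_of_nonneg (hfac i)]
    have e4 : D * (hp i / d i) ≤ |D| * (hp i / d i) :=
      mul_le_mul_of_nonneg_right (le_abs_self D) (by positivity)
    calc _ ≤ (|D| * (hp i / d i)) * (√C * (width (hp i) (d i))⁻¹) :=
          mul_le_mul (e1.trans e4) (sqrt_slope_le hb hpi (hd i)) (hfac i) (by positivity)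
      _ = √C * |D| * ((hp i / d i) * (width (hp i) (d i))⁻¹) := by ring
      _ = _ := by
        congr 1
        have h5 : hp i / d i = width (hp i) (d i) ^ 2 / √(d i) := by
          rw [width_sq hpi, div_div, Real.mul_self_sqrt hdi.le]
        rw [h5]
        field_simp
  · refine ⟨2 ^ (k + 1) * gaussMoment (k + 1) * (√c)⁻¹ ^ (k + 2) * √C, fun i => ?_⟩
    have hdi := (hd i).1
    have hpi := hp0 i
    have hsi := hds i
    have hwi := hwd i
    have hg := gaussMoment_nonneg (k + 1)
    beta_reduce
    rw [sqrt_eta_eq hdi, norm_iteratedFDeriv_eq_norm_iteratedDeriv]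
    have e1 : iteratedDeriv (k + 1) (fun y => tilted φ ℓ (hp i) (d i) y
        * √(HalfWell.slope φ ℓ (d i) / (Real.pi * hp i)) - 1) (d i)
        = (∫ x in (0 : ℝ)..ℓ, (2 / hp i * (x - wellX φ ℓ (d i))) ^ (k + 1)
            * Real.exp (-(2 / hp i * wellPsi φ ℓ (d i) x)))
          * √(HalfWell.slope φ ℓ (d i) / (Real.pi * hp i)) := by
      have e2 := (hder i).2 (k + 1) (d i)
      simp only [hexp] at e2
      rw [← e2, iteratedDeriv_succ', iteratedDeriv_succ']
      have e3 : deriv (fun y => tilted φ ℓ (hp i) (d i) y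
          * √(HalfWell.slope φ ℓ (d i) / (Real.pi * hp i)) - 1)
          = fun y => deriv (tilted φ ℓ (hp i) (d i)) y
          * √(HalfWell.slope φ ℓ (d i) / (Real.pi * hp i)) := by
        ext y
        rw [deriv_sub_const]
        exact deriv_mul_const ((hder i).1.differentiable (by simp) y) _
      rw [e3, iteratedDeriv_mul_const_field]
      rfl
    rw [e1, norm_mul, Real.norm_eq_abs, Real.norm_of_nonneg (hfac i)]
    have e2 : |∫ x in (0 : ℝ)..ℓ, (2 / hp i * (x - wellX φ ℓ (d i))) ^ (k + 1)
            * Real.exp (-(2 / hp i * wellPsi φ ℓ (d i) x))|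
        ≤ (2 / hp i) ^ (k + 1) *
          (gaussMoment (k + 1) * ((√c)⁻¹ * width (hp i) (d i)) ^ (k + 1 + 1)) := by
      refine le_trans ?_ (mul_le_mul_of_nonneg_left (hW.moment_le h1 hb hpi (hd i) (k + 1))
        (by positivity))
      refine (intervalIntegral.abs_integral_le_integral_abs hW.pos.le).trans (le_of_eq ?_)
      rw [← intervalIntegral.integral_const_mul]
      refine intervalIntegral.integral_congr fun x _ => ?_
      simp only [abs_mul, abs_pow, Real.abs_exp, abs_of_pos (show 0 < 2 / hp i by positivity),
        mul_pow]
      ring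
    calc _ ≤ ((2 / hp i) ^ (k + 1) *
          (gaussMoment (k + 1) * ((√c)⁻¹ * width (hp i) (d i)) ^ (k + 1 + 1)))
          * (√C * (width (hp i) (d i))⁻¹) * (hp i / √(d i)) ^ (k + 1) := by
          refine mul_le_mul_of_nonneg_right ?_ (by positivity)
          exact mul_le_mul e2 (sqrt_slope_le hb hpi (hd i)) (hfac i) (by positivity)
      _ = 2 ^ (k + 1) * gaussMoment (k + 1) * (√c)⁻¹ ^ (k + 2) * √C
          * (width (hp i) (d i) / √(d i)) ^ (k + 1) := by
          rw [mul_pow (√c)⁻¹, div_pow, div_pow, div_pow, pow_succ (width (hp i) (d i)) (k + 1)]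
          field_simp
      _ ≤ _ := by
          refine mul_le_mul_of_nonneg_left ?_ (by positivity)
          exact pow_le_of_le_one (by positivity) (hε1 i) (by omega)

/-- The relative error in the Laplace approximation, with all its derivatives. -/
theorem jets_wellQuot (hW : HalfWell φ ℓ) (h1 : δ₁ < φ ℓ) (hb : WellBounds φ ℓ δ₁ c C)
    (hp0 : ∀ i, 0 < hp i) (hd : ∀ i, d i ∈ Ioc 0 δ₁) (hη : ∀ i, hp i ≤ d i * √(d i)) (n : ℕ) :
    JetBound n (fun i y => wellQuot φ ℓ (hp i) y - 1)
      d (fun i => hp i / √(d i)) (fun i => √(hp i / (d i * √(d i)))) := by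
  have hc := hb.c_pos
  have hds : ∀ i, 0 < √(d i) := fun i => Real.sqrt_pos.2 (hd i).1
  have hss : ∀ i, √(d i) * √(d i) = d i := fun i => Real.mul_self_sqrt (hd i).1.le
  have hd0 : ∀ i, 0 < d i := fun i => (hd i).1
  have hd0' : ∀ i, 0 ≤ d i := fun i => (hd i).1.le
  have hlt : ∀ i, d i < φ ℓ := fun i => (hd i).2.trans_lt h1
  have hr : ∀ i, 0 < hp i / √(d i) := fun i => div_pos (hp0 i) (hds i)
  have hη0 : ∀ i, 0 < hp i / (d i * √(d i)) := fun i =>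
    div_pos (hp0 i) (mul_pos (hd0 i) (hds i))
  have hη1 : ∀ i, hp i / (d i * √(d i)) ≤ 1 := fun i => by
    rw [div_le_one (mul_pos (hd0 i) (hds i))]; exact hη i
  have hε0 : ∀ i, 0 ≤ √(hp i / (d i * √(d i))) := fun i => Real.sqrt_nonneg _
  have hε1 : ∀ i, √(hp i / (d i * √(d i))) ≤ 1 := fun i => Real.sqrt_le_one.2 (hη1 i)
  have hηε : ∀ i, hp i / (d i * √(d i)) ≤ 1 * √(hp i / (d i * √(d i))) := fun i => by
    rw [one_mul]
    exact Real.le_sqrt_of_sq_le (by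
      rw [sq]; exact mul_le_of_le_one_left (hη0 i).le (hη1 i))
  have hrd : ∀ i, hp i / √(d i) ≤ d i := fun i => by
    rw [div_le_iff₀ (hds i)]; exact hη i
  have hrat : ∀ i, hp i / √(d i) / d i = hp i / (d i * √(d i)) := fun i => by
    rw [div_div, mul_comm]
  have hJ := hW.jets h1 hb
  have hX : ∀ m, JetBound m (fun (_ : ι) => wellX φ ℓ) d d (fun i => √(d i)) := fun m =>
    (hJ m).1.reindex (fun i => (⟨d i, hd i⟩ : Ioc 0 δ₁))
  have hα : ∀ m, JetBound m (fun (_ : ι) => HalfWell.slope φ ℓ) d d (fun i => √(d i)) := fun m =>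
    (hJ m).2.reindex (fun i => (⟨d i, hd i⟩ : Ioc 0 δ₁))
  -- the exponent
  have hE : JetBound n (fun i y => 2 / hp i * (wellP φ ℓ y - wellP φ ℓ (d i)
      - wellX φ ℓ (d i) * (y - d i))) d (fun i => hp i / √(d i))
      (fun i => hp i / (d i * √(d i))) := by
    have hP : ∀ i, ContDiffAt ℝ ∞ (wellP φ ℓ) (d i) := fun i => by
      have e1 := (hW.wellX_contDiffAt (hd0 i) (hlt i)).1
      have e2 : ContDiff ℝ ∞ (fun x => ∫ y in (0 : ℝ)..x, φ y) := by
        rw [contDiff_infty_iff_deriv]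
        have hd : ∀ x, HasDerivAt (fun x => ∫ y in (0 : ℝ)..x, φ y) (φ x) x := fun x =>
          intervalIntegral.integral_hasDerivAt_right
            (hW.smooth.continuous.intervalIntegrable _ _)
            (hW.smooth.continuous.stronglyMeasurableAtFilter _ _)
            hW.smooth.continuous.continuousAt
        refine ⟨fun x => (hd x).differentiableAt, ?_⟩
        rw [funext fun x => (hd x).deriv]
        exact hW.smooth
      exact (contDiffAt_id.mul e1).sub (e2.contDiffAt.comp (d i) e1)
    have hs : ∀ i, ContDiffAt ℝ ∞ (fun y => 2 / hp i * (wellP φ ℓ y - wellP φ ℓ (d i)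
      - wellX φ ℓ (d i) * (y - d i))) (d i) := fun i =>
      contDiffAt_const.mul (((hP i).sub contDiffAt_const).sub
        (contDiffAt_const.mul (contDiffAt_id.sub contDiffAt_const)))
    have h0 : ∀ i, ‖2 / hp i * (wellP φ ℓ (d i) - wellP φ ℓ (d i)
      - wellX φ ℓ (d i) * (d i - d i))‖ ≤ 0 * (hp i / (d i * √(d i))) := fun i => by simp
    rcases n with _ | n
    · exact JetBound.zero hs h0
    · refine JetBound.of_fderiv hs h0 ?_ hr
      have e0 : JetBound n (fun i (_ : ℝ) => wellX φ ℓ (d i)) d d (fun i => √(d i)) :=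
        JetBound.const _ (C := C) (fun i => by
          rw [Real.norm_eq_abs, abs_of_pos (hW.wellX_spec (hd0 i) (hlt i)).1.1]
          exact hb.X_le _ (hd i)) (fun i => (hds i).le)
      -- The derivative of the exponent is `(2/h)(X(y) - X(d))`. It vanishes at `d`, so going from
      -- the scale `d` down to `h/√d` gains the factor `η = h/d^{3/2}`.
      have e1 := ((hX n).sub e0 hd0').vanish (fun i => sub_self _) hd0 hr hrd
        (fun i => (hds i).le)
      have e2 := e1.const_mul (fun i => 2 / hp i) (fun i => (hr i).le) (fun i =>
        mul_nonneg (hds i).le (div_nonneg (hr i).le (hd0' i)))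
      have e3 := e2.clm (ContinuousLinearMap.smulRightL ℝ ℝ ℝ (1 : ℝ →L[ℝ] ℝ))
        (fun i => (hr i).le)
      refine (e3.congr (f' := fun i => fderiv ℝ (fun y => 2 / hp i * (wellP φ ℓ y - wellP φ ℓ (d i)
        - wellX φ ℓ (d i) * (y - d i)))) (fun i => ?_)).weight (fun i => ?_) 2 (fun i => ?_)
      · have hnb : ∀ᶠ y in 𝓝 (d i), y ∈ Ioo 0 (φ ℓ) := isOpen_Ioo.mem_nhds ⟨hd0 i, hlt i⟩
        filter_upwards [hnb] with y hy
        have g1 := (((hW.wellP_hasDerivAt hy.1 hy.2).sub_const (wellP φ ℓ (d i))).sub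
          (((hasDerivAt_id y).sub_const (d i)).const_mul (wellX φ ℓ (d i)))).const_mul (2 / hp i)
        have g2 := g1.hasFDerivAt.fderiv
        refine g2.trans ?_
        ext
        simp
      · have := hp0 i
        have := hds i
        have := hd0 i
        positivity
      · have g1 := hp0 i
        have g2 := hds i
        have g3 := hd0 i
        rw [abs_of_pos (by positivity)]
        refine le_of_eq ?_
        field_simp
  -- the slope
  have hA : JetBound n (fun i y => (HalfWell.slope φ ℓ (d i))⁻¹ * HalfWell.slope φ ℓ y - 1) d
      (fun i => hp i / √(d i)) (fun i => hp i / (d i * √(d i))) := by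
    have hsl : ∀ i, 0 < HalfWell.slope φ ℓ (d i) := fun i => hW.slope_pos (hd0 i) (hlt i)
    have e1 := (hα n).const_mul (fun i => (HalfWell.slope φ ℓ (d i))⁻¹) hd0' (fun i => (hds i).le)
    have e2 : JetBound n (fun i y => (HalfWell.slope φ ℓ (d i))⁻¹ * HalfWell.slope φ ℓ y) d d 1 := by
      refine e1.weight (fun i => by have := hds i; positivity) c⁻¹ (fun i => ?_)
      have h2 : c * √(d i) ≤ HalfWell.slope φ ℓ (d i) := hb.deriv_ge _ (hd i)
      rw [abs_of_pos (inv_pos.2 (hsl i)), Pi.one_apply, mul_one, inv_mul_eq_div,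
        div_le_iff₀ (hsl i), inv_mul_eq_div, le_div_iff₀ hc]
      linarith
    have e3 : JetBound n (fun (_ : ι) (_ : ℝ) => (1 : ℝ)) d d 1 :=
      JetBound.const _ (C := 1) (fun i => by simp) (fun _ => zero_le_one)
    have e4 := (e2.sub e3 hd0').vanish (fun i => by
      rw [inv_mul_cancel₀ (hsl i).ne', sub_self]) hd0 hr hrd (fun _ => zero_le_one)
    refine e4.weight (fun i => mul_nonneg zero_le_one (div_nonneg (hr i).le (hd0' i))) 1
      (fun i => ?_)
    rw [Pi.one_apply, one_mul, one_mul, hrat]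
  have f1 := hW.jets_tilted h1 hb hp0 hd hη n
  have f2 : JetBound n (fun i y => Real.exp (-(2 / hp i * (wellP φ ℓ y - wellP φ ℓ (d i)
      - wellX φ ℓ (d i) * (y - d i)))) - 1) d (fun i => hp i / √(d i))
      (fun i => √(hp i / (d i * √(d i)))) := by
    have := hE.comp_sub (g := fun t => Real.exp (-t)) (O := univ) (K := {0}) (fun i => (hη0 i).le)
      hη1 isOpen_univ (contDiff_neg.exp.contDiffOn) isCompact_singleton (convex_singleton 0)
      (subset_univ _) rfl (fun i => by simp) hr
    simp only [neg_zero, Real.exp_zero] at this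
    exact this.weight (fun i => (hη0 i).le) 1 hηε
  have f3 : JetBound n (fun i y => √(1 + ((HalfWell.slope φ ℓ (d i))⁻¹ * HalfWell.slope φ ℓ y - 1))
      - 1) d (fun i => hp i / √(d i)) (fun i => √(hp i / (d i * √(d i)))) := by
    have := hA.comp_sub (g := fun t => √(1 + t)) (O := Ioi (-1)) (K := {0}) (fun i => (hη0 i).le)
      hη1 isOpen_Ioi (ContDiffOn.sqrt (contDiff_const.add contDiff_id).contDiffOn
        (fun t ht => by
          have h2 : 0 < 1 + t := by linarith [mem_Ioi.1 ht]
          exact h2.ne'))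
      isCompact_singleton (convex_singleton 0)
      (by simp) rfl (fun i => by
        rw [inv_mul_cancel₀ (hW.slope_pos (hd0 i) (hlt i)).ne', sub_self]; rfl) hr
    simp only [add_zero, Real.sqrt_one] at this
    exact this.weight (fun i => (hη0 i).le) 1 hηε
  -- The relative error is a product of three factors close to one: the recentred integral, the
  -- exponential of the second order remainder of the action, and the square root of the ratio of
  -- slopes.
  refine ((f1.one_add_mul f2 (fun i => (hr i).le) hε0 hε1).one_add_mul f3 (fun i => (hr i).le)
    hε0 hε1).congr fun i => ?_
  have hnb : ∀ᶠ y in 𝓝 (d i), y ∈ Ioo 0 (φ ℓ) := isOpen_Ioo.mem_nhds ⟨hd0 i, hlt i⟩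
  filter_upwards [hnb] with y hy
  have a1 := hW.slope_pos (hd0 i) (hlt i)
  have a2 := hW.slope_pos hy.1 hy.2
  have a3 : √(HalfWell.slope φ ℓ y / (Real.pi * hp i))
      = √(HalfWell.slope φ ℓ (d i) / (Real.pi * hp i))
        * √(1 + ((HalfWell.slope φ ℓ (d i))⁻¹ * HalfWell.slope φ ℓ y - 1)) := by
    have := hp0 i
    have := Real.pi_pos
    rw [← Real.sqrt_mul (by positivity)]
    congr 1
    field_simp
    ring
  rw [wellQuot, hW.wellZ_eq_tilted (d i) y, a3]
  have a4 : Real.exp (2 / hp i * (wellP φ ℓ (d i) + wellX φ ℓ (d i) * (y - d i)))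
      * Real.exp (-(2 / hp i * wellP φ ℓ y))
      = Real.exp (-(2 / hp i * (wellP φ ℓ y - wellP φ ℓ (d i)
      - wellX φ ℓ (d i) * (y - d i)))) := by
    rw [← Real.exp_add]; congr 1; ring
  rw [← a4]
  ring

end Family

/-! ### Size of the action, and the part of the kernel with both variables in one half well. -/

theorem wellPsi_zero (hW : HalfWell φ ℓ) (δ : ℝ) : wellPsi φ ℓ δ 0 = wellP φ ℓ δ := by
  have := hW.exponent_eq δ 0
  simp at this
  linarith

/-- The action is of size at least `δ^{3/2}`, so `e^{2P/h}` dominates `e^{k/η}` for some `k > 0`.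
This is what makes the terms lacking one such factor negligible. -/
theorem wellP_ge (hW : HalfWell φ ℓ) (h1 : δ₁ < φ ℓ) (hb : WellBounds φ ℓ δ₁ c C) {δ : ℝ}
    (hδ : δ ∈ Ioc 0 δ₁) : c ^ 3 / 2 * (δ * √δ) ≤ wellP φ ℓ δ := by
  have hc := hb.c_pos
  have e1 := hW.wellPsi_ge h1 hb hδ (x := 0) ⟨le_rfl, hW.pos.le⟩
  rw [hW.wellPsi_zero] at e1
  refine le_trans ?_ e1
  have e2 := hb.X_ge δ hδ
  have hs := Real.sqrt_pos.2 hδ.1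
  have e3 : (c * √δ) ^ 2 ≤ (0 - wellX φ ℓ δ) ^ 2 := by
    rw [zero_sub, neg_sq]
    exact pow_le_pow_left₀ (by positivity) e2 2
  rw [mul_pow, Real.sq_sqrt hδ.1.le] at e3
  calc c ^ 3 / 2 * (δ * √δ) = c * √δ / 2 * (c ^ 2 * δ) := by ring
    _ ≤ _ := mul_le_mul_of_nonneg_left e3 (by positivity)

theorem wellPsi_sub (hW : HalfWell φ ℓ) (δ x y : ℝ) :
    wellPsi φ ℓ δ y - wellPsi φ ℓ δ x = ∫ u in x..y, (φ u - δ) := by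
  have hcφ := hW.smooth.continuous
  have hi : ∀ u v : ℝ, IntervalIntegrable (fun y => φ y - δ) volume u v := fun u v =>
    (by fun_prop : Continuous fun y => φ y - δ).intervalIntegrable u v
  exact intervalIntegral.integral_interval_sub_left (hi _ _) (hi _ _)

/-- The part of the double integral of `exp ((2/h) ∫ₓ^y (δ - φ))` over `0 < x < y < ℓ`. -/
theorem exists_triangle_le (hW : HalfWell φ ℓ) (h1 : δ₁ < φ ℓ) (hb : WellBounds φ ℓ δ₁ c C) :
    ∃ D : ℝ, 0 < D ∧ ∀ δ ∈ Ioc 0 δ₁, ∀ h : ℝ, 0 < h → h ≤ δ * √δ →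
      ∫ x in (0 : ℝ)..ℓ, Real.exp (2 / h * wellPsi φ ℓ δ x)
          * ∫ y in x..ℓ, Real.exp (-(2 / h * wellPsi φ ℓ δ y))
        ≤ D * δ * Real.exp (2 / h * wellP φ ℓ δ) := by
  have hc := hb.c_pos
  have hC := hb.C_pos
  set D₁ := gaussMoment 0 * (√c)⁻¹ with hD₁
  have hD₁0 : 0 ≤ D₁ := mul_nonneg (gaussMoment_nonneg 0) (by positivity)
  set D₂ := D₁ * (1 + C ^ 2) + D₁ * 2 + c⁻¹ with hD₂
  have hD₂0 : 0 < D₂ := by positivity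
  refine ⟨D₂ * Real.pi, by have := Real.pi_pos; positivity, fun δ hδ h hh hhδ => ?_⟩
  have hδ0 := hδ.1
  have hs := Real.sqrt_pos.2 hδ.1
  have hss : √δ * √δ = δ := Real.mul_self_sqrt hδ0.le
  have hXI := (hW.wellX_spec hδ0 (hδ.2.trans_lt h1)).1
  have hXC := hb.X_le δ hδ
  have hP0 : 0 ≤ wellP φ ℓ δ := le_trans (by positivity) (hW.wellP_ge h1 hb hδ)
  have hΨc := hW.wellPsi_continuous δ
  have hE1 : 1 ≤ Real.exp (2 / h * wellP φ ℓ δ) := Real.one_le_exp (by positivity)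
  have hwd : width h δ ≤ √δ := by
    rw [width]
    refine Real.sqrt_le_sqrt ?_
    rw [div_le_iff₀ hs]; exact hhδ
  set X := wellX φ ℓ δ with hX
  have hcφ := hW.smooth.continuous
  have hi : ∀ u v : ℝ, IntervalIntegrable (fun y => φ y - δ) volume u v := fun u v =>
    (by fun_prop : Continuous fun y => φ y - δ).intervalIntegrable u v
  have hgauss : ∀ x : ℝ, x ≤ ℓ → ∫ y in x..ℓ, Real.exp (-(c * √δ / h * (y - x) ^ 2)) ≤ D₁ * √δ := by
    intro x hx
    have e1 := setIntegral_le_gauss 0 (X := x) (b := c * √δ / h) (by positivity) (s := Ioc x ℓ)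
    simp only [pow_zero, one_mul, zero_add, pow_one] at e1
    rw [intervalIntegral.integral_of_le hx]
    refine e1.trans ?_
    rw [inv_sqrt_eq_width hc, ← mul_assoc]
    exact mul_le_mul_of_nonneg_left hwd hD₁0
  -- The integrand in `x` is dominated by a multiple of `√δ` times a Lorentzian of width `√δ` at the
  -- turning point; integrating it gives the second `√δ`.
  have key : ∀ x ∈ Icc 0 ℓ, Real.exp (2 / h * wellPsi φ ℓ δ x)
          * ∫ y in x..ℓ, Real.exp (-(2 / h * wellPsi φ ℓ δ y))
        ≤ D₂ * √δ * Real.exp (2 / h * wellP φ ℓ δ) * (1 + ((√δ)⁻¹ * (x - X)) ^ 2)⁻¹ := by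
    intro x hx
    have hL0 : 0 < 1 + ((√δ)⁻¹ * (x - X)) ^ 2 := by positivity
    rw [← div_eq_mul_inv, le_div_iff₀ hL0]
    -- Left of `X` the first factor is at most `e^{2P/h}` and the second is a Gaussian integral.
    -- Right of `X` the product is `∫ exp(-(2/h)∫ₓʸ(φ - δ))`: within distance `√δ` it is Gaussian by
    -- the linear bound on `φ - δ`, further out it decays at the rate given by `φ - δ ≥ c (x - X)²`.
    rcases le_or_gt x X with hxX | hXx
    · have e1 : wellPsi φ ℓ δ x ≤ wellP φ ℓ δ := by
        have := hW.wellPsi_sub δ 0 x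
        rw [hW.wellPsi_zero] at this
        have h3 : ∫ u in (0 : ℝ)..x, (φ u - δ) ≤ ∫ u in (0 : ℝ)..x, (0 : ℝ) := by
          refine intervalIntegral.integral_mono_on hx.1 (hi _ _) (by simp) fun u hu => ?_
          have := hb.left_lin δ hδ u ⟨hu.1, hu.2.trans hx.2⟩ (hu.2.trans hxX)
          have h4 : 0 ≤ c * √δ * (X - u) :=
            mul_nonneg (by positivity) (by linarith [hu.2])
          linarith
        simp at h3
        linarith
      have e2 : ∫ y in x..ℓ, Real.exp (-(2 / h * wellPsi φ ℓ δ y)) ≤ D₁ * √δ := by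
        have g1 := hW.moment_le h1 hb hh hδ 0
        simp only [pow_zero, one_mul, zero_add, pow_one] at g1
        have g2 : ∫ y in x..ℓ, Real.exp (-(2 / h * wellPsi φ ℓ δ y))
            ≤ ∫ y in (0 : ℝ)..ℓ, Real.exp (-(2 / h * wellPsi φ ℓ δ y)) := by
          refine intervalIntegral.integral_mono_interval hx.1 hx.2 le_rfl
            (Eventually.of_forall fun y => (Real.exp_pos _).le) ?_
          exact (by fun_prop : Continuous fun y =>
            Real.exp (-(2 / h * wellPsi φ ℓ δ y))).intervalIntegrable _ _
        refine g2.trans (g1.trans ?_)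
        rw [← mul_assoc]
        exact mul_le_mul_of_nonneg_left hwd hD₁0
      have e3 : 1 + ((√δ)⁻¹ * (x - X)) ^ 2 ≤ 1 + C ^ 2 := by
        have g1 : |(√δ)⁻¹ * (x - X)| ≤ C := by
          rw [abs_mul, abs_of_pos (inv_pos.2 hs), abs_of_nonpos (by linarith), inv_mul_eq_div,
            div_le_iff₀ hs]
          linarith [hx.1]
        have := sq_le_sq' (by linarith [abs_le.1 g1]) (abs_le.1 g1).2
        linarith
      have e4 : Real.exp (2 / h * wellPsi φ ℓ δ x) ≤ Real.exp (2 / h * wellP φ ℓ δ) :=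
        Real.exp_le_exp.2 (mul_le_mul_of_nonneg_left e1 (by positivity))
      have e5 : 0 ≤ ∫ y in x..ℓ, Real.exp (-(2 / h * wellPsi φ ℓ δ y)) :=
        intervalIntegral.integral_nonneg hx.2 fun y _ => (Real.exp_pos _).le
      calc _ ≤ Real.exp (2 / h * wellP φ ℓ δ) * (D₁ * √δ) * (1 + C ^ 2) := by gcongr
        _ = D₁ * (1 + C ^ 2) * √δ * Real.exp (2 / h * wellP φ ℓ δ) := by ring
        _ ≤ _ := by
          gcongr
          rw [hD₂]
          have : 0 < c⁻¹ := by positivity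
          linarith
    · have hpull : Real.exp (2 / h * wellPsi φ ℓ δ x)
          * ∫ y in x..ℓ, Real.exp (-(2 / h * wellPsi φ ℓ δ y))
          = ∫ y in x..ℓ, Real.exp (-(2 / h * ∫ u in x..y, (φ u - δ))) := by
        rw [← intervalIntegral.integral_const_mul]
        refine intervalIntegral.integral_congr fun y _ => ?_
        rw [← Real.exp_add, ← hW.wellPsi_sub δ x y]
        congr 1
        ring
      have hcont : Continuous fun y => Real.exp (-(2 / h * ∫ u in x..y, (φ u - δ))) := by
        simp only [← hW.wellPsi_sub δ x]
        fun_prop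
      rw [hpull]
      have hmono : ∀ y ∈ Icc x ℓ, ∀ u ∈ Icc x y, u ∈ Icc 0 ℓ ∧ X ≤ u := fun y hy u hu =>
        ⟨⟨hx.1.trans hu.1, hu.2.trans hy.2⟩, hXx.le.trans hu.1⟩
      rcases le_or_gt (x - X) (√δ) with hnear | hfar
      · have e1 : ∫ y in x..ℓ, Real.exp (-(2 / h * ∫ u in x..y, (φ u - δ))) ≤ D₁ * √δ := by
          refine le_trans ?_ (hgauss x hx.2)
          refine intervalIntegral.integral_mono_on hx.2 (hcont.intervalIntegrable _ _)
            ((by fun_prop : Continuous fun y =>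
              Real.exp (-(c * √δ / h * (y - x) ^ 2))).intervalIntegrable _ _) fun y hy => ?_
          refine Real.exp_le_exp.2 (neg_le_neg ?_)
          have g1 : ∫ u in x..y, (c * √δ) * (u - x) ≤ ∫ u in x..y, (φ u - δ) := by
            refine intervalIntegral.integral_mono_on hy.1
              ((by fun_prop : Continuous fun u => (c * √δ) * (u - x)).intervalIntegrable _ _)
              (hi _ _) fun u hu => ?_
            obtain ⟨m1, m2⟩ := hmono y hy u hu
            refine le_trans ?_ (hb.right_lin δ hδ u m1 m2)
            exact mul_le_mul_of_nonneg_left (by linarith) (by positivity)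
          rw [integral_sub_const_mul] at g1
          calc c * √δ / h * (y - x) ^ 2 = 2 / h * (c * √δ / 2 * (y - x) ^ 2) := by ring
            _ ≤ _ := mul_le_mul_of_nonneg_left g1 (by positivity)
        have e2 : 1 + ((√δ)⁻¹ * (x - X)) ^ 2 ≤ 2 := by
          have g1 : (√δ)⁻¹ * (x - X) ≤ 1 := by
            rw [inv_mul_eq_div, div_le_one hs]; exact hnear
          have g2 : 0 ≤ (√δ)⁻¹ * (x - X) := mul_nonneg (by positivity) (by linarith)
          have := pow_le_one₀ (n := 2) g2 g1
          linarith
        calc _ ≤ (D₁ * √δ) * 2 := by gcongr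
          _ = (D₁ * 2) * √δ * 1 := by ring
          _ ≤ _ := by
            refine mul_le_mul (mul_le_mul_of_nonneg_right ?_ hs.le) hE1 zero_le_one (by positivity)
            rw [hD₂]
            have : 0 < c⁻¹ := by positivity
            have : 0 ≤ D₁ * (1 + C ^ 2) := by positivity
            linarith
      · set κ := 2 / h * (c * (x - X) ^ 2) with hκ
        have hu0 : 0 < x - X := by linarith
        have hκ0 : 0 < κ := by positivity
        have e1 : ∫ y in x..ℓ, Real.exp (-(2 / h * ∫ u in x..y, (φ u - δ))) ≤ κ⁻¹ := by
          have g0 : ∫ y in x..ℓ, Real.exp (-(κ * (y - x))) ≤ κ⁻¹ := by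
            have hder : ∀ y ∈ uIcc x ℓ, HasDerivAt (fun y => -κ⁻¹ * Real.exp (-(κ * (y - x))))
                (Real.exp (-(κ * (y - x)))) y := fun y _ => by
              have := ((((hasDerivAt_id y).sub_const x).const_mul κ).neg.exp).const_mul (-κ⁻¹)
              refine this.congr_deriv ?_
              simp only [id]
              field_simp
              rfl
            rw [intervalIntegral.integral_eq_sub_of_hasDerivAt hder
              ((by fun_prop : Continuous fun y =>
                Real.exp (-(κ * (y - x)))).intervalIntegrable _ _)]
            simp
            positivity
          refine le_trans ?_ g0
          refine intervalIntegral.integral_mono_on hx.2 (hcont.intervalIntegrable _ _)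
            ((by fun_prop : Continuous fun y =>
              Real.exp (-(κ * (y - x)))).intervalIntegrable _ _) fun y hy => ?_
          refine Real.exp_le_exp.2 (neg_le_neg ?_)
          have g1 : ∫ u in x..y, (c * (x - X) ^ 2) ≤ ∫ u in x..y, (φ u - δ) := by
            refine intervalIntegral.integral_mono_on hy.1 (by simp) (hi _ _) fun u hu => ?_
            obtain ⟨m1, m2⟩ := hmono y hy u hu
            refine le_trans ?_ (hb.right_sq δ hδ u m1 m2)
            refine mul_le_mul_of_nonneg_left ?_ hc.le
            exact pow_le_pow_left₀ hu0.le (by linarith [hu.1]) 2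
          rw [intervalIntegral.integral_const, smul_eq_mul] at g1
          calc κ * (y - x) = 2 / h * ((y - x) * (c * (x - X) ^ 2)) := by rw [hκ]; ring
            _ ≤ _ := mul_le_mul_of_nonneg_left g1 (by positivity)
        have e2 : κ⁻¹ * (1 + ((√δ)⁻¹ * (x - X)) ^ 2) ≤ c⁻¹ * √δ := by
          have g1 : (1 : ℝ) ≤ ((√δ)⁻¹ * (x - X)) ^ 2 := by
            refine one_le_pow₀ ?_
            rw [inv_mul_eq_div, le_div_iff₀ hs]; linarith
          calc κ⁻¹ * (1 + ((√δ)⁻¹ * (x - X)) ^ 2) ≤ κ⁻¹ * (2 * ((√δ)⁻¹ * (x - X)) ^ 2) := by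
                gcongr; linarith
            _ = c⁻¹ * (h / (√δ * √δ)) := by rw [hκ]; field_simp
            _ ≤ c⁻¹ * √δ := by
                gcongr
                rw [hss, div_le_iff₀ hδ0]; linarith
        calc _ ≤ κ⁻¹ * (1 + ((√δ)⁻¹ * (x - X)) ^ 2) := by gcongr
          _ ≤ c⁻¹ * √δ * 1 := by rw [mul_one]; exact e2
          _ ≤ _ := by
            refine mul_le_mul (mul_le_mul_of_nonneg_right ?_ hs.le) hE1 zero_le_one (by positivity)
            rw [hD₂]
            have : 0 ≤ D₁ * (1 + C ^ 2) := by positivity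
            linarith
  have hJc : Continuous fun x => Real.exp (2 / h * wellPsi φ ℓ δ x)
          * ∫ y in x..ℓ, Real.exp (-(2 / h * wellPsi φ ℓ δ y)) := by
    have hc1 : Continuous fun y => Real.exp (-(2 / h * wellPsi φ ℓ δ y)) := by fun_prop
    have hc2 : Continuous fun x => ∫ y in x..ℓ, Real.exp (-(2 / h * wellPsi φ ℓ δ y)) := by
      simp only [fun x => intervalIntegral.integral_symm (μ := volume)
        (f := fun y => Real.exp (-(2 / h * wellPsi φ ℓ δ y))) ℓ x]
      exact (intervalIntegral.continuous_primitive (fun u v => hc1.intervalIntegrable u v) _).neg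
    fun_prop
  have hLint : Integrable fun x : ℝ => (1 + ((√δ)⁻¹ * (x - X)) ^ 2)⁻¹ :=
    (integrable_inv_one_add_sq.comp_mul_left' (inv_pos.2 hs).ne').comp_sub_right X
  calc _ ≤ ∫ x in (0 : ℝ)..ℓ, D₂ * √δ * Real.exp (2 / h * wellP φ ℓ δ)
        * (1 + ((√δ)⁻¹ * (x - X)) ^ 2)⁻¹ :=
        intervalIntegral.integral_mono_on hW.pos.le (hJc.intervalIntegrable _ _)
          (hLint.const_mul _).intervalIntegrable key
    _ = D₂ * √δ * Real.exp (2 / h * wellP φ ℓ δ)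
        * ∫ x in Ioc 0 ℓ, (1 + ((√δ)⁻¹ * (x - X)) ^ 2)⁻¹ := by
        rw [intervalIntegral.integral_const_mul, intervalIntegral.integral_of_le hW.pos.le]
    _ ≤ D₂ * √δ * Real.exp (2 / h * wellP φ ℓ δ) * (√δ * Real.pi) := by
        refine mul_le_mul_of_nonneg_left ?_ (by positivity)
        refine (setIntegral_le_integral hLint (Eventually.of_forall fun x => by
          simp only [Pi.zero_apply]; positivity)).trans (le_of_eq ?_)
        rw [integral_sub_right_eq_self (fun x => (1 + ((√δ)⁻¹ * x) ^ 2)⁻¹) X,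
          Measure.integral_comp_mul_left (fun x : ℝ => (1 + x ^ 2)⁻¹), integral_univ_inv_one_add_sq]
        simp [abs_of_pos hs]
    _ = D₂ * Real.pi * (√δ * √δ) * Real.exp (2 / h * wellP φ ℓ δ) := by ring
    _ = _ := by rw [hss]

/-- The triangle integral with the order of integration exchanged. -/
theorem triangle_swap (hW : HalfWell φ ℓ) (δ h : ℝ) :
    ∫ y in (0 : ℝ)..ℓ, Real.exp (-(2 / h * wellPsi φ ℓ δ y))
          * ∫ x in (0 : ℝ)..y, Real.exp (2 / h * wellPsi φ ℓ δ x)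
      = ∫ x in (0 : ℝ)..ℓ, Real.exp (2 / h * wellPsi φ ℓ δ x)
          * ∫ y in x..ℓ, Real.exp (-(2 / h * wellPsi φ ℓ δ y)) := by
  have hΨc := hW.wellPsi_continuous δ
  have c1 : Continuous fun y => Real.exp (-(2 / h * wellPsi φ ℓ δ y)) := by fun_prop
  have c2 : Continuous fun y => Real.exp (2 / h * wellPsi φ ℓ δ y) := by fun_prop
  have d1 : ∀ y ∈ uIcc (0 : ℝ) ℓ, HasDerivAt
      (fun y => ∫ x in (0 : ℝ)..y, Real.exp (2 / h * wellPsi φ ℓ δ x))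
      (Real.exp (2 / h * wellPsi φ ℓ δ y)) y := fun y _ =>
    intervalIntegral.integral_hasDerivAt_right (c2.intervalIntegrable _ _)
      (c2.stronglyMeasurableAtFilter _ _) c2.continuousAt
  have d2 : ∀ y ∈ uIcc (0 : ℝ) ℓ, HasDerivAt
      (fun x => ∫ y in x..ℓ, Real.exp (-(2 / h * wellPsi φ ℓ δ y)))
      (-Real.exp (-(2 / h * wellPsi φ ℓ δ y))) y := fun y _ =>
    intervalIntegral.integral_hasDerivAt_left (c1.intervalIntegrable _ _)
      (c1.stronglyMeasurableAtFilter _ _) c1.continuousAt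
  -- The exchange is an integration by parts between the two primitives, each of which vanishes at
  -- one end.
  have := intervalIntegral.integral_mul_deriv_eq_deriv_mul d1 d2
    (c2.intervalIntegrable _ _) (c1.neg.intervalIntegrable _ _)
  simp only [intervalIntegral.integral_same, mul_zero, zero_mul, sub_zero, zero_sub, mul_neg,
    intervalIntegral.integral_neg, neg_inj] at this
  rw [← this]
  simp only [mul_comm]

end HalfWell

/-! ### Smooth dependence of an eigenvalue -/

/-- A scalar function `τ` solving `Θ ((τ - M + p)⁻¹) = 1` inherits the jets of `M`. -/
theorem JetBound.of_resolvent {ι : Type*} {A : Type*} [NormedRing A] [NormedAlgebra ℝ A]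
    [CompleteSpace A] {G : Type*} [NormedAddCommGroup G] [NormedSpace ℝ G] [CompleteSpace G]
    {M : ι → G → A} {p : ι → A} {Θ : ι → A →L[ℝ] ℝ}
    {τ : ι → G → ℝ} {z : ι → G} {r : ι → ℝ} {C : ℝ} (hr : ∀ i, 0 < r i)
    (hM : ∀ n, JetBound n M z r 1) (hc : ∀ i, ContinuousAt (τ i) (z i)) (h1 : ∀ i, τ i (z i) = 1)
    (hp : ∀ i, ‖p i‖ ≤ C) (hΘ : ∀ i, ‖Θ i‖ ≤ C)
    (hu : ∀ i, IsUnit (algebraMap ℝ A 1 - M i (z i) + p i))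
    (hi : ∀ i, ‖Ring.inverse (algebraMap ℝ A 1 - M i (z i) + p i)‖ ≤ C)
    (hq : ∀ i, Θ i (Ring.inverse (algebraMap ℝ A 1 - M i (z i) + p i)
      * Ring.inverse (algebraMap ℝ A 1 - M i (z i) + p i)) = 1)
    (heq : ∀ i, ∀ᶠ w in 𝓝 (z i),
      Θ i (Ring.inverse (algebraMap ℝ A (τ i w) - M i w + p i)) = 1) (n : ℕ) :
    JetBound n τ z r 1 := by
  have hr' : ∀ i, 0 ≤ r i := fun i => (hr i).le
  have hinv : ∀ {a : A}, IsUnit a → HasFDerivAt Ring.inverse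
      (-ContinuousLinearMap.mulLeftRight ℝ A (Ring.inverse a) (Ring.inverse a)) a := by
    rintro _ ⟨u, rfl⟩
    rw [Ring.inverse_unit]
    exact hasFDerivAt_ringInverse u
  let alg : ℝ →L[ℝ] A := ContinuousLinearMap.smulRight (1 : ℝ →L[ℝ] ℝ) (1 : A)
  have halg : ∀ t : ℝ, alg t = algebraMap ℝ A t := fun t => by
    simp [alg, Algebra.algebraMap_eq_smul_one]
  have hs : ∀ i, ContDiffAt ℝ ∞ (τ i) (z i) := by
    intro i
    -- Smoothness of `τ`: implicit function theorem for `F(w, t) = Θ((t - M(w) + p)⁻¹)`. Its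
    -- derivative in `t` is `-Θ((t - M + p)⁻²)`, which is `-1` at the base point by `hq`; continuity
    -- of `τ` identifies it with the implicit function.
    let a : G × ℝ → A := fun q => alg q.2 - M i q.1 + p i
    let F : G × ℝ → ℝ := fun q => Θ i (Ring.inverse (a q))
    have ha : ContDiffAt ℝ ∞ a (z i, 1) := by
      refine (ContDiffAt.sub (alg.contDiff.comp contDiff_snd).contDiffAt ?_).add contDiffAt_const
      exact ((hM 0).1 i).comp (z i, (1 : ℝ)) contDiffAt_fst
    have hua : IsUnit (a (z i, 1)) := by
      have := hu i
      rw [← halg] at this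
      exact this
    have hF : ContDiffAt ℝ ∞ F (z i, 1) := by
      refine (Θ i).contDiff.contDiffAt.comp (z i, (1 : ℝ)) (ContDiffAt.comp (g := Ring.inverse) (z i, (1 : ℝ)) ?_ ha)
      obtain ⟨u, hu'⟩ := hua
      rw [← hu']
      exact contDiffAt_ringInverse ℝ u
    have hpart : _root_.fderiv ℝ F (z i, 1) ∘L .inr ℝ G ℝ
        = ((ContinuousLinearEquiv.neg ℝ : ℝ ≃L[ℝ] ℝ) : ℝ →L[ℝ] ℝ) := by
      have e1 : HasFDerivAt F (_root_.fderiv ℝ F (z i, 1)) (z i, 1) :=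
        (hF.differentiableAt (by simp)).hasFDerivAt
      have e2 : HasFDerivAt (fun t : ℝ => (z i, t)) (ContinuousLinearMap.inr ℝ G ℝ) 1 :=
        hasFDerivAt_prodMk_right (z i) 1
      have e3 := HasFDerivAt.comp (f := fun t : ℝ => (z i, t)) (g := F) 1 e1 e2
      have e4 : HasFDerivAt (fun t : ℝ => a (z i, t)) alg 1 := by
        exact (alg.hasFDerivAt.sub_const (M i (z i))).add_const (p i)
      have e5 := (Θ i).hasFDerivAt.comp (1 : ℝ) ((hinv hua).comp (1 : ℝ) e4)
      have e6 := e3.unique e5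
      rw [e6]
      ext
      have e7 := hq i
      rw [← halg] at e7
      simp [alg]
      change Θ i (Ring.inverse (alg 1 - M i (z i) + p i) * Ring.inverse (alg 1 - M i (z i) + p i))
        = 1
      exact e7
    have hI : (_root_.fderiv ℝ F (z i, 1) ∘L .inr ℝ G ℝ).IsInvertible := by
      rw [hpart]; exact ContinuousLinearMap.isInvertible_equiv
    have hn : (∞ : WithTop ℕ∞) ≠ 0 := by simp
    have g1 := hF.contDiffAt_implicitFunction hn hI
    refine g1.congr_of_eventuallyEq ?_
    have g2 := hF.eventually_apply_eq_iff_implicitFunction hn hI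
    have g3 : Tendsto (fun w => (w, τ i w)) (𝓝 (z i)) (𝓝 (z i, 1)) := by
      have := (continuousAt_id.prodMk (hc i))
      rw [ContinuousAt, h1 i] at this
      exact this
    have hF1 : F (z i, 1) = 1 := by
      have := (heq i).self_of_nhds
      rw [h1 i, ← halg] at this
      exact this
    filter_upwards [g3.eventually g2, heq i] with w hw hw'
    refine (hw.1 ?_).symm
    rw [hF1]
    rw [← halg] at hw'
    exact hw'
  induction n with
  | zero => exact JetBound.zero (w := 1) hs (C := 1) (fun i => by simp [h1 i])
  | succ n ih =>
    refine JetBound.of_fderiv (w := 1) hs (C := 1) (fun i => by simp [h1 i]) ?_ hr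
    -- Differentiating the equation, with `Q` the inverse, gives `Dτ = Θ(Q²)⁻¹ Θ(Q (DM) Q)`. The
    -- right side uses `τ` only to order `n`.
    have hpc : JetBound n (fun i (_ : G) => p i) z r 1 :=
      JetBound.const _ (C := C) (fun i => by simpa using hp i) (fun _ => zero_le_one)
    have ha : JetBound n (fun i w => alg (τ i w) - M i w + p i) z r 1 :=
      ((ih.clm alg hr').sub (hM n) hr').add hpc hr'
    have hbase : ∀ i, alg (τ i (z i)) - M i (z i) + p i
        = algebraMap ℝ A 1 - M i (z i) + p i := fun i => by rw [h1 i, halg]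
    have hQ := ha.ringInverse (fun i => by rw [hbase]; exact hu i)
      (fun i => by rw [hbase]; exact hi i) hr
    have hQQ := (hQ.bilin hQ (ContinuousLinearMap.mul ℝ A) hr' (fun _ => zero_le_one)
      (fun _ => zero_le_one)).weight (w' := 1) (fun _ => by simp) 1 (fun _ => by simp)
    have hd : JetBound n (fun i w => Θ i (Ring.inverse (alg (τ i w) - M i w + p i)
        * Ring.inverse (alg (τ i w) - M i w + p i))) z r 1 :=
      hQQ.clm_family Θ hΘ hr' (fun _ => zero_le_one)
    have hdi : JetBound n (fun i w => (Θ i (Ring.inverse (alg (τ i w) - M i w + p i)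
        * Ring.inverse (alg (τ i w) - M i w + p i)))⁻¹) z r 1 := hd.comp_compact (g := fun t : ℝ => t⁻¹) (O := {t | t ≠ 0}) (K := {1})
      isOpen_ne (contDiffOn_id.inv fun t ht => ht) isCompact_singleton
      (by simp) (fun i => by
        rw [hbase]
        exact hq i) hr
    have hLR : JetBound n (fun i w => ContinuousLinearMap.mulLeftRight ℝ A
        (Ring.inverse (alg (τ i w) - M i w + p i)) (Ring.inverse (alg (τ i w) - M i w + p i)))
        z r 1 := (hQ.bilin hQ (ContinuousLinearMap.mulLeftRight ℝ A) hr' (fun _ => zero_le_one)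
      (fun _ => zero_le_one)).weight (w' := 1) (fun _ => by simp) 1 (fun _ => by simp)
    have hDM := (hM (n + 1)).fderiv hr
    have hnum := hLR.bilin hDM (ContinuousLinearMap.compL ℝ G A A) hr' (fun _ => zero_le_one)
      (fun i => by have := hr i; simp; positivity)
    have hcomp : ∀ i, ‖ContinuousLinearMap.compL ℝ G A ℝ (Θ i)‖ ≤ C := fun i =>
      ContinuousLinearMap.opNorm_le_bound _ ((norm_nonneg _).trans (hΘ i)) fun f =>
        (ContinuousLinearMap.opNorm_comp_le (Θ i) f).trans
          (mul_le_mul_of_nonneg_right (hΘ i) (norm_nonneg f))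
    have hr1 : ∀ i, 0 ≤ (1 : ι → ℝ) i * ((1 : ι → ℝ) i / r i) := fun i => by
      have := hr i
      simp only [Pi.one_apply]
      positivity
    have hnum2 := hnum.clm_family (fun i => ContinuousLinearMap.compL ℝ G A ℝ (Θ i)) hcomp hr' hr1
    have hfin := hdi.bilin hnum2 (ContinuousLinearMap.lsmul ℝ ℝ (E := G →L[ℝ] ℝ)) hr'
      (fun _ => zero_le_one) hr1
    refine (hfin.congr (f' := fun i => _root_.fderiv ℝ (τ i)) (fun i => ?_)).weight
      (fun i => by have := hr i; simp; positivity) 1 (fun i => by simp)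
    have hau : ∀ᶠ w in 𝓝 (z i), IsUnit (alg (τ i w) - M i w + p i) := by
      refine (ha.1 i).continuousAt.eventually (Units.isOpen.mem_nhds ?_)
      have := hu i
      rw [← hbase] at this
      exact this
    have hτd : ∀ᶠ w in 𝓝 (z i), ContDiffAt ℝ 1 (τ i) w :=
      ((hs i).of_le (m := 1) (by exact_mod_cast le_top)).eventually (by simp)
    have hMd : ∀ᶠ w in 𝓝 (z i), ContDiffAt ℝ 1 (M i) w :=
      (((hM 0).1 i).of_le (m := 1) (by exact_mod_cast le_top)).eventually (by simp)
    have hne : ∀ᶠ w in 𝓝 (z i), Θ i (Ring.inverse (alg (τ i w) - M i w + p i)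
        * Ring.inverse (alg (τ i w) - M i w + p i)) ≠ 0 := by
      have := (hd.1 i).continuousAt
      refine this.eventually (isOpen_ne.mem_nhds ?_)
      change Θ i (Ring.inverse (alg (τ i (z i)) - M i (z i) + p i)
        * Ring.inverse (alg (τ i (z i)) - M i (z i) + p i)) ≠ 0
      rw [hbase, hq i]
      exact one_ne_zero
    filter_upwards [hau, hτd, hMd, hne, (heq i).eventually_nhds] with w w1 w2 w3 w4 w5
    have e1 : HasFDerivAt (fun w => alg (τ i w) - M i w + p i)
        (alg ∘L _root_.fderiv ℝ (τ i) w - _root_.fderiv ℝ (M i) w) w :=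
      ((alg.hasFDerivAt.comp w (w2.differentiableAt (by simp)).hasFDerivAt).sub
        (w3.differentiableAt (by simp)).hasFDerivAt).add_const _
    have e2 := (Θ i).hasFDerivAt.comp w ((hinv w1).comp w e1)
    have e3 : HasFDerivAt ((Θ i) ∘ Ring.inverse ∘ fun w => alg (τ i w) - M i w + p i)
        (0 : G →L[ℝ] ℝ) w := by
      refine (hasFDerivAt_const (1 : ℝ) w).congr_of_eventuallyEq ?_
      filter_upwards [w5] with w' hw'
      rw [← halg] at hw'
      exact hw'
    have e4 := e2.unique e3
    ext v
    have e5 := congrArg (fun L => L v) e4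
    simp [alg] at e5
    simp only [ContinuousLinearMap.lsmul_apply, ContinuousLinearMap.compL_apply,
      smul_apply,
      ContinuousLinearMap.comp_apply, ContinuousLinearMap.mulLeftRight_apply, smul_eq_mul]
    rw [eq_inv_mul_iff_mul_eq₀ w4]
    simp only [alg, ContinuousLinearMap.smulRight_apply, one_apply_eq_self] at *
    linarith

/-- Jets of a bounded holomorphic family. -/
theorem JetBound.of_holomorphic {ι : Type*} {E : Type*} [NormedAddCommGroup E] [NormedSpace ℂ E]
    [NormedSpace ℝ E] [IsScalarTower ℝ ℂ E] [CompleteSpace E] {f : ι → ℂ → E} {z : ι → ℂ} {r : ι → ℝ} {C : ℝ} (hr : ∀ i, 0 < r i)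
    (hd : ∀ i, DifferentiableOn ℂ (f i) (Metric.ball (z i) (r i)))
    (hC : ∀ i, ∀ w ∈ Metric.ball (z i) (r i), ‖f i w‖ ≤ C) (n : ℕ) : JetBound n f z r 1 := by
  have han : ∀ i, ContDiffAt ℂ ∞ (f i) (z i) := fun i =>
    ((hd i).analyticAt (Metric.isOpen_ball.mem_nhds (Metric.mem_ball_self (hr i)))).contDiffAt
  refine ⟨fun i => (han i).restrict_scalars ℝ, fun k _ => ⟨k.factorial * C * 2 ^ k, fun i => ?_⟩⟩
  have hri := hr i
  have h1 := Complex.norm_iteratedDeriv_le_of_forall_mem_sphere_norm_le (f := f i) (c := z i)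
    (R := r i / 2) (C := C) k (by positivity)
    ((hd i).diffContOnCl_ball (Metric.closedBall_subset_ball (by linarith)))
    (fun w hw => hC i w (Metric.closedBall_subset_ball (by linarith)
      (Metric.sphere_subset_closedBall hw)))
  have h2 : ‖iteratedFDeriv ℝ k (f i) (z i)‖ = ‖iteratedFDeriv ℂ k (f i) (z i)‖ := by
    have := ContDiffAt.restrictScalars_iteratedFDeriv (𝕜 := ℝ) (𝕜' := ℂ) (n := k) (f := f i)
      (x := z i) ((han i).of_le (by exact_mod_cast le_top))
    rw [← this]
    simp
  rw [h2, norm_iteratedFDeriv_eq_norm_iteratedDeriv]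
  calc _ ≤ (k.factorial * C / (r i / 2) ^ k) * r i ^ k := by gcongr
    _ = k.factorial * C * 2 ^ k * (1 : ι → ℝ) i := by
      rw [div_pow, Pi.one_apply]; field_simp

/-- The resolvent equation for `R^* R`, in a C⋆-algebra. -/
theorem JetBound.of_star_mul {ι : Type*} {A : Type*} [NormedRing A] [StarRing A] [CStarRing A]
    [NormedAlgebra ℂ A] [StarModule ℂ A] [CompleteSpace A] {R : ι → ℂ → A} {p : ι → A}
    {Φ : ι → A →L[ℂ] ℂ} {τ : ι → ℂ → ℝ} {z : ι → ℂ} {r : ι → ℝ} {C : ℝ} (hr : ∀ i, 0 < r i)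
    (hd : ∀ i, DifferentiableOn ℂ (R i) (Metric.ball (z i) (r i)))
    (hC : ∀ i, ∀ w ∈ Metric.ball (z i) (r i), ‖R i w‖ ≤ C)
    (hc : ∀ i, ContinuousAt (τ i) (z i)) (h1 : ∀ i, τ i (z i) = 1)
    (hp : ∀ i, ‖p i‖ ≤ 2) (hΦ : ∀ i, ‖Φ i‖ ≤ 2)
    (hu : ∀ i, IsUnit (1 - star (R i (z i)) * R i (z i) + p i))
    (hi : ∀ i, ‖Ring.inverse (1 - star (R i (z i)) * R i (z i) + p i)‖ ≤ 2)
    (hq : ∀ i, (Φ i (Ring.inverse (1 - star (R i (z i)) * R i (z i) + p i)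
      * Ring.inverse (1 - star (R i (z i)) * R i (z i) + p i))).re = 1)
    (heq : ∀ i, ∀ᶠ w in 𝓝 (z i),
      (Φ i (Ring.inverse ((τ i w : ℂ) • 1 - star (R i w) * R i w + p i))).re = 1) (n : ℕ) :
    JetBound n τ z r 1 := by
  have hr' : ∀ i, 0 ≤ r i := fun i => (hr i).le
  have hM : ∀ n, JetBound n (fun i w => star (R i w) * R i w) z r 1 := fun n => by
    have hJ := JetBound.of_holomorphic hr hd hC n
    exact ((hJ.clm ((starL' ℝ : A ≃L[ℝ] A) : A →L[ℝ] A) hr').bilin hJ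
      (ContinuousLinearMap.mul ℝ A) hr' (fun _ => zero_le_one) (fun _ => zero_le_one)).weight
      (w' := 1) (fun _ => by simp) 1 (fun _ => by simp)
  refine JetBound.of_resolvent (p := p) (Θ := fun i => Complex.reCLM ∘L (Φ i).restrictScalars ℝ)
    (C := 2) hr hM hc h1 hp (fun i => ?_) (fun i => ?_) (fun i => ?_) (fun i => ?_) (fun i => ?_) n
  · refine ContinuousLinearMap.opNorm_le_bound _ (by norm_num) fun a => ?_
    exact (Complex.abs_re_le_norm _).trans (((Φ i).le_opNorm a).trans
      (mul_le_mul_of_nonneg_right (hΦ i) (norm_nonneg a)))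
  · rw [map_one]; exact hu i
  · rw [map_one]; exact hi i
  · rw [map_one]; exact hq i
  · filter_upwards [heq i] with w hw
    rw [Algebra.algebraMap_eq_smul_one]
    exact hw

/-! ### The top singular value of an operator with a spectral gap -/

section Singular

variable {H : Type*} [NormedAddCommGroup H] [InnerProductSpace ℂ H] [CompleteSpace H]
  {R : H →L[ℂ] H} {Λ : ℝ}

/-- A two-vector Hilbert–Schmidt bound. -/
def PairBound (R : H →L[ℂ] H) (Λ : ℝ) : Prop :=
  ∀ p g : H, inner ℂ p g = 0 →
    ‖R p‖ ^ 2 * ‖g‖ ^ 2 + ‖R g‖ ^ 2 * ‖p‖ ^ 2 ≤ Λ * (‖p‖ ^ 2 * ‖g‖ ^ 2)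

namespace PairBound

theorem sq_norm_apply_le (R : H →L[ℂ] H) (v : H) : ‖R v‖ ^ 2 ≤ ‖R‖ ^ 2 * ‖v‖ ^ 2 := by
  rw [← mul_pow]
  exact pow_le_pow_left₀ (norm_nonneg _) (R.le_opNorm v) 2

/-- For aligned unit vectors, `f + f'` and `f - f'` are orthogonal. If both vectors almost maximize,
the parallelogram law forces `R` to be almost extremal on the sum and on the difference. Since `‖f +
f'‖² ≥ 2`, the pair bound, which allows only 3/2 of the maximum for two orthogonal directions, then
forces the difference to be small. -/
theorem near (hR : PairBound R Λ) (hΛ : Λ ≤ 3 / 2 * ‖R‖ ^ 2) {f f' : H} (hf : ‖f‖ = 1)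
    (hf' : ‖f'‖ = 1) {t κ : ℝ} (ht : 0 ≤ t) (hin : inner ℂ f f' = (t : ℂ))
    (h1 : ‖R‖ ^ 2 - κ ≤ ‖R f‖ ^ 2) (h2 : ‖R‖ ^ 2 - κ ≤ ‖R f'‖ ^ 2) :
    ‖R‖ ^ 2 * ‖f - f'‖ ^ 2 ≤ 16 * κ := by
  have hin' : inner ℂ f' f = (t : ℂ) := by rw [← inner_conj_symm, hin, Complex.conj_ofReal]
  have horth : inner ℂ (f + f') (f - f') = 0 := by
    rw [inner_add_left, inner_sub_right, inner_sub_right, hin, hin', inner_self_eq_norm_sq_to_K,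
      inner_self_eq_norm_sq_to_K, hf, hf']
    ring
  have e1 := hR _ _ horth
  have e2 := parallelogram_law_with_norm ℂ f f'
  have e3 := parallelogram_law_with_norm ℂ (R f) (R f')
  rw [← map_add, ← map_sub] at e3
  have e4 : ‖f + f'‖ ^ 2 = 2 + 2 * t := by
    rw [@norm_add_sq ℂ, hf, hf', hin]
    simp
    ring
  have e5 := sq_norm_apply_le R (f + f')
  have e6 := sq_norm_apply_le R (f - f')
  simp only [hf, hf'] at e2 e3
  set a := ‖f + f'‖ ^ 2
  set b := ‖f - f'‖ ^ 2
  have ha : 2 ≤ a := by rw [e4]; linarith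
  have hb : 0 ≤ b := sq_nonneg _
  set s := ‖R‖ ^ 2
  have hs : 0 ≤ s := sq_nonneg _
  have hab : b = 4 - a := by linarith
  have e7 : s * b - 4 * κ ≤ ‖R (f - f')‖ ^ 2 := by nlinarith
  have e8 : s * a - 4 * κ ≤ ‖R (f + f')‖ ^ 2 := by nlinarith
  have e9 : Λ * (a * b) ≤ 3 / 2 * s * (a * b) :=
    mul_le_mul_of_nonneg_right hΛ (by positivity)
  have e10 : (s * a - 4 * κ) * b + (s * b - 4 * κ) * a ≤ 3 / 2 * s * (a * b) := by
    have := mul_le_mul_of_nonneg_right e8 hb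
    have := mul_le_mul_of_nonneg_right e7 (by linarith : 0 ≤ a)
    linarith
  have e11 : s * (a * b) ≤ 32 * κ := by nlinarith
  have e12 : 2 * (s * b) ≤ s * (a * b) := by
    have := mul_le_mul_of_nonneg_right ha (mul_nonneg hs hb)
    linarith
  linarith

theorem exists_phase (f g : H) : ∃ u : ℂ, ‖u‖ = 1 ∧ inner ℂ f (u • g) = (‖inner ℂ f g‖ : ℂ) := by
  obtain ⟨u, hu, h⟩ := RCLike.exists_norm_eq_mul_self (inner ℂ f g)
  exact ⟨u, hu, by rw [inner_smul_right, ← h]; rfl⟩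

/-- No compactness is used: by `near`, almost maximizing unit vectors with aligned phases form a
Cauchy sequence. The defects `4⁻ⁿ` make consecutive distances at most `4 · 2⁻ⁿ`. -/
theorem exists_maximizer (hR : PairBound R Λ) (hΛ : Λ ≤ 3 / 2 * ‖R‖ ^ 2) (h0 : 0 < ‖R‖) :
    ∃ f : H, ‖f‖ = 1 ∧ ‖R f‖ = ‖R‖ := by
  have hex : ∀ n : ℕ, ∃ g : H, ‖g‖ = 1 ∧ ‖R‖ ^ 2 - ‖R‖ ^ 2 * (1 / 4) ^ n ≤ ‖R g‖ ^ 2 := by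
    intro n
    set c := √(‖R‖ ^ 2 - ‖R‖ ^ 2 * (1 / 4) ^ n) with hc
    have hpos : 0 ≤ ‖R‖ ^ 2 - ‖R‖ ^ 2 * (1 / 4) ^ n := by
      have : (1 / 4 : ℝ) ^ n ≤ 1 := pow_le_one₀ (by norm_num) (by norm_num)
      nlinarith [sq_nonneg ‖R‖]
    have hlt : c < ‖R‖ := by
      rw [hc, Real.sqrt_lt' h0]
      have : 0 < ‖R‖ ^ 2 * (1 / 4) ^ n := by positivity
      linarith
    obtain ⟨x, hx1, hx2⟩ := R.exists_lt_apply_of_lt_opNorm hlt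
    have hx0 : 0 < ‖x‖ := by
      rw [norm_pos_iff]
      rintro rfl
      simp only [map_zero, norm_zero] at hx2
      exact absurd hx2 (not_lt.2 (Real.sqrt_nonneg _))
    refine ⟨((‖x‖ : ℂ)⁻¹) • x, ?_, ?_⟩
    · rw [norm_smul, norm_inv, Complex.norm_real, norm_norm, inv_mul_cancel₀ hx0.ne']
    · have h3 : c ≤ ‖R (((‖x‖ : ℂ)⁻¹) • x)‖ := by
        rw [map_smul, norm_smul, norm_inv, Complex.norm_real, norm_norm, inv_mul_eq_div,
          le_div_iff₀ hx0]
        nlinarith [Real.sqrt_nonneg (‖R‖ ^ 2 - ‖R‖ ^ 2 * (1 / 4) ^ n)]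
      calc _ = c ^ 2 := by rw [hc, Real.sq_sqrt hpos]
        _ ≤ _ := pow_le_pow_left₀ (Real.sqrt_nonneg _) h3 2
  choose g hg1 hg2 using hex
  choose u hu1 hu2 using fun f g : H => exists_phase f g
  -- Each vector is rotated so that its inner product with its predecessor is real and nonnegative.
  let f : ℕ → H := fun n => Nat.rec (g 0) (fun n fn => u fn (g (n + 1)) • g (n + 1)) n
  have hf : ∀ n, f (n + 1) = u (f n) (g (n + 1)) • g (n + 1) := fun n => rfl
  have hfn : ∀ n, ‖f n‖ = 1 ∧ ‖R‖ ^ 2 - ‖R‖ ^ 2 * (1 / 4) ^ n ≤ ‖R (f n)‖ ^ 2 := by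
    intro n
    rcases n with _ | n
    · exact ⟨hg1 0, hg2 0⟩
    · rw [hf, map_smul, norm_smul, norm_smul, hu1, one_mul, one_mul]
      exact ⟨hg1 _, hg2 _⟩
  have hcauchy : CauchySeq f := by
    refine cauchySeq_of_le_geometric (1 / 2) 4 (by norm_num) fun n => ?_
    have h1 : ‖R‖ ^ 2 - ‖R‖ ^ 2 * (1 / 4) ^ n ≤ ‖R (f (n + 1))‖ ^ 2 := by
      refine le_trans ?_ (hfn (n + 1)).2
      have : (1 / 4 : ℝ) ^ (n + 1) ≤ (1 / 4) ^ n :=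
        pow_le_pow_of_le_one (by norm_num) (by norm_num) (Nat.le_succ n)
      nlinarith [sq_nonneg ‖R‖]
    have h2 := hR.near hΛ (hfn n).1 (hfn (n + 1)).1 (norm_nonneg (inner ℂ (f n) (g (n + 1))))
      (by rw [hf]; exact hu2 _ _) (hfn n).2 h1
    have h3 : ‖f n - f (n + 1)‖ ^ 2 ≤ (4 * (1 / 2) ^ n) ^ 2 := by
      have h4 : (4 * (1 / 2 : ℝ) ^ n) ^ 2 = 16 * (1 / 4) ^ n := by
        rw [mul_pow, ← pow_mul, mul_comm n 2, pow_mul]; norm_num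
      rw [h4]
      have : 0 < ‖R‖ ^ 2 := by positivity
      nlinarith
    rw [dist_eq_norm]
    exact le_of_sq_le_sq h3 (by positivity)
  obtain ⟨f₀, hf₀⟩ := cauchySeq_tendsto_of_complete hcauchy
  refine ⟨f₀, ?_, ?_⟩
  · exact tendsto_nhds_unique hf₀.norm (by simp [fun n => (hfn n).1])
  · have h1 : Tendsto (fun n => ‖R (f n)‖ ^ 2) atTop (𝓝 (‖R f₀‖ ^ 2)) :=
      ((R.continuous.tendsto f₀).comp hf₀).norm.pow 2
    have h2 : Tendsto (fun n : ℕ => ‖R‖ ^ 2 - ‖R‖ ^ 2 * (1 / 4) ^ n) atTop (𝓝 (‖R‖ ^ 2)) := by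
      have := (tendsto_pow_atTop_nhds_zero_of_lt_one (r := (1 / 4 : ℝ)) (by norm_num)
        (by norm_num)).const_mul (‖R‖ ^ 2)
      simpa using this.const_sub (‖R‖ ^ 2)
    have h3 := le_of_tendsto_of_tendsto' h2 h1 fun n => (hfn n).2
    have hf1 : ‖f₀‖ = 1 := tendsto_nhds_unique hf₀.norm (by simp [fun n => (hfn n).1])
    refine le_antisymm (by simpa [hf1] using R.le_opNorm f₀) (le_of_sq_le_sq h3 (norm_nonneg _))

theorem maximizer_unique (hR : PairBound R Λ) (hΛ : Λ ≤ 3 / 2 * ‖R‖ ^ 2) (h0 : 0 < ‖R‖)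
    {f f' : H} (hf : ‖f‖ = 1) (hf' : ‖f'‖ = 1) (h1 : ‖R f‖ = ‖R‖) (h2 : ‖R f'‖ = ‖R‖) :
    ∃ u : ℂ, ‖u‖ = 1 ∧ f = u • f' := by
  obtain ⟨u, hu, hin⟩ := exists_phase f f'
  refine ⟨u, hu, ?_⟩
  have h3 := hR.near hΛ hf (by rw [norm_smul, hu, hf', one_mul])
    (norm_nonneg _) hin (κ := 0) (by rw [h1]; linarith) (by
      rw [map_smul, norm_smul, hu, one_mul, h2]; linarith)
  have h4 : ‖f - u • f'‖ ^ 2 ≤ 0 := by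
    have : 0 < ‖R‖ ^ 2 := by positivity
    nlinarith
  have h5 : ‖f - u • f'‖ = 0 := by nlinarith [norm_nonneg (f - u • f')]
  exact sub_eq_zero.1 (norm_eq_zero.1 h5)

end PairBound

/-- Equality case of the norm bound: in the expansion of the squared distance the cross term is
`-2‖R‖⁴`, while both squares are at most `‖R‖⁴`. -/
theorem adjoint_apply_of_norm_eq {f : H} (hf : ‖f‖ = 1) (h1 : ‖R f‖ = ‖R‖) :
    ContinuousLinearMap.adjoint R (R f) = ((‖R‖ ^ 2 : ℝ) : ℂ) • f := by
  have h2 : ‖ContinuousLinearMap.adjoint R (R f) - ((‖R‖ ^ 2 : ℝ) : ℂ) • f‖ ^ 2 ≤ 0 := by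
    rw [@norm_sub_sq ℂ, inner_smul_right, ContinuousLinearMap.adjoint_inner_left,
      inner_self_eq_norm_sq_to_K, h1, norm_smul, hf]
    have h3 : ‖ContinuousLinearMap.adjoint R (R f)‖ ≤ ‖R‖ * ‖R‖ := by
      refine (ContinuousLinearMap.le_opNorm _ _).trans ?_
      rw [h1, LinearIsometryEquiv.norm_map]
    have h4 := pow_le_pow_left₀ (norm_nonneg _) h3 2
    simp only [Complex.norm_real, Real.norm_eq_abs, abs_pow, abs_norm]
    have h5 : RCLike.re (((‖R‖ ^ 2 : ℝ) : ℂ) * ((‖R‖ : ℂ) ^ 2)) = ‖R‖ ^ 2 * ‖R‖ ^ 2 := by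
      rw [← Complex.ofReal_pow, ← Complex.ofReal_mul]
      exact Complex.ofReal_re _
    have h6 : RCLike.re (((‖R‖ ^ 2 : ℝ) : ℂ) * ((RCLike.ofReal ‖R‖ : ℂ) ^ 2))
        = ‖R‖ ^ 2 * ‖R‖ ^ 2 := h5
    rw [h6]
    nlinarith
  have h3 : ‖ContinuousLinearMap.adjoint R (R f) - ((‖R‖ ^ 2 : ℝ) : ℂ) • f‖ = 0 := by
    nlinarith [norm_nonneg (ContinuousLinearMap.adjoint R (R f) - ((‖R‖ ^ 2 : ℝ) : ℂ) • f)]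
  exact sub_eq_zero.1 (norm_eq_zero.1 h3)

/-- The gradient of `‖R z‖²` for a resolvent family. -/
theorem norm_fderiv_sq_norm {Rz : ℂ → H →L[ℂ] H} {z : ℂ} (hR : HasDerivAt Rz (Rz z * Rz z) z)
    (hT : DifferentiableAt ℝ (fun w => ‖Rz w‖ ^ 2) z) {f : H} (hf : ‖f‖ = 1)
    (h1 : ‖Rz z f‖ = ‖Rz z‖) :
    ‖fderiv ℝ (fun w => ‖Rz w‖ ^ 2) z‖ = 2 * ‖Rz z‖ ^ 2 * ‖inner ℂ f (Rz z f)‖ := by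
  have e0 : HasDerivAt (fun w => Rz w f) (Rz z (Rz z f)) z := by
    have := (ContinuousLinearMap.apply ℂ H f).hasFDerivAt.comp_hasDerivAt z hR
    exact this
  have e1 : HasFDerivAt (fun w => Rz w f)
      ((ContinuousLinearMap.smulRight (1 : ℂ →L[ℂ] ℂ) (Rz z (Rz z f))).restrictScalars ℝ) z :=
    e0.hasFDerivAt.restrictScalars ℝ
  have e2 : HasFDerivAt (fun w => ‖Rz w f‖ ^ 2)
      ((2 * ‖Rz z‖ ^ 2) • (Complex.reCLM ∘L
        ((ContinuousLinearMap.mul ℝ ℂ) (inner ℂ f (Rz z f))))) z := by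
    have g1 := Complex.reCLM.hasFDerivAt.comp z (e1.inner ℂ e1)
    have g2 : (fun w => ‖Rz w f‖ ^ 2) = Complex.reCLM ∘ fun w => inner ℂ (Rz w f) (Rz w f) := by
      ext w
      exact (inner_self_eq_norm_sq (𝕜 := ℂ) (Rz w f)).symm
    rw [g2]
    refine g1.congr_fderiv ?_
    ext ζ
    -- Here the maximality of `f` enters, through `R* R f = ‖R‖² f`.
    have g3 : inner ℂ (Rz z f) (Rz z (Rz z f)) = ((‖Rz z‖ ^ 2 : ℝ) : ℂ) * inner ℂ f (Rz z f) := by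
      rw [← ContinuousLinearMap.adjoint_inner_left, adjoint_apply_of_norm_eq hf h1,
        inner_smul_left, Complex.conj_ofReal]
    have g4 : (inner ℂ (ζ • Rz z (Rz z f)) (Rz z f)).re
        = (inner ℂ (Rz z f) (ζ • Rz z (Rz z f))).re := inner_re_symm (𝕜 := ℂ) _ _
    have g5 : (inner ℂ (Rz z f) (ζ • Rz z (Rz z f))).re
        = ‖Rz z‖ ^ 2 * (inner ℂ f (Rz z f) * ζ).re := by
      rw [inner_smul_right, g3, ← Complex.re_ofReal_mul]
      congr 1
      ring
    change (fderivInnerCLM ℂ (Rz z f, Rz z f) (ζ • Rz z (Rz z f), ζ • Rz z (Rz z f))).re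
      = (2 * ‖Rz z‖ ^ 2) • (inner ℂ f (Rz z f) * ζ).re
    rw [fderivInnerCLM_apply, Complex.add_re, g4, g5, smul_eq_mul]
    ring
  -- With `f` frozen, `‖R(w) f‖²` lies below `‖R(w)‖²` and touches it at `z`, so both have the same
  -- gradient there. No differentiation of the maximizing vector is needed.
  have e3 : IsLocalMin (fun w => ‖Rz w‖ ^ 2 - ‖Rz w f‖ ^ 2) z := by
    refine Eventually.of_forall fun w => ?_
    have := PairBound.sq_norm_apply_le (Rz w) f
    rw [hf] at this
    simp only [h1]
    linarith
  have e4 := e3.hasFDerivAt_eq_zero (hT.hasFDerivAt.sub e2)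
  rw [sub_eq_zero.1 e4, norm_smul, Real.norm_eq_abs, abs_of_nonneg (by positivity)]
  congr 1
  set c := inner ℂ f (Rz z f)
  refine le_antisymm (ContinuousLinearMap.opNorm_le_bound _ (norm_nonneg c) fun ζ => ?_) ?_
  · exact (Complex.abs_re_le_norm _).trans (norm_mul_le _ _)
  · rcases eq_or_ne c 0 with hc | hc
    · rw [hc, norm_zero]; exact norm_nonneg _
    · have g1 := (Complex.reCLM ∘L ((ContinuousLinearMap.mul ℝ ℂ) c)).le_opNorm
        (starRingEnd ℂ c)
      have g2 : (Complex.reCLM ∘L ((ContinuousLinearMap.mul ℝ ℂ) c)) (starRingEnd ℂ c)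
          = ‖c‖ ^ 2 := by
        change (c * starRingEnd ℂ c).re = _
        rw [Complex.mul_conj, Complex.ofReal_re, Complex.normSq_eq_norm_sq]
      have hc0 : 0 < ‖c‖ := norm_pos_iff.2 hc
      rw [g2, RCLike.norm_conj, Real.norm_eq_abs, abs_of_nonneg (by positivity), sq] at g1
      exact le_of_mul_le_mul_right g1 hc0

theorem star_mul_apply_of_norm_eq_one (hR : ‖R‖ = 1) {f : H} (hf : ‖f‖ = 1) (h1 : ‖R f‖ = 1) :
    (star R * R) f = f := by
  have := adjoint_apply_of_norm_eq (R := R) hf (by rw [h1, hR])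
  rw [hR] at this
  simp only [one_pow, Complex.ofReal_one, one_smul] at this
  exact this

/-- Below the top singular value there is a gap. -/
theorem PairBound.norm_star_mul_sub_le (hb : PairBound R Λ) (hΛ : Λ ≤ 3 / 2 * ‖R‖ ^ 2)
    (hR : ‖R‖ = 1) {f : H} (hf : ‖f‖ = 1) (h1 : ‖R f‖ = 1) {p : H →L[ℂ] H}
    (hp : ∀ v, p v = inner ℂ f v • f) : ‖star R * R - p‖ ≤ 1 / 2 := by
  have hMf := star_mul_apply_of_norm_eq_one hR hf h1
  have hMself : ∀ v w, inner ℂ v ((star R * R) w) = inner ℂ (R v) (R w) :=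
    fun v w => by
      rw [ContinuousLinearMap.star_eq_adjoint, mul_apply_eq_comp,
        ContinuousLinearMap.adjoint_inner_right]
  -- The top vector uses up 1 of the total 3/2, leaving 1/2 for every orthogonal direction. The rest
  -- shows that `R* R` preserves the orthogonal complement of `f`.
  have hhalf : ∀ w, inner ℂ f w = 0 → ‖R w‖ ^ 2 ≤ 1 / 2 * ‖w‖ ^ 2 := fun w hw => by
    have h2 := hb _ _ hw
    rw [h1, hf] at h2
    rw [hR] at hΛ
    nlinarith [sq_nonneg ‖w‖]
  have hbd : ∀ N : H →L[ℂ] H, (∀ u, ‖N u‖ ≤ 1 / 2 * ‖u‖) → ‖N‖ ≤ 1 / 2 := fun N hN =>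
    ContinuousLinearMap.opNorm_le_bound N (show (0 : ℝ) ≤ 1 / 2 by norm_num) hN
  apply hbd
  intro u
  set w := u - inner ℂ f u • f with hw
  have hfw : inner ℂ f w = 0 := by
    rw [hw, inner_sub_right, inner_smul_right, inner_self_eq_norm_sq_to_K, hf]
    simp
  have hNu : (star R * R - p) u = (star R * R) w := by
    rw [sub_apply, hp, hw, map_sub, map_smul, hMf]
  have hMw : inner ℂ f ((star R * R) w) = 0 := by
    rw [hMself, ← ContinuousLinearMap.adjoint_inner_left, ← ContinuousLinearMap.star_eq_adjoint,
      ← mul_apply_eq_comp, hMf, hfw]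
  have hwu : ‖w‖ ≤ ‖u‖ := by
    have e1 : ‖u‖ ^ 2 = ‖w‖ ^ 2 + ‖inner ℂ f u • f‖ ^ 2 := by
      have e2 : u = w + inner ℂ f u • f := by rw [hw]; abel
      have e3 : inner ℂ w (inner ℂ f u • f) = 0 := by
        rw [inner_smul_right, inner_eq_zero_symm.1 hfw, mul_zero]
      have := norm_add_sq_eq_norm_sq_add_norm_sq_of_inner_eq_zero w _ e3
      rw [← e2] at this
      simpa [sq] using this
    exact le_of_sq_le_sq (by rw [e1]; linarith [sq_nonneg ‖inner ℂ f u • f‖]) (norm_nonneg _)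
  rw [hNu]
  set y := (star R * R) w with hy
  have e1 : ‖y‖ ^ 2 ≤ ‖R y‖ * ‖R w‖ := by
    have e2 := inner_self_eq_norm_sq_to_K (𝕜 := ℂ) y
    have e3 := norm_inner_le_norm (𝕜 := ℂ) (R y) (R w)
    rw [← hMself, ← hy, e2] at e3
    simpa using e3
  have e2 := hhalf _ hfw
  have e3 := hhalf _ hMw
  have e4 : ‖y‖ ^ 2 ≤ 1 / 2 * (‖y‖ * ‖w‖) := by
    refine e1.trans (le_of_sq_le_sq ?_ (by positivity))
    calc (‖R y‖ * ‖R w‖) ^ 2 = ‖R y‖ ^ 2 * ‖R w‖ ^ 2 := by ring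
      _ ≤ (1 / 2 * ‖y‖ ^ 2) * (1 / 2 * ‖w‖ ^ 2) :=
        mul_le_mul e3 e2 (by positivity) (by positivity)
      _ = _ := by ring
  have e5 : ‖y‖ ≤ 1 / 2 * ‖w‖ := by
    rcases (norm_nonneg y).eq_or_lt with h | h
    · rw [← h]; positivity
    · nlinarith
  linarith

/-- Jets of the square of the top singular value of a holomorphic family. -/
theorem JetBound.sq_norm {ι : Type*} {R : ι → ℂ → H →L[ℂ] H} {z : ι → ℂ} {r : ι → ℝ} {C : ℝ}
    (hr : ∀ i, 0 < r i)
    (hd : ∀ i, DifferentiableOn ℂ (R i) (Metric.ball (z i) (r i)))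
    (hC : ∀ i, ∀ w ∈ Metric.ball (z i) (r i), ‖R i w‖ ≤ C * ‖R i (z i)‖)
    (h0 : ∀ i, ∀ w ∈ Metric.ball (z i) (r i), 0 < ‖R i w‖)
    (hp : ∀ i, ∀ w ∈ Metric.ball (z i) (r i), ∃ Λ ≤ 3 / 2 * ‖R i w‖ ^ 2, PairBound (R i w) Λ)
    (n : ℕ) :
    JetBound n (fun i w => ‖R i w‖ ^ 2 / ‖R i (z i)‖ ^ 2) z r 1 := by
  have hz : ∀ i, z i ∈ Metric.ball (z i) (r i) := fun i => Metric.mem_ball_self (hr i)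
  have hs : ∀ i, 0 < ‖R i (z i)‖ := fun i => h0 i _ (hz i)
  have hr' : ∀ i, 0 ≤ r i := fun i => (hr i).le
  -- Normalising the norm to one at the base point makes all constants independent of the index.
  let Rn : ι → ℂ → H →L[ℂ] H := fun i w => ((‖R i (z i)‖⁻¹ : ℝ) : ℂ) • R i w
  have hRn : ∀ i w, ‖Rn i w‖ = ‖R i (z i)‖⁻¹ * ‖R i w‖ := fun i w => by
    rw [norm_smul, Complex.norm_real, Real.norm_eq_abs, abs_of_pos (inv_pos.2 (hs i))]
  have hRn1 : ∀ i, ‖Rn i (z i)‖ = 1 := fun i => by rw [hRn, inv_mul_cancel₀ (hs i).ne']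
  have hτ : ∀ i w, ‖R i w‖ ^ 2 / ‖R i (z i)‖ ^ 2 = ‖Rn i w‖ ^ 2 := fun i w => by
    rw [hRn, mul_pow, inv_pow]; field_simp
  simp only [hτ]
  have hRd : ∀ i, DifferentiableOn ℂ (Rn i) (Metric.ball (z i) (r i)) := fun i =>
    (hd i).const_smul (((‖R i (z i)‖⁻¹ : ℝ) : ℂ))
  have hRc : ∀ i, ContinuousAt (Rn i) (z i) := fun i =>
    ((hRd i).differentiableAt (Metric.isOpen_ball.mem_nhds (hz i))).continuousAt
  have hpn : ∀ i, ∀ w ∈ Metric.ball (z i) (r i),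
      ∃ Λ ≤ 3 / 2 * ‖Rn i w‖ ^ 2, PairBound (Rn i w) Λ := fun i w hw => by
    obtain ⟨Λ, hΛ, hb⟩ := hp i w hw
    refine ⟨‖R i (z i)‖⁻¹ ^ 2 * Λ, ?_, fun p g hpg => ?_⟩
    · rw [hRn, mul_pow]
      nlinarith [sq_nonneg ‖R i (z i)‖⁻¹]
    · have h1 := hb p g hpg
      have h2 : ∀ v, ‖Rn i w v‖ ^ 2 = ‖R i (z i)‖⁻¹ ^ 2 * ‖R i w v‖ ^ 2 := fun v => by
        rw [← mul_pow]
        congr 1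
        change ‖((‖R i (z i)‖⁻¹ : ℝ) : ℂ) • R i w v‖ = _
        rw [norm_smul, Complex.norm_real, Real.norm_eq_abs, abs_of_pos (inv_pos.2 (hs i))]
      rw [h2, h2]
      have := mul_le_mul_of_nonneg_left h1 (sq_nonneg ‖R i (z i)‖⁻¹)
      linarith
  have hn0 : ∀ i, ∀ w ∈ Metric.ball (z i) (r i), 0 < ‖Rn i w‖ := fun i w hw => by
    rw [hRn]; exact mul_pos (inv_pos.2 (hs i)) (h0 i w hw)
  have hmax : ∀ i, ∀ w ∈ Metric.ball (z i) (r i), ∃ f : H, ‖f‖ = 1 ∧ ‖Rn i w f‖ = ‖Rn i w‖ :=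
    fun i w hw => by
      obtain ⟨Λ, hΛ, hb⟩ := hpn i w hw
      exact hb.exists_maximizer hΛ (hn0 i w hw)
  choose f hf1 hf2 using fun i => hmax i (z i) (hz i)
  let M : ι → ℂ → H →L[ℂ] H := fun i w => star (Rn i w) * Rn i w
  -- Adding the projection onto the top vector lifts the eigenvalue one: by the gap `‖M - p‖ ≤ 1/2`,
  -- so `1 - M + p` is invertible by a Neumann series with inverse of norm at most 2.
  let p : ι → H →L[ℂ] H := fun i => (innerSL ℂ (f i)).smulRight (f i)
  have hpa : ∀ i v, p i v = inner ℂ (f i) v • f i := fun i v => rfl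
  let Φ : ι → (H →L[ℂ] H) →L[ℂ] ℂ := fun i =>
    (innerSL ℂ (f i)) ∘L (ContinuousLinearMap.apply ℂ H (f i))
  have hΦa : ∀ i a, Φ i a = inner ℂ (f i) (a (f i)) := fun i a => rfl
  have hMf : ∀ i, M i (z i) (f i) = f i := fun i => star_mul_apply_of_norm_eq_one (hRn1 i) (hf1 i)
    (by rw [hf2, hRn1])
  have hgap : ∀ i, ‖M i (z i) - p i‖ ≤ 1 / 2 := fun i => by
    obtain ⟨Λ, hΛ, hb⟩ := hpn i _ (hz i)
    exact hb.norm_star_mul_sub_le hΛ (hRn1 i) (hf1 i) (by rw [hf2, hRn1]) (hpa i)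
  have hsub : ∀ i, 1 - M i (z i) + p i = 1 - (M i (z i) - p i) := fun i => by abel
  have hunit : ∀ i, IsUnit (1 - M i (z i) + p i) := fun i => by
    rw [hsub]
    exact isUnit_one_sub_of_norm_lt_one ((hgap i).trans_lt (by norm_num))
  have hQ : ∀ i, Ring.inverse (1 - M i (z i) + p i)
      * (1 - (M i (z i) - p i)) = 1 := fun i => by
    rw [← hsub]; exact Ring.inverse_mul_cancel _ (hunit i)
  have hQf : ∀ i, Ring.inverse (1 - M i (z i) + p i) (f i) = f i :=
    fun i => by
      have h1 : (1 - (M i (z i) - p i)) (f i) = f i := by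
        change f i - (M i (z i) (f i) - p i (f i)) = f i
        rw [hMf, hpa, inner_self_eq_norm_sq_to_K, hf1]
        simp
      have h2 := congrArg (fun a : H →L[ℂ] H => a (f i)) (hQ i)
      change Ring.inverse (1 - M i (z i) + p i)
        ((1 - (M i (z i) - p i)) (f i)) = f i at h2
      rwa [h1] at h2
  have hone : ‖(1 : H →L[ℂ] H)‖ ≤ 1 := ContinuousLinearMap.norm_id_le
  refine JetBound.of_star_mul (R := Rn) (p := p) (Φ := Φ) (C := C) hr hRd (fun i w hw => ?_)
    (fun i => ?_) (fun i => by rw [hRn1, one_pow]) (fun i => ?_) (fun i => ?_) hunit (fun i => ?_) (fun i => ?_)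
    (fun i => ?_) n
  · rw [hRn, inv_mul_eq_div, div_le_iff₀ (hs i)]
    exact hC i w hw
  · exact (hRc i).norm.pow 2
  · refine ContinuousLinearMap.opNorm_le_bound (p i) (show (0 : ℝ) ≤ 2 by norm_num) fun v => ?_
    rw [hpa, norm_smul, hf1, _root_.mul_one]
    have := norm_inner_le_norm (𝕜 := ℂ) (f i) v
    rw [hf1, one_mul] at this
    linarith [norm_nonneg v]
  · refine ContinuousLinearMap.opNorm_le_bound (Φ i) (show (0 : ℝ) ≤ 2 by norm_num) fun a => ?_
    rw [hΦa]
    refine (norm_inner_le_norm _ _).trans ?_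
    have := a.le_opNorm (f i)
    rw [hf1, _root_.mul_one] at this
    rw [hf1, one_mul]
    linarith [norm_nonneg a]
  · set Q := Ring.inverse (1 - M i (z i) + p i) with hQdef
    have h1 : Q = 1 + Q * (M i (z i) - p i) := by
      have := hQ i
      rw [mul_sub, _root_.mul_one] at this
      rw [← this]; abel
    have h2 : ‖Q‖ ≤ 1 + ‖Q‖ * (1 / 2) := by
      calc ‖Q‖ = ‖1 + Q * (M i (z i) - p i)‖ := by rw [← h1]
        _ ≤ ‖(1 : H →L[ℂ] H)‖ + ‖Q‖ * ‖M i (z i) - p i‖ :=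
          (norm_add_le _ _).trans (add_le_add le_rfl (norm_mul_le _ _))
        _ ≤ _ := add_le_add hone (mul_le_mul_of_nonneg_left (hgap i) (norm_nonneg _))
    linarith
  · change (inner ℂ (f i) (Ring.inverse (1 - M i (z i) + p i)
      (Ring.inverse (1 - M i (z i) + p i) (f i)))).re = 1
    rw [hQf, hQf, inner_self_eq_norm_sq_to_K, hf1]
    simp
  · have hcont : ContinuousAt (fun w => ((‖Rn i w‖ ^ 2 : ℝ) : ℂ) • (1 : H →L[ℂ] H) - M i w + p i)
        (z i) :=
      (((Complex.continuous_ofReal.continuousAt.comp ((hRc i).norm.pow 2)).smul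
        continuousAt_const).sub ((hRc i).star.mul (hRc i))).add continuousAt_const
    have hev : ∀ᶠ w in 𝓝 (z i),
        IsUnit (((‖Rn i w‖ ^ 2 : ℝ) : ℂ) • (1 : H →L[ℂ] H) - M i w + p i) := by
      refine hcont.eventually (Units.isOpen.mem_nhds ?_)
      have := hunit i
      change IsUnit (((‖Rn i (z i)‖ ^ 2 : ℝ) : ℂ) • (1 : H →L[ℂ] H) - M i (z i) + p i)
      rw [hRn1, one_pow, Complex.ofReal_one, one_smul]
      exact this
    -- The characteristic equation near `z`: a top vector `v` at `w` satisfies `(τ - M + p) v =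
    -- (f|v) f`. Inverting and pairing with `f` gives the value 1, after division by `(f|v)`, which
    -- cannot vanish because `v ≠ 0`.
    filter_upwards [hev, Metric.isOpen_ball.mem_nhds (hz i)] with w hw hwb
    obtain ⟨v, hv1, hv2⟩ := hmax i w hwb
    have hMv := adjoint_apply_of_norm_eq hv1 hv2
    set a := ((‖Rn i w‖ ^ 2 : ℝ) : ℂ) • (1 : H →L[ℂ] H) - M i w + p i with ha
    have hav : a v = inner ℂ (f i) v • f i := by
      change (((‖Rn i w‖ ^ 2 : ℝ) : ℂ) • (1 : H →L[ℂ] H)) v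
        - ContinuousLinearMap.adjoint (Rn i w) (Rn i w v) + p i v = _
      rw [hMv, hpa]
      change ((‖Rn i w‖ ^ 2 : ℝ) : ℂ) • v - ((‖Rn i w‖ ^ 2 : ℝ) : ℂ) • v + _ = _
      rw [sub_self, zero_add]
    have hQa : ∀ y, Ring.inverse a (a y) = y := fun y => by
      have := congrArg (fun b : H →L[ℂ] H => b y) (Ring.inverse_mul_cancel _ hw)
      exact this
    have h2 : v = inner ℂ (f i) v • Ring.inverse a (f i) := by
      rw [← map_smul, ← hav, hQa]
    have h3 : inner ℂ (f i) v ≠ 0 := fun h => by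
      rw [h, zero_smul] at h2
      rw [h2, norm_zero] at hv1
      exact zero_ne_one hv1
    have h4 : inner ℂ (f i) v = inner ℂ (f i) v * inner ℂ (f i) (Ring.inverse a (f i)) := by
      conv_lhs => rw [h2, inner_smul_right]
    have h5 : inner ℂ (f i) (Ring.inverse a (f i)) = 1 :=
      mul_left_cancel₀ h3 (by rw [← h4, _root_.mul_one])
    change (Φ i (Ring.inverse a)).re = 1
    rw [hΦa, h5, Complex.one_re]

end Singular

/-! ### Unbounded operators with a bounded inverse -/

section Inverse

variable {A : L2S1 →ₗ.[ℂ] L2S1} {R : L2S1 →L[ℂ] L2S1}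

/-- `R` is the bounded inverse of the densely defined operator `A`. -/
structure IsResolvent (A : L2S1 →ₗ.[ℂ] L2S1) (R : L2S1 →L[ℂ] L2S1) : Prop where
  dense : Dense (A.domain : Set L2S1)
  iff : ∀ u v : L2S1, (∃ hu : u ∈ A.domain, A ⟨u, hu⟩ = v) ↔ u = R v

theorem opMul_apply_iff (A B : L2S1 →ₗ.[ℂ] L2S1) (u w : L2S1) :
    (∃ hu : u ∈ (opMul A B).domain, opMul A B ⟨u, hu⟩ = w) ↔
      ∃ v, (∃ hu : u ∈ B.domain, B ⟨u, hu⟩ = v) ∧ ∃ hv : v ∈ A.domain, A ⟨v, hv⟩ = w := by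
  constructor
  · rintro ⟨hu, rfl⟩
    obtain ⟨y, hyA, rfl⟩ := hu
    exact ⟨B y, ⟨y.2, rfl⟩, hyA, rfl⟩
  · rintro ⟨v, ⟨hu, rfl⟩, hv, rfl⟩
    exact ⟨⟨⟨u, hu⟩, hv, rfl⟩, rfl⟩

namespace IsResolvent

theorem adjoint_iff (h : IsResolvent A R) (y x : L2S1) :
    (∃ hy : y ∈ A.adjoint.domain, A.adjoint ⟨y, hy⟩ = x) ↔ y = ContinuousLinearMap.adjoint R x := by
  constructor
  · rintro ⟨hy, rfl⟩
    refine ext_inner_right ℂ fun v => ?_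
    obtain ⟨hu, hv⟩ := (h.iff (R v) v).2 rfl
    have h1 := LinearPMap.adjoint_isFormalAdjoint h.dense ⟨y, hy⟩ ⟨R v, hu⟩
    rw [hv] at h1
    rw [ContinuousLinearMap.adjoint_inner_left]
    exact h1.symm
  · rintro rfl
    have h1 : ∀ u : A.domain, inner ℂ x (u : L2S1)
        = inner ℂ (ContinuousLinearMap.adjoint R x) (A u) := fun u => by
      have h2 := (h.iff (u : L2S1) (A u)).1 ⟨u.2, rfl⟩
      rw [ContinuousLinearMap.adjoint_inner_left, ← h2]
    have hy := LinearPMap.mem_adjoint_domain_of_exists (T := A) _ ⟨x, h1⟩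
    exact ⟨hy, LinearPMap.adjoint_apply_eq h.dense ⟨_, hy⟩ h1⟩

theorem isUnitEigenvector_left (h : IsResolvent A R) (μ : ℝ) (u : L2S1) :
    IsUnitEigenvector (opMul A.adjoint A) μ u ↔
      ‖u‖ = 1 ∧ u = (μ : ℂ) • R (ContinuousLinearMap.adjoint R u) := by
  rw [IsUnitEigenvector, opMul_apply_iff]
  refine and_congr_right fun _ => ?_
  simp only [h.iff, h.adjoint_iff]
  constructor
  · rintro ⟨v, h1, h2⟩
    rwa [h2, map_smul, map_smul] at h1
  · intro h1
    exact ⟨_, by rwa [map_smul, map_smul], rfl⟩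

theorem isUnitEigenvector_right (h : IsResolvent A R) (μ : ℝ) (u : L2S1) :
    IsUnitEigenvector (opMul A A.adjoint) μ u ↔
      ‖u‖ = 1 ∧ u = (μ : ℂ) • ContinuousLinearMap.adjoint R (R u) := by
  rw [IsUnitEigenvector, opMul_apply_iff]
  refine and_congr_right fun _ => ?_
  simp only [h.iff, h.adjoint_iff]
  constructor
  · rintro ⟨v, h1, h2⟩
    rwa [h2, map_smul, map_smul] at h1
  · intro h1
    exact ⟨_, by rwa [map_smul, map_smul], rfl⟩

end IsResolvent

/-- The lowest eigenvectors are the top singular vectors of the resolvent. -/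
theorem isLowestPair_of_isResolvent {g : S1 → ℂ} {h : ℝ} {z : ℂ} {Λ : ℝ}
    (hR : IsResolvent (opPsub g h z) R) (hΛ : PairBound R Λ) (hΛ' : Λ ≤ 3 / 2 * ‖R‖ ^ 2)
    (h0 : 0 < ‖R‖) {f : L2S1} (hf : ‖f‖ = 1) (hf' : ‖R f‖ = ‖R‖) :
    (∃ e₀ f₀, IsLowestPair g h z e₀ f₀) ∧
      ∀ e₀ f₀, IsLowestPair g h z e₀ f₀ → ‖inner ℂ f₀ e₀‖ = ‖inner ℂ f (R f)‖ / ‖R‖ := by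
  set s := ‖R‖ with hs
  have hsC : ((s : ℝ) : ℂ) ≠ 0 := Complex.ofReal_ne_zero.2 h0.ne'
  have hRf := adjoint_apply_of_norm_eq hf hf'
  rw [← hs] at hRf
  -- Pairing `u = μ R R* u` with `u` gives `1 = μ ‖R* u‖² ≤ μ ‖R‖²`, hence no eigenvalue lies below
  -- `‖R‖⁻²`.
  have hpos : ∀ μ u, IsUnitEigenvector (opQ g h z) μ u → 0 ≤ μ ∧ 1 ≤ μ * s ^ 2 ∧
      μ * ‖ContinuousLinearMap.adjoint R u‖ ^ 2 = 1 := by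
    intro μ u hu
    obtain ⟨hu1, hu2⟩ := (hR.isUnitEigenvector_left μ u).1 hu
    have h1 : (1 : ℂ) = ((μ * ‖ContinuousLinearMap.adjoint R u‖ ^ 2 : ℝ) : ℂ) := by
      have h2 : inner ℂ u u = (1 : ℂ) := by rw [inner_self_eq_norm_sq_to_K, hu1]; simp
      rw [← h2]
      conv_lhs => rw [hu2]
      rw [inner_smul_left, ← ContinuousLinearMap.adjoint_inner_right,
        Complex.conj_ofReal]
      rw [← hu2, inner_self_eq_norm_sq_to_K]
      simp
    have h2 : 1 = μ * ‖ContinuousLinearMap.adjoint R u‖ ^ 2 := by exact_mod_cast h1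
    have h3 : 0 ≤ μ := by
      by_contra hneg
      have := mul_nonpos_of_nonpos_of_nonneg (not_le.1 hneg).le
        (sq_nonneg ‖ContinuousLinearMap.adjoint R u‖)
      linarith
    have h4 : ‖ContinuousLinearMap.adjoint R u‖ ^ 2 ≤ s ^ 2 := by
      have := (ContinuousLinearMap.adjoint R).le_opNorm u
      rw [LinearIsometryEquiv.norm_map, hu1, mul_one] at this
      exact pow_le_pow_left₀ (norm_nonneg _) this 2
    exact ⟨h3, by rw [h2]; exact mul_le_mul_of_nonneg_left h4 h3, h2.symm⟩
  have hs2 : (((s⁻¹ ^ 2 : ℝ)) : ℂ) * ((s ^ 2 : ℝ) : ℂ) = 1 := by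
    rw [← Complex.ofReal_mul, ← mul_pow, inv_mul_cancel₀ h0.ne']; simp
  have he : IsUnitEigenvector (opQ g h z) (s⁻¹ ^ 2) (((s⁻¹ : ℝ) : ℂ) • R f) := by
    refine (hR.isUnitEigenvector_left _ _).2 ⟨?_, ?_⟩
    · rw [norm_smul, hf', Complex.norm_real, Real.norm_eq_abs, abs_of_pos (inv_pos.2 h0),
        inv_mul_cancel₀ h0.ne']
    · rw [map_smul, hRf, smul_comm, map_smul, smul_smul, map_smul, hs2, one_smul]
  have hff : IsUnitEigenvector (opQtilde g h z) (s⁻¹ ^ 2) f := by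
    refine (hR.isUnitEigenvector_right _ _).2 ⟨hf, ?_⟩
    rw [hRf, smul_smul, hs2, one_smul]
  have hleast : IsLeast {μ : ℝ | ∃ u, IsUnitEigenvector (opQ g h z) μ u} (s⁻¹ ^ 2) := by
    refine ⟨⟨_, he⟩, ?_⟩
    rintro μ ⟨u, hu⟩
    have := (hpos μ u hu).2.1
    rw [inv_pow, inv_eq_one_div, div_le_iff₀ (by positivity)]
    exact this
  refine ⟨⟨_, f, s⁻¹ ^ 2, hleast, he, hff⟩, ?_⟩
  rintro e₀ f₀ ⟨μ, hμ, he₀, hf₀⟩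
  obtain rfl := hμ.unique hleast
  have hp := (hpos _ _ he₀).2.2
  obtain ⟨he1, he2⟩ := (hR.isUnitEigenvector_left _ _).1 he₀
  obtain ⟨hf1, hf2⟩ := (hR.isUnitEigenvector_right _ _).1 hf₀
  have hnorm : ‖ContinuousLinearMap.adjoint R e₀‖ = s := by
    have h1 : ‖ContinuousLinearMap.adjoint R e₀‖ ^ 2 = s ^ 2 := by
      have : s ^ 2 * (s⁻¹ ^ 2 * ‖ContinuousLinearMap.adjoint R e₀‖ ^ 2) = s ^ 2 := by
        rw [hp, mul_one]
      rw [← this]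
      field_simp
    exact (sq_eq_sq₀ (norm_nonneg _) h0.le).1 h1
  -- Both `f'` and `f₀` turn out to be unit maximizing vectors of `R`, with `e₀ = s⁻¹ R f'`.
  -- Uniqueness up to phase then identifies them with `f`, and phases disappear in the modulus.
  set f' := ((s⁻¹ : ℝ) : ℂ) • ContinuousLinearMap.adjoint R e₀ with hf'def
  have hf'1 : ‖f'‖ = 1 := by
    rw [hf'def, norm_smul, hnorm, Complex.norm_real, Real.norm_eq_abs, abs_of_pos (inv_pos.2 h0),
      inv_mul_cancel₀ h0.ne']
  have hee : e₀ = ((s⁻¹ : ℝ) : ℂ) • R f' := by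
    rw [hf'def, map_smul, smul_smul]
    conv_lhs => rw [he2]
    congr 1
    push_cast
    ring
  have hf'2 : ‖R f'‖ = s := by
    have := congrArg norm hee
    rw [norm_smul, he1, Complex.norm_real, Real.norm_eq_abs, abs_of_pos (inv_pos.2 h0)] at this
    field_simp at this
    linarith
  have hf₀2 : ‖R f₀‖ = s := by
    have h1 : (1 : ℂ) = ((s⁻¹ ^ 2 * ‖R f₀‖ ^ 2 : ℝ) : ℂ) := by
      have h2 : inner ℂ f₀ f₀ = (1 : ℂ) := by rw [inner_self_eq_norm_sq_to_K, hf1]; simp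
      rw [← h2]
      conv_lhs => rw [hf2]
      rw [inner_smul_left, ContinuousLinearMap.adjoint_inner_left, Complex.conj_ofReal, ← hf2,
        inner_self_eq_norm_sq_to_K]
      simp
    have h2 : 1 = s⁻¹ ^ 2 * ‖R f₀‖ ^ 2 := by exact_mod_cast h1
    have h3 : ‖R f₀‖ ^ 2 = s ^ 2 := by
      have : s ^ 2 * (s⁻¹ ^ 2 * ‖R f₀‖ ^ 2) = s ^ 2 := by rw [← h2, mul_one]
      rw [← this]
      field_simp
    exact (sq_eq_sq₀ (norm_nonneg _) h0.le).1 h3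
  obtain ⟨u, hu, rfl⟩ := hΛ.maximizer_unique hΛ' h0 hf1 hf hf₀2 hf'
  obtain ⟨u', hu', hfu'⟩ := hΛ.maximizer_unique hΛ' h0 hf'1 hf hf'2 hf'
  rw [hee, hfu', map_smul, inner_smul_left, inner_smul_right, inner_smul_right, norm_mul,
    norm_mul, norm_mul, RCLike.norm_conj, hu, hu', Complex.norm_real, Real.norm_eq_abs,
    abs_of_pos (inv_pos.2 h0)]
  field_simp

end Inverse

/-! ### Periodic first order linear equations -/

/-- The primitive of `a` vanishing at `0`. -/
def prim (a : ℝ → ℂ) (x : ℝ) : ℂ := ∫ y in (0 : ℝ)..x, a y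

/-- The periodic solution of `φ' = a φ + ψ`. -/
def solFun (a ψ : ℝ → ℂ) (x : ℝ) : ℂ :=
  (Complex.exp (-prim a (2 * Real.pi)) - 1)⁻¹ *
    (Complex.exp (prim a x) * ∫ y in x..(x + 2 * Real.pi), Complex.exp (-prim a y) * ψ y)

section Periodic

variable {a ψ : ℝ → ℂ}

theorem prim_hasDerivAt (ha : Continuous a) (x : ℝ) : HasDerivAt (prim a) (a x) x :=
  intervalIntegral.integral_hasDerivAt_right (ha.intervalIntegrable _ _)
    (ha.stronglyMeasurableAtFilter _ _) ha.continuousAt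

theorem prim_continuous (ha : Continuous a) : Continuous (prim a) :=
  continuous_iff_continuousAt.2 fun x => (prim_hasDerivAt ha x).continuousAt

theorem prim_neg (a : ℝ → ℂ) (x : ℝ) : prim (fun y => -a y) x = -prim a x :=
  intervalIntegral.integral_neg

theorem prim_sub (ha : Continuous a) (x y : ℝ) : prim a y - prim a x = ∫ s in x..y, a s :=
  intervalIntegral.integral_interval_sub_left (ha.intervalIntegrable _ _)
    (ha.intervalIntegrable _ _)

theorem prim_add_period (ha : Continuous a) (hp : Function.Periodic a (2 * Real.pi)) (x : ℝ) :
    prim a (x + 2 * Real.pi) = prim a x + prim a (2 * Real.pi) := by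
  have h1 := prim_sub ha x (x + 2 * Real.pi)
  have h2 := hp.intervalIntegral_add_eq x 0
  rw [zero_add] at h2
  rw [h2] at h1
  rw [← sub_eq_iff_eq_add', h1, prim]

theorem solFun_periodic (ha : Continuous a) (hp : Function.Periodic a (2 * Real.pi))
    (hψ : Function.Periodic ψ (2 * Real.pi)) : Function.Periodic (solFun a ψ) (2 * Real.pi) := by
  intro x
  have h1 : ∫ y in (x + 2 * Real.pi)..(x + 2 * Real.pi + 2 * Real.pi), Complex.exp (-prim a y) * ψ y
      = Complex.exp (-prim a (2 * Real.pi)) *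
        ∫ y in x..(x + 2 * Real.pi), Complex.exp (-prim a y) * ψ y := by
    rw [← intervalIntegral.integral_comp_add_right
      (fun y => Complex.exp (-prim a y) * ψ y) (2 * Real.pi),
      ← intervalIntegral.integral_const_mul]
    refine intervalIntegral.integral_congr fun y _ => ?_
    rw [prim_add_period ha hp, hψ y, neg_add, Complex.exp_add]
    ring
  rw [solFun, solFun, h1, prim_add_period ha hp, Complex.exp_add, Complex.exp_neg]
  field_simp [Complex.exp_ne_zero]

theorem continuous_integral_period {E : Type*} [NormedAddCommGroup E] [NormedSpace ℝ E]
    {F : ℝ → E} (hF : ∀ s t, IntervalIntegrable F volume s t) :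
    Continuous fun x => ∫ y in x..(x + 2 * Real.pi), F y := by
  have h1 := intervalIntegral.continuous_primitive hF 0
  have h2 : (fun x => ∫ y in x..(x + 2 * Real.pi), F y)
      = fun x => (∫ y in (0 : ℝ)..(x + 2 * Real.pi), F y) - ∫ y in (0 : ℝ)..x, F y := by
    ext x
    rw [intervalIntegral.integral_interval_sub_left (hF _ _) (hF _ _)]
  rw [h2]
  exact (h1.comp (continuous_id.add continuous_const)).sub h1

theorem exp_prim_continuous (ha : Continuous a) : Continuous fun y => Complex.exp (-prim a y) :=
  Complex.continuous_exp.comp (prim_continuous ha).neg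

theorem solFun_continuous (ha : Continuous a) (hψ : ∀ s t, IntervalIntegrable ψ volume s t) :
    Continuous (solFun a ψ) :=
  continuous_const.mul ((Complex.continuous_exp.comp (prim_continuous ha)).mul
    (continuous_integral_period fun s t =>
      (hψ s t).continuousOn_mul (exp_prim_continuous ha).continuousOn))

/-- Moving the window of integration contributes the endpoint difference `(e^{-A} - 1) e^{-prim a x}
ψ(x)`, with `A` the integral of `a` over a period. The prefactors reduce it to `ψ(x)`. -/
theorem solFun_hasDerivAt (ha : Continuous a) (hp : Function.Periodic a (2 * Real.pi))
    (hψ : Continuous ψ) (hψp : Function.Periodic ψ (2 * Real.pi))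
    (hne : Complex.exp (-prim a (2 * Real.pi)) ≠ 1) (x : ℝ) :
    HasDerivAt (solFun a ψ) (a x * solFun a ψ x + ψ x) x := by
  have hc : Continuous fun y => Complex.exp (-prim a y) * ψ y := (exp_prim_continuous ha).mul hψ
  have h1 : ∀ x, HasDerivAt (fun x => ∫ y in (0 : ℝ)..x, Complex.exp (-prim a y) * ψ y)
      (Complex.exp (-prim a x) * ψ x) x := fun x =>
    intervalIntegral.integral_hasDerivAt_right (hc.intervalIntegrable _ _)
      (hc.stronglyMeasurableAtFilter _ _) hc.continuousAt
  have h2 : HasDerivAt (fun x => ∫ y in x..(x + 2 * Real.pi), Complex.exp (-prim a y) * ψ y)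
      (Complex.exp (-prim a (x + 2 * Real.pi)) * ψ (x + 2 * Real.pi)
        - Complex.exp (-prim a x) * ψ x) x := by
    have h3 : (fun x => ∫ y in x..(x + 2 * Real.pi), Complex.exp (-prim a y) * ψ y)
        = fun x => (∫ y in (0 : ℝ)..(x + 2 * Real.pi), Complex.exp (-prim a y) * ψ y)
          - ∫ y in (0 : ℝ)..x, Complex.exp (-prim a y) * ψ y := by
      ext x
      rw [intervalIntegral.integral_interval_sub_left (hc.intervalIntegrable _ _)
        (hc.intervalIntegrable _ _)]
    rw [h3]
    exact ((h1 (x + 2 * Real.pi)).comp_add_const x (2 * Real.pi)).sub (h1 x)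
  have h4 := (((prim_hasDerivAt ha x).cexp.mul h2).const_mul
    (Complex.exp (-prim a (2 * Real.pi)) - 1)⁻¹)
  refine h4.congr_deriv ?_
  rw [prim_add_period ha hp, hψp x, neg_add, Complex.exp_add, solFun]
  have h5 : Complex.exp (prim a x) * Complex.exp (-prim a x) = 1 := by
    rw [← Complex.exp_add, add_neg_cancel, Complex.exp_zero]
  have h6 : Complex.exp (-prim a (2 * Real.pi)) - 1 ≠ 0 := sub_ne_zero.2 hne
  have h7 : (Complex.exp (-prim a (2 * Real.pi)) - 1)⁻¹ *
      (Complex.exp (-prim a (2 * Real.pi)) - 1) = 1 := inv_mul_cancel₀ h6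
  linear_combination (ψ x * (Complex.exp (prim a x) * Complex.exp (-prim a x))) * h7 + ψ x * h5

theorem solFun_contDiff (ha : ContDiff ℝ ∞ a) (hp : Function.Periodic a (2 * Real.pi))
    (hψ : ContDiff ℝ ∞ ψ) (hψp : Function.Periodic ψ (2 * Real.pi))
    (hne : Complex.exp (-prim a (2 * Real.pi)) ≠ 1) : ContDiff ℝ ∞ (solFun a ψ) := by
  have hd := solFun_hasDerivAt ha.continuous hp hψ.continuous hψp hne
  refine contDiff_infty.2 fun n => ?_
  induction n with
  | zero =>
    refine contDiff_zero.2
      (continuous_iff_continuousAt.2 fun x => (hd x).continuousAt)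
  | succ n ih =>
    push_cast
    refine contDiff_succ_iff_deriv.2 ⟨fun x => (hd x).differentiableAt, by simp, ?_⟩
    rw [funext fun x => (hd x).deriv]
    exact ((ha.of_le (by exact_mod_cast le_top)).mul ih).add (hψ.of_le (by exact_mod_cast le_top))

end Periodic

/-! ### Functions on the circle -/

/-- The continuous function on the circle with a given periodic lift. -/
def circleFun (f : ℝ → ℂ) (hc : Continuous f) (hp : Function.Periodic f (2 * Real.pi)) :
    C(S1, ℂ) :=
  ⟨hp.lift, (QuotientAddGroup.isQuotientMap_mk _).continuous_iff.2 hc⟩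

theorem circleFun_coe {f : ℝ → ℂ} (hc : Continuous f) (hp : Function.Periodic f (2 * Real.pi))
    (x : ℝ) : circleFun f hc hp (x : S1) = f x := rfl

theorem continuous_of_lift {f : S1 → ℂ} (hf : Continuous fun x : ℝ => f (x : S1)) :
    Continuous f :=
  (QuotientAddGroup.isQuotientMap_mk _).continuous_iff.2 hf

theorem periodic_lift {α : Type*} (f : S1 → α) :
    Function.Periodic (fun x : ℝ => f (x : S1)) (2 * Real.pi) := fun x => by
  simp only [AddCircle.coe_add_period]

/-- The class in `L²` of a continuous function on the circle. -/
def toL2 (f : C(S1, ℂ)) : L2S1 := ContinuousMap.toLp 2 volume ℂ f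

theorem coeFn_toL2 (f : C(S1, ℂ)) : (toL2 f : S1 → ℂ) =ᵐ[volume] f := ContinuousMap.coeFn_toLp _ _

theorem ae_lift_Ioc {p : S1 → Prop} (hp : ∀ᵐ x : S1, p x) (s : ℝ) :
    ∀ᵐ x : ℝ ∂(volume.restrict (Ioc s (s + 2 * Real.pi))), p (x : S1) :=
  (AddCircle.measurePreserving_mk (2 * Real.pi) s).quasiMeasurePreserving.ae hp

theorem memLp_lift (u : L2S1) (s : ℝ) :
    MemLp (fun x : ℝ => u (x : S1)) 2 (volume.restrict (Ioc s (s + 2 * Real.pi))) :=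
  (Lp.memLp u).comp_measurePreserving (AddCircle.measurePreserving_mk (2 * Real.pi) s)

theorem le_add_two_pi (s : ℝ) : s ≤ s + 2 * Real.pi := by linarith [Real.two_pi_pos]

theorem intervalIntegrable_lift_period (u : L2S1) (s : ℝ) :
    IntervalIntegrable (fun x : ℝ => u (x : S1)) volume s (s + 2 * Real.pi) := by
  rw [intervalIntegrable_iff_integrableOn_Ioc_of_le (le_add_two_pi s)]
  exact (memLp_lift u s).integrable (by norm_num)

theorem intervalIntegrable_lift (u : L2S1) (s t : ℝ) :
    IntervalIntegrable (fun x : ℝ => u (x : S1)) volume s t :=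
  (periodic_lift u).intervalIntegrable Real.two_pi_pos.ne' (intervalIntegrable_lift_period u 0) s t

theorem inner_eq_integral (u v : L2S1) (s : ℝ) :
    inner ℂ u v = ∫ x in s..(s + 2 * Real.pi), starRingEnd ℂ (u (x : S1)) * v (x : S1) := by
  rw [L2.inner_def, ← AddCircle.intervalIntegral_preimage (2 * Real.pi) s]
  refine intervalIntegral.integral_congr fun x _ => ?_
  simp only [RCLike.inner_apply]
  ring

theorem sq_norm_eq_integral (u : L2S1) (s : ℝ) :
    ‖u‖ ^ 2 = ∫ x in s..(s + 2 * Real.pi), ‖u (x : S1)‖ ^ 2 := by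
  have h1 := inner_eq_integral u u s
  have h2 : ∫ x in s..(s + 2 * Real.pi), starRingEnd ℂ (u (x : S1)) * u (x : S1)
      = ((∫ x in s..(s + 2 * Real.pi), ‖u (x : S1)‖ ^ 2 : ℝ) : ℂ) := by
    rw [← intervalIntegral.integral_ofReal]
    refine intervalIntegral.integral_congr fun x _ => ?_
    rw [Complex.conj_mul', Complex.ofReal_pow]
  rw [h2, inner_self_eq_norm_sq_to_K] at h1
  exact Complex.ofReal_injective (by rw [← h1]; simp)

theorem integral_congr_lift {f : ℝ → ℂ} {u v : S1 → ℂ} (h : u =ᵐ[volume] v) (s : ℝ) :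
    ∫ x in s..(s + 2 * Real.pi), f x * u (x : S1)
      = ∫ x in s..(s + 2 * Real.pi), f x * v (x : S1) := by
  refine intervalIntegral.integral_congr_ae_restrict ?_
  rw [Set.uIoc_of_le (le_add_two_pi s)]
  filter_upwards [ae_lift_Ioc h s] with x hx
  rw [hx]

theorem sq_norm_toL2 (f : C(S1, ℂ)) (s : ℝ) :
    ‖toL2 f‖ ^ 2 = ∫ x in s..(s + 2 * Real.pi), ‖f (x : S1)‖ ^ 2 := by
  rw [sq_norm_eq_integral _ s]
  refine intervalIntegral.integral_congr_ae_restrict ?_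
  rw [Set.uIoc_of_le (le_add_two_pi s)]
  filter_upwards [ae_lift_Ioc (coeFn_toL2 f) s] with x hx
  rw [hx]

/-- The Cauchy–Schwarz inequality over a period. -/
theorem sq_norm_integral_mul_le {k : ℝ → ℂ} (hk : Continuous k) (u : L2S1) (s : ℝ) :
    ‖∫ x in s..(s + 2 * Real.pi), k x * u (x : S1)‖ ^ 2
      ≤ (∫ x in s..(s + 2 * Real.pi), ‖k x‖ ^ 2) * ‖u‖ ^ 2 := by
  have hk2 : MemLp k (ENNReal.ofReal 2) (volume.restrict (Ioc s (s + 2 * Real.pi))) := by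
    have h1 : Integrable (fun x => ‖k x‖ ^ 2) (volume.restrict (Ioc s (s + 2 * Real.pi))) :=
      ((hk.norm.pow 2).intervalIntegrable s (s + 2 * Real.pi)).1
    have h2 := (memLp_two_iff_integrable_sq_norm (hk.aestronglyMeasurable.restrict)).2 h1
    simpa using h2
  have hu2 : MemLp (fun x : ℝ => u (x : S1)) (ENNReal.ofReal 2)
      (volume.restrict (Ioc s (s + 2 * Real.pi))) := by simpa using memLp_lift u s
  have h1 := integral_mul_norm_le_Lp_mul_Lq Real.HolderConjugate.two_two hk2 hu2
  simp only [Real.rpow_two, ← Real.sqrt_eq_rpow] at h1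
  have h2 : ‖∫ x in s..(s + 2 * Real.pi), k x * u (x : S1)‖
      ≤ ∫ x in Ioc s (s + 2 * Real.pi), ‖k x‖ * ‖u (x : S1)‖ := by
    rw [intervalIntegral.integral_of_le (le_add_two_pi s)]
    refine (norm_integral_le_integral_norm _).trans_eq ?_
    simp only [norm_mul]
  have h3 := pow_le_pow_left₀ (norm_nonneg _) (h2.trans h1) 2
  rwa [mul_pow, Real.sq_sqrt (integral_nonneg fun x => by positivity),
    Real.sq_sqrt (integral_nonneg fun x => by positivity),
    ← intervalIntegral.integral_of_le (le_add_two_pi s),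
    ← intervalIntegral.integral_of_le (le_add_two_pi s), ← sq_norm_eq_integral u s] at h3

/-! ### The solution operator on `L²`: boundedness, Hilbert–Schmidt control, weak solutions. -/

section SolOp

variable {a : ℝ → ℂ}

/-- The pointwise Cauchy–Schwarz constant of the solution operator. -/
def solKer (a : ℝ → ℂ) (x : ℝ) : ℝ :=
  ‖(Complex.exp (-prim a (2 * Real.pi)) - 1)⁻¹‖ ^ 2 *
    (Real.exp (2 * (prim a x).re) * ∫ y in x..(x + 2 * Real.pi), Real.exp (-(2 * (prim a y).re)))

theorem sq_norm_cexp (w : ℂ) : ‖Complex.exp w‖ ^ 2 = Real.exp (2 * w.re) := by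
  rw [Complex.norm_exp, ← Real.exp_nat_mul]
  norm_num

theorem exp_re_prim_continuous (ha : Continuous a) (c : ℝ) :
    Continuous fun y => Real.exp (c * (prim a y).re) :=
  Real.continuous_exp.comp (continuous_const.mul (Complex.continuous_re.comp (prim_continuous ha)))

theorem solKer_continuous (ha : Continuous a) : Continuous (solKer a) := by
  refine continuous_const.mul ((exp_re_prim_continuous ha 2).mul
    (continuous_integral_period fun s t => ?_))
  simp only [← neg_mul]
  exact (exp_re_prim_continuous ha (-2)).intervalIntegrable _ _

theorem sq_norm_solFun_le (ha : Continuous a) (v : L2S1) (x : ℝ) :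
    ‖solFun a (fun y => v (y : S1)) x‖ ^ 2 ≤ solKer a x * ‖v‖ ^ 2 := by
  have h1 := sq_norm_integral_mul_le (exp_prim_continuous ha) v x
  simp only [sq_norm_cexp, Complex.neg_re, mul_neg] at h1
  rw [solFun, solKer, norm_mul, norm_mul, mul_pow, mul_pow, sq_norm_cexp, mul_assoc, mul_assoc]
  gcongr

theorem solFun_add (ha : Continuous a) (u v : L2S1) (x : ℝ) :
    solFun a (fun y => (u + v : L2S1) (y : S1)) x
      = solFun a (fun y => u (y : S1)) x + solFun a (fun y => v (y : S1)) x := by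
  have hi : ∀ w : L2S1, IntervalIntegrable (fun y : ℝ => Complex.exp (-prim a y) * w (y : S1))
      volume x (x + 2 * Real.pi) := fun w =>
    (intervalIntegrable_lift w _ _).continuousOn_mul (exp_prim_continuous ha).continuousOn
  simp only [solFun]
  rw [integral_congr_lift (Lp.coeFn_add u v)]
  simp only [Pi.add_apply, mul_add]
  rw [intervalIntegral.integral_add (hi u) (hi v)]
  ring

theorem solFun_smul (c : ℂ) (v : L2S1) (x : ℝ) :
    solFun a (fun y => (c • v : L2S1) (y : S1)) x = c * solFun a (fun y => v (y : S1)) x := by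
  simp only [solFun]
  rw [integral_congr_lift (Lp.coeFn_smul c v)]
  simp only [Pi.smul_apply, smul_eq_mul, mul_left_comm _ c]
  rw [intervalIntegral.integral_const_mul]
  ring

/-- The solution of `φ' = a φ + v` as a continuous function on the circle. -/
def solMap (ha : Continuous a) (hp : Function.Periodic a (2 * Real.pi)) (v : L2S1) : C(S1, ℂ) :=
  circleFun (solFun a fun y => v (y : S1)) (solFun_continuous ha (intervalIntegrable_lift v))
    (solFun_periodic ha hp (periodic_lift v))

theorem solMap_coe (ha : Continuous a) (hp : Function.Periodic a (2 * Real.pi)) (v : L2S1) (x : ℝ) :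
    solMap ha hp v (x : S1) = solFun a (fun y => v (y : S1)) x := rfl

theorem sq_norm_toL2_solMap_le (ha : Continuous a) (hp : Function.Periodic a (2 * Real.pi))
    (v : L2S1) (s : ℝ) :
    ‖toL2 (solMap ha hp v)‖ ^ 2 ≤ (∫ x in s..(s + 2 * Real.pi), solKer a x) * ‖v‖ ^ 2 := by
  rw [sq_norm_toL2 _ s, ← intervalIntegral.integral_mul_const]
  refine intervalIntegral.integral_mono_on (le_add_two_pi s) ?_ ?_
    fun x _ => sq_norm_solFun_le ha v x
  · exact ((solFun_continuous ha (intervalIntegrable_lift v)).norm.pow 2).intervalIntegrable _ _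
  · exact ((solKer_continuous ha).mul continuous_const).intervalIntegrable _ _

/-- The solution operator of `φ' = a φ + v`. -/
def solOp (ha : Continuous a) (hp : Function.Periodic a (2 * Real.pi)) : L2S1 →L[ℂ] L2S1 :=
  LinearMap.mkContinuous
    { toFun := fun v => toL2 (solMap ha hp v)
      map_add' := fun u v => by
        rw [toL2, toL2, toL2, ← map_add]
        congr 1
        ext x
        obtain ⟨x, rfl⟩ := QuotientAddGroup.mk_surjective x
        exact solFun_add ha u v x
      map_smul' := fun c v => by
        rw [toL2, toL2, RingHom.id_apply, ← map_smul]
        congr 1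
        ext x
        obtain ⟨x, rfl⟩ := QuotientAddGroup.mk_surjective x
        exact solFun_smul c v x }
    (√(∫ x in (0 : ℝ)..(0 + 2 * Real.pi), solKer a x)) fun v => by
      have h1 := Real.le_sqrt_of_sq_le (sq_norm_toL2_solMap_le ha hp v 0)
      rw [Real.sqrt_mul' _ (sq_nonneg _), Real.sqrt_sq (norm_nonneg _)] at h1
      exact h1

theorem solOp_apply (ha : Continuous a) (hp : Function.Periodic a (2 * Real.pi)) (v : L2S1) :
    solOp ha hp v = toL2 (solMap ha hp v) := rfl

/-- Pointwise in `x`, evaluation of the solution is a functional of squared norm at most `solKer a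
x`. Applied to the combination of `p` and `q` with coefficients conjugate to its own values, it
yields Bessel's inequality for the orthogonal pair; integrating in `x` gives the claim. -/
theorem pairBound_solOp (ha : Continuous a) (hp : Function.Periodic a (2 * Real.pi)) (s : ℝ) :
    PairBound (solOp ha hp) (∫ x in s..(s + 2 * Real.pi), solKer a x) := by
  intro p q hpq
  have hc : ∀ v : L2S1, IntervalIntegrable
      (fun x => ‖solMap ha hp v (x : S1)‖ ^ 2) volume s (s + 2 * Real.pi) := fun v =>
    ((solFun_continuous ha (intervalIntegrable_lift v)).norm.pow 2).intervalIntegrable _ _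
  rw [solOp_apply, solOp_apply, sq_norm_toL2 _ s, sq_norm_toL2 _ s,
    ← intervalIntegral.integral_mul_const, ← intervalIntegral.integral_mul_const,
    ← intervalIntegral.integral_mul_const, ← intervalIntegral.integral_add
      ((hc p).mul_const _) ((hc q).mul_const _)]
  refine intervalIntegral.integral_mono_on (le_add_two_pi s)
    (((hc p).mul_const _).add ((hc q).mul_const _))
    (((solKer_continuous ha).mul continuous_const).intervalIntegrable _ _) fun x _ => ?_
  rw [solMap_coe, solMap_coe]
  set α := solFun a (fun y => p (y : S1)) x with hα
  set β := solFun a (fun y => q (y : S1)) x with hβ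
  set σ := ‖α‖ ^ 2 * ‖q‖ ^ 2 + ‖β‖ ^ 2 * ‖p‖ ^ 2 with hσ
  have h1 := sq_norm_solFun_le ha ((starRingEnd ℂ α * (‖q‖ ^ 2 : ℝ)) • p
    + (starRingEnd ℂ β * (‖p‖ ^ 2 : ℝ)) • q) x
  rw [solFun_add ha, solFun_smul, solFun_smul, ← hα, ← hβ] at h1
  have h2 : starRingEnd ℂ α * (‖q‖ ^ 2 : ℝ) * α + starRingEnd ℂ β * (‖p‖ ^ 2 : ℝ) * β
      = (σ : ℂ) := by
    have e1 := Complex.conj_mul' α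
    have e2 := Complex.conj_mul' β
    rw [hσ]
    push_cast
    linear_combination (‖q‖ ^ 2 : ℂ) * e1 + (‖p‖ ^ 2 : ℂ) * e2
  have h3 : ‖(starRingEnd ℂ α * (‖q‖ ^ 2 : ℝ)) • p + (starRingEnd ℂ β * (‖p‖ ^ 2 : ℝ)) • q‖ ^ 2
      = ‖p‖ ^ 2 * ‖q‖ ^ 2 * σ := by
    have h4 : inner ℂ ((starRingEnd ℂ α * (‖q‖ ^ 2 : ℝ)) • p)
        ((starRingEnd ℂ β * (‖p‖ ^ 2 : ℝ)) • q) = 0 := by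
      rw [inner_smul_left, inner_smul_right, hpq, mul_zero, mul_zero]
    have h5 := norm_add_sq_eq_norm_sq_add_norm_sq_of_inner_eq_zero _ _ h4
    rw [sq, h5]
    simp only [norm_smul, norm_mul, RCLike.norm_conj, Complex.norm_real, norm_pow, norm_norm]
    rw [hσ]
    ring
  have hσ0 : 0 ≤ σ := by positivity
  rw [h2, h3, Complex.norm_real, Real.norm_eq_abs, sq_abs] at h1
  rcases hσ0.eq_or_lt with h | h
  · rw [← h]
    have : 0 ≤ solKer a x := by
      rw [solKer]
      refine mul_nonneg (by positivity) (mul_nonneg (Real.exp_pos _).le ?_)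
      exact intervalIntegral.integral_nonneg (le_add_two_pi x) fun y _ => (Real.exp_pos _).le
    positivity
  · nlinarith

theorem inner_toL2 (f : C(S1, ℂ)) (v : L2S1) :
    inner ℂ (toL2 f) v
      = ∫ x in (0 : ℝ)..(2 * Real.pi), v (x : S1) * starRingEnd ℂ (f (x : S1)) := by
  rw [inner_eq_integral _ _ 0, zero_add]
  refine intervalIntegral.integral_congr_ae_restrict ?_
  filter_upwards [ae_lift (coeFn_toL2 f)] with x hx
  rw [hx, mul_comm]

/-- Integration against a continuous periodic function is continuous. -/
theorem continuous_integral_mul {k : ℝ → ℂ} (hk : Continuous k)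
    (hkp : Function.Periodic k (2 * Real.pi)) :
    Continuous fun v : L2S1 => ∫ x in (0 : ℝ)..(2 * Real.pi), v (x : S1) * k x := by
  have hc : Continuous fun x => starRingEnd ℂ (k x) := Complex.continuous_conj.comp hk
  have hp : Function.Periodic (fun x => starRingEnd ℂ (k x)) (2 * Real.pi) := fun x => by
    simp only [hkp x]
  have h1 : (fun v : L2S1 => ∫ x in (0 : ℝ)..(2 * Real.pi), v (x : S1) * k x)
      = fun v => inner ℂ (toL2 (circleFun _ hc hp)) v := by
    ext v
    rw [inner_toL2]
    simp only [circleFun_coe, Complex.conj_conj]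
  rw [h1]
  exact (innerSL ℂ (toL2 (circleFun _ hc hp))).continuous

theorem integral_toL2_mul (f : C(S1, ℂ)) (k : ℝ → ℂ) :
    ∫ x in (0 : ℝ)..(2 * Real.pi), toL2 f (x : S1) * k x
      = ∫ x in (0 : ℝ)..(2 * Real.pi), f (x : S1) * k x := by
  refine intervalIntegral.integral_congr_ae_restrict ?_
  filter_upwards [ae_lift (coeFn_toL2 f)] with x hx
  rw [hx]

/-- `u' = a u + v` in the sense of distributions. -/
def WeakSol (a : ℝ → ℂ) (u v : L2S1) : Prop :=
  ∀ χ : ℝ → ℂ, ContDiff ℝ ∞ χ → Function.Periodic χ (2 * Real.pi) →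
    ∫ x in (0 : ℝ)..(2 * Real.pi), u (x : S1) * (deriv χ x + a x * χ x)
      = -∫ x in (0 : ℝ)..(2 * Real.pi), v (x : S1) * χ x

theorem periodic_deriv {χ : ℝ → ℂ} (hp : Function.Periodic χ (2 * Real.pi)) :
    Function.Periodic (deriv χ) (2 * Real.pi) := fun x => by
  rw [← deriv_comp_add_const]
  congr 1
  exact funext hp

/-- Both sides depend continuously on `v`, so continuous `v` suffice; the solution is then
classical, and the identity is an integration by parts over a period. -/
theorem weakSol_solOp (ha : Continuous a) (hp : Function.Periodic a (2 * Real.pi))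
    (hne : Complex.exp (-prim a (2 * Real.pi)) ≠ 1) (v : L2S1) : WeakSol a (solOp ha hp v) v := by
  intro χ hχ hχp
  have hχ' : Continuous (deriv χ) := hχ.continuous_deriv (by simp)
  have hk : Continuous fun x => deriv χ x + a x * χ x := hχ'.add (ha.mul hχ.continuous)
  have hkp : Function.Periodic (fun x => deriv χ x + a x * χ x) (2 * Real.pi) := fun x => by
    simp only [periodic_deriv hχp x, hp x, hχp x]
  have hcl : IsClosed {v : L2S1 | ∫ x in (0 : ℝ)..(2 * Real.pi),
      solOp ha hp v (x : S1) * (deriv χ x + a x * χ x)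
        = -∫ x in (0 : ℝ)..(2 * Real.pi), v (x : S1) * χ x} :=
    isClosed_eq ((continuous_integral_mul hk hkp).comp (solOp ha hp).continuous)
      (continuous_integral_mul hχ.continuous hχp).neg
  have hd : DenseRange toL2 := ContinuousMap.toLp_denseRange ℂ volume ℂ (by norm_num)
  refine (hd.induction_on (p := fun v : L2S1 => ∫ x in (0 : ℝ)..(2 * Real.pi),
      solOp ha hp v (x : S1) * (deriv χ x + a x * χ x)
        = -∫ x in (0 : ℝ)..(2 * Real.pi), v (x : S1) * χ x) v hcl fun f => ?_)
  have hfc : Continuous fun x : ℝ => f (x : S1) := f.continuous.comp continuous_quotient_mk'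
  rw [solOp_apply, integral_toL2_mul, integral_toL2_mul]
  have h1 : ∀ x : ℝ, solMap ha hp (toL2 f) (x : S1) = solFun a (fun y => f (y : S1)) x := fun x => by
    rw [solMap_coe, solFun, solFun, integral_congr_lift (coeFn_toL2 f)]
  simp only [h1]
  have h2 := solFun_hasDerivAt ha hp hfc (periodic_lift f) hne
  have hφ : Continuous (solFun a fun y => f (y : S1)) :=
    continuous_iff_continuousAt.2 fun x => (h2 x).continuousAt
  have h3 : ∀ x, HasDerivAt (fun x => solFun a (fun y => f (y : S1)) x * χ x)
      (solFun a (fun y => f (y : S1)) x * (deriv χ x + a x * χ x) + f (x : S1) * χ x) x :=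
    fun x => ((h2 x).mul (hχ.differentiable (by simp) x).hasDerivAt).congr_deriv (by ring)
  have hc1 : Continuous fun x => solFun a (fun y => f (y : S1)) x * (deriv χ x + a x * χ x) :=
    hφ.mul hk
  have hc2 : Continuous fun x : ℝ => f (x : S1) * χ x := hfc.mul hχ.continuous
  have h4 := intervalIntegral.integral_eq_sub_of_hasDerivAt (a := 0) (b := 2 * Real.pi)
    (fun x _ => h3 x) ((hc1.add hc2).intervalIntegrable _ _)
  rw [intervalIntegral.integral_add (hc1.intervalIntegrable _ _)
    (hc2.intervalIntegrable _ _)] at h4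
  have h5 : χ (2 * Real.pi) = χ 0 := by simpa using hχp 0
  have h6 : solFun a (fun y => f (y : S1)) (2 * Real.pi) = solFun a (fun y => f (y : S1)) 0 := by
    simpa using solFun_periodic ha hp (periodic_lift f) 0
  rw [h5, h6, sub_self] at h4
  exact eq_neg_of_add_eq_zero_left h4

theorem integral_sub_mul (u v : L2S1) (φ : ℝ → ℂ) (hφ : Continuous φ) :
    ∫ x in (0 : ℝ)..(2 * Real.pi), (u - v : L2S1) (x : S1) * φ x
      = (∫ x in (0 : ℝ)..(2 * Real.pi), u (x : S1) * φ x)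
        - ∫ x in (0 : ℝ)..(2 * Real.pi), v (x : S1) * φ x := by
  rw [← intervalIntegral.integral_sub (intervalIntegrable_mul u φ hφ)
    (intervalIntegrable_mul v φ hφ)]
  refine intervalIntegral.integral_congr_ae_restrict ?_
  filter_upwards [ae_lift (Lp.coeFn_sub u v)] with x hx
  rw [hx, Pi.sub_apply, sub_mul]

/-- A class orthogonal to all smooth functions vanishes. -/
theorem eq_zero_of_forall_integral {u : L2S1} (h : ∀ χ : ℝ → ℂ, ContDiff ℝ ∞ χ →
    Function.Periodic χ (2 * Real.pi) → ∫ x in (0 : ℝ)..(2 * Real.pi), u (x : S1) * χ x = 0) :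
    u = 0 := by
  refine HasWeakDeriv.eq_zero fun χ hχ hχp => ?_
  rw [h χ hχ hχp, neg_zero]
  have h3 := integral_smul_mul 0 0 (deriv χ)
  rwa [zero_smul, zero_mul] at h3

/-- By duality: every smooth `θ` is of the form `χ' + a χ` with `χ` smooth and periodic, obtained by
solving the transposed equation with coefficient `-a`. -/
theorem WeakSol.unique (ha : ContDiff ℝ ∞ a) (hp : Function.Periodic a (2 * Real.pi))
    (hne : Complex.exp (-prim a (2 * Real.pi)) ≠ 1) {u u' v : L2S1} (h : WeakSol a u v)
    (h' : WeakSol a u' v) : u = u' := by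
  rw [← sub_eq_zero]
  refine eq_zero_of_forall_integral fun θ hθ hθp => ?_
  have ha' : ContDiff ℝ ∞ fun x => -a x := ha.neg
  have hp' : Function.Periodic (fun x => -a x) (2 * Real.pi) := fun x => by simp only [hp x]
  have hne' : Complex.exp (-prim (fun x => -a x) (2 * Real.pi)) ≠ 1 := fun hh => by
    rw [prim_neg, neg_neg] at hh
    rw [Complex.exp_neg, hh, inv_one] at hne
    exact hne rfl
  have hs := solFun_contDiff ha' hp' hθ hθp hne'
  have hsp := solFun_periodic ha'.continuous hp' hθp
  have h1 := h _ hs hsp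
  have h2 := h' _ hs hsp
  have h3 : ∀ x, deriv (solFun (fun x => -a x) θ) x + a x * solFun (fun x => -a x) θ x = θ x :=
    fun x => by
      rw [(solFun_hasDerivAt ha'.continuous hp' hθ.continuous hθp hne' x).deriv]
      ring
  simp only [h3] at h1 h2
  rw [integral_sub_mul _ _ _ hθ.continuous, h1, h2, sub_self]

end SolOp

/-! ### The resolvent of `P_h` -/

section Resolvent

variable {g : S1 → ℂ} {h : ℝ} {z : ℂ}

theorem opPsub_apply_iff (g : S1 → ℂ) (h : ℝ) (z : ℂ) (u v : L2S1) :
    (∃ hu : u ∈ (opPsub g h z).domain, opPsub g h z ⟨u, hu⟩ = v) ↔ (u, v + z • u) ∈ graphP g h := by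
  have h1 : (opP g h).graph = graphP g h := Submodule.toLinearPMap_graph_eq _ (graphP_single g h)
  rw [← h1, LinearPMap.mem_graph_iff]
  constructor
  · rintro ⟨hu, rfl⟩
    refine ⟨⟨u, hu⟩, rfl, ?_⟩
    change opP g h ⟨u, hu⟩ = -(z • u) + opP g h ⟨u, hu⟩ + z • u
    abel
  · rintro ⟨⟨u', hu'⟩, rfl, h2⟩
    refine ⟨hu', ?_⟩
    change -(z • u') + opP g h ⟨u', hu'⟩ = v
    rw [h2]
    simp only
    abel

/-- The coefficient of the equation `(P_h - z) u = v` in the form `u' = a u + (i/h) v`. -/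
def resCoeff (g : S1 → ℂ) (h : ℝ) (z : ℂ) (x : ℝ) : ℂ := Complex.I / h * (z - g (x : S1))

theorem resCoeff_periodic (g : S1 → ℂ) (h : ℝ) (z : ℂ) :
    Function.Periodic (resCoeff g h z) (2 * Real.pi) :=
  periodic_lift fun x => Complex.I / h * (z - g x)

theorem resCoeff_contDiff (hg : ContDiff ℝ ∞ fun x : ℝ => g (x : S1)) (h : ℝ) (z : ℂ) :
    ContDiff ℝ ∞ (resCoeff g h z) :=
  contDiff_const.mul (contDiff_const.sub hg)

theorem exists_mul_L2 (hg : Continuous g) (u : L2S1) :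
    ∃ w : L2S1, ∀ᵐ x : S1, w x = g x * u x := by
  obtain ⟨C, hC⟩ := isCompact_univ.exists_bound_of_continuousOn hg.continuousOn
  have h1 : MemLp (fun x => g x * u x) 2 (volume : Measure S1) := by
    refine (Lp.memLp u).of_le_mul (c := C)
      (hg.aestronglyMeasurable.mul (Lp.memLp u).1) (Eventually.of_forall fun x => ?_)
    rw [norm_mul]
    exact mul_le_mul_of_nonneg_right (hC x (mem_univ x)) (norm_nonneg _)
  exact ⟨h1.toLp, h1.coeFn_toLp⟩

theorem opPsub_iff_weakSol (hg : ContDiff ℝ ∞ fun x : ℝ => g (x : S1)) (h0 : h ≠ 0) (u v : L2S1) :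
    (∃ hu : u ∈ (opPsub g h z).domain, opPsub g h z ⟨u, hu⟩ = v) ↔
      WeakSol (resCoeff g h z) u ((Complex.I / h) • v) := by
  have h0' : (h : ℂ) ≠ 0 := Complex.ofReal_ne_zero.2 h0
  have hgc := hg.continuous
  rw [opPsub_apply_iff]
  have key : ∀ w : L2S1, (∀ᵐ x : S1, w x = Complex.I / h * (v x + z * u x - g x * u x)) →
      (HasWeakDeriv u w ↔ WeakSol (resCoeff g h z) u ((Complex.I / h) • v)) := by
    intro w hw
    refine forall_congr' fun χ => forall_congr' fun hχ => forall_congr' fun hχp => ?_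
    have hχ' : Continuous (deriv χ) := hχ.continuous_deriv (by simp)
    have ha : Continuous fun x => resCoeff g h z x * χ x :=
      (resCoeff_contDiff hg h z).continuous.mul hχ.continuous
    have e1 : ∫ x in (0 : ℝ)..(2 * Real.pi), u (x : S1) * (deriv χ x + resCoeff g h z x * χ x)
        = (∫ x in (0 : ℝ)..(2 * Real.pi), u (x : S1) * deriv χ x)
          + ∫ x in (0 : ℝ)..(2 * Real.pi), u (x : S1) * (resCoeff g h z x * χ x) := by
      rw [← intervalIntegral.integral_add (intervalIntegrable_mul u _ hχ')
        (intervalIntegrable_mul u _ ha)]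
      simp only [mul_add]
    have e2 : ∫ x in (0 : ℝ)..(2 * Real.pi), w (x : S1) * χ x
        = (∫ x in (0 : ℝ)..(2 * Real.pi), ((Complex.I / h) • v : L2S1) (x : S1) * χ x)
          + ∫ x in (0 : ℝ)..(2 * Real.pi), u (x : S1) * (resCoeff g h z x * χ x) := by
      rw [← intervalIntegral.integral_add (intervalIntegrable_mul _ _ hχ.continuous)
        (intervalIntegrable_mul u _ ha)]
      refine intervalIntegral.integral_congr_ae_restrict ?_
      filter_upwards [ae_lift hw, ae_lift (Lp.coeFn_smul (Complex.I / h) v)] with x h1 h2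
      rw [h1, h2, Pi.smul_apply, smul_eq_mul, resCoeff]
      ring
    rw [e1, e2, neg_add, eq_add_neg_iff_add_eq]
  constructor
  · rintro ⟨w, hw, hw'⟩
    refine (key w ?_).1 hw
    filter_upwards [hw', Lp.coeFn_add v (z • u), Lp.coeFn_smul z u] with x h1 h2 h3
    rw [h2, Pi.add_apply, h3, Pi.smul_apply, smul_eq_mul] at h1
    rw [h1]
    field_simp
    ring_nf
  · intro hw
    obtain ⟨q, hq⟩ := exists_mul_L2 (continuous_of_lift hgc) u
    have hw2 : ∀ᵐ x : S1, ((Complex.I / h : ℂ) • (v + z • u - q) : L2S1) x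
        = Complex.I / h * (v x + z * u x - g x * u x) := by
      filter_upwards [hq, Lp.coeFn_smul (Complex.I / h : ℂ) (v + z • u - q),
        Lp.coeFn_sub (v + z • u) q, Lp.coeFn_add v (z • u), Lp.coeFn_smul z u] with x h1 h2 h3 h4 h5
      rw [h2, Pi.smul_apply, h3, Pi.sub_apply, h4, Pi.add_apply, h5, Pi.smul_apply, h1]
      rfl
    refine ⟨_, (key _ hw2).2 hw, ?_⟩
    filter_upwards [hw2, Lp.coeFn_add v (z • u), Lp.coeFn_smul z u] with x h1 h2 h3
    rw [h1, h2, Pi.add_apply, h3, Pi.smul_apply, smul_eq_mul]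
    field_simp
    ring_nf

theorem smooth_mem_domain (hg : ContDiff ℝ ∞ fun x : ℝ => g (x : S1)) {φ : ℝ → ℂ}
    (hφ : ContDiff ℝ ∞ φ) (hp : Function.Periodic φ (2 * Real.pi)) :
    toL2 (circleFun φ hφ.continuous hp) ∈ (opPsub g h z).domain := by
  have hφ' : Continuous (deriv φ) := hφ.continuous_deriv (by simp)
  set u := toL2 (circleFun φ hφ.continuous hp) with hu
  set v := toL2 (circleFun (deriv φ) hφ' (periodic_deriv hp)) with hv
  have h1 : HasWeakDeriv u v := by
    intro χ hχ hχp
    have hχ' : Continuous (deriv χ) := hχ.continuous_deriv (by simp)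
    rw [hu, hv, integral_toL2_mul, integral_toL2_mul]
    simp only [circleFun_coe]
    have h4 := intervalIntegral.integral_mul_deriv_eq_deriv_mul (a := 0) (b := 2 * Real.pi)
      (u := φ) (v := χ) (u' := deriv φ) (v' := deriv χ)
      (fun x _ => (hφ.differentiable (by simp) x).hasDerivAt)
      (fun x _ => (hχ.differentiable (by simp) x).hasDerivAt)
      (hφ'.intervalIntegrable _ _) (hχ'.intervalIntegrable _ _)
    have h5 : χ (2 * Real.pi) = χ 0 := by simpa using hχp 0
    have h6 : φ (2 * Real.pi) = φ 0 := by simpa using hp 0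
    rw [h4, h5, h6, sub_self, zero_sub]
  obtain ⟨q, hq⟩ := exists_mul_L2 (continuous_of_lift hg.continuous) u
  have h2 : (u, ((h / Complex.I : ℂ) • v + q - z • u) + z • u) ∈ graphP g h := by
    refine ⟨v, h1, ?_⟩
    rw [sub_add_cancel]
    filter_upwards [hq, Lp.coeFn_add ((h / Complex.I : ℂ) • v) q,
      Lp.coeFn_smul (h / Complex.I : ℂ) v] with x e1 e2 e3
    rw [e2, Pi.add_apply, e3, Pi.smul_apply, e1]
    rfl
  exact ((opPsub_apply_iff g h z _ _).2 h2).1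

theorem dense_domain (hg : ContDiff ℝ ∞ fun x : ℝ => g (x : S1)) :
    Dense ((opPsub g h z).domain : Set L2S1) := by
  rw [Submodule.dense_iff_topologicalClosure_eq_top, Submodule.topologicalClosure_eq_top_iff,
    Submodule.eq_bot_iff]
  intro w hw
  refine eq_zero_of_forall_integral fun χ hχ hχp => ?_
  have hc : ContDiff ℝ ∞ fun x => starRingEnd ℂ (χ x) := Complex.conjCLE.contDiff.comp hχ
  have hp : Function.Periodic (fun x => starRingEnd ℂ (χ x)) (2 * Real.pi) := fun x => by
    simp only [hχp x]
  have h1 := (Submodule.mem_orthogonal _ _).1 hw _ (smooth_mem_domain (h := h) (z := z) hg hc hp)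
  rw [inner_toL2] at h1
  simpa only [circleFun_coe, Complex.conj_conj] using h1

/-- The resolvent `(P_h - z)⁻¹`. -/
def resOp (hg : ContDiff ℝ ∞ fun x : ℝ => g (x : S1)) (h : ℝ) (z : ℂ) : L2S1 →L[ℂ] L2S1 :=
  (Complex.I / h : ℂ) • solOp (resCoeff_contDiff hg h z).continuous (resCoeff_periodic g h z)

theorem isResolvent_resOp (hg : ContDiff ℝ ∞ fun x : ℝ => g (x : S1)) (h0 : h ≠ 0)
    (hne : Complex.exp (-prim (resCoeff g h z) (2 * Real.pi)) ≠ 1) :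
    IsResolvent (opPsub g h z) (resOp hg h z) where
  dense := dense_domain hg
  iff u v := by
    rw [opPsub_iff_weakSol hg h0]
    have h1 := weakSol_solOp (resCoeff_contDiff hg h z).continuous (resCoeff_periodic g h z) hne
      ((Complex.I / h : ℂ) • v)
    rw [map_smul] at h1
    exact ⟨fun h2 => h2.unique (resCoeff_contDiff hg h z) (resCoeff_periodic g h z) hne h1,
      fun h2 => h2 ▸ h1⟩

end Resolvent

/-! ### Holomorphy of the resolvent from the resolvent identity. -/

section Holomorphy

variable {g : S1 → ℂ} {h : ℝ}

theorem IsResolvent.identity {z w : ℂ} {R R' : L2S1 →L[ℂ] L2S1}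
    (hR : IsResolvent (opPsub g h z) R) (hR' : IsResolvent (opPsub g h w) R') :
    R' - R = (w - z) • (R * R') := by
  have key : ∀ v, R' v = R v + (w - z) • R (R' v) := fun v => by
    have h1 := (opPsub_apply_iff g h w _ _).1 ((hR'.iff (R' v) v).2 rfl)
    have h3 : v + w • R' v = v + (w - z) • R' v + z • R' v := by
      rw [sub_smul]
      abel
    rw [h3] at h1
    have h2 := (hR.iff _ _).1 ((opPsub_apply_iff g h z _ _).2 h1)
    rwa [map_add, map_smul] at h2
  refine ContinuousLinearMap.ext fun v => ?_
  rw [sub_apply, smul_apply, mul_apply_eq_comp, sub_eq_iff_eq_add']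
  exact key v

/-- A family satisfying the resolvent identity near `z` is holomorphic there. -/
theorem hasDerivAt_of_resolvent {R : ℂ → L2S1 →L[ℂ] L2S1} {z : ℂ}
    (hR : ∀ᶠ w in 𝓝 z, R w - R z = (w - z) • (R z * R w)) : HasDerivAt R (R z * R z) z := by
  set s := ‖R z‖ with hs
  -- The identity alone bounds `R` near `z`: once `‖w - z‖ ‖R(z)‖ < 1/2`, the term with `R(w)` on
  -- the right can be absorbed. Continuity and the derivative follow from it.
  have h1 : ∀ᶠ w in 𝓝 z, ‖R w‖ ≤ 2 * s := by
    have h2 : ∀ᶠ w in 𝓝 z, ‖w - z‖ * s < 1 / 2 := by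
      have : Tendsto (fun w : ℂ => ‖w - z‖ * s) (𝓝 z) (𝓝 (‖z - z‖ * s)) :=
        ((continuous_id.sub continuous_const).norm.mul continuous_const).tendsto z
      rw [sub_self, norm_zero, zero_mul] at this
      exact this.eventually (gt_mem_nhds (by norm_num))
    filter_upwards [hR, h2] with w hw hw2
    have h3 : ‖R w‖ ≤ s + ‖w - z‖ * (s * ‖R w‖) := by
      have h4 : R w = R z + (w - z) • (R z * R w) := by rw [← hw]; abel
      calc ‖R w‖ = ‖R z + (w - z) • (R z * R w)‖ := by rw [← h4]
        _ ≤ ‖R z‖ + ‖(w - z) • (R z * R w)‖ := norm_add_le _ _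
        _ ≤ _ := by
          rw [norm_smul]
          gcongr
          exact norm_mul_le _ _
    nlinarith [norm_nonneg (R w)]
  have hc : ContinuousAt R z := by
    rw [ContinuousAt, tendsto_iff_norm_sub_tendsto_zero]
    have h4 : Tendsto (fun w : ℂ => ‖w - z‖ * (s * (2 * s))) (𝓝 z) (𝓝 0) := by
      have : Tendsto (fun w : ℂ => ‖w - z‖ * (s * (2 * s))) (𝓝 z) (𝓝 (‖z - z‖ * (s * (2 * s)))) :=
        ((continuous_id.sub continuous_const).norm.mul continuous_const).tendsto z
      simpa using this
    refine tendsto_of_tendsto_of_tendsto_of_le_of_le' tendsto_const_nhds h4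
      (Eventually.of_forall fun w => norm_nonneg _) ?_
    filter_upwards [hR, h1] with w hw hw1
    rw [hw, norm_smul]
    gcongr
    exact (norm_mul_le _ _).trans (mul_le_mul_of_nonneg_left hw1 (norm_nonneg _))
  rw [hasDerivAt_iff_tendsto_slope]
  have h5 : Tendsto (fun w => R z * R w) (𝓝[≠] z) (𝓝 (R z * R z)) :=
    ((continuousAt_const.mul hc).tendsto).mono_left nhdsWithin_le_nhds
  refine h5.congr' ?_
  filter_upwards [hR.filter_mono nhdsWithin_le_nhds, self_mem_nhdsWithin] with w hw hw'
  rw [slope_def_module, hw, smul_smul, inv_mul_cancel₀ (sub_ne_zero.2 hw'), one_smul]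

end Holomorphy

/-! ### A lower bound for the norm from a test function. -/

section LowerBound

variable {a : ℝ → ℂ}

/-- The test function is the conjugate of `e^{-prim a}` on `(α, β)` and zero on the rest of the
period. For `x` in `(β - 2π, α)` the window `(x, x + 2π)` contains `(α, β)` exactly once, so the
solution is an explicit multiple of `e^{prim a x}` there: this is the rank one block of the kernel.
-/
theorem norm_solOp_sq_ge (ha : Continuous a) (hp : Function.Periodic a (2 * Real.pi)) {α β : ℝ}
    (h1 : β - 2 * Real.pi ≤ α) (h2 : α < β) :
    ‖(Complex.exp (-prim a (2 * Real.pi)) - 1)⁻¹‖ ^ 2 *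
      ((∫ x in (β - 2 * Real.pi)..α, Real.exp (2 * (prim a x).re))
        * ∫ y in α..β, Real.exp (-(2 * (prim a y).re))) ≤ ‖solOp ha hp‖ ^ 2 := by
  set s := β - 2 * Real.pi with hs
  have hsβ : s + 2 * Real.pi = β := by rw [hs]; ring
  set F : ℝ → ℂ := fun x => if α < x then starRingEnd ℂ (Complex.exp (-prim a x)) else 0 with hF
  have hcc : Continuous fun x => starRingEnd ℂ (Complex.exp (-prim a x)) :=
    Complex.continuous_conj.comp (exp_prim_continuous ha)
  have hFm : Measurable F := Measurable.ite measurableSet_Ioi hcc.measurable measurable_const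
  set q : S1 → ℂ := fun θ => F (AddCircle.measurableEquivIoc (2 * Real.pi) s θ : ℝ) with hq
  have hqm : Measurable q :=
    hFm.comp (measurable_subtype_coe.comp (AddCircle.measurableEquivIoc (2 * Real.pi) s).measurable)
  have hqF : ∀ x ∈ Ioc s (s + 2 * Real.pi), q (x : S1) = F x := fun x hx => by
    simp only [hq]
    congr 1
    exact AddCircle.equivIoc_coe_of_mem hx
  obtain ⟨C, hC⟩ := (isCompact_Icc (a := s) (b := s + 2 * Real.pi)).exists_bound_of_continuousOn
    hcc.continuousOn
  have hC0 : 0 ≤ C := (norm_nonneg _).trans (hC s ⟨le_rfl, le_add_two_pi s⟩)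
  have hqL : MemLp q 2 (volume : Measure S1) := by
    refine MemLp.of_bound hqm.aestronglyMeasurable C (Eventually.of_forall fun θ => ?_)
    have hm := (AddCircle.measurableEquivIoc (2 * Real.pi) s θ).2
    simp only [hq, hF]
    split_ifs
    · exact hC _ (Ioc_subset_Icc_self hm)
    · simpa using hC0
  set v : L2S1 := hqL.toLp with hv
  have hvq : (v : S1 → ℂ) =ᵐ[volume] q := hqL.coeFn_toLp
  set Y := ∫ y in α..β, Real.exp (-(2 * (prim a y).re)) with hY
  have hexpc : Continuous fun y => Real.exp (-(2 * (prim a y).re)) := by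
    simp only [← neg_mul]
    exact exp_re_prim_continuous ha (-2)
  have hY0 : 0 < Y :=
    intervalIntegral.intervalIntegral_pos_of_pos (hexpc.intervalIntegrable _ _)
      (fun _ => Real.exp_pos _) h2
  have hFz : ∀ x ≤ α, F x = 0 := fun x hx => if_neg (not_lt.2 hx)
  have hFn : ∀ x, α < x → ‖F x‖ ^ 2 = Real.exp (-(2 * (prim a x).re)) := fun x hx => by
    simp only [hF, if_pos hx, RCLike.norm_conj, sq_norm_cexp, Complex.neg_re, mul_neg]
  have hqi : ∀ u w : ℝ, IntervalIntegrable (fun x : ℝ => q (x : S1)) volume u w := by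
    intro u w
    refine (periodic_lift q).intervalIntegrable Real.two_pi_pos.ne' (t := 0) ?_ u w
    rw [intervalIntegrable_iff_integrableOn_Ioc_of_le (le_add_two_pi 0)]
    exact (hqL.comp_measurePreserving
      (AddCircle.measurePreserving_mk (2 * Real.pi) 0)).integrable (by norm_num)
  have hvn : ‖v‖ ^ 2 = Y := by
    rw [sq_norm_eq_integral v s]
    have e1 : ∫ x in s..(s + 2 * Real.pi), ‖v (x : S1)‖ ^ 2
        = ∫ x in s..(s + 2 * Real.pi), ‖F x‖ ^ 2 := by
      refine intervalIntegral.integral_congr_ae_restrict ?_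
      rw [Set.uIoc_of_le (le_add_two_pi s)]
      filter_upwards [ae_lift_Ioc hvq s, ae_restrict_mem measurableSet_Ioc] with x hx hx'
      rw [hx, hqF x hx']
    have e2 : ∀ x ∈ uIoc s α, ‖F x‖ ^ 2 = 0 := fun x hx => by
      rw [Set.uIoc_of_le h1] at hx
      rw [hFz x hx.2]
      simp
    have e3 : ∀ x ∈ uIoc α β, ‖F x‖ ^ 2 = Real.exp (-(2 * (prim a x).re)) := fun x hx => by
      rw [Set.uIoc_of_le h2.le] at hx
      exact hFn x hx.1
    have i1 : IntervalIntegrable (fun x => ‖F x‖ ^ 2) volume s α :=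
      (intervalIntegrable_const (c := (0 : ℝ))).congr fun x hx => (e2 x hx).symm
    have i2 : IntervalIntegrable (fun x => ‖F x‖ ^ 2) volume α β :=
      (hexpc.intervalIntegrable _ _).congr fun x hx => (e3 x hx).symm
    rw [e1, hsβ, ← intervalIntegral.integral_add_adjacent_intervals i1 i2,
      intervalIntegral.integral_congr_ae (g := fun _ => (0 : ℝ)) (ae_of_all _ e2),
      intervalIntegral.integral_congr_ae (ae_of_all _ e3)]
    simp [hY]
  set c := (Complex.exp (-prim a (2 * Real.pi)) - 1)⁻¹ with hc
  have hsol : ∀ x ∈ Icc s α, solFun a (fun y => v (y : S1)) x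
      = c * (Complex.exp (prim a x) * (Y : ℂ)) := by
    intro x hx
    rw [solFun, ← hc, integral_congr_lift hvq x]
    congr 2
    have hi : ∀ u w : ℝ, IntervalIntegrable
        (fun y : ℝ => Complex.exp (-prim a y) * q (y : S1)) volume u w := fun u w =>
      (hqi u w).continuousOn_mul (exp_prim_continuous ha).continuousOn
    have e1 : ∀ y ∈ uIoc x α, Complex.exp (-prim a y) * q (y : S1) = 0 := fun y hy => by
      rw [Set.uIoc_of_le hx.2] at hy
      rw [hqF y ⟨hx.1.trans_lt hy.1, by linarith [hy.2]⟩, hFz y hy.2, mul_zero]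
    have e2 : ∀ y ∈ uIoc α β, Complex.exp (-prim a y) * q (y : S1)
        = ((Real.exp (-(2 * (prim a y).re)) : ℝ) : ℂ) := fun y hy => by
      rw [Set.uIoc_of_le h2.le] at hy
      rw [hqF y ⟨h1.trans_lt hy.1, by linarith [hy.2]⟩]
      simp only [hF, if_pos hy.1]
      rw [Complex.mul_conj', ← Complex.ofReal_pow, sq_norm_cexp, Complex.neg_re, mul_neg]
    have hxβ : β ≤ x + 2 * Real.pi := by linarith [hx.1]
    have e3 : ∀ y ∈ uIoc β (x + 2 * Real.pi), Complex.exp (-prim a y) * q (y : S1) = 0 := fun y hy => by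
      rw [Set.uIoc_of_le hxβ] at hy
      have e4 : q (y : S1) = q ((y - 2 * Real.pi : ℝ) : S1) := by
        have := periodic_lift q (y - 2 * Real.pi)
        simp only [sub_add_cancel] at this
        exact this
      rw [e4, hqF _ ⟨by linarith [hy.1], by linarith [hy.2, hx.2]⟩,
        hFz _ (by linarith [hy.2, hx.2]), mul_zero]
    rw [← intervalIntegral.integral_add_adjacent_intervals (hi x β) (hi β _),
      ← intervalIntegral.integral_add_adjacent_intervals (hi x α) (hi α β),
      intervalIntegral.integral_congr_ae (g := fun _ => (0 : ℂ)) (ae_of_all _ e1),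
      intervalIntegral.integral_congr_ae (g := fun _ => (0 : ℂ)) (ae_of_all _ e3),
      intervalIntegral.integral_congr_ae (ae_of_all _ e2), intervalIntegral.integral_ofReal, ← hY]
    simp
  have hge : ‖c‖ ^ 2 * ((∫ x in s..α, Real.exp (2 * (prim a x).re)) * Y) * Y
      ≤ ‖solOp ha hp v‖ ^ 2 := by
    have hφc : Continuous fun x : ℝ => ‖solMap ha hp v (x : S1)‖ ^ 2 :=
      (solFun_continuous ha (intervalIntegrable_lift v)).norm.pow 2
    rw [solOp_apply, sq_norm_toL2 _ s]
    calc _ = ∫ x in s..α, ‖c‖ ^ 2 * Real.exp (2 * (prim a x).re) * Y ^ 2 := by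
          rw [intervalIntegral.integral_mul_const, intervalIntegral.integral_const_mul]
          ring
      _ = ∫ x in s..α, ‖solMap ha hp v (x : S1)‖ ^ 2 := by
          refine intervalIntegral.integral_congr fun x hx => ?_
          rw [Set.uIcc_of_le h1] at hx
          rw [solMap_coe, hsol x hx, norm_mul, norm_mul, mul_pow, mul_pow, sq_norm_cexp,
            Complex.norm_real, Real.norm_eq_abs, sq_abs]
          ring
      _ ≤ _ := intervalIntegral.integral_mono_interval le_rfl h1 (by linarith)
          (Eventually.of_forall fun x => by positivity) (hφc.intervalIntegrable _ _)
  have hle := PairBound.sq_norm_apply_le (solOp ha hp) v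
  rw [hvn] at hle
  exact le_of_mul_le_mul_right (hge.trans hle) hY0

end LowerBound

/-! ### The kernel in terms of the potential -/

/-- The real phase `(2/h) ∫ₐˣ (t - f)`. -/
def phase (f : ℝ → ℝ) (a h t x : ℝ) : ℝ := 2 / h * ∫ y in a..x, (t - f y)

section Kernel

variable {g : S1 → ℂ} {h : ℝ} {z : ℂ}

theorem imLift_periodic (g : S1 → ℂ) : Function.Periodic (imLift g) (2 * Real.pi) :=
  periodic_lift fun x => (g x).im

theorem imLift_contDiff (hg : ContDiff ℝ ∞ fun x : ℝ => g (x : S1)) : ContDiff ℝ ∞ (imLift g) :=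
  Complex.imCLM.contDiff.comp hg

theorem re_prim_resCoeff (hg : ContDiff ℝ ∞ fun x : ℝ => g (x : S1)) (h : ℝ) (z : ℂ) (x : ℝ) :
    2 * (prim (resCoeff g h z) x).re = -(2 / h * ∫ y in (0 : ℝ)..x, (z.im - imLift g y)) := by
  have hc := (resCoeff_contDiff hg h z).continuous
  have h1 : (prim (resCoeff g h z) x).re = ∫ y in (0 : ℝ)..x, (resCoeff g h z y).re :=
    (Complex.reCLM.intervalIntegral_comp_comm (hc.intervalIntegrable 0 x)).symm
  rw [h1, ← intervalIntegral.integral_const_mul, ← intervalIntegral.integral_const_mul,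
    ← intervalIntegral.integral_neg]
  refine intervalIntegral.integral_congr fun y _ => ?_
  simp only [resCoeff, imLift]
  rw [div_mul_eq_mul_div, Complex.div_ofReal_re, Complex.I_mul_re, Complex.sub_im]
  ring

theorem re_prim_eq_phase (hg : ContDiff ℝ ∞ fun x : ℝ => g (x : S1)) (h : ℝ) (z : ℂ) (a x : ℝ) :
    2 * (prim (resCoeff g h z) x).re
      = -phase (imLift g) a h z.im x + 2 * (prim (resCoeff g h z) a).re := by
  have hc : Continuous fun y => z.im - imLift g y :=
    continuous_const.sub (imLift_contDiff hg).continuous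
  have h1 := intervalIntegral.integral_add_adjacent_intervals (hc.intervalIntegrable (μ := volume) 0 a)
    (hc.intervalIntegrable a x)
  rw [re_prim_resCoeff hg, re_prim_resCoeff hg, phase, ← h1]
  ring

theorem solKer_eq_phase (hg : ContDiff ℝ ∞ fun x : ℝ => g (x : S1)) (h : ℝ) (z : ℂ) (a x : ℝ) :
    solKer (resCoeff g h z) x = ‖(Complex.exp (-prim (resCoeff g h z) (2 * Real.pi)) - 1)⁻¹‖ ^ 2 *
      (Real.exp (-phase (imLift g) a h z.im x)
        * ∫ y in x..(x + 2 * Real.pi), Real.exp (phase (imLift g) a h z.im y)) := by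
  rw [solKer]
  congr 1
  rw [← intervalIntegral.integral_const_mul, ← intervalIntegral.integral_const_mul]
  refine intervalIntegral.integral_congr fun y _ => ?_
  rw [← Real.exp_add, ← Real.exp_add, re_prim_eq_phase hg h z a x, re_prim_eq_phase hg h z a y]
  congr 1
  ring

/-- The multiplier over a period is exponentially small below the mean of `Im g`, and of modulus one
exactly at the mean, where the resolvent may fail to exist. This is why `Im z` is kept away from the
mean. -/
theorem norm_exp_prim_period (hg : ContDiff ℝ ∞ fun x : ℝ => g (x : S1)) (h : ℝ) (z : ℂ) :
    ‖Complex.exp (-prim (resCoeff g h z) (2 * Real.pi))‖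
      = Real.exp (-(2 * Real.pi / h * (meanIm g - z.im))) := by
  have hi := (imLift_contDiff hg).continuous.intervalIntegrable (μ := volume) 0 (2 * Real.pi)
  have h1 := re_prim_resCoeff hg h z (2 * Real.pi)
  rw [intervalIntegral.integral_sub (by simp) hi, intervalIntegral.integral_const] at h1
  rw [Complex.norm_exp, Complex.neg_re]
  congr 1
  have hpi := Real.two_pi_pos.ne'
  have h2 : ∫ y in (0 : ℝ)..(2 * Real.pi), imLift g y = 2 * Real.pi * meanIm g := by
    rw [meanIm, ← mul_assoc, mul_inv_cancel₀ hpi, one_mul]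
  rw [h2, sub_zero, smul_eq_mul] at h1
  have h3 : (prim (resCoeff g h z) (2 * Real.pi)).re
      = -(1 / h * (2 * Real.pi * z.im - 2 * Real.pi * meanIm g)) := by
    linear_combination h1 / 2
  rw [h3]
  ring

theorem exp_prim_period_ne_one (hg : ContDiff ℝ ∞ fun x : ℝ => g (x : S1)) (h0 : h ≠ 0)
    (hz : z.im ≠ meanIm g) : Complex.exp (-prim (resCoeff g h z) (2 * Real.pi)) ≠ 1 := by
  intro h1
  have h2 := norm_exp_prim_period hg h z
  rw [h1, norm_one, eq_comm, Real.exp_eq_one_iff, neg_eq_zero, mul_eq_zero, sub_eq_zero] at h2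
  rcases h2 with h2 | h2
  · exact div_ne_zero Real.two_pi_pos.ne' h0 h2
  · exact hz h2.symm

theorem hasDerivAt_resOp (hg : ContDiff ℝ ∞ fun x : ℝ => g (x : S1)) (h0 : h ≠ 0)
    (hz : z.im ≠ meanIm g) :
    HasDerivAt (fun w => resOp hg h w) (resOp hg h z * resOp hg h z) z := by
  refine hasDerivAt_of_resolvent (R := fun w => resOp hg h w) ?_
  have h1 : ∀ᶠ w : ℂ in 𝓝 z, w.im ≠ meanIm g :=
    Complex.continuous_im.continuousAt.eventually_ne hz
  filter_upwards [h1] with w hw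
  exact (isResolvent_resOp hg h0 (exp_prim_period_ne_one hg h0 hz)).identity
    (isResolvent_resOp hg h0 (exp_prim_period_ne_one hg h0 hw))

end Kernel

/-! ### The two half wells of the potential -/

/-- The potential to the right of its minimum. -/
def wellRight (f : ℝ → ℝ) (a s : ℝ) : ℝ := f (a + s) - f a

/-- The potential to the left of its minimum. -/
def wellLeft (f : ℝ → ℝ) (a s : ℝ) : ℝ := f (a - s) - f a

theorem forall_deriv_pos_or_neg {f : ℝ → ℝ} (hf : ContDiff ℝ ∞ f) {u v : ℝ}
    (hne : ∀ x ∈ Ioo u v, deriv f x ≠ 0) :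
    (∀ x ∈ Ioo u v, 0 < deriv f x) ∨ ∀ x ∈ Ioo u v, deriv f x < 0 := by
  by_contra! hcon
  obtain ⟨⟨x, hx, hx'⟩, y, hy, hy'⟩ := hcon
  have hc : ContinuousOn (deriv f) (Ioo u v) := (hf.continuous_deriv (by simp)).continuousOn
  obtain ⟨w, hw, hw'⟩ := (isPreconnected_Ioo (a := u) (b := v)).intermediate_value hx hy hc
    ⟨hx', hy'⟩
  exact hne w hw hw'

namespace IsPotential

variable {g : S1 → ℂ} {a b : ℝ}

theorem contDiff (hg : IsPotential g a b) : ContDiff ℝ ∞ (imLift g) := imLift_contDiff hg.smooth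

theorem continuous (hg : IsPotential g a b) : Continuous (imLift g) := hg.contDiff.continuous

theorem hasDerivAt (hg : IsPotential g a b) (x : ℝ) :
    HasDerivAt (imLift g) (deriv (imLift g) x) x :=
  (hg.contDiff.differentiable (by simp) x).hasDerivAt

theorem deriv_pos (hg : IsPotential g a b) : ∀ x ∈ Ioo a b, 0 < deriv (imLift g) x := by
  have hab := hg.lt_ab
  have hba := hg.lt_ba
  have hne : ∀ x ∈ Ioo a b, deriv (imLift g) x ≠ 0 := by
    intro x hx h0
    have hxm : x ∈ Ico a (a + 2 * Real.pi) := ⟨hx.1.le, hx.2.trans hba⟩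
    rcases (hg.critical_iff x).1 h0 with h1 | h1
    · rw [AddCircle.coe_eq_coe_iff_of_mem_Ico hxm ⟨le_rfl, by linarith⟩] at h1
      exact hx.1.ne' h1
    · rw [AddCircle.coe_eq_coe_iff_of_mem_Ico hxm ⟨hab.le, hba⟩] at h1
      exact hx.2.ne h1
  rcases forall_deriv_pos_or_neg hg.contDiff hne with h | h
  · exact h
  · have h1 := strictAntiOn_of_deriv_neg (convex_Icc a b) hg.continuous.continuousOn
      (by simpa using h)
    exact absurd (h1 ⟨le_rfl, hab.le⟩ ⟨hab.le, le_rfl⟩ hab) hg.min_lt_max.not_gt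

theorem imLift_sub_period (g : S1 → ℂ) (b : ℝ) :
    imLift g (b - 2 * Real.pi) = imLift g b := by
  have := imLift_periodic g (b - 2 * Real.pi)
  rw [sub_add_cancel] at this
  exact this.symm

theorem deriv_neg (hg : IsPotential g a b) :
    ∀ x ∈ Ioo (b - 2 * Real.pi) a, deriv (imLift g) x < 0 := by
  have hab := hg.lt_ab
  have hba := hg.lt_ba
  have hpi := Real.two_pi_pos
  have hb : ((b : ℝ) : S1) = ((b - 2 * Real.pi : ℝ) : S1) := by
    rw [← AddCircle.coe_add_period (2 * Real.pi) (b - 2 * Real.pi), sub_add_cancel]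
  have hne : ∀ x ∈ Ioo (b - 2 * Real.pi) a, deriv (imLift g) x ≠ 0 := by
    intro x hx h0
    have hxm : x ∈ Ico (b - 2 * Real.pi) (b - 2 * Real.pi + 2 * Real.pi) :=
      ⟨hx.1.le, by linarith [hx.2]⟩
    rcases (hg.critical_iff x).1 h0 with h1 | h1
    · rw [AddCircle.coe_eq_coe_iff_of_mem_Ico hxm ⟨by linarith, by linarith⟩] at h1
      exact hx.2.ne h1
    · rw [hb, AddCircle.coe_eq_coe_iff_of_mem_Ico hxm ⟨le_rfl, by linarith⟩] at h1
      exact hx.1.ne' h1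
  rcases forall_deriv_pos_or_neg hg.contDiff hne with h | h
  · have h1 := strictMonoOn_of_deriv_pos (convex_Icc (b - 2 * Real.pi) a)
      hg.continuous.continuousOn (by simpa using h)
    have h2 := h1 ⟨le_rfl, by linarith⟩ ⟨by linarith, le_rfl⟩ (by linarith : b - 2 * Real.pi < a)
    rw [imLift_sub_period] at h2
    exact absurd h2 hg.min_lt_max.not_gt
  · exact h

theorem deriv_min (hg : IsPotential g a b) : deriv (imLift g) a = 0 :=
  (hg.critical_iff a).2 (Or.inl rfl)

theorem deriv2_min_pos (hg : IsPotential g a b) : 0 < deriv (deriv (imLift g)) a := by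
  have h2 : ContDiff ℝ ∞ (deriv (imLift g)) :=
    ((contDiff_infty_iff_deriv (𝕜 := ℝ)).1 hg.contDiff).2
  have hd := (h2.differentiable (by simp) a).hasDerivAt
  refine lt_of_le_of_ne ?_ hg.nondegenerate_min.symm
  have h3 := hd.tendsto_slope.mono_left
    (nhdsWithin_mono a (fun x (hx : x ∈ Ioi a) => (ne_of_gt hx : x ≠ a)))
  refine ge_of_tendsto h3 ?_
  filter_upwards [Ioo_mem_nhdsGT hg.lt_ab] with x hx
  rw [slope_def_field, hg.deriv_min, sub_zero]
  exact div_nonneg (hg.deriv_pos x hx).le (by linarith [hx.1])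

theorem halfWell_right (hg : IsPotential g a b) : HalfWell (wellRight (imLift g) a) (b - a) := by
  have hd : deriv (wellRight (imLift g) a) = fun s => deriv (imLift g) (a + s) := by
    ext s
    exact (((hg.hasDerivAt (a + s)).comp_const_add a s).sub_const _).deriv
  refine ⟨?_, sub_pos.2 hg.lt_ab, by simp [wellRight], by rw [hd]; simpa using hg.deriv_min,
    fun s hs => ?_, ?_⟩
  · exact (hg.contDiff.comp (contDiff_const.add contDiff_id)).sub contDiff_const
  · rw [hd]
    exact hg.deriv_pos _ ⟨by linarith [hs.1], by linarith [hs.2]⟩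
  · rw [hd, deriv_comp_const_add, add_zero]
    exact hg.deriv2_min_pos

theorem halfWell_left (hg : IsPotential g a b) :
    HalfWell (wellLeft (imLift g) a) (a - b + 2 * Real.pi) := by
  have hd : deriv (wellLeft (imLift g) a) = fun s => -deriv (imLift g) (a - s) := by
    ext s
    exact (((hg.hasDerivAt (a - s)).comp_const_sub a s).sub_const _).deriv
  refine ⟨?_, by linarith [hg.lt_ba], by simp [wellLeft], by rw [hd]; simpa using hg.deriv_min,
    fun s hs => ?_, ?_⟩
  · exact (hg.contDiff.comp (contDiff_const.sub contDiff_id)).sub contDiff_const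
  · rw [hd]
    have := hg.deriv_neg (a - s) ⟨by linarith [hs.2], by linarith [hs.1]⟩
    simpa using this
  · rw [hd, deriv.fun_neg, deriv_comp_const_sub, neg_neg, sub_zero]
    exact hg.deriv2_min_pos

theorem wellRight_end (a b : ℝ) : wellRight (imLift g) a (b - a) = imLift g b - imLift g a := by
  rw [wellRight, add_sub_cancel]

theorem wellLeft_end (a b : ℝ) :
    wellLeft (imLift g) a (a - b + 2 * Real.pi) = imLift g b - imLift g a := by
  rw [wellLeft, show a - (a - b + 2 * Real.pi) = b - 2 * Real.pi by ring]
  have := imLift_periodic g (b - 2 * Real.pi)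
  rw [sub_add_cancel] at this
  rw [this]

theorem mem_Icc (hg : IsPotential g a b) (x : ℝ) : imLift g x ∈ Icc (imLift g a) (imLift g b) := by
  have hR := hg.halfWell_right
  have hL := hg.halfWell_left
  obtain ⟨y, hy, hxy⟩ := (imLift_periodic g).exists_mem_Ico Real.two_pi_pos x (b - 2 * Real.pi)
  rw [hxy]
  rcases le_total a y with h | h
  · have e1 := hR.strictMonoOn.monotoneOn (a := 0) (b := y - a) ⟨le_rfl, hR.pos.le⟩
      ⟨by linarith, by linarith [hy.2]⟩ (by linarith)
    have e2 := hR.strictMonoOn.monotoneOn (a := y - a) (b := b - a)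
      ⟨by linarith, by linarith [hy.2]⟩ ⟨hR.pos.le, le_rfl⟩ (by linarith [hy.2])
    rw [wellRight_end] at e2
    simp only [wellRight, add_sub_cancel, add_zero] at e1 e2
    exact ⟨by linarith, by linarith⟩
  · have e1 := hL.strictMonoOn.monotoneOn (a := 0) (b := a - y) ⟨le_rfl, hL.pos.le⟩
      ⟨by linarith, by linarith [hy.1]⟩ (by linarith)
    have e2 := hL.strictMonoOn.monotoneOn (a := a - y) (b := a - b + 2 * Real.pi)
      ⟨by linarith, by linarith [hy.1]⟩ ⟨hL.pos.le, le_rfl⟩ (by linarith [hy.1])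
    rw [wellLeft_end] at e2
    simp only [wellLeft, sub_sub_cancel, sub_zero] at e1 e2
    exact ⟨by linarith, by linarith⟩

end IsPotential

/-- The area of a half well below the level `δ`. -/
theorem HalfWell.integral_posPart {φ : ℝ → ℝ} {ℓ δ : ℝ} (hW : HalfWell φ ℓ) (hδ : 0 < δ)
    (hδ1 : δ < φ ℓ) : ∫ s in (0 : ℝ)..ℓ, max (δ - φ s) 0 = wellP φ ℓ δ := by
  obtain ⟨hX, hφX⟩ := hW.wellX_spec hδ hδ1
  have hc : Continuous fun s => max (δ - φ s) 0 :=
    (continuous_const.sub hW.smooth.continuous).max continuous_const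
  have hm := hW.strictMonoOn.monotoneOn
  rw [wellP]
  set X := wellX φ ℓ δ
  rw [← intervalIntegral.integral_add_adjacent_intervals (hc.intervalIntegrable 0 X)
    (hc.intervalIntegrable X ℓ)]
  have e1 : ∫ s in (0 : ℝ)..X, max (δ - φ s) 0 = ∫ s in (0 : ℝ)..X, (δ - φ s) := by
    refine intervalIntegral.integral_congr fun s hs => ?_
    rw [uIcc_of_le hX.1.le] at hs
    have := hm ⟨hs.1, hs.2.trans hX.2.le⟩ (Ioo_subset_Icc_self hX) hs.2
    exact max_eq_left (by linarith)
  have e2 : ∫ s in X..ℓ, max (δ - φ s) 0 = ∫ s in X..ℓ, (0 : ℝ) := by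
    refine intervalIntegral.integral_congr fun s hs => ?_
    rw [uIcc_of_le hX.2.le] at hs
    have := hm (Ioo_subset_Icc_self hX) ⟨hX.1.le.trans hs.1, hs.2⟩ hs.1
    exact max_eq_right (by linarith)
  rw [e1, e2, intervalIntegral.integral_sub (by simp)
    (hW.smooth.continuous.intervalIntegrable _ _)]
  simp
  ring

/-! ### The Hilbert–Schmidt norm of the kernel -/

section Phase

variable {f : ℝ → ℝ} {a b h t : ℝ}

theorem phase_right (hf : Continuous f) (s : ℝ) :
    phase f a h t (a + s) = 2 / h * ((t - f a) * s - ∫ y in (0 : ℝ)..s, wellRight f a y) := by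
  rw [phase]
  congr 1
  have h1 : ∫ y in a..(a + s), (t - f y) = ∫ y in (0 : ℝ)..s, (t - f (a + y)) := by
    rw [intervalIntegral.integral_comp_add_left (fun y => t - f y) a, add_zero]
  have hc : Continuous fun y => wellRight f a y := by unfold wellRight; fun_prop
  rw [h1]
  have h2 : ∀ y, t - f (a + y) = (t - f a) - wellRight f a y := fun y => by
    rw [wellRight]; ring
  simp only [h2]
  rw [intervalIntegral.integral_sub (by simp) (hc.intervalIntegrable _ _)]
  simp
  ring

theorem phase_left (hf : Continuous f) (s : ℝ) :
    phase f a h t (a - s) = -(2 / h * ((t - f a) * s - ∫ y in (0 : ℝ)..s, wellLeft f a y)) := by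
  rw [phase, ← mul_neg]
  congr 1
  have h1 : ∫ y in a..(a - s), (t - f y) = -∫ y in (0 : ℝ)..s, (t - f (a - y)) := by
    rw [intervalIntegral.integral_comp_sub_left (fun y => t - f y) a, sub_zero,
      intervalIntegral.integral_symm]
  have hc : Continuous fun y => wellLeft f a y := by unfold wellLeft; fun_prop
  rw [h1]
  have h2 : ∀ y, t - f (a - y) = (t - f a) - wellLeft f a y := fun y => by
    rw [wellLeft]; ring
  simp only [h2]
  rw [intervalIntegral.integral_sub (by simp) (hc.intervalIntegrable _ _)]
  simp
  ring

theorem phase_continuous (hf : Continuous f) (a h t : ℝ) : Continuous (phase f a h t) :=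
  continuous_const.mul (intervalIntegral.continuous_primitive
    (fun u v => (continuous_const.sub hf).intervalIntegrable u v) a)

theorem phase_sub (hf : Continuous f) (a h t x y : ℝ) :
    phase f a h t y - phase f a h t x = 2 / h * ∫ u in x..y, (t - f u) := by
  have hc : Continuous fun y => t - f y := continuous_const.sub hf
  rw [phase, phase, ← mul_sub, intervalIntegral.integral_interval_sub_left
    (hc.intervalIntegrable _ _) (hc.intervalIntegrable _ _)]

theorem integral_exp_phase_right (hf : Continuous f) :
    ∫ y in a..b, Real.exp (phase f a h t y) = wellZ (wellRight f a) (b - a) h (t - f a) := by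
  have h1 := intervalIntegral.integral_comp_add_left
    (fun y => Real.exp (phase f a h t y)) a (a := 0) (b := b - a)
  rw [add_zero, add_sub_cancel] at h1
  rw [← h1, wellZ]
  simp only [phase_right hf]

theorem integral_exp_phase_left (hf : Continuous f) :
    ∫ x in (b - 2 * Real.pi)..a, Real.exp (-phase f a h t x)
      = wellZ (wellLeft f a) (a - b + 2 * Real.pi) h (t - f a) := by
  have h1 := intervalIntegral.integral_comp_sub_left
    (fun y => Real.exp (-phase f a h t y)) a (a := 0) (b := a - b + 2 * Real.pi)
  rw [sub_zero, show a - (a - b + 2 * Real.pi) = b - 2 * Real.pi by ring] at h1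
  rw [← h1, wellZ]
  simp only [phase_left hf, neg_neg]

theorem double_right (hf : Continuous f) (hR : HalfWell (wellRight f a) (b - a)) :
    ∫ x in a..b, Real.exp (-phase f a h t x) * ∫ y in x..b, Real.exp (phase f a h t y)
      = ∫ x in (0 : ℝ)..(b - a), Real.exp (2 / h * wellPsi (wellRight f a) (b - a) (t - f a) x)
          * ∫ y in x..(b - a),
            Real.exp (-(2 / h * wellPsi (wellRight f a) (b - a) (t - f a) y)) := by
  have h1 := intervalIntegral.integral_comp_add_left
    (fun x => Real.exp (-phase f a h t x) * ∫ y in x..b, Real.exp (phase f a h t y)) a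
    (a := 0) (b := b - a)
  rw [add_zero, add_sub_cancel] at h1
  rw [← h1]
  refine intervalIntegral.integral_congr fun x _ => ?_
  have h2 := intervalIntegral.integral_comp_add_left
    (fun y => Real.exp (phase f a h t y)) a (a := x) (b := b - a)
  rw [add_sub_cancel] at h2
  rw [← h2, ← intervalIntegral.integral_const_mul, ← intervalIntegral.integral_const_mul]
  refine intervalIntegral.integral_congr fun y _ => ?_
  simp only [phase_right hf, hR.exponent_eq, ← Real.exp_add]
  congr 1
  ring

theorem double_left (hf : Continuous f) (hL : HalfWell (wellLeft f a) (a - b + 2 * Real.pi)) :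
    ∫ x in (b - 2 * Real.pi)..a, Real.exp (-phase f a h t x)
        * ∫ y in x..a, Real.exp (phase f a h t y)
      = ∫ x in (0 : ℝ)..(a - b + 2 * Real.pi),
          Real.exp (2 / h * wellPsi (wellLeft f a) (a - b + 2 * Real.pi) (t - f a) x)
          * ∫ y in x..(a - b + 2 * Real.pi),
            Real.exp (-(2 / h * wellPsi (wellLeft f a) (a - b + 2 * Real.pi) (t - f a) y)) := by
  rw [← hL.triangle_swap]
  have h1 := intervalIntegral.integral_comp_sub_left
    (fun x => Real.exp (-phase f a h t x) * ∫ y in x..a, Real.exp (phase f a h t y)) a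
    (a := 0) (b := a - b + 2 * Real.pi)
  rw [sub_zero, show a - (a - b + 2 * Real.pi) = b - 2 * Real.pi by ring] at h1
  rw [← h1]
  refine intervalIntegral.integral_congr fun x _ => ?_
  have h2 := intervalIntegral.integral_comp_sub_left
    (fun y => Real.exp (phase f a h t y)) a (a := 0) (b := x)
  rw [sub_zero] at h2
  rw [← h2, ← intervalIntegral.integral_const_mul, ← intervalIntegral.integral_const_mul]
  refine intervalIntegral.integral_congr fun y _ => ?_
  simp only [phase_left hf, hL.exponent_eq, ← Real.exp_add]
  congr 1
  ring

theorem integral_posPart_period (hL : HalfWell (wellLeft f a) (a - b + 2 * Real.pi))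
    (hR : HalfWell (wellRight f a) (b - a)) (hf : Continuous f) (h0 : 0 < t - f a)
    (h1 : t - f a < wellLeft f a (a - b + 2 * Real.pi)) (h2 : t - f a < wellRight f a (b - a)) :
    ∫ x in (b - 2 * Real.pi)..b, max (t - f x) 0
      = wellP (wellLeft f a) (a - b + 2 * Real.pi) (t - f a)
        + wellP (wellRight f a) (b - a) (t - f a) := by
  have hc : Continuous fun s => max (t - f s) 0 := (continuous_const.sub hf).max continuous_const
  rw [← hL.integral_posPart h0 h1, ← hR.integral_posPart h0 h2,
    ← intervalIntegral.integral_add_adjacent_intervals (hc.intervalIntegrable (b - 2 * Real.pi) a)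
      (hc.intervalIntegrable a b)]
  congr 1
  · have h3 := intervalIntegral.integral_comp_sub_left
      (fun x => max (t - f x) 0) a (a := 0) (b := a - b + 2 * Real.pi)
    rw [sub_zero, show a - (a - b + 2 * Real.pi) = b - 2 * Real.pi by ring] at h3
    rw [← h3]
    refine intervalIntegral.integral_congr fun x _ => ?_
    simp only [wellLeft]
    congr 1
    ring
  · have h3 := intervalIntegral.integral_comp_add_left
      (fun x => max (t - f x) 0) a (a := 0) (b := b - a)
    rw [add_zero, add_sub_cancel] at h3
    rw [← h3]
    refine intervalIntegral.integral_congr fun x _ => ?_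
    simp only [wellRight]
    congr 1
    ring

/-- Across the maximum the kernel is small. -/
theorem integral_across_le (hf : Continuous f) (hp : Function.Periodic f (2 * Real.pi)) {c r S : ℝ}
    (hc : 0 < c) (hr : 0 < r) (hfb : ∀ x ∈ Icc (b - r) (b + r), t + c ≤ f x)
    (hS : ∫ x in (b - 2 * Real.pi)..b, max (t - f x) 0 ≤ S) {x y : ℝ}
    (hx : x ∈ Icc (b - 2 * Real.pi) b) (hy : y ∈ Icc b (x + 2 * Real.pi)) :
    ∫ u in x..y, (t - f u) ≤ -(c * (y - b)) ∨ ∫ u in x..y, (t - f u) ≤ S - c * r := by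
  have hc1 : Continuous fun s => t - f s := continuous_const.sub hf
  have hc2 : Continuous fun s => max (t - f s) 0 := hc1.max continuous_const
  have hpp : Function.Periodic (fun s => max (t - f s) 0) (2 * Real.pi) := fun s => by
    simp only [hp s]
  have hpos : ∀ u v : ℝ, u ≤ v → ∫ s in u..v, (t - f s) ≤ ∫ s in u..v, max (t - f s) 0 :=
    fun u v huv => intervalIntegral.integral_mono_on huv (hc1.intervalIntegrable _ _)
      (hc2.intervalIntegrable _ _) fun s _ => le_max_left _ _
  have hnn : ∀ u v : ℝ, u ≤ v → 0 ≤ ∫ s in u..v, max (t - f s) 0 := fun u v huv =>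
    intervalIntegral.integral_nonneg huv fun s _ => le_max_right _ _
  have hneg : ∀ u v : ℝ, b - r ≤ u → u ≤ v → v ≤ b + r → ∫ s in u..v, (t - f s) ≤ -(c * (v - u)) := by
    intro u v h1 h2 h3
    have := intervalIntegral.integral_mono_on (g := fun _ => -c) h2
      (hc1.intervalIntegrable (μ := volume) _ _)
      (continuous_const.intervalIntegrable _ _) fun s hs => by
        have := hfb s ⟨h1.trans hs.1, hs.2.trans h3⟩
        linarith
    refine this.trans_eq ?_
    rw [intervalIntegral.integral_const, smul_eq_mul]
    ring
  have hadd : ∀ u v w : ℝ, ∫ s in u..w, (t - f s) = (∫ s in u..v, (t - f s)) + ∫ s in v..w, (t - f s) :=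
    fun u v w => (intervalIntegral.integral_add_adjacent_intervals (hc1.intervalIntegrable _ _)
      (hc1.intervalIntegrable _ _)).symm
  have hadd' : ∀ u v w : ℝ, ∫ s in u..w, max (t - f s) 0
      = (∫ s in u..v, max (t - f s) 0) + ∫ s in v..w, max (t - f s) 0 :=
    fun u v w => (intervalIntegral.integral_add_adjacent_intervals (hc2.intervalIntegrable _ _)
      (hc2.intervalIntegrable _ _)).symm
  have htot : ∫ s in x..y, max (t - f s) 0 ≤ S := by
    have e1 := hpp.intervalIntegral_add_eq x (b - 2 * Real.pi)
    rw [sub_add_cancel] at e1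
    have e2 := hadd' x y (x + 2 * Real.pi)
    have e3 := hnn y _ hy.2
    linarith
  -- Either the path from `x` to `y` stays within `r` of the maximum, where `t - f ≤ -c`, or it
  -- crosses a whole interval of length `r` on one side of it, which subtracts `c r` from the total
  -- positive area.
  rcases le_or_gt y (b + r) with h1 | h1
  · rcases le_or_gt (b - r) x with h2 | h2
    · left
      refine (hneg x y h2 (hx.2.trans hy.1) h1).trans ?_
      have : c * (y - b) ≤ c * (y - x) := mul_le_mul_of_nonneg_left (by linarith [hx.2]) hc.le
      linarith
    · right
      have e1 := hadd x (b - r) y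
      have e2 := hadd (b - r) b y
      have e3 := hneg (b - r) b le_rfl (by linarith) (by linarith)
      have e4 := hpos x (b - r) h2.le
      have e5 := hpos b y hy.1
      have e6 := hadd' x (b - r) y
      have e7 := hadd' (b - r) b y
      have e8 := hnn (b - r) b (by linarith)
      have e9 : c * (b - (b - r)) = c * r := by ring
      linarith
  · right
    have e1 := hadd x b y
    have e2 := hadd b (b + r) y
    have e3 := hneg b (b + r) (by linarith) (by linarith) le_rfl
    have e4 := hpos x b hx.2
    have e5 := hpos (b + r) y h1.le
    have e6 := hadd' x b y
    have e7 := hadd' b (b + r) y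
    have e8 := hnn b (b + r) (by linarith)
    have e9 : c * (b + r - b) = c * r := by ring
    linarith

theorem integral_exp_neg_mul_le {k : ℝ} (hk : 0 < k) (u v : ℝ) :
    ∫ y in u..v, Real.exp (-(k * (y - u))) ≤ k⁻¹ := by
  have h1 : ∀ y, HasDerivAt (fun y => -(k⁻¹ * Real.exp (-(k * (y - u)))))
      (Real.exp (-(k * (y - u)))) y := fun y => by
    have h2 : HasDerivAt (fun y => -(k * (y - u))) (-(k * 1)) y :=
      (((hasDerivAt_id y).sub_const u).const_mul k).neg
    refine (h2.exp.const_mul k⁻¹).neg.congr_deriv ?_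
    field_simp
  rw [intervalIntegral.integral_eq_sub_of_hasDerivAt (fun y _ => h1 y)
    ((by fun_prop : Continuous fun y => Real.exp (-(k * (y - u)))).intervalIntegrable _ _)]
  simp only [sub_self, mul_zero, neg_zero, Real.exp_zero, mul_one]
  have : 0 ≤ k⁻¹ * Real.exp (-(k * (v - u))) := by positivity
  linarith

/-- The domain `x < y < x + 2π` over one period in `x` splits into the rectangle `x < a < y < b`,
which is the rank one main term, the two triangles inside one half well, and the pairs with `y`
beyond the maximum `b`, controlled by `integral_across_le`. -/
theorem double_period_le (hf : Continuous f) (hp : Function.Periodic f (2 * Real.pi)) (hh : 0 < h)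
    (hab : a ≤ b) (hba : b - 2 * Real.pi ≤ a) {c r S : ℝ}
    (hc : 0 < c) (hr : 0 < r) (hfb : ∀ x ∈ Icc (b - r) (b + r), t + c ≤ f x)
    (hS : ∫ x in (b - 2 * Real.pi)..b, max (t - f x) 0 ≤ S) :
    ∫ x in (b - 2 * Real.pi)..b, Real.exp (-phase f a h t x)
        * ∫ y in x..(x + 2 * Real.pi), Real.exp (phase f a h t y)
      ≤ (∫ x in (b - 2 * Real.pi)..a, Real.exp (-phase f a h t x))
          * (∫ y in a..b, Real.exp (phase f a h t y))
        + (∫ x in (b - 2 * Real.pi)..a, Real.exp (-phase f a h t x)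
            * ∫ y in x..a, Real.exp (phase f a h t y))
        + (∫ x in a..b, Real.exp (-phase f a h t x) * ∫ y in x..b, Real.exp (phase f a h t y))
        + 2 * Real.pi * ((2 * c / h)⁻¹ + 2 * Real.pi * Real.exp (2 / h * (S - c * r))) := by
  have hG := phase_continuous hf a h t
  set G := phase f a h t with hGdef
  have c1 : Continuous fun x => Real.exp (-G x) := by fun_prop
  have c2 : Continuous fun x => Real.exp (G x) := by fun_prop
  have i2 : ∀ u v, IntervalIntegrable (fun x => Real.exp (G x)) volume u v := fun u v =>
    c2.intervalIntegrable u v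
  have cl : ∀ v, Continuous fun x => ∫ y in x..v, Real.exp (G y) := fun v => by
    have h1 : (fun x => ∫ y in x..v, Real.exp (G y)) = fun x => -∫ y in v..x, Real.exp (G y) := by
      ext x
      rw [intervalIntegral.integral_symm]
    rw [h1]
    exact (intervalIntegral.continuous_primitive i2 v).neg
  have cr : Continuous fun x => ∫ y in b..(x + 2 * Real.pi), Real.exp (G y) :=
    (intervalIntegral.continuous_primitive i2 b).comp (continuous_id.add continuous_const)
  have d1 : ∀ v, Continuous fun x => Real.exp (-G x) * ∫ y in x..v, Real.exp (G y) := fun v =>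
    c1.mul (cl v)
  have d2 : Continuous fun x => Real.exp (-G x) * ∫ y in b..(x + 2 * Real.pi), Real.exp (G y) :=
    c1.mul cr
  have hsplit : ∀ x, Real.exp (-G x) * ∫ y in x..(x + 2 * Real.pi), Real.exp (G y)
      = Real.exp (-G x) * (∫ y in x..b, Real.exp (G y))
        + Real.exp (-G x) * ∫ y in b..(x + 2 * Real.pi), Real.exp (G y) := fun x => by
    rw [← mul_add, intervalIntegral.integral_add_adjacent_intervals (i2 _ _) (i2 _ _)]
  simp only [hsplit]
  rw [intervalIntegral.integral_add ((d1 b).intervalIntegrable _ _) (d2.intervalIntegrable _ _),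
    ← intervalIntegral.integral_add_adjacent_intervals ((d1 b).intervalIntegrable _ a)
      ((d1 b).intervalIntegrable a b)]
  have hleft : ∫ x in (b - 2 * Real.pi)..a, Real.exp (-G x) * ∫ y in x..b, Real.exp (G y)
      = (∫ x in (b - 2 * Real.pi)..a, Real.exp (-G x) * ∫ y in x..a, Real.exp (G y))
        + (∫ x in (b - 2 * Real.pi)..a, Real.exp (-G x)) * ∫ y in a..b, Real.exp (G y) := by
    have c3 : Continuous fun x => Real.exp (-G x) * ∫ y in a..b, Real.exp (G y) :=
      c1.mul continuous_const
    rw [← intervalIntegral.integral_mul_const, ← intervalIntegral.integral_add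
      ((d1 a).intervalIntegrable _ _) (c3.intervalIntegrable _ _)]
    refine intervalIntegral.integral_congr fun x _ => ?_
    rw [← mul_add, intervalIntegral.integral_add_adjacent_intervals (i2 _ _) (i2 _ _)]
  rw [hleft]
  have hcross : ∫ x in (b - 2 * Real.pi)..b, Real.exp (-G x)
        * ∫ y in b..(x + 2 * Real.pi), Real.exp (G y)
      ≤ 2 * Real.pi * ((2 * c / h)⁻¹ + 2 * Real.pi * Real.exp (2 / h * (S - c * r))) := by
    have h1 : ∀ x ∈ Icc (b - 2 * Real.pi) b, Real.exp (-G x)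
        * ∫ y in b..(x + 2 * Real.pi), Real.exp (G y)
        ≤ (2 * c / h)⁻¹ + 2 * Real.pi * Real.exp (2 / h * (S - c * r)) := by
      intro x hx
      have hbx : b ≤ x + 2 * Real.pi := by linarith [hx.1]
      have hcE : Continuous fun y => Real.exp (-(2 * c / h * (y - b))) := by fun_prop
      rw [← intervalIntegral.integral_const_mul]
      calc ∫ y in b..(x + 2 * Real.pi), Real.exp (-G x) * Real.exp (G y)
          ≤ ∫ y in b..(x + 2 * Real.pi), (Real.exp (-(2 * c / h * (y - b)))
            + Real.exp (2 / h * (S - c * r))) := by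
            refine intervalIntegral.integral_mono_on hbx
              ((continuous_const.mul c2).intervalIntegrable _ _)
              ((hcE.add continuous_const).intervalIntegrable _ _) fun y hy => ?_
            rw [← Real.exp_add, neg_add_eq_sub, hGdef, phase_sub hf]
            rcases integral_across_le hf hp hc hr hfb hS hx hy with h2 | h2
            · refine le_add_of_le_of_nonneg (Real.exp_le_exp.2 ?_) (Real.exp_pos _).le
              calc 2 / h * ∫ u in x..y, (t - f u) ≤ 2 / h * -(c * (y - b)) :=
                    mul_le_mul_of_nonneg_left h2 (by positivity)
                _ = _ := by ring
            · refine le_add_of_nonneg_of_le (Real.exp_pos _).le (Real.exp_le_exp.2 ?_)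
              exact mul_le_mul_of_nonneg_left h2 (by positivity)
        _ ≤ _ := by
            rw [intervalIntegral.integral_add (hcE.intervalIntegrable _ _) (by simp)]
            refine add_le_add (integral_exp_neg_mul_le (by positivity) _ _) ?_
            rw [intervalIntegral.integral_const, smul_eq_mul]
            refine mul_le_mul_of_nonneg_right ?_ (Real.exp_pos _).le
            linarith [hx.2]
    have h2 := intervalIntegral.integral_mono_on (μ := volume) (a := b - 2 * Real.pi) (b := b)
      (by linarith [Real.two_pi_pos]) (d2.intervalIntegrable _ _)
      (continuous_const.intervalIntegrable _ _) h1
    rw [intervalIntegral.integral_const, smul_eq_mul, sub_sub_cancel] at h2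
    exact h2
  linarith

end Phase

/-! ### Asymptotics of the norm of the resolvent -/

theorem exists_exp_neg_div_le {k : ℝ} (hk : 0 < k) (N : ℕ) :
    ∃ C : ℝ, 0 < C ∧ ∀ x : ℝ, 0 < x → Real.exp (-(k / x)) ≤ C * x ^ N := by
  refine ⟨N.factorial / k ^ N, by positivity, fun x hx => ?_⟩
  have h1 := Real.pow_div_factorial_le_exp (k / x) (by positivity) N
  have h2 : 0 < (k / x) ^ N / N.factorial := by positivity
  rw [Real.exp_neg]
  calc (Real.exp (k / x))⁻¹ ≤ ((k / x) ^ N / N.factorial)⁻¹ := inv_anti₀ h2 h1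
    _ = _ := by
      rw [inv_div, div_pow]
      field_simp

theorem exists_inv_mul_exp_neg_div_le {k : ℝ} (hk : 0 < k) (N : ℕ) :
    ∃ C : ℝ, 0 < C ∧ ∀ x : ℝ, 0 < x → x⁻¹ * Real.exp (-(k / x)) ≤ C * x ^ N := by
  obtain ⟨C, hC, h⟩ := exists_exp_neg_div_le hk (N + 1)
  refine ⟨C, hC, fun x hx => ?_⟩
  calc x⁻¹ * Real.exp (-(k / x)) ≤ x⁻¹ * (C * x ^ (N + 1)) :=
        mul_le_mul_of_nonneg_left (h x hx) (by positivity)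
    _ = _ := by
      rw [pow_succ]
      field_simp

namespace HalfWell

variable {φ : ℝ → ℝ} {ℓ δ₁ c C : ℝ}

theorem exists_wellZ_ge (hW : HalfWell φ ℓ) (h1 : δ₁ < φ ℓ) (hb : WellBounds φ ℓ δ₁ c C) :
    ∃ η₀ ∈ Ioc (0 : ℝ) 1, ∃ b₀ : ℝ, 0 < b₀ ∧ ∀ δ ∈ Ioc 0 δ₁, ∀ h : ℝ, 0 < h → h ≤ η₀ * (δ * √δ) →
      |wellQuot φ ℓ h δ - 1| ≤ 1 / 2 ∧
        b₀ * √(h / √δ) * Real.exp (2 / h * wellP φ ℓ δ) ≤ wellZ φ ℓ h δ := by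
  have hC := hb.C_pos
  obtain ⟨B, hB⟩ := (hW.jets_wellQuot h1 hb
    (hp := fun i : {q : ℝ × ℝ // 0 < q.1 ∧ q.2 ∈ Ioc 0 δ₁ ∧ q.1 ≤ q.2 * √q.2} => i.1.1)
    (d := fun i => i.1.2) (fun i => i.2.1) (fun i => i.2.2.1) (fun i => i.2.2.2) 0).norm_le
  set B' := |B| + 1 with hB'
  have hB'0 : 1 ≤ B' := by rw [hB']; linarith [abs_nonneg B]
  -- The bound `η ≤ (2B')⁻²` makes the relative Laplace error `B √η` at most 1/2. The second
  -- constant is half the leading term with the slope replaced by its upper bound `C√δ`.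
  refine ⟨(2 * B')⁻¹ ^ 2, ⟨by positivity, ?_⟩, √Real.pi / (2 * √C), by positivity,
    fun δ hδ h hh hη => ?_⟩
  · exact pow_le_one₀ (by positivity) (inv_le_one_of_one_le₀ (by linarith))
  have hs := Real.sqrt_pos.2 hδ.1
  have hδs : 0 < δ * √δ := mul_pos hδ.1 hs
  have hη1 : (2 * B')⁻¹ ^ 2 ≤ 1 :=
    pow_le_one₀ (by positivity) (inv_le_one_of_one_le₀ (by linarith))
  have h2 := hB ⟨(h, δ), hh, hδ, hη.trans (by nlinarith)⟩
  simp only [Real.norm_eq_abs] at h2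
  have h3 : √(h / (δ * √δ)) ≤ (2 * B')⁻¹ := by
    rw [← Real.sqrt_sq (show 0 ≤ (2 * B')⁻¹ by positivity)]
    exact Real.sqrt_le_sqrt ((div_le_iff₀ hδs).2 hη)
  have h4 : |wellQuot φ ℓ h δ - 1| ≤ 1 / 2 := by
    refine h2.trans ?_
    calc B * √(h / (δ * √δ)) ≤ B' * (2 * B')⁻¹ := by
          refine mul_le_mul ?_ h3 (Real.sqrt_nonneg _) (by linarith)
          rw [hB']; linarith [le_abs_self B]
      _ = 1 / 2 := by field_simp
  refine ⟨h4, ?_⟩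
  have hα := hW.slope_pos hδ.1 (hδ.2.trans_lt h1)
  have hαC : HalfWell.slope φ ℓ δ ≤ C * √δ := hb.deriv_le δ hδ
  set α := HalfWell.slope φ ℓ δ with hαdef
  have h5 : 1 / 2 ≤ wellQuot φ ℓ h δ := by linarith [(abs_le.1 h4).1]
  rw [wellQuot, ← hαdef] at h5
  have hq : 0 < √(α / (Real.pi * h)) := Real.sqrt_pos.2 (by positivity)
  set E := Real.exp (2 / h * wellP φ ℓ δ) with hE
  have hE0 : 0 < E := Real.exp_pos _
  have h6 : Real.exp (-(2 / h * wellP φ ℓ δ)) = E⁻¹ := by rw [Real.exp_neg]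
  rw [h6] at h5
  have h7 : 1 / 2 * E ≤ wellZ φ ℓ h δ * √(α / (Real.pi * h)) := by
    calc 1 / 2 * E ≤ (wellZ φ ℓ h δ * E⁻¹ * √(α / (Real.pi * h))) * E :=
          mul_le_mul_of_nonneg_right h5 hE0.le
      _ = _ := by field_simp
  have h8 : √Real.pi / (2 * √C) * √(h / √δ) * √(α / (Real.pi * h)) ≤ 1 / 2 := by
    have e1 : √Real.pi / (2 * √C) * √(h / √δ) * √(α / (Real.pi * h))
        = 1 / 2 * √(α / (C * √δ)) := by
      rw [show √Real.pi / (2 * √C) * √(h / √δ) * √(α / (Real.pi * h))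
        = 1 / 2 * (√Real.pi / √C * √(h / √δ) * √(α / (Real.pi * h))) by ring,
        ← Real.sqrt_div' _ hC.le, ← Real.sqrt_mul (by positivity), ← Real.sqrt_mul (by positivity)]
      congr 2
      field_simp
    rw [e1]
    have e2 : √(α / (C * √δ)) ≤ 1 := by
      rw [← Real.sqrt_one]
      exact Real.sqrt_le_sqrt ((div_le_one (by positivity)).2 hαC)
    linarith
  refine le_of_mul_le_mul_right ?_ hq
  calc √Real.pi / (2 * √C) * √(h / √δ) * E * √(α / (Real.pi * h))
      = (√Real.pi / (2 * √C) * √(h / √δ) * √(α / (Real.pi * h))) * E := by ring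
    _ ≤ 1 / 2 * E := mul_le_mul_of_nonneg_right h8 hE0.le
    _ ≤ _ := h7

end HalfWell

theorem PairBound.smul {R : L2S1 →L[ℂ] L2S1} {Λ : ℝ} (hR : PairBound R Λ) (c : ℂ) :
    PairBound (c • R) (‖c‖ ^ 2 * Λ) := by
  intro p q hpq
  have h1 := hR p q hpq
  rw [smul_apply, smul_apply, norm_smul, norm_smul, mul_pow, mul_pow]
  have := mul_le_mul_of_nonneg_left h1 (sq_nonneg ‖c‖)
  linarith

section

variable {g : S1 → ℂ} {a b δ₁ : ℝ}

theorem IsPotential.meanIm_le (hg : IsPotential g a b) : meanIm g ≤ imLift g b := by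
  have h1 : ∫ y in (0 : ℝ)..(2 * Real.pi), imLift g y ≤ ∫ y in (0 : ℝ)..(2 * Real.pi), imLift g b :=
    intervalIntegral.integral_mono_on Real.two_pi_pos.le (hg.continuous.intervalIntegrable _ _)
      (by simp) fun x _ => (hg.mem_Icc x).2
  rw [intervalIntegral.integral_const, smul_eq_mul, sub_zero] at h1
  rw [meanIm, inv_mul_le_iff₀ Real.two_pi_pos]
  exact h1

/-- The product of the two Laplace integrals. -/
def wellZZ (f : ℝ → ℝ) (a b h δ : ℝ) : ℝ :=
  wellZ (wellLeft f a) (a - b + 2 * Real.pi) h δ * wellZ (wellRight f a) (b - a) h δ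

theorem norm_resOp_sq (hg : ContDiff ℝ ∞ fun x : ℝ => g (x : S1)) {h : ℝ} (hh : 0 < h) (z : ℂ) :
    ‖resOp hg h z‖ ^ 2 * h ^ 2
      = ‖solOp (resCoeff_contDiff hg h z).continuous (resCoeff_periodic g h z)‖ ^ 2 := by
  rw [resOp, norm_smul, norm_div, Complex.norm_I, Complex.norm_real, Real.norm_eq_abs,
    abs_of_pos hh]
  field_simp

theorem solKer_integral_ge (hg : IsPotential g a b) {h : ℝ} (z : ℂ) :
    ‖(Complex.exp (-prim (resCoeff g h z) (2 * Real.pi)) - 1)⁻¹‖ ^ 2 *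
      wellZZ (imLift g) a b h (z.im - imLift g a)
      ≤ ‖solOp (resCoeff_contDiff hg.smooth h z).continuous (resCoeff_periodic g h z)‖ ^ 2 := by
  have h1 := norm_solOp_sq_ge (resCoeff_contDiff hg.smooth h z).continuous
    (resCoeff_periodic g h z) (α := a) (β := b) (by linarith [hg.lt_ba]) hg.lt_ab
  refine le_of_eq_of_le ?_ h1
  congr 1
  rw [wellZZ, ← integral_exp_phase_left hg.continuous, ← integral_exp_phase_right hg.continuous]
  obtain ⟨k, hk⟩ : ∃ k, ∀ x, 2 * (prim (resCoeff g h z) x).re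
      = -phase (imLift g) a h z.im x + k := ⟨_, re_prim_eq_phase hg.smooth h z a⟩
  simp only [hk, Real.exp_add, neg_add, neg_neg, intervalIntegral.integral_mul_const]
  have e1 : Real.exp k * Real.exp (-k) = 1 := by
    rw [← Real.exp_add, add_neg_cancel, Real.exp_zero]
  linear_combination (-(∫ x in (b - 2 * Real.pi)..a, Real.exp (-phase (imLift g) a h z.im x))
    * ∫ y in a..b, Real.exp (phase (imLift g) a h z.im y)) * e1

theorem norm_solOp_sq_le (hg : IsPotential g a b) {h : ℝ} (z : ℂ) :
    ‖solOp (resCoeff_contDiff hg.smooth h z).continuous (resCoeff_periodic g h z)‖ ^ 2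
      ≤ ∫ x in (b - 2 * Real.pi)..b, solKer (resCoeff g h z) x := by
  have hc := (resCoeff_contDiff hg.smooth h z).continuous
  have h0 : 0 ≤ ∫ x in (b - 2 * Real.pi)..b, solKer (resCoeff g h z) x := by
    refine intervalIntegral.integral_nonneg (by linarith [Real.two_pi_pos]) fun x _ => ?_
    rw [solKer]
    refine mul_nonneg (by positivity) (mul_nonneg (Real.exp_pos _).le ?_)
    exact intervalIntegral.integral_nonneg (le_add_two_pi x) fun y _ => (Real.exp_pos _).le
  rw [← Real.sqrt_le_sqrt_iff h0, Real.sqrt_sq (norm_nonneg _)]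
  refine ContinuousLinearMap.opNorm_le_bound _ (Real.sqrt_nonneg _) fun v => ?_
  have h1 := Real.le_sqrt_of_sq_le (sq_norm_toL2_solMap_le hc (resCoeff_periodic g h z) v
    (b - 2 * Real.pi))
  rwa [Real.sqrt_mul' _ (sq_nonneg _), Real.sqrt_sq (norm_nonneg _), sub_add_cancel] at h1

/-- The relative size of the terms of the Hilbert–Schmidt norm away from the two wells. -/
theorem exists_double_le (hg : IsPotential g a b) (h0 : 0 < δ₁) (h1 : δ₁ < imLift g b - imLift g a) :
    ∃ η₀ ∈ Ioc (0 : ℝ) 1, ∀ N : ℕ, ∃ C : ℝ, 0 < C ∧ ∀ t h : ℝ, t - imLift g a ∈ Ioc 0 δ₁ → 0 < h →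
      h ≤ η₀ * ((t - imLift g a) * √(t - imLift g a)) →
      0 < wellZZ (imLift g) a b h (t - imLift g a) ∧
      ∫ x in (b - 2 * Real.pi)..b, Real.exp (-phase (imLift g) a h t x)
        * ∫ y in x..(x + 2 * Real.pi), Real.exp (phase (imLift g) a h t y)
      ≤ wellZZ (imLift g) a b h (t - imLift g a)
        * (1 + C * (h / ((t - imLift g a) * √(t - imLift g a))) ^ N) := by
  set f := imLift g with hf
  have hL := hg.halfWell_left
  have hR := hg.halfWell_right
  rw [← hf] at hL hR
  have hfc : Continuous f := hg.continuous
  have hLe : δ₁ < wellLeft f a (a - b + 2 * Real.pi) := by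
    rw [hf, IsPotential.wellLeft_end]; exact h1
  have hRe : δ₁ < wellRight f a (b - a) := by
    rw [hf, IsPotential.wellRight_end]; exact h1
  obtain ⟨cL, CL, hbL⟩ := hL.exists_bounds h0 hLe
  obtain ⟨cR, CR, hbR⟩ := hR.exists_bounds h0 hRe
  obtain ⟨ηL, hηL, bL, hbL0, hZL⟩ := hL.exists_wellZ_ge hLe hbL
  obtain ⟨ηR, hηR, bR, hbR0, hZR⟩ := hR.exists_wellZ_ge hRe hbR
  obtain ⟨DL, hDL0, hDL⟩ := hL.exists_triangle_le hLe hbL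
  obtain ⟨DR, hDR0, hDR⟩ := hR.exists_triangle_le hRe hbR
  have hcL := hbL.c_pos
  have hcR := hbR.c_pos
  -- Half of the height left between the highest admissible level and the maximum: by continuity `f`
  -- stays above the level by `c` within some distance `r` of `b`.
  set c := (f b - f a - δ₁) / 2 with hc
  have hc0 : 0 < c := by rw [hc]; linarith
  obtain ⟨r, hr0, hr⟩ : ∃ r > 0, ∀ x ∈ Icc (b - r) (b + r), f a + δ₁ + c ≤ f x := by
    have e1 : ∀ᶠ x in 𝓝 b, f a + δ₁ + c < f x :=
      hfc.continuousAt.eventually (lt_mem_nhds (by rw [hc]; linarith))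
    obtain ⟨r, hr, hr'⟩ := Metric.eventually_nhds_iff.1 e1
    refine ⟨r / 2, by positivity, fun x hx => (hr' ?_).le⟩
    rw [Real.dist_eq, abs_lt]
    exact ⟨by linarith [hx.1], by linarith [hx.2]⟩
  have hs1 := Real.sqrt_pos.2 h0
  refine ⟨min ηL ηR, ⟨lt_min hηL.1 hηR.1, (min_le_left _ _).trans hηL.2⟩, fun N => ?_⟩
  obtain ⟨C₁, hC₁, hE₁⟩ := exists_inv_mul_exp_neg_div_le (pow_pos hcR 3) N
  obtain ⟨C₂, hC₂, hE₂⟩ := exists_inv_mul_exp_neg_div_le (pow_pos hcL 3) N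
  obtain ⟨C₃, hC₃, hE₃⟩ := exists_exp_neg_div_le (pow_pos hcL 3) N
  obtain ⟨C₄, hC₄, hE₄⟩ := exists_inv_mul_exp_neg_div_le (k := 2 * c * r) (by positivity) N
  set b₀ := bL * bR with hb₀
  have hb₀0 : 0 < b₀ := mul_pos hbL0 hbR0
  set Q := b₀⁻¹ * (DL * C₁ + DR * C₂ + 2 * Real.pi * (2 * c)⁻¹ * √δ₁ * C₃
    + 4 * Real.pi ^ 2 * √δ₁ * (C₄ * (δ₁ * √δ₁) ^ N)) with hQ
  refine ⟨Q, by rw [hQ]; positivity, fun t h ht hh hη => ?_⟩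
  set δ := t - f a with hδ
  have hs := Real.sqrt_pos.2 ht.1
  have hss := Real.mul_self_sqrt ht.1.le
  have hδs : 0 < δ * √δ := mul_pos ht.1 hs
  have hη1 : h ≤ ηL * (δ * √δ) := hη.trans (mul_le_mul_of_nonneg_right (min_le_left _ _) hδs.le)
  have hη2 : h ≤ ηR * (δ * √δ) := hη.trans (mul_le_mul_of_nonneg_right (min_le_right _ _) hδs.le)
  have hη3 : h ≤ δ * √δ := hη1.trans (mul_le_of_le_one_left hδs.le hηL.2)
  have hZL' := (hZL δ ht h hh hη1).2
  have hZR' := (hZR δ ht h hh hη2).2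
  have hPL := hL.wellP_ge hLe hbL ht
  have hPR := hR.wellP_ge hRe hbR ht
  set PL := wellP (wellLeft f a) (a - b + 2 * Real.pi) δ with hPLdef
  set PR := wellP (wellRight f a) (b - a) δ with hPRdef
  have hS := integral_posPart_period hL hR hfc ht.1 (ht.2.trans_lt hLe) (ht.2.trans_lt hRe)
  have hmain := double_period_le (a := a) (b := b) (h := h) (t := t) hfc (imLift_periodic g) hh
    hg.lt_ab.le (by linarith [hg.lt_ba]) hc0 hr0
    (fun x hx => (by linarith [ht.2] : t + c ≤ f a + δ₁ + c).trans (hr x hx)) hS.le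
  rw [integral_exp_phase_left hfc, integral_exp_phase_right hfc, double_left hfc hL,
    double_right hfc hR, ← hδ, ← hPLdef, ← hPRdef] at hmain
  have hLL := hDL δ ht h hh hη3
  have hRR := hDR δ ht h hh hη3
  rw [← hPLdef] at hLL
  rw [← hPRdef] at hRR
  set η := h / (δ * √δ) with hηdef
  have hη0 : 0 < η := by positivity
  set EL := Real.exp (2 / h * PL) with hEL
  set ER := Real.exp (2 / h * PR) with hER
  have hEL0 : 0 < EL := Real.exp_pos _
  have hER0 : 0 < ER := Real.exp_pos _
  have hB : b₀ * (h / √δ) * (EL * ER) ≤ wellZZ f a b h δ := by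
    have e1 : √(h / √δ) * √(h / √δ) = h / √δ := Real.mul_self_sqrt (by positivity)
    calc b₀ * (h / √δ) * (EL * ER)
        = b₀ * (√(h / √δ) * √(h / √δ)) * (EL * ER) := by rw [e1]
      _ = (bL * √(h / √δ) * EL) * (bR * √(h / √δ) * ER) := by rw [hb₀]; ring
      _ ≤ _ := mul_le_mul hZL' hZR' (by positivity) ((by positivity : (0 : ℝ) ≤ _).trans hZL')
  have hB0 : 0 < wellZZ f a b h δ := lt_of_lt_of_le (by positivity) hB
  refine ⟨hB0, ?_⟩
  have hηinv : η⁻¹ = δ * √δ / h := by rw [hηdef, inv_div]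
  -- A well that does not contribute its exponential is paid for by `e^{-k/η}`, which beats every
  -- power of `η`.
  have hexp : ∀ k P : ℝ, k / 2 * (δ * √δ) ≤ P → Real.exp (-(k / η)) * Real.exp (2 / h * P) ≥ 1 := by
    intro k P hkP
    rw [← Real.exp_add, ge_iff_le, ← Real.exp_zero, Real.exp_le_exp, div_eq_mul_inv, hηinv]
    have : k * (δ * √δ / h) ≤ 2 / h * P := by
      calc k * (δ * √δ / h) = 2 / h * (k / 2 * (δ * √δ)) := by ring
        _ ≤ _ := mul_le_mul_of_nonneg_left hkP (by positivity)
    linarith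
  have hxR := hexp _ _ hPR
  have hxL := hexp _ _ hPL
  have hE₁' := hE₁ η hη0
  have hE₂' := hE₂ η hη0
  have hE₃' := hE₃ η hη0
  have hE₄' := hE₄ h hh
  have hsle : √δ ≤ √δ₁ := Real.sqrt_le_sqrt ht.2
  have hhη : h = η * (δ * √δ) := by rw [hηdef, div_mul_cancel₀ _ hδs.ne']
  have hδη : δ * √δ ≤ δ₁ * √δ₁ := mul_le_mul ht.2 hsle hs.le h0.le
  -- the unit `U` bounds the product of the Laplace integrals from below
  set U := (h / √δ) * (EL * ER) with hU
  have hU0 : 0 < U := by positivity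
  -- The triangle in the left well only carries the left exponential; the missing right one supplies
  -- the decay. The prefactor is `δ = η⁻¹ h/√δ`. The other terms are treated in the same way.
  have t1 : DL * δ * EL ≤ DL * C₁ * η ^ N * U := by
    have e1 : δ = η⁻¹ * (h / √δ) := by
      rw [hηinv]; field_simp
    calc DL * δ * EL ≤ DL * δ * EL * (Real.exp (-(cR ^ 3 / η)) * ER) :=
          le_mul_of_one_le_right (by have := ht.1; positivity) hxR
      _ = DL * (η⁻¹ * Real.exp (-(cR ^ 3 / η))) * U := by
          rw [hU]
          conv_lhs => rw [e1]
          ring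
      _ ≤ DL * (C₁ * η ^ N) * U := by gcongr
      _ = _ := by ring
  have t2 : DR * δ * ER ≤ DR * C₂ * η ^ N * U := by
    have e1 : δ = η⁻¹ * (h / √δ) := by
      rw [hηinv]; field_simp
    calc DR * δ * ER ≤ DR * δ * ER * (Real.exp (-(cL ^ 3 / η)) * EL) :=
          le_mul_of_one_le_right (by have := ht.1; positivity) hxL
      _ = DR * (η⁻¹ * Real.exp (-(cL ^ 3 / η))) * U := by
          rw [hU]
          conv_lhs => rw [e1]
          ring
      _ ≤ DR * (C₂ * η ^ N) * U := by gcongr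
      _ = _ := by ring
  have hER1 : 1 ≤ ER := by
    rw [hER, ← Real.exp_zero, Real.exp_le_exp]
    have : 0 ≤ PR := le_trans (by positivity) hPR
    positivity
  have t3 : 2 * Real.pi * (2 * c / h)⁻¹ ≤ 2 * Real.pi * (2 * c)⁻¹ * √δ₁ * C₃ * η ^ N * U := by
    have e1 : 2 * Real.pi * (2 * c / h)⁻¹ = 2 * Real.pi * (2 * c)⁻¹ * √δ * (h / √δ) := by
      field_simp
    have e2 : 1 ≤ Real.exp (-(cL ^ 3 / η)) * EL * ER := by
      calc (1 : ℝ) = 1 * 1 := by norm_num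
        _ ≤ _ := mul_le_mul hxL hER1 (by norm_num) (by positivity)
    calc 2 * Real.pi * (2 * c / h)⁻¹ = 2 * Real.pi * (2 * c)⁻¹ * √δ * (h / √δ) := e1
      _ ≤ 2 * Real.pi * (2 * c)⁻¹ * √δ * (h / √δ) * (Real.exp (-(cL ^ 3 / η)) * EL * ER) :=
          le_mul_of_one_le_right (by positivity) e2
      _ = 2 * Real.pi * (2 * c)⁻¹ * √δ * Real.exp (-(cL ^ 3 / η)) * U := by rw [hU]; ring
      _ ≤ 2 * Real.pi * (2 * c)⁻¹ * √δ₁ * (C₃ * η ^ N) * U := by gcongr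
      _ = _ := by ring
  have t4 : 2 * Real.pi * (2 * Real.pi * Real.exp (2 / h * (PL + PR - c * r)))
      ≤ 4 * Real.pi ^ 2 * √δ₁ * (C₄ * (δ₁ * √δ₁) ^ N) * η ^ N * U := by
    have e1 : Real.exp (2 / h * (PL + PR - c * r)) = EL * ER * Real.exp (-(2 * c * r / h)) := by
      rw [hEL, hER, ← Real.exp_add, ← Real.exp_add]
      congr 1
      ring
    have e2 : EL * ER = √δ * h⁻¹ * U := by
      rw [hU]; field_simp
    have e3 : h ^ N ≤ (δ₁ * √δ₁) ^ N * η ^ N := by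
      rw [← mul_pow]
      refine pow_le_pow_left₀ hh.le ?_ N
      calc h = η * (δ * √δ) := hhη
        _ ≤ η * (δ₁ * √δ₁) := mul_le_mul_of_nonneg_left hδη hη0.le
        _ = _ := by ring
    calc 2 * Real.pi * (2 * Real.pi * Real.exp (2 / h * (PL + PR - c * r)))
        = 4 * Real.pi ^ 2 * √δ * (h⁻¹ * Real.exp (-(2 * c * r / h))) * U := by
          rw [e1, e2]; ring
      _ ≤ 4 * Real.pi ^ 2 * √δ₁ * (C₄ * ((δ₁ * √δ₁) ^ N * η ^ N)) * U := by
          have := hE₄'.trans (mul_le_mul_of_nonneg_left e3 hC₄.le)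
          gcongr
      _ = _ := by ring
  have hUB : U ≤ b₀⁻¹ * wellZZ f a b h δ := by
    rw [inv_mul_eq_div, le_div_iff₀ hb₀0, hU]
    linarith [hB]
  have hfin : (DL * C₁ + DR * C₂ + 2 * Real.pi * (2 * c)⁻¹ * √δ₁ * C₃
      + 4 * Real.pi ^ 2 * √δ₁ * (C₄ * (δ₁ * √δ₁) ^ N)) * η ^ N * U
      ≤ wellZZ f a b h δ * (Q * η ^ N) := by
    calc _ ≤ (DL * C₁ + DR * C₂ + 2 * Real.pi * (2 * c)⁻¹ * √δ₁ * C₃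
        + 4 * Real.pi ^ 2 * √δ₁ * (C₄ * (δ₁ * √δ₁) ^ N)) * η ^ N * (b₀⁻¹ * wellZZ f a b h δ) := by
          gcongr
      _ = _ := by rw [hQ]; ring
  have hzz : wellZZ f a b h δ = wellZ (wellLeft f a) (a - b + 2 * Real.pi) h δ
    * wellZ (wellRight f a) (b - a) h δ := rfl
  rw [← hzz] at hmain
  rw [mul_add, mul_one]
  linarith [hLL, hRR]

/-- The norm of the resolvent is the product of the two Laplace integrals up to `O(η^∞)`. -/
theorem exists_norm_resOp (hg : IsPotential g a b) (h0 : 0 < δ₁)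
    (h1 : δ₁ < meanIm g - imLift g a) :
    ∃ η₀ ∈ Ioc (0 : ℝ) 1,
      (∀ (z : ℂ) (h : ℝ), z.im - imLift g a ∈ Ioc 0 δ₁ → 0 < h →
        h ≤ η₀ * ((z.im - imLift g a) * √(z.im - imLift g a)) →
        0 < wellZZ (imLift g) a b h (z.im - imLift g a) ∧ 0 < ‖resOp hg.smooth h z‖ ∧
        (∃ Λ ≤ 3 / 2 * ‖resOp hg.smooth h z‖ ^ 2, PairBound (resOp hg.smooth h z) Λ)) ∧
      ∀ N : ℕ, ∃ C : ℝ, 0 < C ∧ ∀ (z : ℂ) (h : ℝ), z.im - imLift g a ∈ Ioc 0 δ₁ → 0 < h →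
        h ≤ η₀ * ((z.im - imLift g a) * √(z.im - imLift g a)) →
        |‖resOp hg.smooth h z‖ ^ 2 * h ^ 2 / wellZZ (imLift g) a b h (z.im - imLift g a) - 1|
          ≤ C * (h / ((z.im - imLift g a) * √(z.im - imLift g a))) ^ N := by
  have hmb := hg.meanIm_le
  obtain ⟨η₁, hη₁, hD⟩ := exists_double_le hg h0 (by linarith)
  set k := 2 * Real.pi * (meanIm g - imLift g a - δ₁) with hk
  have hk0 : 0 < k := by rw [hk]; have := Real.two_pi_pos; nlinarith
  have hs1 := Real.sqrt_pos.2 h0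
  have hδ1s : 0 < δ₁ * √δ₁ := mul_pos h0 hs1
  -- Decay in `1/h` is stronger than decay in `1/η`, because `h ≤ δ₁^{3/2} η`.
  have hq : ∀ N : ℕ, ∃ C : ℝ, 0 < C ∧ ∀ (z : ℂ) (h : ℝ), z.im - imLift g a ∈ Ioc 0 δ₁ → 0 < h →
      ‖Complex.exp (-prim (resCoeff g h z) (2 * Real.pi))‖
        ≤ C * (h / ((z.im - imLift g a) * √(z.im - imLift g a))) ^ N := by
    intro N
    obtain ⟨C, hC, hE⟩ := exists_exp_neg_div_le hk0 N
    refine ⟨C * (δ₁ * √δ₁) ^ N, by positivity, fun z h hz hh => ?_⟩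
    set δ := z.im - imLift g a with hδ
    have hs := Real.sqrt_pos.2 hz.1
    have hδs : 0 < δ * √δ := mul_pos hz.1 hs
    rw [norm_exp_prim_period hg.smooth]
    calc Real.exp (-(2 * Real.pi / h * (meanIm g - z.im))) ≤ Real.exp (-(k / h)) := by
          refine Real.exp_le_exp.2 (neg_le_neg ?_)
          rw [div_mul_eq_mul_div, hk]
          refine div_le_div_of_nonneg_right (mul_le_mul_of_nonneg_left ?_ Real.two_pi_pos.le) hh.le
          linarith [hz.2]
      _ ≤ C * h ^ N := hE h hh
      _ ≤ C * ((δ₁ * √δ₁) * (h / (δ * √δ))) ^ N := by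
          have : h ≤ (δ₁ * √δ₁) * (h / (δ * √δ)) := by
            rw [mul_div_assoc', le_div_iff₀ hδs, mul_comm]
            exact mul_le_mul_of_nonneg_right
              (mul_le_mul hz.2 (Real.sqrt_le_sqrt hz.2) hs.le h0.le) hh.le
          gcongr
      _ = _ := by rw [mul_pow]; ring
  obtain ⟨C₁, hC₁, hq1⟩ := hq 1
  obtain ⟨C₂, hC₂, hD1⟩ := hD 1
  set η₀ := min η₁ (min (2 * C₁)⁻¹ (2 * C₂)⁻¹) with hη₀
  have hle1 : η₀ ≤ η₁ := min_le_left _ _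
  have hle2 : η₀ ≤ (2 * C₁)⁻¹ := (min_le_right _ _).trans (min_le_left _ _)
  have hle3 : η₀ ≤ (2 * C₂)⁻¹ := (min_le_right _ _).trans (min_le_right _ _)
  have key : ∀ (z : ℂ) (h : ℝ), z.im - imLift g a ∈ Ioc 0 δ₁ → 0 < h →
      h ≤ η₀ * ((z.im - imLift g a) * √(z.im - imLift g a)) →
      h ≤ η₁ * ((z.im - imLift g a) * √(z.im - imLift g a)) ∧
      ‖Complex.exp (-prim (resCoeff g h z) (2 * Real.pi))‖ ≤ 1 / 2 ∧
      C₂ * (h / ((z.im - imLift g a) * √(z.im - imLift g a))) ^ 1 ≤ 1 / 2 := by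
    intro z h hz hh hη
    set δ := z.im - imLift g a with hδ
    have hδs : 0 < δ * √δ := mul_pos hz.1 (Real.sqrt_pos.2 hz.1)
    have hη' : h / (δ * √δ) ≤ η₀ := (div_le_iff₀ hδs).2 hη
    have hη0 : 0 < h / (δ * √δ) := by positivity
    refine ⟨hη.trans (mul_le_mul_of_nonneg_right hle1 hδs.le), (hq1 z h hz hh).trans ?_, ?_⟩
    · rw [pow_one]
      calc C₁ * (h / (δ * √δ)) ≤ C₁ * (2 * C₁)⁻¹ :=
            mul_le_mul_of_nonneg_left (hη'.trans hle2) hC₁.le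
        _ = 1 / 2 := by field_simp
    · rw [pow_one]
      calc C₂ * (h / (δ * √δ)) ≤ C₂ * (2 * C₂)⁻¹ :=
            mul_le_mul_of_nonneg_left (hη'.trans hle3) hC₂.le
        _ = 1 / 2 := by field_simp
  have hHS : ∀ (z : ℂ) (h : ℝ), ∫ x in (b - 2 * Real.pi)..b, solKer (resCoeff g h z) x
      = ‖(Complex.exp (-prim (resCoeff g h z) (2 * Real.pi)) - 1)⁻¹‖ ^ 2 *
        ∫ x in (b - 2 * Real.pi)..b, Real.exp (-phase (imLift g) a h z.im x)
        * ∫ y in x..(x + 2 * Real.pi), Real.exp (phase (imLift g) a h z.im y) := by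
    intro z h
    rw [← intervalIntegral.integral_const_mul]
    refine intervalIntegral.integral_congr fun x _ => ?_
    exact solKer_eq_phase hg.smooth h z a x
  have hκ : ∀ q : ℂ, ‖q‖ ≤ 1 / 2 → 0 < ‖(q - 1)⁻¹‖ ^ 2 ∧ |‖(q - 1)⁻¹‖ ^ 2 - 1| ≤ 12 * ‖q‖ ∧
      ‖(q - 1)⁻¹‖ ^ 2 ≤ 4 := by
    intro q hq
    have e1 : 1 - ‖q‖ ≤ ‖q - 1‖ := by
      have := norm_sub_norm_le (1 : ℂ) q
      rw [norm_one, norm_sub_rev] at this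
      exact this
    have e2 : ‖q - 1‖ ≤ 1 + ‖q‖ := by
      have := norm_sub_le q 1
      rw [norm_one] at this
      linarith
    have e3 : 1 / 2 ≤ ‖q - 1‖ := by linarith
    set y := ‖q - 1‖ with hy
    have hy0 : 0 < y := by linarith
    rw [norm_inv, ← hy, inv_pow]
    have hy2 : 1 / 4 ≤ y ^ 2 := by nlinarith
    have e4 : (y ^ 2)⁻¹ ≤ 4 := by
      rw [inv_le_comm₀ (by positivity) (by norm_num)]
      linarith
    refine ⟨by positivity, ?_, e4⟩
    have e5 : (y ^ 2)⁻¹ - 1 = (1 - y ^ 2) * (y ^ 2)⁻¹ := by field_simp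
    rw [e5, abs_mul, abs_of_pos (inv_pos.2 (by positivity : 0 < y ^ 2))]
    have hq0 := norm_nonneg q
    have e6 : |1 - y ^ 2| ≤ 3 * ‖q‖ := by
      rw [abs_le]
      constructor <;> nlinarith
    calc |1 - y ^ 2| * (y ^ 2)⁻¹ ≤ 3 * ‖q‖ * 4 :=
          mul_le_mul e6 e4 (by positivity) (by positivity)
      _ = _ := by ring
  refine ⟨η₀, ⟨lt_min hη₁.1 (lt_min (by positivity) (by positivity)), hle1.trans hη₁.2⟩, ?_, ?_⟩
  · intro z h hz hh hη
    obtain ⟨k1, k2, k3⟩ := key z h hz hh hη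
    obtain ⟨hB, hI⟩ := hD1 z.im h hz hh k1
    obtain ⟨κ1, -, -⟩ := hκ _ k2
    have hge := solKer_integral_ge hg (h := h) z
    have hn := norm_resOp_sq hg.smooth hh z
    set κ := ‖(Complex.exp (-prim (resCoeff g h z) (2 * Real.pi)) - 1)⁻¹‖ ^ 2 with hκdef
    rw [← hn] at hge
    have hpos : 0 < ‖resOp hg.smooth h z‖ ^ 2 * h ^ 2 := (mul_pos κ1 hB).trans_le hge
    refine ⟨hB, ?_, ?_⟩
    · by_contra hcon
      have : ‖resOp hg.smooth h z‖ = 0 := le_antisymm (not_lt.1 hcon) (norm_nonneg _)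
      rw [this] at hpos
      simp at hpos
    -- The constant of the pair bound is the Hilbert–Schmidt bound. It exceeds the product of
    -- Laplace integrals, a lower bound for the squared norm, by a factor of at most `1 + 1/2`.
    · refine ⟨_, ?_, (pairBound_solOp _ _ (b - 2 * Real.pi)).smul _⟩
      rw [norm_div, Complex.norm_I, Complex.norm_real, Real.norm_eq_abs, abs_of_pos hh,
        sub_add_cancel, hHS, ← hκdef, div_pow, one_pow, div_mul_eq_mul_div, one_mul,
        div_le_iff₀ (by positivity)]
      calc κ * _ ≤ κ * (wellZZ (imLift g) a b h (z.im - imLift g a) * (1 + 1 / 2)) := by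
            refine mul_le_mul_of_nonneg_left (hI.trans ?_) κ1.le
            refine mul_le_mul_of_nonneg_left ?_ hB.le
            linarith
        _ ≤ _ := by linarith
  · intro N
    obtain ⟨C₃, hC₃, hqN⟩ := hq N
    obtain ⟨C₄, hC₄, hDN⟩ := hD N
    refine ⟨12 * C₃ + 4 * C₄, by positivity, fun z h hz hh hη => ?_⟩
    obtain ⟨k1, k2, k3⟩ := key z h hz hh hη
    obtain ⟨hB, hI⟩ := hDN z.im h hz hh k1
    obtain ⟨κ1, κ2, κ3⟩ := hκ _ k2
    have hge := solKer_integral_ge hg (h := h) z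
    have hle := norm_solOp_sq_le hg (h := h) z
    have hqq := hqN z h hz hh
    rw [hHS] at hle
    rw [norm_resOp_sq hg.smooth hh]
    set κ := ‖(Complex.exp (-prim (resCoeff g h z) (2 * Real.pi)) - 1)⁻¹‖ ^ 2 with hκdef
    set B := wellZZ (imLift g) a b h (z.im - imLift g a) with hBdef
    set T := ‖solOp (resCoeff_contDiff hg.smooth h z).continuous (resCoeff_periodic g h z)‖ ^ 2
    set E := (h / ((z.im - imLift g a) * √(z.im - imLift g a))) ^ N with hE
    have hE0 : 0 ≤ E := by
      have := hz.1
      positivity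
    have e1 : κ ≤ T / B := (le_div_iff₀ hB).2 hge
    have e2 : T / B ≤ κ + κ * (C₄ * E) := by
      rw [div_le_iff₀ hB]
      refine (hle.trans (mul_le_mul_of_nonneg_left hI κ1.le)).trans_eq ?_
      ring
    have e3 : κ * (C₄ * E) ≤ 4 * (C₄ * E) := mul_le_mul_of_nonneg_right κ3 (by positivity)
    have e4 := abs_le.1 κ2
    rw [abs_le]
    constructor
    · nlinarith [mul_nonneg hC₄.le hE0]
    · nlinarith [mul_nonneg hC₄.le hE0]

end

/-! ### Jets of the normalising factor of a half well -/

/-- Jets of the reciprocal of a function that is not small compared with its weight. -/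
theorem JetBound.inv {ι G : Type*} [NormedAddCommGroup G] [NormedSpace ℝ G] {n : ℕ}
    {f : ι → G → ℝ} {x : ι → G} {r w : ι → ℝ} (h : JetBound n f x r w) (hr : ∀ i, 0 < r i)
    (hw : ∀ i, 0 < w i) {c : ℝ} (hc : 0 < c) (hf : ∀ i, c * w i ≤ f i (x i)) :
    JetBound n (fun i y => (f i y)⁻¹) x r (fun i => (w i)⁻¹) := by
  have hr' : ∀ i, 0 ≤ r i := fun i => (hr i).le
  have hw' : ∀ i, 0 ≤ w i := fun i => (hw i).le
  have e1 := h.const_mul (fun i => (w i)⁻¹) hr' hw'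
  have e2 : JetBound n (fun i y => (w i)⁻¹ * f i y) x r 1 := by
    refine e1.weight (fun i => mul_nonneg (abs_nonneg _) (hw' i)) 1 fun i => ?_
    rw [abs_of_pos (inv_pos.2 (hw i)), inv_mul_cancel₀ (hw i).ne', Pi.one_apply, _root_.mul_one]
  obtain ⟨B, hB⟩ := e2.norm_le
  have e3 := e2.comp_compact (g := fun t : ℝ => t⁻¹) (O := {t | t ≠ 0}) (K := Icc c B)
    isOpen_ne (contDiffOn_id.inv fun t ht => ht) isCompact_Icc
    (fun t ht => (hc.trans_le ht.1).ne') (fun i => ⟨by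
      rw [inv_mul_eq_div, le_div_iff₀ (hw i)]
      exact hf i, by
      have := hB i
      rw [Pi.one_apply, _root_.mul_one] at this
      exact (le_abs_self _).trans this⟩) hr
  have e4 := e3.const_mul (fun i => (w i)⁻¹) hr' (fun _ => zero_le_one)
  refine (e4.congr fun i => Eventually.of_forall fun y => ?_).weight
    (fun i => mul_nonneg (abs_nonneg _) zero_le_one) 1 fun i => ?_
  · simp only [mul_inv, inv_inv]
    rw [← mul_assoc, inv_mul_cancel₀ (hw i).ne', one_mul]
  · rw [abs_of_pos (inv_pos.2 (hw i)), Pi.one_apply, _root_.mul_one, one_mul]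

/-- The factor `e^{-2P/h} √(α/(πh))` that normalises the Laplace integral. -/
def wellNorm (φ : ℝ → ℝ) (ℓ h δ : ℝ) : ℝ :=
  Real.exp (-(2 / h * wellP φ ℓ δ)) * √(HalfWell.slope φ ℓ δ / (Real.pi * h))

theorem wellQuot_eq (φ : ℝ → ℝ) (ℓ h δ : ℝ) :
    wellQuot φ ℓ h δ = wellZ φ ℓ h δ * wellNorm φ ℓ h δ := by
  rw [wellQuot, wellNorm, mul_assoc]

namespace HalfWell

variable {φ : ℝ → ℝ} {ℓ δ₁ c C : ℝ}

theorem wellNorm_pos (hW : HalfWell φ ℓ) {δ h : ℝ} (hδ : 0 < δ) (hδ1 : δ < φ ℓ) (hh : 0 < h) :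
    0 < wellNorm φ ℓ h δ :=
  mul_pos (Real.exp_pos _) (Real.sqrt_pos.2
    (div_pos (hW.slope_pos hδ hδ1) (mul_pos Real.pi_pos hh)))

theorem wellP_contDiffAt (hW : HalfWell φ ℓ) {δ : ℝ} (hδ : 0 < δ) (hδ1 : δ < φ ℓ) :
    ContDiffAt ℝ ∞ (wellP φ ℓ) δ := by
  have e1 := (hW.wellX_contDiffAt hδ hδ1).1
  have e2 : ContDiff ℝ ∞ (fun x => ∫ y in (0 : ℝ)..x, φ y) := by
    rw [contDiff_infty_iff_deriv]
    have hd : ∀ x, HasDerivAt (fun x => ∫ y in (0 : ℝ)..x, φ y) (φ x) x := fun x =>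
      intervalIntegral.integral_hasDerivAt_right
        (hW.smooth.continuous.intervalIntegrable _ _)
        (hW.smooth.continuous.stronglyMeasurableAtFilter _ _)
        hW.smooth.continuous.continuousAt
    refine ⟨fun x => (hd x).differentiableAt, ?_⟩
    rw [funext fun x => (hd x).deriv]
    exact hW.smooth
  exact (contDiffAt_id.mul e1).sub (e2.contDiffAt.comp δ e1)

/-- Half of the logarithmic derivative of the slope. -/
def slopeLog (φ : ℝ → ℝ) (ℓ δ : ℝ) : ℝ :=
  deriv (deriv φ) (wellX φ ℓ δ) * ((HalfWell.slope φ ℓ δ)⁻¹ * (HalfWell.slope φ ℓ δ)⁻¹) / 2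

theorem wellNorm_hasDerivAt (hW : HalfWell φ ℓ) {δ h : ℝ} (hδ : 0 < δ) (hδ1 : δ < φ ℓ)
    (hh : 0 < h) : HasDerivAt (wellNorm φ ℓ h)
      (wellNorm φ ℓ h δ * (slopeLog φ ℓ δ - 2 / h * wellX φ ℓ δ)) δ := by
  have hα := hW.slope_pos hδ hδ1
  have h1 := ((hW.wellP_hasDerivAt hδ hδ1).const_mul (2 / h)).fun_neg.exp
  have hpos : 0 < HalfWell.slope φ ℓ δ / (Real.pi * h) := div_pos hα (mul_pos Real.pi_pos hh)
  have h2 := ((hW.slope_contDiffAt hδ hδ1).2.div_const (Real.pi * h)).sqrt hpos.ne'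
  refine (h1.mul h2).congr_deriv ?_
  rw [wellNorm, slopeLog]
  set q := √(HalfWell.slope φ ℓ δ / (Real.pi * h)) with hq
  have hq0 : 0 < q := Real.sqrt_pos.2 hpos
  have hqq : q * q = HalfWell.slope φ ℓ δ / (Real.pi * h) := Real.mul_self_sqrt hpos.le
  have h3 : deriv (deriv φ) (wellX φ ℓ δ) / HalfWell.slope φ ℓ δ / (Real.pi * h) / (2 * q)
      -- The derivative of `√(α/(πh))` is `α'/(2α)` times itself, with `α' = φ''(X)/α`.
      = q * (deriv (deriv φ) (wellX φ ℓ δ)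
        * ((HalfWell.slope φ ℓ δ)⁻¹ * (HalfWell.slope φ ℓ δ)⁻¹) / 2) := by
    have hpi := Real.pi_pos
    have h4 : HalfWell.slope φ ℓ δ = q * q * (Real.pi * h) := by rw [hqq]; field_simp
    rw [h4]
    field_simp
  rw [h3]
  ring

section Family

variable {ι : Type*} {hp d : ι → ℝ}

theorem jets_family (hW : HalfWell φ ℓ) (h1 : δ₁ < φ ℓ) (hb : WellBounds φ ℓ δ₁ c C)
    (hd : ∀ i, d i ∈ Ioc 0 δ₁) (n : ℕ) :
    JetBound n (fun (_ : ι) => wellX φ ℓ) d d (fun i => √(d i)) ∧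
      JetBound n (fun (_ : ι) => HalfWell.slope φ ℓ) d d (fun i => √(d i)) :=
  ⟨(hW.jets h1 hb n).1.reindex (fun i => (⟨d i, hd i⟩ : Ioc 0 δ₁)),
    (hW.jets h1 hb n).2.reindex (fun i => (⟨d i, hd i⟩ : Ioc 0 δ₁))⟩

theorem jets_slopeLog (hW : HalfWell φ ℓ) (h1 : δ₁ < φ ℓ) (hb : WellBounds φ ℓ δ₁ c C)
    (hd : ∀ i, d i ∈ Ioc 0 δ₁) (n : ℕ) :
    JetBound n (fun (_ : ι) => slopeLog φ ℓ) d d (fun i => (d i)⁻¹) := by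
  have hds : ∀ i, 0 < √(d i) := fun i => Real.sqrt_pos.2 (hd i).1
  have hd0 : ∀ i, 0 < d i := fun i => (hd i).1
  have hd0' : ∀ i, 0 ≤ d i := fun i => (hd i).1.le
  obtain ⟨hX, hα⟩ := hW.jets_family h1 hb hd n
  have e1 := hα.inv hd0 hds hb.c_pos fun i => hb.deriv_ge _ (hd i)
  have hs' : ∀ i, 0 ≤ (√(d i))⁻¹ := fun i => (inv_pos.2 (hds i)).le
  have e2 := e1.mul e1 hd0' hs' hs'
  have hX1 : JetBound n (fun (_ : ι) => wellX φ ℓ) d d 1 :=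
    hX.weight (fun i => (hds i).le) √δ₁ fun i => by
      rw [Pi.one_apply, mul_one]
      exact Real.sqrt_le_sqrt (hd i).2
  have hdd : ContDiff ℝ ∞ (deriv (deriv φ)) :=
    ((contDiff_infty_iff_deriv (𝕜 := ℝ)).1 hW.smooth_deriv).2
  have e3 := hX1.comp_compact isOpen_univ hdd.contDiffOn (isCompact_Icc (a := 0) (b := ℓ))
    (subset_univ _)
    (fun i => Ioo_subset_Icc_self (hW.wellX_spec (hd0 i) ((hd i).2.trans_lt h1)).1) hd0
  have e4 := e3.mul e2 hd0' (fun _ => zero_le_one) (fun i => mul_nonneg (hs' i) (hs' i))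
  have e5 := e4.const_mul (fun _ => 2⁻¹) hd0'
    (fun i => mul_nonneg zero_le_one (mul_nonneg (hs' i) (hs' i)))
  refine (e5.congr fun i => Eventually.of_forall fun y => ?_).weight
    (fun i => mul_nonneg (abs_nonneg _)
      (mul_nonneg zero_le_one (mul_nonneg (hs' i) (hs' i)))) 1 fun i => ?_
  · rw [slopeLog]
    ring
  · rw [Pi.one_apply, one_mul, ← mul_inv, Real.mul_self_sqrt (hd0' i),
      abs_of_pos (by norm_num), one_mul]
    have := inv_pos.2 (hd0 i)
    linarith

/-- Jets of the normalising factor relative to its value, at scale `h / √δ`. -/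
theorem jets_wellNorm (hW : HalfWell φ ℓ) (h1 : δ₁ < φ ℓ) (hb : WellBounds φ ℓ δ₁ c C)
    (hp0 : ∀ i, 0 < hp i) (hd : ∀ i, d i ∈ Ioc 0 δ₁) (hη : ∀ i, hp i ≤ d i * √(d i)) (n : ℕ) :
    JetBound n (fun i y => wellNorm φ ℓ (hp i) y / wellNorm φ ℓ (hp i) (d i))
      d (fun i => hp i / √(d i)) 1 := by
  have hc := hb.c_pos
  have hds : ∀ i, 0 < √(d i) := fun i => Real.sqrt_pos.2 (hd i).1
  have hd0 : ∀ i, 0 < d i := fun i => (hd i).1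
  have hd0' : ∀ i, 0 ≤ d i := fun i => (hd i).1.le
  have hlt : ∀ i, d i < φ ℓ := fun i => (hd i).2.trans_lt h1
  have hr : ∀ i, 0 < hp i / √(d i) := fun i => div_pos (hp0 i) (hds i)
  have hr' : ∀ i, 0 ≤ hp i / √(d i) := fun i => (hr i).le
  have hrd : ∀ i, hp i / √(d i) ≤ d i := fun i => by
    rw [div_le_iff₀ (hds i)]; exact hη i
  have hE : JetBound n (fun i y => -(2 / hp i * (wellP φ ℓ y - wellP φ ℓ (d i)))) d
      (fun i => hp i / √(d i)) 1 := by
    have hs : ∀ i, ContDiffAt ℝ ∞ (fun y => -(2 / hp i * (wellP φ ℓ y - wellP φ ℓ (d i)))) (d i) :=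
      fun i => (contDiffAt_const.mul
        ((hW.wellP_contDiffAt (hd0 i) (hlt i)).sub contDiffAt_const)).neg
    have h0 : ∀ i, ‖-(2 / hp i * (wellP φ ℓ (d i) - wellP φ ℓ (d i)))‖ ≤ 0 * (1 : ι → ℝ) i :=
      fun i => by simp
    rcases n with _ | n
    · exact JetBound.zero hs h0
    · refine JetBound.of_fderiv hs h0 ?_ hr
      have e1 := (hW.jets_family h1 hb hd n).1.scale hr' hrd
      have e2 := e1.const_mul (fun i => -(2 / hp i)) hr' (fun i => (hds i).le)
      have e3 := e2.clm (ContinuousLinearMap.smulRightL ℝ ℝ ℝ (1 : ℝ →L[ℝ] ℝ)) hr'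
      refine (e3.congr (f' := fun i => fderiv ℝ
        (fun y => -(2 / hp i * (wellP φ ℓ y - wellP φ ℓ (d i))))) (fun i => ?_)).weight
        (fun i => mul_nonneg (abs_nonneg _) (hds i).le) 2 (fun i => ?_)
      · have hnb : ∀ᶠ y in 𝓝 (d i), y ∈ Ioo 0 (φ ℓ) := isOpen_Ioo.mem_nhds ⟨hd0 i, hlt i⟩
        filter_upwards [hnb] with y hy
        have g1 := (((hW.wellP_hasDerivAt hy.1 hy.2).sub_const (wellP φ ℓ (d i))).const_mul
          (2 / hp i)).fun_neg
        refine g1.hasFDerivAt.fderiv.trans ?_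
        ext
        simp
      · have g1 := hp0 i
        have g2 := hds i
        rw [abs_neg, abs_of_pos (by positivity), Pi.one_apply]
        refine le_of_eq ?_
        field_simp
  have hA : JetBound n (fun i y => (HalfWell.slope φ ℓ (d i))⁻¹ * HalfWell.slope φ ℓ y) d
      (fun i => hp i / √(d i)) 1 := by
    have hsl : ∀ i, 0 < HalfWell.slope φ ℓ (d i) := fun i => hW.slope_pos (hd0 i) (hlt i)
    have e1 := ((hW.jets_family h1 hb hd n).2.scale hr' hrd).const_mul
      (fun i => (HalfWell.slope φ ℓ (d i))⁻¹) hr' (fun i => (hds i).le)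
    refine e1.weight (fun i => by have := hds i; positivity) c⁻¹ (fun i => ?_)
    have h2 : c * √(d i) ≤ HalfWell.slope φ ℓ (d i) := hb.deriv_ge _ (hd i)
    rw [abs_of_pos (inv_pos.2 (hsl i)), Pi.one_apply, mul_one, inv_mul_eq_div,
      div_le_iff₀ (hsl i), inv_mul_eq_div, le_div_iff₀ hc]
    linarith
  have f2 := hE.comp_compact (g := Real.exp) isOpen_univ Real.contDiff_exp.contDiffOn
    (isCompact_singleton (x := (0 : ℝ))) (subset_univ _) (fun i => by simp) hr
  have f3 := hA.comp_compact (g := fun t => √t) (O := Ioi 0) isOpen_Ioi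
    (ContDiffOn.sqrt contDiffOn_id fun t ht => (mem_Ioi.1 ht).ne')
    (isCompact_singleton (x := (1 : ℝ))) (by simp)
    (fun i => by rw [inv_mul_cancel₀ (hW.slope_pos (hd0 i) (hlt i)).ne']; rfl) hr
  refine (f2.mul_one f3 hr' (fun _ => zero_le_one)).congr fun i => ?_
  have hnb : ∀ᶠ y in 𝓝 (d i), y ∈ Ioo 0 (φ ℓ) := isOpen_Ioo.mem_nhds ⟨hd0 i, hlt i⟩
  filter_upwards [hnb] with y hy
  have a1 := hW.slope_pos (hd0 i) (hlt i)
  have a2 := hW.slope_pos hy.1 hy.2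
  have hpi := Real.pi_pos
  have hpp := hp0 i
  have a3 : √(HalfWell.slope φ ℓ y / (Real.pi * hp i))
      = √(HalfWell.slope φ ℓ (d i) / (Real.pi * hp i))
        * √((HalfWell.slope φ ℓ (d i))⁻¹ * HalfWell.slope φ ℓ y) := by
    rw [← Real.sqrt_mul (by positivity)]
    congr 1
    field_simp
  have a4 : Real.exp (-(2 / hp i * wellP φ ℓ y))
      = Real.exp (-(2 / hp i * wellP φ ℓ (d i)))
        * Real.exp (-(2 / hp i * (wellP φ ℓ y - wellP φ ℓ (d i)))) := by
    rw [← Real.exp_add]; congr 1; ring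
  have a5 : 0 < √(HalfWell.slope φ ℓ (d i) / (Real.pi * hp i)) := Real.sqrt_pos.2 (by positivity)
  have a6 := Real.exp_pos (-(2 / hp i * wellP φ ℓ (d i)))
  rw [wellNorm, wellNorm, a3, a4]
  field_simp

end Family

/-- Over an energy range `h/√δ` the action, whose derivative is `X = O(√δ)`, changes by `O(h)`. The
exponential therefore changes by a bounded factor, and so does the slope, which is comparable with
`√δ`. -/
theorem wellNorm_div_le (hW : HalfWell φ ℓ) (h1 : δ₁ < φ ℓ) (hb : WellBounds φ ℓ δ₁ c C) :
    ∃ D : ℝ, 0 < D ∧ ∀ δ ∈ Ioc 0 δ₁, ∀ δ' ∈ Ioc 0 δ₁, ∀ h : ℝ, 0 < h → δ' ∈ Icc (δ / 2) (2 * δ) →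
      |δ' - δ| ≤ h / √δ → wellNorm φ ℓ h δ ≤ D * wellNorm φ ℓ h δ' := by
  have hc := hb.c_pos
  have hC := hb.C_pos
  refine ⟨Real.exp (4 * C) * √(2 * C / c), by positivity, fun δ hδ δ' hδ' h hh hδδ hd => ?_⟩
  have hs := Real.sqrt_pos.2 hδ.1
  have hs' := Real.sqrt_pos.2 hδ'.1
  have hs2 : √(2 * δ) ≤ 2 * √δ := by
    rw [Real.sqrt_le_left (by positivity), mul_pow, Real.sq_sqrt hδ.1.le]
    linarith [hδ.1]
  have hs3 : √δ ≤ 2 * √δ' := by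
    rw [Real.sqrt_le_left (by positivity), mul_pow, Real.sq_sqrt hδ'.1.le]
    linarith [hδδ.1, hδ.1]
  have hP : |wellP φ ℓ δ' - wellP φ ℓ δ| ≤ 2 * C * √δ * |δ' - δ| := by
    have hseg : uIcc δ δ' ⊆ Ioc 0 δ₁ ∩ Iic (2 * δ) := fun y hy => by
      rcases mem_uIcc.1 hy with h | h
      · exact ⟨⟨hδ.1.trans_le h.1, h.2.trans hδ'.2⟩, h.2.trans hδδ.2⟩
      · exact ⟨⟨hδ'.1.trans_le h.1, h.2.trans hδ.2⟩, h.2.trans (by linarith [hδ.1])⟩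
    have := Convex.norm_image_sub_le_of_norm_hasDerivWithin_le (f := wellP φ ℓ)
      (f' := wellX φ ℓ) (s := uIcc δ δ') (C := 2 * C * √δ) (x := δ) (y := δ')
      (fun y hy => (hW.wellP_hasDerivAt (hseg hy).1.1
        ((hseg hy).1.2.trans_lt h1)).hasDerivWithinAt)
      (fun y hy => by
        have e1 := (hseg hy).1
        rw [Real.norm_eq_abs, abs_of_pos (hW.wellX_spec e1.1 (e1.2.trans_lt h1)).1.1]
        refine (hb.X_le y e1).trans ?_
        have : √y ≤ √(2 * δ) := Real.sqrt_le_sqrt (hseg hy).2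
        nlinarith)
      (convex_uIcc δ δ') left_mem_uIcc right_mem_uIcc
    simpa only [Real.norm_eq_abs] using this
  have hα := hb.deriv_le δ hδ
  have hα' := hb.deriv_ge δ' hδ'
  have hα0 := hW.slope_pos hδ.1 (hδ.2.trans_lt h1)
  have hα0' := hW.slope_pos hδ'.1 (hδ'.2.trans_lt h1)
  have hpi := Real.pi_pos
  have e1 : -(2 / h * wellP φ ℓ δ) ≤ 4 * C + -(2 / h * wellP φ ℓ δ') := by
    have e2 : wellP φ ℓ δ' - wellP φ ℓ δ ≤ 2 * C * h := by
      refine (le_abs_self _).trans (hP.trans ?_)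
      calc 2 * C * √δ * |δ' - δ| ≤ 2 * C * √δ * (h / √δ) :=
            mul_le_mul_of_nonneg_left hd (by positivity)
        _ = 2 * C * h := by field_simp
    have e3 : 2 / h * (wellP φ ℓ δ' - wellP φ ℓ δ) ≤ 2 / h * (2 * C * h) :=
      mul_le_mul_of_nonneg_left e2 (by positivity)
    have e4 : 2 / h * (2 * C * h) = 4 * C := by field_simp; ring
    linarith
  have e5 : HalfWell.slope φ ℓ δ ≤ 2 * C / c * HalfWell.slope φ ℓ δ' := by
    calc HalfWell.slope φ ℓ δ ≤ C * √δ := hα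
      _ ≤ C * (2 * √δ') := mul_le_mul_of_nonneg_left hs3 hC.le
      _ = 2 * C / c * (c * √δ') := by field_simp
      _ ≤ _ := mul_le_mul_of_nonneg_left hα' (by positivity)
  rw [wellNorm, wellNorm]
  calc Real.exp (-(2 / h * wellP φ ℓ δ)) * √(HalfWell.slope φ ℓ δ / (Real.pi * h))
      ≤ Real.exp (4 * C + -(2 / h * wellP φ ℓ δ'))
        * √(2 * C / c * (HalfWell.slope φ ℓ δ' / (Real.pi * h))) := by
        refine mul_le_mul (Real.exp_le_exp.2 e1) (Real.sqrt_le_sqrt ?_) (Real.sqrt_nonneg _)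
          (Real.exp_pos _).le
        rw [mul_div_assoc']
        exact div_le_div_of_nonneg_right e5 (by positivity)
    _ = _ := by
        rw [Real.exp_add, Real.sqrt_mul (by positivity)]
        ring

end HalfWell

/-- The norm of a real linear functional on `ℂ`. -/
theorem norm_clm_complex (T : ℂ →L[ℝ] ℝ) : ‖T‖ = √(T 1 ^ 2 + T Complex.I ^ 2) := by
  have happ : ∀ w : ℂ, T w = w.re * T 1 + w.im * T Complex.I := fun w => by
    conv_lhs => rw [← Complex.re_add_im w]
    have e1 : ((w.re : ℂ) + (w.im : ℂ) * Complex.I) = w.re • (1 : ℂ) + w.im • Complex.I := by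
      simp
    rw [e1, map_add, map_smul, map_smul, smul_eq_mul, smul_eq_mul]
  refine le_antisymm (ContinuousLinearMap.opNorm_le_bound T (Real.sqrt_nonneg _) fun w => ?_) ?_
  · rw [Complex.norm_eq_sqrt_sq_add_sq, ← Real.sqrt_mul (by positivity), Real.norm_eq_abs,
      ← Real.sqrt_sq_eq_abs]
    refine Real.sqrt_le_sqrt ?_
    rw [happ]
    nlinarith [sq_nonneg (w.re * T Complex.I - w.im * T 1)]
  · set s := √(T 1 ^ 2 + T Complex.I ^ 2) with hs
    rcases (Real.sqrt_nonneg (T 1 ^ 2 + T Complex.I ^ 2)).eq_or_lt with h | h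
    · rw [← hs] at h
      rw [← h]
      exact norm_nonneg T
    · rw [← hs] at h
      have hss : s * s = T 1 ^ 2 + T Complex.I ^ 2 := Real.mul_self_sqrt (by positivity)
      have e1 := T.le_opNorm ⟨T 1, T Complex.I⟩
      rw [happ, Complex.norm_eq_sqrt_sq_add_sq] at e1
      simp only at e1
      rw [← hs, Real.norm_eq_abs] at e1
      have e2 := (le_abs_self _).trans e1
      have e3 : s * s ≤ ‖T‖ * s := by rw [hss]; linarith
      exact le_of_mul_le_mul_right e3 h

theorem JetBound.im {ι : Type*} {n : ℕ} {f : ι → ℝ → ℝ} {z : ι → ℂ} {m : ℝ} {r w : ι → ℝ}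
    (h : JetBound n f (fun i => (z i).im - m) r w) (hr : ∀ i, 0 ≤ r i) :
    JetBound n (fun i y => f i (y.im - m)) z r w := by
  have := JetBound.comp_clm_right Complex.imCLM (by simp) (-m) (x' := z)
    (fun i => (sub_eq_add_neg (z i).im m).symm) h hr
  exact this

/-! ### Comparison of an abstract function with the product of two Laplace integrals. -/

/-- Two half wells over the energy `m`, and a function `T h z` to be compared with the product of
their Laplace integrals. -/
structure WellPair where
  φ : ℝ → ℝ
  ℓ : ℝ
  ψ : ℝ → ℝ
  k : ℝ
  m : ℝ
  T : ℝ → ℂ → ℝ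

namespace WellPair

variable (W : WellPair)

/-- The height of `Im z` over the minimum. -/
def dep (z : ℂ) : ℝ := z.im - W.m

/-- The admissible parameters `(h, z)`: the depth is at most `δ` and `h ≤ η depth^{3/2}`. -/
def adm (δ η : ℝ) : Set (ℝ × ℂ) :=
  {q | W.dep q.2 ∈ Ioc 0 δ ∧ 0 < q.1 ∧ q.1 ≤ η * (W.dep q.2 * √(W.dep q.2))}

/-- The length scale `h / √depth` of the jets. -/
def scale (q : ℝ × ℂ) : ℝ := q.1 / √(W.dep q.2)

/-- The small parameter `h / depth^{3/2}`. -/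
def small (q : ℝ × ℂ) : ℝ := q.1 / (W.dep q.2 * √(W.dep q.2))

/-- The product of the two normalising factors. -/
def M (h : ℝ) (z : ℂ) : ℝ := wellNorm W.φ W.ℓ h (W.dep z) * wellNorm W.ψ W.k h (W.dep z)

/-- The product of the two Laplace integrals, normalised. -/
def Q (h : ℝ) (z : ℂ) : ℝ := wellQuot W.φ W.ℓ h (W.dep z) * wellQuot W.ψ W.k h (W.dep z)

/-- `T` relative to the two Laplace integrals. -/
def X (h : ℝ) (z : ℂ) : ℝ :=
  W.T h z * h ^ 2 / (wellZ W.φ W.ℓ h (W.dep z) * wellZ W.ψ W.k h (W.dep z))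

/-- `T` relative to the leading terms of the two Laplace integrals. -/
def Y (h : ℝ) (z : ℂ) : ℝ := W.T h z * h ^ 2 * W.M h z

/-- The distance between the turning points. -/
def len (z : ℂ) : ℝ := wellX W.φ W.ℓ (W.dep z) + wellX W.ψ W.k (W.dep z)

/-- The logarithmic derivative of the square root of the two slopes. -/
def slopes (z : ℂ) : ℝ :=
  HalfWell.slopeLog W.φ W.ℓ (W.dep z) + HalfWell.slopeLog W.ψ W.k (W.dep z)

/-- `T` agrees with the product of the Laplace integrals to all orders. -/
structure Good (δ₁ η₁ : ℝ) : Prop where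
  left : HalfWell W.φ W.ℓ
  right : HalfWell W.ψ W.k
  lt_left : δ₁ < W.φ W.ℓ
  lt_right : δ₁ < W.ψ W.k
  bounds_left : ∃ c C, WellBounds W.φ W.ℓ δ₁ c C
  bounds_right : ∃ c C, WellBounds W.ψ W.k δ₁ c C
  η_pos : 0 < η₁
  η_le : η₁ ≤ 1
  quot_left : ∀ q ∈ W.adm δ₁ η₁, |wellQuot W.φ W.ℓ q.1 (W.dep q.2) - 1| ≤ 1 / 2
  quot_right : ∀ q ∈ W.adm δ₁ η₁, |wellQuot W.ψ W.k q.1 (W.dep q.2) - 1| ≤ 1 / 2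
  approx : ∀ q ∈ W.adm δ₁ η₁, |W.X q.1 q.2 - 1| ≤ 1 / 2
  approx_pow : ∀ N : ℕ, ∃ C : ℝ, ∀ q ∈ W.adm δ₁ η₁, |W.X q.1 q.2 - 1| ≤ C * W.small q ^ N

variable {W} {δ₁ η₁ δ₂ η₂ : ℝ}

theorem adm_mono (hδ : δ₂ ≤ δ₁) (hη : η₂ ≤ η₁) : W.adm δ₂ η₂ ⊆ W.adm δ₁ η₁ := fun _ hq =>
  ⟨⟨hq.1.1, hq.1.2.trans hδ⟩, hq.2.1, hq.2.2.trans
    (mul_le_mul_of_nonneg_right hη (mul_nonneg hq.1.1.le (Real.sqrt_nonneg _)))⟩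

section Basic

variable {q : ℝ × ℂ}

theorem sqrt_dep_pos (hq : q ∈ W.adm δ₁ η₁) : 0 < √(W.dep q.2) := Real.sqrt_pos.2 hq.1.1

theorem scale_pos (hq : q ∈ W.adm δ₁ η₁) : 0 < W.scale q := div_pos hq.2.1 (sqrt_dep_pos hq)

theorem small_pos (hq : q ∈ W.adm δ₁ η₁) : 0 < W.small q :=
  div_pos hq.2.1 (mul_pos hq.1.1 (sqrt_dep_pos hq))

theorem small_le (hq : q ∈ W.adm δ₁ η₁) : W.small q ≤ η₁ :=
  (div_le_iff₀ (mul_pos hq.1.1 (sqrt_dep_pos hq))).2 hq.2.2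

theorem scale_eq (hq : q ∈ W.adm δ₁ η₁) : W.scale q = W.small q * W.dep q.2 := by
  have h1 := sqrt_dep_pos hq
  have h2 := hq.1.1
  rw [scale, small]
  field_simp

end Basic

/-- On a ball of radius `h/√depth = η · depth` the depth is essentially constant, so the nearby
points remain admissible for slightly larger parameters, with comparable scale and small parameter.
-/
theorem exists_ball (h0 : 0 < δ₂) (h : δ₂ < δ₁) (hη : 0 < η₁) (hη1 : η₁ ≤ 1) :
    ∃ η₂ : ℝ, 0 < η₂ ∧ η₂ ≤ η₁ ∧ ∀ q ∈ W.adm δ₂ η₂, ∀ y ∈ Metric.ball q.2 (W.scale q),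
      (q.1, y) ∈ W.adm δ₁ η₁ ∧ W.dep y ∈ Icc (W.dep q.2 / 2) (2 * W.dep q.2) ∧
        |W.dep y - W.dep q.2| ≤ W.scale q ∧ W.scale q ≤ 2 * W.scale (q.1, y) ∧
        W.small (q.1, y) ≤ 4 * W.small q := by
  -- The first entry absorbs the factor of at most 4 by which `depth^{3/2}` can drop when the depth
  -- is halved; the second keeps the depth below `δ₁`.
  refine ⟨min (η₁ / 4) ((δ₁ - δ₂) / δ₂), lt_min (by positivity) (div_pos (by linarith) h0),
    (min_le_left _ _).trans (by linarith), fun q hq y hy => ?_⟩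
  have hs := sqrt_dep_pos hq
  have hd := hq.1.1
  have hh := hq.2.1
  have e1 : W.small q ≤ η₁ / 4 := (small_le hq).trans (min_le_left _ _)
  have e2 : W.small q ≤ (δ₁ - δ₂) / δ₂ := (small_le hq).trans (min_le_right _ _)
  have e3 := scale_eq hq
  have e4 := small_pos hq
  have e5 : |W.dep y - W.dep q.2| ≤ W.scale q := by
    have : W.dep y - W.dep q.2 = (y - q.2).im := by simp [dep]
    rw [this]
    refine (Complex.abs_im_le_norm _).trans ?_
    rw [← dist_eq_norm]
    exact (Metric.mem_ball.1 hy).le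
  have e6 := abs_le.1 e5
  have e7 : W.scale q ≤ W.dep q.2 / 2 := by rw [e3]; nlinarith
  have e8 : W.scale q ≤ δ₁ - δ₂ := by
    rw [e3]
    calc W.small q * W.dep q.2 ≤ (δ₁ - δ₂) / δ₂ * δ₂ :=
          mul_le_mul e2 hq.1.2 hd.le (div_nonneg (by linarith) h0.le)
      _ = _ := by field_simp
  have e9 : W.dep q.2 / 2 ≤ W.dep y := by linarith
  have hy0 : 0 < W.dep y := by linarith
  have hsy := Real.sqrt_pos.2 hy0
  have e10 : √(W.dep q.2) ≤ 2 * √(W.dep y) := by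
    rw [Real.sqrt_le_left (by positivity), mul_pow, Real.sq_sqrt hy0.le]
    linarith
  have e10' : √(W.dep y) ≤ 2 * √(W.dep q.2) := by
    rw [Real.sqrt_le_left (by positivity), mul_pow, Real.sq_sqrt hd.le]
    linarith
  have e11 : W.dep q.2 * √(W.dep q.2) ≤ 4 * (W.dep y * √(W.dep y)) := by
    calc W.dep q.2 * √(W.dep q.2) ≤ (2 * W.dep y) * (2 * √(W.dep y)) :=
          mul_le_mul (by linarith) e10 hs.le (by positivity)
      _ = _ := by ring
  refine ⟨⟨⟨hy0, ?_⟩, hh, ?_⟩, ⟨e9, by linarith⟩, e5, ?_, ?_⟩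
  · have := hq.1.2
    show W.dep y ≤ δ₁
    linarith
  · have h1 := (div_le_iff₀ (mul_pos hd hs)).1 e1
    show q.1 ≤ η₁ * (W.dep y * √(W.dep y))
    nlinarith
  · rw [scale, scale, ← mul_div_assoc, div_le_div_iff₀ hs hsy]
    nlinarith
  · rw [small, small, ← mul_div_assoc, div_le_div_iff₀ (mul_pos hy0 hsy) (mul_pos hd hs)]
    nlinarith

namespace Good

/-- The factorisation `Y = X Q` separates the two kinds of error: `X - 1` is smaller than every
power of `η`, whereas `Q - 1` is the Laplace error of size `√η`. -/
theorem pos (hW : W.Good δ₁ η₁) {q : ℝ × ℂ} (hq : q ∈ W.adm δ₁ η₁) :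
    0 < W.M q.1 q.2 ∧ W.Q q.1 q.2 ∈ Icc (1 / 4) (9 / 4) ∧ W.X q.1 q.2 ∈ Icc (1 / 2) (3 / 2) ∧
      W.Y q.1 q.2 = W.X q.1 q.2 * W.Q q.1 q.2 ∧ 0 < W.T q.1 q.2 := by
  have h1 := hW.left.wellNorm_pos hq.1.1 (hq.1.2.trans_lt hW.lt_left) hq.2.1
  have h2 := hW.right.wellNorm_pos hq.1.1 (hq.1.2.trans_lt hW.lt_right) hq.2.1
  have h3 := abs_le.1 (hW.quot_left q hq)
  have h4 := abs_le.1 (hW.quot_right q hq)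
  have h5 := abs_le.1 (hW.approx q hq)
  have hM : 0 < W.M q.1 q.2 := mul_pos h1 h2
  have hQ : W.Q q.1 q.2 ∈ Icc (1 / 4) (9 / 4) := by
    rw [Q]
    constructor <;> nlinarith
  have hX : W.X q.1 q.2 ∈ Icc (1 / 2) (3 / 2) := ⟨by linarith, by linarith⟩
  have hQe : W.Q q.1 q.2 = wellZ W.φ W.ℓ q.1 (W.dep q.2) * wellZ W.ψ W.k q.1 (W.dep q.2)
      * W.M q.1 q.2 := by
    rw [Q, M, wellQuot_eq, wellQuot_eq]; ring
  have hZ : wellZ W.φ W.ℓ q.1 (W.dep q.2) * wellZ W.ψ W.k q.1 (W.dep q.2) ≠ 0 := fun h0 => by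
    rw [h0, zero_mul] at hQe
    linarith [hQ.1]
  have hY : W.Y q.1 q.2 = W.X q.1 q.2 * W.Q q.1 q.2 := by
    rw [hQe, X, Y, ← mul_assoc, div_mul_cancel₀ _ hZ]
  refine ⟨hM, hQ, hX, hY, ?_⟩
  have hY0 : 0 < W.Y q.1 q.2 := by rw [hY]; nlinarith [hX.1, hQ.1]
  have hh := hq.2.1
  rw [Y] at hY0
  exact pos_of_mul_pos_left (pos_of_mul_pos_left hY0 hM.le) (by positivity)

theorem eventually_mem {q : ℝ × ℂ} (hq : q ∈ W.adm δ₂ η₂) (hδ : δ₂ < δ₁) (hη : η₂ < η₁) :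
    ∀ᶠ y in 𝓝 q.2, (q.1, y) ∈ W.adm δ₁ η₁ := by
  have hc : Continuous W.dep := Complex.continuous_im.sub continuous_const
  have h1 : ∀ᶠ y in 𝓝 q.2, W.dep y ∈ Ioo 0 δ₁ :=
    hc.continuousAt (isOpen_Ioo.mem_nhds ⟨hq.1.1, hq.1.2.trans_lt hδ⟩)
  have h2 : ∀ᶠ y in 𝓝 q.2, q.1 < η₁ * (W.dep y * √(W.dep y)) := by
    refine Continuous.continuousAt (f := fun y => η₁ * (W.dep y * √(W.dep y)))
      (continuous_const.mul (hc.mul (Real.continuous_sqrt.comp hc))) (lt_mem_nhds ?_)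
    exact hq.2.2.trans_lt (mul_lt_mul_of_pos_right hη (mul_pos hq.1.1 (sqrt_dep_pos hq)))
  filter_upwards [h1, h2] with y hy1 hy2
  exact ⟨⟨hy1.1, hy1.2.le⟩, hq.2.1, hy2.le⟩

theorem eta_le (hW : W.Good δ₁ η₁) {q : ℝ × ℂ} (hq : q ∈ W.adm δ₁ η₁) :
    q.1 ≤ W.dep q.2 * √(W.dep q.2) :=
  hq.2.2.trans (mul_le_of_le_one_left (mul_nonneg hq.1.1.le (Real.sqrt_nonneg _)) hW.η_le)

theorem sqrt_small_le (hW : W.Good δ₁ η₁) {q : ℝ × ℂ} (hq : q ∈ W.adm δ₁ η₁) : √(W.small q) ≤ 1 :=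
  Real.sqrt_le_one.2 ((small_le hq).trans hW.η_le)

theorem jets_quot (hW : W.Good δ₁ η₁) (n : ℕ) :
    JetBound n (fun (i : W.adm δ₁ η₁) y => wellQuot W.φ W.ℓ i.1.1 (W.dep y) - 1)
        (fun i => i.1.2) (fun i => W.scale i.1) (fun i => √(W.small i.1)) ∧
      JetBound n (fun (i : W.adm δ₁ η₁) y => wellQuot W.ψ W.k i.1.1 (W.dep y) - 1)
        (fun i => i.1.2) (fun i => W.scale i.1) (fun i => √(W.small i.1)) := by
  obtain ⟨c, C, hb⟩ := hW.bounds_left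
  obtain ⟨c', C', hb'⟩ := hW.bounds_right
  exact ⟨(hW.left.jets_wellQuot hW.lt_left hb (hp := fun i : W.adm δ₁ η₁ => i.1.1)
      (d := fun i => W.dep i.1.2) (fun i => i.2.2.1) (fun i => i.2.1)
      (fun i => hW.eta_le i.2) n).im (fun i => (scale_pos i.2).le),
    (hW.right.jets_wellQuot hW.lt_right hb' (hp := fun i : W.adm δ₁ η₁ => i.1.1)
      (d := fun i => W.dep i.1.2) (fun i => i.2.2.1) (fun i => i.2.1)
      (fun i => hW.eta_le i.2) n).im (fun i => (scale_pos i.2).le)⟩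

theorem jets_Q (hW : W.Good δ₁ η₁) (n : ℕ) :
    JetBound n (fun (i : W.adm δ₁ η₁) y => W.Q i.1.1 y - 1)
    (fun i => i.1.2) (fun i => W.scale i.1) (fun i => √(W.small i.1)) :=
  (hW.jets_quot n).1.one_add_mul (hW.jets_quot n).2 (fun i => (scale_pos i.2).le)
    (fun _ => Real.sqrt_nonneg _) (C := 1) (fun i => hW.sqrt_small_le i.2)

theorem jets_M (hW : W.Good δ₁ η₁) (n : ℕ) :
    JetBound n (fun (i : W.adm δ₁ η₁) y => W.M i.1.1 y / W.M i.1.1 i.1.2)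
    (fun i => i.1.2) (fun i => W.scale i.1) 1 := by
  obtain ⟨c, C, hb⟩ := hW.bounds_left
  obtain ⟨c', C', hb'⟩ := hW.bounds_right
  have e1 := (hW.left.jets_wellNorm hW.lt_left hb (hp := fun i : W.adm δ₁ η₁ => i.1.1)
      (d := fun i => W.dep i.1.2) (fun i => i.2.2.1) (fun i => i.2.1)
      (fun i => hW.eta_le i.2) n).im (fun i => (scale_pos i.2).le)
  have e2 := (hW.right.jets_wellNorm hW.lt_right hb' (hp := fun i : W.adm δ₁ η₁ => i.1.1)
      (d := fun i => W.dep i.1.2) (fun i => i.2.2.1) (fun i => i.2.1)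
      (fun i => hW.eta_le i.2) n).im (fun i => (scale_pos i.2).le)
  refine (e1.mul_one e2 (fun i => (scale_pos i.2).le) (fun _ => zero_le_one)).congr fun i =>
    Eventually.of_forall fun y => ?_
  simp only [M]
  rw [mul_div_mul_comm]
  rfl

/-- Supplies the uniform bound on balls of radius `scale` that the Cauchy estimates for the
resolvent require. -/
theorem exists_T_le (hW : W.Good δ₁ η₁) (h0 : 0 < δ₂) (h : δ₂ < δ₁) :
    ∃ η₂ : ℝ, 0 < η₂ ∧ η₂ ≤ η₁ ∧ ∃ D : ℝ, 0 < D ∧ ∀ q ∈ W.adm δ₂ η₂,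
      ∀ y ∈ Metric.ball q.2 (W.scale q), (q.1, y) ∈ W.adm δ₁ η₁ ∧
        W.T q.1 y ≤ D * W.T q.1 q.2 := by
  obtain ⟨η₂, hη2, hle, hball⟩ := exists_ball (W := W) h0 h hW.η_pos hW.η_le
  obtain ⟨c, C, hb⟩ := hW.bounds_left
  obtain ⟨c', C', hb'⟩ := hW.bounds_right
  obtain ⟨D₁, hD₁, h1⟩ := hW.left.wellNorm_div_le hW.lt_left hb
  obtain ⟨D₂, hD₂, h2⟩ := hW.right.wellNorm_div_le hW.lt_right hb'
  refine ⟨η₂, hη2, hle, 27 * (D₁ * D₂), by positivity, fun q hq y hy => ?_⟩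
  obtain ⟨k1, k2, k3, -, -⟩ := hball q hq y hy
  refine ⟨k1, ?_⟩
  have hq1 := adm_mono h.le hle hq
  obtain ⟨a1, a2, a3, a4, a5⟩ := hW.pos hq1
  obtain ⟨b1, b2, b3, b4, b5⟩ := hW.pos k1
  have e1 := h1 _ hq1.1 _ k1.1 q.1 hq.2.1 k2 k3
  have e2 := h2 _ hq1.1 _ k1.1 q.1 hq.2.1 k2 k3
  have hM : W.M q.1 q.2 ≤ D₁ * D₂ * W.M q.1 y := by
    calc W.M q.1 q.2 ≤ (D₁ * wellNorm W.φ W.ℓ q.1 (W.dep y))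
          * (D₂ * wellNorm W.ψ W.k q.1 (W.dep y)) :=
          mul_le_mul e1 e2 (hW.right.wellNorm_pos hq1.1.1 (hq1.1.2.trans_lt hW.lt_right)
            hq.2.1).le (mul_nonneg hD₁.le (hW.left.wellNorm_pos k1.1.1
              (k1.1.2.trans_lt hW.lt_left) hq.2.1).le)
      _ = _ := by rw [M]; ring
  simp only at b1 b2 b3 b4 b5
  have hh : 0 < q.1 ^ 2 := by have := hq.2.1; positivity
  have e3 : W.Y q.1 y ≤ 27 * W.Y q.1 q.2 := by
    have g1 : W.X q.1 y * W.Q q.1 y ≤ 3 / 2 * (9 / 4) :=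
      mul_le_mul b3.2 b2.2 (by linarith [b2.1]) (by norm_num)
    have g2 : 1 / 2 * (1 / 4) ≤ W.X q.1 q.2 * W.Q q.1 q.2 :=
      mul_le_mul a3.1 a2.1 (by norm_num) (by linarith [a3.1])
    rw [a4, b4]
    linarith
  rw [Y, Y] at e3
  refine le_of_mul_le_mul_right ?_ (mul_pos hh b1)
  calc W.T q.1 y * (q.1 ^ 2 * W.M q.1 y) ≤ 27 * (W.T q.1 q.2 * q.1 ^ 2 * W.M q.1 q.2) := by
        linarith
    _ ≤ 27 * (W.T q.1 q.2 * q.1 ^ 2 * (D₁ * D₂ * W.M q.1 y)) := by gcongr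
    _ = _ := by ring

/-- Crude jets of the error, from those of `T`. -/
theorem jets_X_crude (hW : W.Good δ₁ η₁) (hδ : δ₂ < δ₁) (hη : η₂ < η₁) {n : ℕ}
    (hT : JetBound n (fun (i : W.adm δ₂ η₂) y => W.T i.1.1 y / W.T i.1.1 i.1.2)
      (fun i => i.1.2) (fun i => W.scale i.1) 1) :
    JetBound n (fun (i : W.adm δ₂ η₂) y => W.X i.1.1 y - 1)
      (fun i => i.1.2) (fun i => W.scale i.1) 1 := by
  have hsub : ∀ i : W.adm δ₂ η₂, i.1 ∈ W.adm δ₁ η₁ := fun i => adm_mono hδ.le hη.le i.2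
  let e : W.adm δ₂ η₂ → W.adm δ₁ η₁ := fun i => ⟨i.1, hsub i⟩
  have hr : ∀ i : W.adm δ₂ η₂, 0 < W.scale i.1 := fun i => scale_pos i.2
  have hr' : ∀ i : W.adm δ₂ η₂, 0 ≤ W.scale i.1 := fun i => (hr i).le
  have h1 := (hW.jets_M n).reindex e
  have hc1 : JetBound n (fun (_ : W.adm δ₂ η₂) (_ : ℂ) => (1 : ℝ)) (fun i => i.1.2)
      (fun i => W.scale i.1) 1 :=
    JetBound.const (fun _ => 1) (C := 1) (by simp) (fun _ => zero_le_one)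
  have h2 : JetBound n (fun (i : W.adm δ₂ η₂) y => W.Q i.1.1 y) (fun i => i.1.2)
      (fun i => W.scale i.1) 1 := by
    refine ((((hW.jets_Q n).reindex e).weight (w' := 1) (fun _ => Real.sqrt_nonneg _) 1
      (fun i => ?_)).add hc1 hr').congr fun i => Eventually.of_forall fun y => ?_
    · rw [Pi.one_apply, mul_one]
      exact hW.sqrt_small_le (hsub i)
    · exact (sub_add_cancel _ _).symm
  have h3 := h2.inv hr (fun _ => zero_lt_one) (c := 1 / 4) (by norm_num)
    (fun i => by rw [Pi.one_apply, mul_one]; exact (hW.pos (hsub i)).2.1.1)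
  have h4 : JetBound n (fun (i : W.adm δ₂ η₂) y => (W.Q i.1.1 y)⁻¹) (fun i => i.1.2)
      (fun i => W.scale i.1) 1 := h3.weight (fun i => by simp) 1 (fun i => by simp)
  have hc2 : JetBound n (fun (i : W.adm δ₂ η₂) (_ : ℂ) => W.Y i.1.1 i.1.2) (fun i => i.1.2)
      (fun i => W.scale i.1) 1 := by
    refine JetBound.const _ (C := 3 / 2 * (9 / 4)) (fun i => ?_) (fun _ => zero_le_one)
    obtain ⟨-, a2, a3, a4, -⟩ := hW.pos (hsub i)
    rw [Pi.one_apply, mul_one, a4, Real.norm_eq_abs, abs_of_nonneg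
      (mul_nonneg (by linarith [a3.1]) (by linarith [a2.1]))]
    exact mul_le_mul a3.2 a2.2 (by linarith [a2.1]) (by norm_num)
  have h01 : ∀ i : W.adm δ₂ η₂, 0 ≤ (1 : W.adm δ₂ η₂ → ℝ) i := fun _ => zero_le_one
  refine (((((hT.mul_one h1 hr' h01).mul_one hc2 hr' h01).mul_one h4 hr' h01)).sub hc1
    hr').congr fun i => ?_
  filter_upwards [eventually_mem i.2 hδ hη] with y hy
  obtain ⟨a1, a2, a3, a4, a5⟩ := hW.pos (hsub i)
  obtain ⟨b1, b2, b3, b4, b5⟩ := hW.pos hy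
  simp only at b1 b2 b3 b4 b5
  have hq0 : W.Q i.1.1 y ≠ 0 := by linarith [b2.1]
  have : W.X i.1.1 y = W.Y i.1.1 y * (W.Q i.1.1 y)⁻¹ := by rw [b4]; field_simp
  rw [this, Y, Y]
  simp only [e]
  field_simp

/-- Jets of the relative error `Y - 1`. -/
theorem jets_Y (hW : W.Good δ₁ η₁) (hδ : δ₂ < δ₁) (hη : η₂ < η₁) (hη0 : 0 < η₂)
    (hT : ∀ n, JetBound n (fun (i : W.adm δ₂ η₂) y => W.T i.1.1 y / W.T i.1.1 i.1.2)
      (fun i => i.1.2) (fun i => W.scale i.1) 1) {δ₃ : ℝ} (hδ3 : δ₃ < δ₂) (h0 : 0 < δ₃) :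
    ∃ η₃ : ℝ, 0 < η₃ ∧ η₃ ≤ η₂ ∧ ∀ n, JetBound n (fun (i : W.adm δ₃ η₃) y => W.Y i.1.1 y - 1)
      (fun i => i.1.2) (fun i => W.scale i.1) (fun i => √(W.small i.1)) := by
  obtain ⟨η₃, hη3, hle, hball⟩ := exists_ball (W := W) h0 hδ3 hη0 (hη.le.trans hW.η_le)
  have hsub : ∀ i : W.adm δ₃ η₃, i.1 ∈ W.adm δ₁ η₁ := fun i =>
    adm_mono (hδ3.le.trans hδ.le) (hle.trans hη.le) i.2
  have hX := fun n => hW.jets_X_crude hδ hη (hT n)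
  refine ⟨η₃, hη3, hle, fun n => ?_⟩
  have hr : ∀ i : W.adm δ₃ η₃, 0 < W.scale i.1 := fun i => scale_pos i.2
  -- The crude jets hold at every admissible base point, hence at all points of the ball up to
  -- comparable scales. Together with `X - 1 = O(η^N)` on the ball, interpolation gives jets of
  -- weight `η ≤ √η`.
  have hsm := JetBound.of_small (f := fun (i : W.adm δ₃ η₃) y => W.X i.1.1 y - 1)
    (x := fun i => i.1.2) (r := fun i => W.scale i.1) (η := fun i => W.small i.1) hr
    (fun i => small_pos i.2) (fun i => (small_le (hsub i)).trans hW.η_le)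
    (fun i y hy => (hX 0).1 ⟨(i.1.1, y), (hball i.1 i.2 y hy).1⟩)
    (fun k => by
      obtain ⟨B, hB⟩ := (hX k).2 k le_rfl
      refine ⟨2 ^ k * B, fun i y hy => ?_⟩
      obtain ⟨k1, -, -, k4, -⟩ := hball i.1 i.2 y hy
      have h1 := hB ⟨(i.1.1, y), k1⟩
      simp only [Pi.one_apply, mul_one] at h1
      calc _ ≤ ‖iteratedFDeriv ℝ k (fun y => W.X i.1.1 y - 1) y‖
            * (2 * W.scale (i.1.1, y)) ^ k := by
            gcongr
            exact (hr i).le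
        _ = 2 ^ k * (‖iteratedFDeriv ℝ k (fun y => W.X i.1.1 y - 1) y‖
            * W.scale (i.1.1, y) ^ k) := by ring
        _ ≤ _ := mul_le_mul_of_nonneg_left h1 (by positivity))
    (fun N => by
      obtain ⟨C, hC⟩ := hW.approx_pow N
      refine ⟨|C| * 4 ^ N, fun i y hy => ?_⟩
      obtain ⟨k1, -, -, -, k5⟩ := hball i.1 i.2 y hy
      have k1' := adm_mono hδ.le hη.le k1
      rw [Real.norm_eq_abs]
      refine (hC _ k1').trans ?_
      have := (small_pos k1').le
      calc C * W.small (i.1.1, y) ^ N ≤ |C| * (4 * W.small i.1) ^ N := by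
            gcongr
            exact le_abs_self C
        _ = _ := by ring) n 1
  have h1 := hsm.weight (w' := fun i => √(W.small i.1)) (fun i => by
      rw [pow_one]
      exact (small_pos i.2).le) 1 (fun i => by
    rw [pow_one, one_mul]
    have e1 := hW.sqrt_small_le (hsub i)
    have e2 := Real.mul_self_sqrt (small_pos i.2).le
    nlinarith [Real.sqrt_nonneg (W.small i.1)])
  have h2 := (hW.jets_Q n).reindex (fun i : W.adm δ₃ η₃ => (⟨i.1, hsub i⟩ : W.adm δ₁ η₁))
  refine (h1.one_add_mul h2 (fun i => (hr i).le) (fun _ => Real.sqrt_nonneg _) (C := 1)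
    (fun i => hW.sqrt_small_le (hsub i))).congr fun i => ?_
  filter_upwards [eventually_mem i.2 (hδ3.trans hδ) (hle.trans_lt hη)] with y hy
  have := (hW.pos hy).2.2.2.1
  simp only at this
  rw [this]

end Good

end WellPair

/-! ### The gradient of the squared norm and the relative error of the overlap. -/

namespace WellPair

variable {W : WellPair} {δ₁ η₁ δ₂ η₂ : ℝ}

variable (W) in
/-- The relative correction to the logarithmic derivative of `T` in direction `v`. -/
def corr (h : ℝ) (z v : ℂ) : ℝ :=
  h / 2 * (W.len z)⁻¹ * ((W.Y h z)⁻¹ * fderiv ℝ (W.Y h) z v - v.im * W.slopes z)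

variable (W) in
/-- The relative error of the overlap. -/
def K (h : ℝ) (z : ℂ) : ℝ :=
  (√(1 + (W.Y h z - 1)))⁻¹
    * √(W.corr h z 1 ^ 2 + (1 + W.corr h z Complex.I) ^ 2) - 1

namespace Good

theorem len_pos (hW : W.Good δ₁ η₁) {q : ℝ × ℂ} (hq : q ∈ W.adm δ₁ η₁) : 0 < W.len q.2 :=
  add_pos (hW.left.wellX_spec hq.1.1 (hq.1.2.trans_lt hW.lt_left)).1.1
    (hW.right.wellX_spec hq.1.1 (hq.1.2.trans_lt hW.lt_right)).1.1

/-- From `T = Y / (h² M)`, the logarithmic derivative of `T` is that of `Y` minus that of `M`. The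
latter is `slopes - (2/h) len` times `d Im z`. The term `(2/h) len` dominates, and `corr` collects
the others relative to it. -/
theorem fderiv_T (hW : W.Good δ₁ η₁) {q : ℝ × ℂ} (hq : q ∈ W.adm δ₁ η₁)
    (hT : DifferentiableAt ℝ (W.T q.1) q.2) (v : ℂ) : fderiv ℝ (W.T q.1) q.2 v
      = 2 * W.T q.1 q.2 * W.len q.2 / q.1 * (v.im + W.corr q.1 q.2 v) := by
  obtain ⟨a1, a2, a3, a4, a5⟩ := hW.pos hq
  have hh := hq.2.1
  have hlen := hW.len_pos hq
  have e1 := (hW.left.wellNorm_hasDerivAt hq.1.1 (hq.1.2.trans_lt hW.lt_left) hh).mul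
    (hW.right.wellNorm_hasDerivAt hq.1.1 (hq.1.2.trans_lt hW.lt_right) hh)
  have e2 : HasFDerivAt W.dep Complex.imCLM q.2 := Complex.imCLM.hasFDerivAt.sub_const _
  have e3 := e1.comp_hasFDerivAt q.2 e2
  have e4 : HasFDerivAt (W.M q.1)
      ((W.M q.1 q.2 * (W.slopes q.2 - 2 / q.1 * W.len q.2)) • Complex.imCLM) q.2 := by
    refine e3.congr_fderiv ?_
    congr 1
    rw [M, slopes, len]
    ring
  have e5 : HasFDerivAt (W.Y q.1) _ q.2 := (hT.hasFDerivAt.mul_const (q.1 ^ 2)).mul e4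
  have hY0 : W.Y q.1 q.2 = W.T q.1 q.2 * q.1 ^ 2 * W.M q.1 q.2 := rfl
  have e6 : fderiv ℝ (W.Y q.1) q.2 v = W.T q.1 q.2 * q.1 ^ 2 * (W.M q.1 q.2
      * (W.slopes q.2 - 2 / q.1 * W.len q.2) * v.im)
      + W.M q.1 q.2 * (q.1 ^ 2 * fderiv ℝ (W.T q.1) q.2 v) := by
    rw [e5.fderiv]
    simp
  rw [corr, e6, hY0]
  field_simp
  ring

theorem jets_len (hW : W.Good δ₁ η₁) (n : ℕ) :
    JetBound n (fun (i : W.adm δ₁ η₁) y => i.1.1 / 2 * (W.len y)⁻¹)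
    (fun i => i.1.2) (fun i => W.scale i.1) (fun i => W.scale i.1) ∧
    JetBound n (fun (_ : W.adm δ₁ η₁) y => W.slopes y)
      (fun i => i.1.2) (fun i => W.scale i.1) (fun i => (W.dep i.1.2)⁻¹) := by
  obtain ⟨c, C, hb⟩ := hW.bounds_left
  obtain ⟨c', C', hb'⟩ := hW.bounds_right
  have hr : ∀ i : W.adm δ₁ η₁, 0 < W.scale i.1 := fun i => scale_pos i.2
  have hr' : ∀ i : W.adm δ₁ η₁, 0 ≤ W.scale i.1 := fun i => (hr i).le
  have hrd : ∀ i : W.adm δ₁ η₁, W.scale i.1 ≤ W.dep i.1.2 := fun i => by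
    rw [scale_eq i.2]
    exact mul_le_of_le_one_left i.2.1.1.le ((small_le i.2).trans hW.η_le)
  have hs : ∀ i : W.adm δ₁ η₁, 0 < √(W.dep i.1.2) := fun i => sqrt_dep_pos i.2
  have hd : ∀ i : W.adm δ₁ η₁, W.dep i.1.2 ∈ Ioc 0 δ₁ := fun i => i.2.1
  have e1 := (((hW.left.jets_family hW.lt_left hb hd n).1.scale hr' hrd).im hr').add
    (((hW.right.jets_family hW.lt_right hb' hd n).1.scale hr' hrd).im hr') hr'
  have e2 := e1.inv hr hs hb.c_pos (fun i => by
    have h1 := hb.X_ge _ (hd i)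
    have h2 := (hW.right.wellX_spec (hd i).1 ((hd i).2.trans_lt hW.lt_right)).1.1
    exact h1.trans (le_add_of_nonneg_right h2.le))
  refine ⟨(e2.const_mul (fun i => i.1.1 / 2) hr' (fun i => (inv_pos.2 (hs i)).le)).weight
    (fun i => mul_nonneg (abs_nonneg _) (inv_pos.2 (hs i)).le) 1 (fun i => ?_),
    (((hW.left.jets_slopeLog hW.lt_left hb hd n).scale hr' hrd).im hr').add
    (((hW.right.jets_slopeLog hW.lt_right hb' hd n).scale hr' hrd).im hr') hr'⟩
  have hh := i.2.2.1
  have hs' := hs i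
  rw [scale, abs_of_pos (by positivity), one_mul, div_eq_mul_inv i.1.1 (√(W.dep i.1.2))]
  exact mul_le_mul_of_nonneg_right (by linarith) (inv_pos.2 hs').le

/-- Jets of the relative error of the overlap. -/
theorem jets_K (hW : W.Good δ₁ η₁) (hδ : δ₂ ≤ δ₁) (hη : η₂ ≤ η₁) (h0 : 0 < η₂)
    (hY : ∀ n, JetBound n (fun (i : W.adm δ₂ η₂) y => W.Y i.1.1 y - 1)
      (fun i => i.1.2) (fun i => W.scale i.1) (fun i => √(W.small i.1))) :
    ∃ η₃ : ℝ, 0 < η₃ ∧ η₃ ≤ η₂ ∧ ∀ n, JetBound n (fun (i : W.adm δ₂ η₃) => W.K i.1.1)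
      (fun i => i.1.2) (fun i => W.scale i.1) (fun i => √(W.small i.1)) := by
  have hsub : ∀ i : W.adm δ₂ η₂, i.1 ∈ W.adm δ₁ η₁ := fun i => adm_mono hδ hη i.2
  let e : W.adm δ₂ η₂ → W.adm δ₁ η₁ := fun i => ⟨i.1, hsub i⟩
  have hr : ∀ i : W.adm δ₂ η₂, 0 < W.scale i.1 := fun i => scale_pos i.2
  have hr' : ∀ i : W.adm δ₂ η₂, 0 ≤ W.scale i.1 := fun i => (hr i).le
  have hε : ∀ i : W.adm δ₂ η₂, 0 ≤ √(W.small i.1) := fun i => Real.sqrt_nonneg _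
  have hε1 : ∀ i : W.adm δ₂ η₂, √(W.small i.1) ≤ 1 := fun i => hW.sqrt_small_le (hsub i)
  -- A derivative of `Y` costs one power of `scale`, and the prefactor `h / (2 len)` is of the size
  -- of `scale` and gives it back. The contribution of the slopes, of size `1/depth = η/scale`, is
  -- even smaller.
  have hcorr : ∀ v n, JetBound n (fun (i : W.adm δ₂ η₂) y => W.corr i.1.1 y v)
      (fun i => i.1.2) (fun i => W.scale i.1) (fun i => √(W.small i.1)) := by
    intro v n
    have e1 := ((hW.jets_len n).1.reindex e)
    have e2 := ((hW.jets_len n).2.reindex e).const_mul (fun _ => v.im) hr'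
      (fun i => (inv_pos.2 (hsub i).1.1).le)
    have hc1 : JetBound n (fun (_ : W.adm δ₂ η₂) (_ : ℂ) => (1 : ℝ)) (fun i => i.1.2)
        (fun i => W.scale i.1) 1 :=
      JetBound.const (fun _ => 1) (C := 1) (by simp) (fun _ => zero_le_one)
    have e3 : JetBound n (fun (i : W.adm δ₂ η₂) y => W.Y i.1.1 y) (fun i => i.1.2)
        (fun i => W.scale i.1) 1 := by
      refine (((hY n).weight (w' := 1) hε 1 (fun i => ?_)).add hc1 hr').congr fun i =>
        Eventually.of_forall fun y => (sub_add_cancel _ _).symm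
      rw [Pi.one_apply, mul_one]
      exact hε1 i
    have e4 := (e3.inv hr (fun _ => zero_lt_one) (c := 1 / 2 * (1 / 4)) (by norm_num)
      (fun i => by
        obtain ⟨-, a2, a3, a4, -⟩ := hW.pos (hsub i)
        rw [Pi.one_apply, mul_one, a4]
        exact mul_le_mul a3.1 a2.1 (by norm_num) (by linarith [a3.1]))).weight (w' := 1)
      (fun i => by simp) 1 (fun i => by simp)
    have e5 : JetBound n (fun (i : W.adm δ₂ η₂) y => fderiv ℝ (W.Y i.1.1) y v)
        (fun i => i.1.2) (fun i => W.scale i.1) (fun i => √(W.small i.1) / W.scale i.1) := by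
      refine (((hY (n + 1)).fderiv hr).clm (ContinuousLinearMap.apply ℝ ℝ v) hr').congr fun i =>
        Eventually.of_forall fun y => ?_
      simp only [ContinuousLinearMap.apply_apply]
      rw [fderiv_sub_const]
    have hw5 : ∀ i : W.adm δ₂ η₂, 0 ≤ √(W.small i.1) / W.scale i.1 := fun i =>
      div_nonneg (hε i) (hr' i)
    have e6 := e5.mul_one e4 hr' hw5
    have e7 := e2.weight (w' := fun i => √(W.small i.1) / W.scale i.1)
      (fun i => mul_nonneg (abs_nonneg _) (inv_pos.2 (hsub i).1.1).le) |v.im| (fun i => by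
        refine mul_le_mul_of_nonneg_left ?_ (abs_nonneg _)
        have hd := i.2.1.1
        rw [scale_eq i.2, le_div_iff₀ (mul_pos (small_pos i.2) hd), mul_comm (W.small _),
          inv_mul_cancel_left₀ hd.ne']
        have := Real.mul_self_sqrt (small_pos i.2).le
        nlinarith [hε i, hε1 i])
    refine ((e1.mul (e6.sub e7 hr') hr' hr' hw5).congr fun i =>
      Eventually.of_forall fun y => ?_).weight (fun i => mul_nonneg (hr' i) (hw5 i)) 1
      (fun i => ?_)
    · simp only [corr, e]
      rw [mul_comm (W.Y i.1.1 y)⁻¹]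
    · rw [one_mul]
      exact (mul_div_cancel₀ _ (hr i).ne').le
  have hF : ∀ n, JetBound n (fun (i : W.adm δ₂ η₂) y =>
      (W.Y i.1.1 y - 1, W.corr i.1.1 y 1, W.corr i.1.1 y Complex.I))
      (fun i => i.1.2) (fun i => W.scale i.1) (fun i => √(W.small i.1)) := fun n =>
    (hY n).prodMk ((hcorr 1 n).prodMk (hcorr Complex.I n) hr') hr'
  obtain ⟨B, hB⟩ := (hF 0).norm_le
  set B' := |B| + 1 with hB'
  have hB'0 : 0 < B' := by rw [hB']; linarith [abs_nonneg B]
  -- This threshold keeps the triple of errors in the ball of radius 1/2, where `1 + p.1` and `1 +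
  -- p.2.2` stay positive and both square roots are smooth.
  refine ⟨min η₂ ((2 * B')⁻¹ ^ 2), lt_min h0 (by positivity), min_le_left _ _, fun n => ?_⟩
  let e' : W.adm δ₂ (min η₂ ((2 * B')⁻¹ ^ 2)) → W.adm δ₂ η₂ := fun i =>
    ⟨i.1, adm_mono le_rfl (min_le_left _ _) i.2⟩
  have hO : IsOpen {p : ℝ × ℝ × ℝ | -1 < p.1 ∧ -1 < p.2.2} :=
    (isOpen_lt continuous_const continuous_fst).inter
      (isOpen_lt continuous_const (continuous_snd.comp continuous_snd))
  have hG : ContDiffOn ℝ ∞ (fun p : ℝ × ℝ × ℝ => (√(1 + p.1))⁻¹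
      * √(p.2.1 ^ 2 + (1 + p.2.2) ^ 2)) {p : ℝ × ℝ × ℝ | -1 < p.1 ∧ -1 < p.2.2} := by
    refine ContDiffOn.mul (ContDiffOn.inv (ContDiffOn.sqrt ?_ fun p hp => ?_) fun p hp => ?_)
      (ContDiffOn.sqrt ?_ fun p hp => ?_)
    · exact (contDiff_const.add contDiff_fst).contDiffOn
    · exact (by linarith [hp.1] : 0 < 1 + p.1).ne'
    · exact (Real.sqrt_pos.2 (by linarith [hp.1] : 0 < 1 + p.1)).ne'
    · exact ((contDiff_snd.fst.pow 2).add
        ((contDiff_const.add contDiff_snd.snd).pow 2)).contDiffOn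
    · have : 0 < 1 + p.2.2 := by linarith [hp.2]
      positivity
  have := ((hF n).reindex e').comp_sub (g := fun p : ℝ × ℝ × ℝ => (√(1 + p.1))⁻¹
    * √(p.2.1 ^ 2 + (1 + p.2.2) ^ 2)) (K := Metric.closedBall 0 (1 / 2)) (fun i => hε (e' i))
    (C := 1) (fun i => hε1 (e' i)) hO hG (isCompact_closedBall _ _) (convex_closedBall _ _)
    (fun p hp => ?_) (by simp) (fun i => ?_) (fun i => hr (e' i))
  · refine this.congr fun i => Eventually.of_forall fun y => ?_
    simp [K, e']
  · rw [mem_closedBall_zero_iff] at hp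
    have h1 := (norm_fst_le p).trans hp
    have h2 := (norm_snd_le p.2).trans ((norm_snd_le p).trans hp)
    rw [Real.norm_eq_abs] at h1 h2
    exact ⟨by linarith [(abs_le.1 h1).1], by linarith [(abs_le.1 h2).1]⟩
  · rw [mem_closedBall_zero_iff]
    refine (hB (e' i)).trans ?_
    have h1 : √(W.small (e' i).1) ≤ (2 * B')⁻¹ := by
      rw [Real.sqrt_le_left (by positivity)]
      exact (small_le i.2).trans (min_le_right _ _)
    calc B * √(W.small (e' i).1) ≤ B' * (2 * B')⁻¹ :=
          mul_le_mul (by rw [hB']; linarith [le_abs_self B]) h1 (hε _) hB'0.le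
      _ = 1 / 2 := by field_simp

/-- The logarithmic derivative of `T` in terms of the relative error. -/
theorem norm_fderiv_T (hW : W.Good δ₁ η₁) {q : ℝ × ℂ} (hq : q ∈ W.adm δ₁ η₁)
    (hT : DifferentiableAt ℝ (W.T q.1) q.2) :
    ‖fderiv ℝ (W.T q.1) q.2‖ = 2 * W.T q.1 q.2 * √(W.T q.1 q.2)
      * (W.len q.2 * √(W.M q.1 q.2) * (1 + W.K q.1 q.2)) := by
  obtain ⟨a1, a2, a3, a4, a5⟩ := hW.pos hq
  have hh := hq.2.1
  have hlen := hW.len_pos hq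
  rw [norm_clm_complex, hW.fderiv_T hq hT, hW.fderiv_T hq hT, K, add_sub_cancel,
    add_sub_cancel, Y, Real.sqrt_mul (by positivity), Real.sqrt_mul a5.le, Real.sqrt_sq hh.le,
    Complex.one_im, Complex.I_im, zero_add, mul_pow, mul_pow, ← mul_add,
    Real.sqrt_mul (by positivity), Real.sqrt_sq (by positivity)]
  have h1 := Real.sqrt_pos.2 a5
  have h2 := Real.sqrt_pos.2 a1
  field_simp

end Good

end WellPair

/-! ### The overlap for energies below the mean. -/

section Lower

variable {g : S1 → ℂ} {a b : ℝ}

/-- The two half wells at the minimum of `Im g`, with the squared norm of the resolvent. -/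
def potPair (hg : IsPotential g a b) : WellPair where
  φ := wellLeft (imLift g) a
  ℓ := a - b + 2 * Real.pi
  ψ := wellRight (imLift g) a
  k := b - a
  m := imLift g a
  T h z := ‖resOp hg.smooth h z‖ ^ 2

/-- The resolvent norm is a good function for the two half wells. -/
theorem exists_good (hg : IsPotential g a b) {δ₁ : ℝ} (h0 : 0 < δ₁)
    (h1 : δ₁ < meanIm g - imLift g a) :
    ∃ η₁ : ℝ, (potPair hg).Good δ₁ η₁ ∧ ∀ q ∈ (potPair hg).adm δ₁ η₁,
      0 < ‖resOp hg.smooth q.1 q.2‖ ∧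
      ∃ Λ ≤ 3 / 2 * ‖resOp hg.smooth q.1 q.2‖ ^ 2, PairBound (resOp hg.smooth q.1 q.2) Λ := by
  have hmb := hg.meanIm_le
  have hl : δ₁ < wellLeft (imLift g) a (a - b + 2 * Real.pi) := by
    rw [IsPotential.wellLeft_end]; linarith
  have hr : δ₁ < wellRight (imLift g) a (b - a) := by rw [IsPotential.wellRight_end]; linarith
  obtain ⟨c, C, hb⟩ := hg.halfWell_left.exists_bounds h0 hl
  obtain ⟨c', C', hb'⟩ := hg.halfWell_right.exists_bounds h0 hr
  obtain ⟨ηl, hηl, _, _, hql⟩ := hg.halfWell_left.exists_wellZ_ge hl hb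
  obtain ⟨ηr, hηr, _, _, hqr⟩ := hg.halfWell_right.exists_wellZ_ge hr hb'
  obtain ⟨η₀, hη₀, hR, hN⟩ := exists_norm_resOp hg h0 h1
  obtain ⟨C₁, hC₁, hN1⟩ := hN 1
  set η := min (min ηl ηr) (min η₀ (2 * C₁)⁻¹) with hη
  have hm : ∀ {η'}, η ≤ η' → ∀ q ∈ (potPair hg).adm δ₁ η,
      q.1 ≤ η' * ((potPair hg).dep q.2 * √((potPair hg).dep q.2)) := fun h q hq =>
    (WellPair.adm_mono le_rfl h hq).2.2
  have hle0 : η ≤ η₀ := (min_le_right _ _).trans (min_le_left _ _)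
  have hlel : η ≤ ηl := (min_le_left _ _).trans (min_le_left _ _)
  refine ⟨η, ⟨hg.halfWell_left, hg.halfWell_right, hl, hr, ⟨c, C, hb⟩, ⟨c', C', hb'⟩,
    lt_min (lt_min hηl.1 hηr.1) (lt_min hη₀.1 (by positivity)), hlel.trans hηl.2,
    fun q hq => (hql _ hq.1 _ hq.2.1 (hm hlel q hq)).1,
    fun q hq => (hqr _ hq.1 _ hq.2.1
      (hm ((min_le_left _ _).trans (min_le_right _ _)) q hq)).1,
    fun q hq => (hN1 _ _ hq.1 hq.2.1 (hm hle0 q hq)).trans ?_, fun N => ?_⟩, fun q hq =>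
    (hR _ _ hq.1 hq.2.1 (hm hle0 q hq)).2⟩
  · have e1 : (potPair hg).small q ≤ (2 * C₁)⁻¹ :=
      (WellPair.small_le hq).trans ((min_le_right _ _).trans (min_le_right _ _))
    rw [pow_one]
    calc C₁ * (potPair hg).small q ≤ C₁ * (2 * C₁)⁻¹ := mul_le_mul_of_nonneg_left e1 hC₁.le
      _ = 1 / 2 := by field_simp
  · obtain ⟨C₂, -, hN2⟩ := hN N
    exact ⟨C₂, fun q hq => hN2 _ _ hq.1 hq.2.1 (hm hle0 q hq)⟩

/-- `c` is the overlap of a maximizing vector of the resolvent with its image. -/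
def HasOverlap (g : S1 → ℂ) (h : ℝ) (z : ℂ) (c : ℝ) : Prop :=
  ∃ (R : L2S1 →L[ℂ] L2S1) (Λ : ℝ) (f : L2S1), IsResolvent (opPsub g h z) R ∧ PairBound R Λ ∧
    Λ ≤ 3 / 2 * ‖R‖ ^ 2 ∧ 0 < ‖R‖ ∧ ‖f‖ = 1 ∧ ‖R f‖ = ‖R‖ ∧ ‖inner ℂ f (R f)‖ / ‖R‖ = c

/-- The overlap of the lowest pair for energies below the mean. -/
theorem exists_overlap (hg : IsPotential g a b) {δ₃ : ℝ} (h0 : 0 < δ₃)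
    (h1 : δ₃ < meanIm g - imLift g a) :
    ∃ η : ℝ, 0 < η ∧ (∀ q ∈ (potPair hg).adm δ₃ η,
      HasOverlap g q.1 q.2 ((potPair hg).len q.2 * √((potPair hg).M q.1 q.2)
          * (1 + (potPair hg).K q.1 q.2))) ∧
      ∀ n, JetBound n (fun (i : (potPair hg).adm δ₃ η) => (potPair hg).K i.1.1)
        (fun i => i.1.2) (fun i => (potPair hg).scale i.1)
        (fun i => √((potPair hg).small i.1)) := by
  set W := potPair hg with hWdef
  -- Room is needed twice: for the balls of the Cauchy estimates and for those of the interpolation.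
  obtain ⟨δ₂, h32, h2⟩ := exists_between h1
  obtain ⟨δ₁, h21, h1'⟩ := exists_between h2
  obtain ⟨η₁, hW, hR⟩ := exists_good hg (h0.trans (h32.trans h21)) h1'
  obtain ⟨η₂', hη2', hle2', D, hD, hT⟩ := hW.exists_T_le (h0.trans h32) h21
  set η₂ := η₂' / 2 with hη2def
  have hη2 : 0 < η₂ := by positivity
  have hη12 : η₂ < η₁ := by linarith
  have hT' : ∀ q ∈ W.adm δ₂ η₂, ∀ y ∈ Metric.ball q.2 (W.scale q), (q.1, y) ∈ W.adm δ₁ η₁ ∧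
        W.T q.1 y ≤ D * W.T q.1 q.2 := fun q hq =>
    hT q (WellPair.adm_mono le_rfl (by linarith) hq)
  have hmean : ∀ q ∈ W.adm δ₁ η₁, q.2.im ≠ meanIm g := fun q hq => by
    have : q.2.im - imLift g a ≤ δ₁ := hq.1.2
    intro h
    linarith
  have hderiv : ∀ q ∈ W.adm δ₁ η₁, HasDerivAt (fun w => resOp hg.smooth q.1 w)
      (resOp hg.smooth q.1 q.2 * resOp hg.smooth q.1 q.2) q.2 := fun q hq =>
    hasDerivAt_resOp hg.smooth hq.2.1.ne' (hmean q hq)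
  have hTj : ∀ n, JetBound n (fun (i : W.adm δ₂ η₂) y => W.T i.1.1 y / W.T i.1.1 i.1.2)
      (fun i => i.1.2) (fun i => W.scale i.1) 1 := fun n =>
    JetBound.sq_norm (R := fun (i : W.adm δ₂ η₂) w => resOp hg.smooth i.1.1 w) (C := √D)
      (fun i => WellPair.scale_pos i.2)
      (fun i y hy => (hderiv _ (hT' i.1 i.2 y hy).1).differentiableAt.differentiableWithinAt)
      (fun i y hy => by
        have := (hT' i.1 i.2 y hy).2
        change ‖resOp hg.smooth i.1.1 y‖ ^ 2 ≤ D * ‖resOp hg.smooth i.1.1 i.1.2‖ ^ 2 at this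
        refine (sq_le_sq₀ (norm_nonneg _) (by positivity)).1 ?_
        rw [mul_pow, Real.sq_sqrt hD.le]
        exact this)
      (fun i y hy => (hR _ (hT' i.1 i.2 y hy).1).1)
      (fun i y hy => (hR _ (hT' i.1 i.2 y hy).1).2) n
  obtain ⟨η₃, hη3, hle3, hY⟩ := hW.jets_Y h21 hη12 hη2 hTj h32 h0
  obtain ⟨η₄, hη4, hle4, hK⟩ := hW.jets_K (h32.trans h21).le (hle3.trans hη12.le) hη3 hY
  refine ⟨η₄, hη4, fun q hq => ?_, hK⟩
  have hq2 : q ∈ W.adm δ₂ η₂ := WellPair.adm_mono h32.le (hle4.trans hle3) hq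
  have hq1 : q ∈ W.adm δ₁ η₁ := WellPair.adm_mono h21.le hη12.le hq2
  obtain ⟨hpos, Λ, hΛ, hΛb⟩ := hR q hq1
  obtain ⟨f, hf, hf'⟩ := hΛb.exists_maximizer hΛ hpos
  have hTd : DifferentiableAt ℝ (W.T q.1) q.2 := by
    have e1 := ((hTj 0).1 ⟨q, hq2⟩).differentiableAt (by simp)
    have hne : W.T q.1 q.2 ≠ 0 := (hW.pos hq1).2.2.2.2.ne'
    refine (e1.mul_const (W.T q.1 q.2)).congr_of_eventuallyEq (Eventually.of_forall fun y => ?_)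
    exact (div_mul_cancel₀ _ hne).symm
  have hres := isResolvent_resOp hg.smooth hq.2.1.ne'
    (exp_prim_period_ne_one hg.smooth hq.2.1.ne' (hmean q hq1))
  -- The gradient of `‖R‖²` is computed in two ways, through the maximizing vector and through the
  -- Laplace asymptotics; comparing them gives the overlap.
  have e2 := norm_fderiv_sq_norm (hderiv q hq1) hTd hf hf'
  have e3 := hW.norm_fderiv_T hq1 hTd
  refine ⟨_, Λ, f, hres, hΛb, hΛ, hpos, hf, hf', ?_⟩
  have e4 : ‖fderiv ℝ (W.T q.1) q.2‖ = 2 * ‖resOp hg.smooth q.1 q.2‖ ^ 2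
    * ‖inner ℂ f (resOp hg.smooth q.1 q.2 f)‖ := e2
  have e5 : W.T q.1 q.2 = ‖resOp hg.smooth q.1 q.2‖ ^ 2 := rfl
  rw [e3, e5, Real.sqrt_sq hpos.le] at e4
  rw [div_eq_iff hpos.ne']
  have h6 : 0 < 2 * ‖resOp hg.smooth q.1 q.2‖ ^ 2 := by positivity
  refine mul_left_cancel₀ h6.ne' ?_
  rw [← e4]
  ring

end Lower

/-! ### Symbol range, turning points, action and Poisson brackets in terms of the half wells. -/

section Classical

variable {g : S1 → ℂ} {a b : ℝ}

namespace IsPotential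

theorem sigmaSet_eq (hg : IsPotential g a b) :
    sigmaSet g = Complex.im ⁻¹' Icc (imLift g a) (imLift g b) := by
  have hr : (range fun q : ℝ × ℝ => symbol g q.1 q.2)
      = Complex.im ⁻¹' Icc (imLift g a) (imLift g b) := by
    ext z
    constructor
    · rintro ⟨q, rfl⟩
      have : (symbol g q.1 q.2).im = imLift g q.1 := by simp [symbol, imLift]
      rw [mem_preimage, this]
      exact hg.mem_Icc q.1
    · intro hz
      obtain ⟨x, -, hx⟩ := intermediate_value_Icc hg.lt_ab.le hg.continuous.continuousOn hz
      refine ⟨(x, z.re - (g (x : S1)).re), Complex.ext (by simp [symbol]) ?_⟩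
      rw [← hx]
      simp [symbol, imLift]
  rw [sigmaSet, hr]
  exact (isClosed_Icc.preimage Complex.continuous_im).closure_eq

theorem mem_interior_sigmaSet (hg : IsPotential g a b) {z : ℂ} :
    z ∈ interior (sigmaSet g) ↔ z.im ∈ Ioo (imLift g a) (imLift g b) := by
  rw [hg.sigmaSet_eq, Complex.interior_preimage_im, interior_Icc, mem_preimage]

theorem bdDist_eq (hg : IsPotential g a b) {z : ℂ} (hz : z ∈ sigmaSet g) :
    bdDist g z = min (z.im - imLift g a) (imLift g b - z.im) := by
  rw [hg.sigmaSet_eq] at hz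
  rw [bdDist, hg.sigmaSet_eq, Complex.frontier_preimage_im, frontier_Icc hg.min_lt_max.le]
  have hmem : ∀ s ∈ ({imLift g a, imLift g b} : Set ℝ),
      Metric.infDist z (Complex.im ⁻¹' {imLift g a, imLift g b}) ≤ |z.im - s| := fun s hs => by
    have h1 : (⟨z.re, s⟩ : ℂ) ∈ Complex.im ⁻¹' ({imLift g a, imLift g b} : Set ℝ) := hs
    refine (Metric.infDist_le_dist_of_mem h1).trans (le_of_eq ?_)
    rw [Complex.dist_of_re_eq (show z.re = (⟨z.re, s⟩ : ℂ).re from rfl), Real.dist_eq]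
  refine le_antisymm (le_min ?_ ?_) ?_
  · have := hmem (imLift g a) (by simp)
    rwa [abs_of_nonneg (by linarith [hz.1])] at this
  · have := hmem (imLift g b) (by simp)
    rwa [abs_sub_comm, abs_of_nonneg (by linarith [hz.2])] at this
  · refine (Metric.le_infDist ⟨⟨0, imLift g a⟩, by simp⟩).2 fun w hw => ?_
    have h1 : |z.im - w.im| ≤ dist z w := by
      rw [← Complex.sub_im, dist_eq_norm]
      exact Complex.abs_im_le_norm _
    rcases hw with hw | hw
    · rw [hw] at h1
      exact (min_le_left _ _).trans ((le_abs_self _).trans h1)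
    · rw [hw, abs_sub_comm] at h1
      exact (min_le_right _ _).trans ((le_abs_self _).trans h1)

theorem deriv_periodic (g : S1 → ℂ) : Function.Periodic (deriv (imLift g)) (2 * Real.pi) :=
  fun x => by
    rw [← deriv_comp_add_const]
    congr 1
    exact funext (imLift_periodic g)

/-- The turning points are those of the two half wells, up to a common period. -/
theorem exists_turning (hg : IsPotential g a b) {z : ℂ} {xp xm : ℝ}
    (h : IsTurningPair g z xp xm) (hz : z.im ∈ Ioo (imLift g a) (imLift g b)) :
    ∃ n : ℤ, xp = a - wellX (wellLeft (imLift g) a) (a - b + 2 * Real.pi) (z.im - imLift g a)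
        + n * (2 * Real.pi) ∧
      xm = a + wellX (wellRight (imLift g) a) (b - a) (z.im - imLift g a)
        + n * (2 * Real.pi) := by
  have hpi := Real.two_pi_pos
  have hab := hg.lt_ab
  have hba := hg.lt_ba
  obtain ⟨hL1, hL2⟩ := hg.halfWell_left.wellX_spec (δ := z.im - imLift g a)
    (by linarith [hz.1]) (by rw [wellLeft_end]; linarith [hz.2])
  obtain ⟨hR1, hR2⟩ := hg.halfWell_right.wellX_spec (δ := z.im - imLift g a)
    (by linarith [hz.1]) (by rw [wellRight_end]; linarith [hz.2])
  set XL := wellX (wellLeft (imLift g) a) (a - b + 2 * Real.pi) (z.im - imLift g a)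
  set XR := wellX (wellRight (imLift g) a) (b - a) (z.im - imLift g a)
  -- Both points are moved to the period `[b - 2π, b)`, where the sign of the derivative decides on
  -- which side of `a` they lie.
  have hshift : ∀ x : ℝ, ∃ n : ℤ, x + n * (2 * Real.pi) ∈ Ico (b - 2 * Real.pi) b ∧
      imLift g (x + n * (2 * Real.pi)) = imLift g x ∧
      deriv (imLift g) (x + n * (2 * Real.pi)) = deriv (imLift g) x := fun x => by
    obtain ⟨n, hn, -⟩ := existsUnique_add_zsmul_mem_Ico hpi x (b - 2 * Real.pi)
    rw [sub_add_cancel, zsmul_eq_mul] at hn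
    exact ⟨n, hn, (imLift_periodic g).int_mul n x, (deriv_periodic g).int_mul n x⟩
  have hb0 : deriv (imLift g) (b - 2 * Real.pi) = 0 := by
    have := deriv_periodic g (b - 2 * Real.pi)
    rw [sub_add_cancel] at this
    rw [← this]
    exact (hg.critical_iff b).2 (Or.inr rfl)
  obtain ⟨n, hn, hn1, hn2⟩ := hshift xp
  obtain ⟨j, hj, hj1, hj2⟩ := hshift xm
  set yp := xp + n * (2 * Real.pi) with hyp
  set ym := xm + j * (2 * Real.pi) with hym
  have hyp1 : yp < a := by
    by_contra! hc
    rcases hc.eq_or_lt with hc | hc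
    · have := h.deriv_xp
      rw [← hn2, ← hc, hg.deriv_min] at this
      exact this.ne rfl
    · have := hg.deriv_pos yp ⟨hc, hn.2⟩
      rw [hn2] at this
      linarith [h.deriv_xp]
  have hym1 : a < ym := by
    by_contra! hc
    have hd := h.deriv_xm
    rw [← hj2] at hd
    rcases hj.1.eq_or_lt with hc' | hc'
    · rw [← hc', hb0] at hd
      exact hd.ne rfl
    · rcases hc.eq_or_lt with hc | hc
      · rw [hc, hg.deriv_min] at hd
        exact hd.ne rfl
      · linarith [hg.deriv_neg ym ⟨hc', hc⟩]
  have e1 : a - yp = XL := by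
    refine hg.halfWell_left.strictMonoOn.injOn ⟨by linarith, by linarith [hn.1]⟩
      (Ioo_subset_Icc_self hL1) ?_
    rw [hL2, wellLeft, sub_sub_cancel, hn1, h.im_xp]
  have e2 : ym - a = XR := by
    refine hg.halfWell_right.strictMonoOn.injOn ⟨by linarith, by linarith [hj.2]⟩
      (Ioo_subset_Icc_self hR1) ?_
    rw [hR2, wellRight, add_sub_cancel, hj1, h.im_xm]
  have h1 := h.lt_xp
  have h2 := h.xp_lt
  -- Both turning points are moved by the same number of periods, because the given representatives
  -- satisfy `x₋ - 2π < x₊ < x₋`.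
  have h3 : (n : ℝ) = j := by
    have k1 : ((j - n : ℤ) : ℝ) * (2 * Real.pi) < 1 * (2 * Real.pi) := by
      push_cast
      linarith [hL1.2, hR1.2]
    have k2 : ((-1 : ℤ) : ℝ) * (2 * Real.pi) < ((j - n : ℤ) : ℝ) * (2 * Real.pi) := by
      push_cast
      linarith [hL1.1, hR1.1]
    have k3 : j - n < 1 := by exact_mod_cast lt_of_mul_lt_mul_right k1 hpi.le
    have k4 : -1 < j - n := by exact_mod_cast lt_of_mul_lt_mul_right k2 hpi.le
    have : n = j := by omega
    rw [this]
  refine ⟨-n, ?_, ?_⟩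
  · push_cast
    linarith
  · push_cast
    rw [h3]
    linarith

theorem integral_im (hg : IsPotential g a b) (z : ℂ) (x y : ℝ) :
    (∫ s in x..y, (z - g (s : S1))).im = ∫ s in x..y, (z.im - imLift g s) := by
  have hc : Continuous fun s : ℝ => z - g (s : S1) := continuous_const.sub hg.smooth.continuous
  exact (Complex.imCLM.intervalIntegral_comp_comm (hc.intervalIntegrable x y)).symm

/-- Below the mean the action is the sum of the actions of the two half wells. -/
theorem action_eq (hg : IsPotential g a b) {z : ℂ} {xp xm : ℂ → ℝ}
    (h : IsTurningPair g z (xp z) (xm z)) (hz : z.im ∈ Ioo (imLift g a) (imLift g b))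
    (hm : z.im ≤ meanIm g) :
    action g xp xm z = wellP (wellLeft (imLift g) a) (a - b + 2 * Real.pi) (z.im - imLift g a)
      + wellP (wellRight (imLift g) a) (b - a) (z.im - imLift g a) := by
  have hpi := Real.two_pi_pos
  obtain ⟨n, h1, h2⟩ := hg.exists_turning h hz
  have hc : Continuous fun s => z.im - imLift g s := continuous_const.sub hg.continuous
  have hi : ∀ x y, IntervalIntegrable (fun s => z.im - imLift g s) volume x y := fun x y =>
    hc.intervalIntegrable x y
  have hper : Function.Periodic (fun s => z.im - imLift g s) (2 * Real.pi) := fun s => by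
    simp only [imLift_periodic g s]
  -- The two integrals competing in the minimum differ by `2π (Im z - ⟨Im g⟩)`, so below the mean
  -- the one through the minimum `a` is the smaller.
  have e1 : ∫ s in (xm z - 2 * Real.pi)..(xm z), (z.im - imLift g s)
      = 2 * Real.pi * (z.im - meanIm g) := by
    have k1 := hper.intervalIntegral_add_eq (xm z - 2 * Real.pi) 0
    rw [sub_add_cancel, zero_add] at k1
    rw [k1, intervalIntegral.integral_sub (by simp) (hg.continuous.intervalIntegrable _ _),
      intervalIntegral.integral_const, meanIm]
    simp only [sub_zero, smul_eq_mul]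
    field_simp
  have e2 : ∫ s in (xp z)..(xm z), (z.im - imLift g s)
      = wellP (wellLeft (imLift g) a) (a - b + 2 * Real.pi) (z.im - imLift g a)
      + wellP (wellRight (imLift g) a) (b - a) (z.im - imLift g a) := by
    rw [h1, h2, wellP, wellP]
    set XL := wellX (wellLeft (imLift g) a) (a - b + 2 * Real.pi) (z.im - imLift g a)
    set XR := wellX (wellRight (imLift g) a) (b - a) (z.im - imLift g a)
    rw [← intervalIntegral.integral_comp_add_right
      (f := fun s => z.im - imLift g s) (d := (n : ℝ) * (2 * Real.pi))]
    simp only [(imLift_periodic g).int_mul n _]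
    rw [← intervalIntegral.integral_add_adjacent_intervals (hi _ a) (hi a _)]
    have k1 := intervalIntegral.integral_comp_sub_left (a := 0) (b := XL)
      (fun s => z.im - imLift g s) a
    have k2 := intervalIntegral.integral_comp_add_left (a := 0) (b := XR)
      (fun s => z.im - imLift g s) a
    rw [sub_zero] at k1
    rw [add_zero] at k2
    rw [← k1, ← k2]
    have k3 : Continuous fun s => wellLeft (imLift g) a s :=
      hg.halfWell_left.smooth.continuous
    have k4 : Continuous fun s => wellRight (imLift g) a s :=
      hg.halfWell_right.smooth.continuous
    congr 1
    · calc _ = ∫ s in (0 : ℝ)..XL, (z.im - imLift g a - wellLeft (imLift g) a s) := by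
            refine intervalIntegral.integral_congr fun s _ => ?_
            rw [wellLeft]
            ring
        _ = _ := by
            rw [intervalIntegral.integral_sub (by simp) (k3.intervalIntegrable _ _),
              intervalIntegral.integral_const, sub_zero, smul_eq_mul, mul_comm]
    · calc _ = ∫ s in (0 : ℝ)..XR, (z.im - imLift g a - wellRight (imLift g) a s) := by
            refine intervalIntegral.integral_congr fun s _ => ?_
            rw [wellRight]
            ring
        _ = _ := by
            rw [intervalIntegral.integral_sub (by simp) (k4.intervalIntegrable _ _),
              intervalIntegral.integral_const, sub_zero, smul_eq_mul, mul_comm]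
  have e3 := intervalIntegral.integral_add_adjacent_intervals
    (hi (xp z) (xm z - 2 * Real.pi)) (hi (xm z - 2 * Real.pi) (xm z))
  rw [e1] at e3
  rw [action, hg.integral_im, hg.integral_im, ← e2, min_eq_left]
  nlinarith

theorem poisson_eq (hg : IsPotential g a b) (x ξ : ℝ) :
    Complex.I / 2 * poisson (symbol g) (symbolConj g) x ξ = ((deriv (imLift g) x : ℝ) : ℂ) ∧
      Complex.I / 2 * poisson (symbolConj g) (symbol g) x ξ = ((-deriv (imLift g) x : ℝ) : ℂ) := by
  have hd := (hg.smooth.differentiable (by simp) x).hasDerivAt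
  set g' := deriv (fun x : ℝ => g (x : S1)) x
  have him : deriv (imLift g) x = g'.im :=
    (Complex.imCLM.hasFDerivAt.comp_hasDerivAt x hd).deriv
  have k1 : deriv (fun t => symbol g x t) ξ = 1 :=
    ((Complex.ofRealCLM.hasDerivAt (x := ξ)).add_const _).deriv.trans (by simp)
  have k2 : deriv (fun s => symbol g s ξ) x = g' := (hd.const_add _).deriv
  have k3 : deriv (fun t => symbolConj g x t) ξ = 1 := by
    have : (fun t => symbolConj g x t) = fun t : ℝ => (t : ℂ) + starRingEnd ℂ (g (x : S1)) := by
      ext t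
      simp [symbolConj, symbol]
    rw [this]
    exact ((Complex.ofRealCLM.hasDerivAt (x := ξ)).add_const _).deriv.trans (by simp)
  have k4 : deriv (fun s => symbolConj g s ξ) x = starRingEnd ℂ g' :=
    (Complex.conjCLE.toContinuousLinearMap.hasFDerivAt.comp_hasDerivAt x (hd.const_add _)).deriv
  rw [poisson, poisson, k1, k2, k3, k4, him]
  constructor <;> apply Complex.ext <;> simp <;> ring

/-- The leading term in terms of the half wells. -/
theorem leading_eq (hg : IsPotential g a b) {xp xm : ℂ → ℝ}
    (hx : ∀ z ∈ interior (sigmaSet g), IsTurningPair g z (xp z) (xm z)) {z : ℂ} {h : ℝ}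
    (hh : 0 < h) (hz : z.im ∈ Ioo (imLift g a) (imLift g b)) (hm : z.im < meanIm g) :
    leadingCoeff g xp xm h z * Real.exp (-(action g xp xm z) / h)
      = (potPair hg).len z * √((potPair hg).M h z) := by
  have hL := hg.halfWell_left
  have hR := hg.halfWell_right
  have hδ : 0 < z.im - imLift g a := by linarith [hz.1]
  have hδL : z.im - imLift g a < wellLeft (imLift g) a (a - b + 2 * Real.pi) := by
    rw [wellLeft_end]; linarith [hz.2]
  have hδR : z.im - imLift g a < wellRight (imLift g) a (b - a) := by
    rw [wellRight_end]; linarith [hz.2]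
  have hturn := hx z (hg.mem_interior_sigmaSet.2 hz)
  have hact := hg.action_eq hturn hz hm.le
  -- The identity for the action holds in a neighbourhood of `Im z`, still below the mean, and the
  -- derivatives of the two half actions are the turning points.
  have hd : dImAction g xp xm z = (potPair hg).len z := by
    have k1 := ((hL.wellP_hasDerivAt hδ hδL).comp_sub_const z.im (imLift g a)).add
      ((hR.wellP_hasDerivAt hδ hδR).comp_sub_const z.im (imLift g a))
    refine HasDerivAt.deriv (k1.congr_of_eventuallyEq ?_)
    filter_upwards [isOpen_Ioo.mem_nhds hz, gt_mem_nhds hm] with t ht htm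
    have him : ((z.re : ℂ) + (t : ℂ) * Complex.I).im = t := by simp
    have := hg.action_eq (hx ((z.re : ℂ) + (t : ℂ) * Complex.I)
      (hg.mem_interior_sigmaSet.2 (by rw [him]; exact ht))) (by rw [him]; exact ht)
      (by rw [him]; exact htm.le)
    rw [him] at this
    exact this
  -- Each bracket is minus the slope of its half well, hence negative; the two signs cancel in the
  -- product.
  have hbr : (bracketProd g z (xp z) (xm z)).re
      = HalfWell.slope (wellLeft (imLift g) a) (a - b + 2 * Real.pi) (z.im - imLift g a)
        * HalfWell.slope (wellRight (imLift g) a) (b - a) (z.im - imLift g a) := by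
    obtain ⟨n, h1, h2⟩ := hg.exists_turning hturn hz
    have k1 : deriv (imLift g) (xp z)
        = -HalfWell.slope (wellLeft (imLift g) a) (a - b + 2 * Real.pi) (z.im - imLift g a) := by
      rw [h1, (deriv_periodic g).int_mul n, HalfWell.slope, eq_comm, neg_eq_iff_eq_neg]
      exact (((hg.hasDerivAt _).comp_const_sub a _).sub_const _).deriv
    have k2 : deriv (imLift g) (xm z)
        = HalfWell.slope (wellRight (imLift g) a) (b - a) (z.im - imLift g a) := by
      rw [h2, (deriv_periodic g).int_mul n, HalfWell.slope, eq_comm]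
      exact (((hg.hasDerivAt _).comp_const_add a _).sub_const _).deriv
    rw [bracketProd, (hg.poisson_eq _ _).1, (hg.poisson_eq _ _).2, k1, k2,
      ← Complex.ofReal_mul, Complex.ofReal_re]
    ring
  have hlen : 0 < (potPair hg).len z :=
    add_pos (hL.wellX_spec hδ hδL).1.1 (hR.wellX_spec hδ hδR).1.1
  have hM : (potPair hg).M h z = wellNorm (wellLeft (imLift g) a) (a - b + 2 * Real.pi) h
      (z.im - imLift g a) * wellNorm (wellRight (imLift g) a) (b - a) h (z.im - imLift g a) := rfl
  rw [leadingCoeff, hd, abs_of_pos hlen, hbr, hact, hM, wellNorm, wellNorm]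
  have hα := hL.slope_pos hδ hδL
  have hβ := hR.slope_pos hδ hδR
  set α := HalfWell.slope (wellLeft (imLift g) a) (a - b + 2 * Real.pi) (z.im - imLift g a)
  set β := HalfWell.slope (wellRight (imLift g) a) (b - a) (z.im - imLift g a)
  set P := wellP (wellLeft (imLift g) a) (a - b + 2 * Real.pi) (z.im - imLift g a)
  set P' := wellP (wellRight (imLift g) a) (b - a) (z.im - imLift g a)
  have hpi := Real.pi_pos
  -- Both sides are nonnegative, so it suffices to compare squares.
  have key : (α * β) ^ (1 / 4 : ℝ) / √(Real.pi * h) * Real.exp (-(P + P') / h)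
      = √(Real.exp (-(2 / h * P)) * √(α / (Real.pi * h))
        * (Real.exp (-(2 / h * P')) * √(β / (Real.pi * h)))) := by
    rw [eq_comm, Real.sqrt_eq_iff_mul_self_eq (by positivity) (by positivity)]
    symm
    have k1 : (α * β) ^ (1 / 4 : ℝ) * (α * β) ^ (1 / 4 : ℝ) = √(α * β) := by
      rw [← Real.rpow_add (by positivity), Real.sqrt_eq_rpow]
      norm_num
    have k2 : Real.exp (-(P + P') / h) * Real.exp (-(P + P') / h)
        = Real.exp (-(2 / h * P)) * Real.exp (-(2 / h * P')) := by
      rw [← Real.exp_add, ← Real.exp_add]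
      congr 1
      ring
    have k3 : √(α / (Real.pi * h)) * √(β / (Real.pi * h)) = √(α * β) / (Real.pi * h) := by
      rw [← Real.sqrt_mul (by positivity), div_mul_div_comm, Real.sqrt_div (by positivity),
        Real.sqrt_mul_self (by positivity)]
    have k4 : √(Real.pi * h) * √(Real.pi * h) = Real.pi * h := Real.mul_self_sqrt (by positivity)
    calc _ = ((α * β) ^ (1 / 4 : ℝ) * (α * β) ^ (1 / 4 : ℝ)) / (√(Real.pi * h) * √(Real.pi * h))
          * (Real.exp (-(P + P') / h) * Real.exp (-(P + P') / h)) := by ring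
      _ = (√(α / (Real.pi * h)) * √(β / (Real.pi * h)))
          * (Real.exp (-(2 / h * P)) * Real.exp (-(2 / h * P'))) := by rw [k1, k2, k3, k4]
      _ = _ := by ring
  rw [← key]
  ring

end IsPotential

end Classical

/-! ### Uniform statement below the mean, in terms of the distance to the boundary. -/

/-- The points of `Σ` well below the mean and not too close to the boundary. -/
def lowSet (g : S1 → ℂ) (κ A h : ℝ) : Set ℂ :=
  {z | z ∈ sigmaSet g ∧ z.im < meanIm g - κ ∧ A * h ^ (2 / 3 : ℝ) < bdDist g z}

/-- The origin of the exponent 2/3: the admissibility condition `h ≤ η d^{3/2}` is `d ≥ η^{-2/3}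
h^{2/3}`, so `A` is taken to be `η^{-2/3}`. -/
theorem le_mul_mul_sqrt {η h d : ℝ} (hη : 0 < η) (hh : 0 < h)
    (h1 : η ^ (-(2 / 3) : ℝ) * h ^ (2 / 3 : ℝ) < d) : h ≤ η * (d * √d) := by
  have hd : 0 < d := lt_trans (by positivity) h1
  have e1 : d * √d = d ^ (3 / 2 : ℝ) := by
    rw [Real.sqrt_eq_rpow]
    nth_rewrite 1 [← Real.rpow_one d]
    rw [← Real.rpow_add hd]
    norm_num
  have e2 := Real.rpow_le_rpow (by positivity) h1.le (by norm_num : (0 : ℝ) ≤ 3 / 2)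
  rw [Real.mul_rpow (by positivity) (by positivity), ← Real.rpow_mul hη.le,
    ← Real.rpow_mul hh.le] at e2
  norm_num at e2
  rw [Real.rpow_neg_one, inv_mul_le_iff₀ hη] at e2
  rw [e1]
  exact e2

/-- Translates jets of weight `√(h/d^{3/2})` at scale `h/√d` into the powers of the theorem: the
quotient of the weight by `(h/√d)^k` is `d^{k/2-3/4} h^{-k+1/2}`. -/
theorem le_rpow_mul_rpow {h d x B : ℝ} {k : ℕ} (hh : 0 < h) (hd : 0 < d)
    (h1 : x * (h / √d) ^ k ≤ B * √(h / (d * √d))) :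
    x ≤ B * (d ^ ((k : ℝ) / 2 - 3 / 4) * h ^ (-(k : ℝ) + 1 / 2)) := by
  have hs := Real.sqrt_pos.2 hd
  have e1 : √(h / (d * √d)) = (d ^ ((k : ℝ) / 2 - 3 / 4) * h ^ (-(k : ℝ) + 1 / 2))
      * (h / √d) ^ k := by
    rw [Real.sqrt_eq_rpow, Real.sqrt_eq_rpow, Real.div_rpow hh.le (by positivity),
      Real.mul_rpow hd.le (by positivity), ← Real.rpow_mul hd.le, ← Real.rpow_natCast,
      Real.div_rpow hh.le (by positivity), ← Real.rpow_mul hd.le, ← Real.rpow_add hd,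
      Real.rpow_sub hd, Real.rpow_add hh, Real.rpow_neg hh.le]
    have e2 : (1 / 2 + 1 / 2 * (1 / 2) : ℝ) = 3 / 4 := by norm_num
    have e3 : (1 / 2 * (k : ℝ)) = k / 2 := by ring
    rw [e2, e3]
    have e4 : h ^ (k : ℝ) ≠ 0 := (Real.rpow_pos_of_pos hh _).ne'
    have e5 : d ^ ((k : ℝ) / 2) ≠ 0 := (Real.rpow_pos_of_pos hd _).ne'
    field_simp
  rw [e1, ← mul_assoc] at h1
  exact le_of_mul_le_mul_right h1 (by positivity)

/-- The jets of `K` are controlled by the depth over the minimum, whereas the statement uses the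
distance to the boundary. Below the mean the two are comparable, since such energies stay a fixed
distance below the maximum of `Im g`. -/
theorem exists_lower {g : S1 → ℂ} {a b : ℝ} (hg : IsPotential g a b) {xp xm : ℂ → ℝ}
    (hx : ∀ z ∈ interior (sigmaSet g), IsTurningPair g z (xp z) (xm z)) {κ : ℝ} (hκ : 0 < κ) :
    ∃ A > (0 : ℝ), ∃ K : ℝ → ℂ → ℝ,
      (∀ h > 0, ∀ z ∈ lowSet g κ A h, ContDiffAt ℝ ∞ (K h) z ∧
        HasOverlap g h z (leadingCoeff g xp xm h z * (1 + K h z)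
          * Real.exp (-(action g xp xm z) / h))) ∧
      ∀ k : ℕ, ∃ B : ℝ, ∀ h > 0, ∀ z ∈ lowSet g κ A h, ‖iteratedFDeriv ℝ k (K h) z‖
        ≤ B * bdDist g z ^ ((k : ℝ) / 2 - 3 / 4) * h ^ (-(k : ℝ) + 1 / 2) := by
  have hsig : ∀ z ∈ sigmaSet g, z.im ∈ Icc (imLift g a) (imLift g b) := fun z hz => by
    rw [hg.sigmaSet_eq] at hz
    exact hz
  by_cases hmean : imLift g a < meanIm g
  swap
  · have hempty : ∀ A h, ∀ z ∈ lowSet g κ A h, False := fun A h z hz => by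
      linarith [(hsig z hz.1).1, hz.2.1]
    exact ⟨1, one_pos, 0, fun h _ z hz => (hempty 1 h z hz).elim,
      fun k => ⟨0, fun h _ z hz => (hempty 1 h z hz).elim⟩⟩
  -- The first entry covers the depths of the set; the second keeps `δ` positive when `κ` is large
  -- and the set is empty.
  set δ := max (meanIm g - imLift g a - κ) ((meanIm g - imLift g a) / 2) with hδ
  have hδ0 : 0 < δ := lt_max_of_lt_right (by linarith)
  have hδ1 : δ < meanIm g - imLift g a := max_lt (by linarith) (by linarith)
  obtain ⟨η, hη, hov, hjet⟩ := exists_overlap hg hδ0 hδ1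
  have hmb := hg.meanIm_le
  set γ := imLift g b - imLift g a - δ with hγ
  have hγ0 : 0 < γ := by rw [hγ]; linarith
  set W := potPair hg with hW
  have hdep : ∀ z, W.dep z = z.im - imLift g a := fun z => rfl
  have hkey : ∀ h > 0, ∀ z ∈ lowSet g κ (η ^ (-(2 / 3) : ℝ)) h, (h, z) ∈ W.adm δ η ∧
      0 < bdDist g z ∧ bdDist g z ≤ W.dep z ∧ W.dep z ≤ (1 + δ / γ) * bdDist g z ∧
      z.im ∈ Ioo (imLift g a) (imLift g b) := fun h hh z hz => by
    have e0 := hg.bdDist_eq hz.1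
    have e1 : bdDist g z ≤ W.dep z := by rw [e0]; exact min_le_left _ _
    have e1' : bdDist g z ≤ imLift g b - z.im := by rw [e0]; exact min_le_right _ _
    have e2 : 0 < bdDist g z := lt_trans (by positivity) hz.2.2
    have e3 : W.dep z ≤ δ := by
      rw [hdep]
      exact le_trans (by linarith [hz.2.1]) (le_max_left _ _)
    refine ⟨⟨⟨e2.trans_le e1, e3⟩, hh, le_mul_mul_sqrt hη hh (hz.2.2.trans_le e1)⟩, e2, e1, ?_,
      by linarith [hdep z], by linarith⟩
    have hq : 0 < δ / γ := by positivity
    -- If the lower boundary is the nearer one, depth and distance coincide. Otherwise the distance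
    -- is at least `γ` while the depth is at most `δ`.
    rcases min_choice (z.im - imLift g a) (imLift g b - z.im) with h1 | h1
    · rw [← e0] at h1
      rw [h1, ← hdep]
      nlinarith
    · rw [← e0] at h1
      have h2 : γ ≤ bdDist g z := by rw [h1, hγ]; linarith [hdep z]
      have h3 : δ / γ * γ = δ := by field_simp
      nlinarith
  refine ⟨η ^ (-(2 / 3) : ℝ), by positivity, W.K, fun h hh z hz => ?_, fun k => ?_⟩
  · obtain ⟨hq, -, -, -, hz2⟩ := hkey h hh z hz
    refine ⟨(hjet 0).1 ⟨_, hq⟩, ?_⟩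
    have e1 := hg.leading_eq hx hh hz2 (by linarith [hz.2.1])
    have e2 : leadingCoeff g xp xm h z * (1 + W.K h z) * Real.exp (-(action g xp xm z) / h)
        = W.len z * √(W.M h z) * (1 + W.K h z) := by rw [mul_right_comm, e1]
    rw [e2]
    exact hov (h, z) hq
  · obtain ⟨B, hB⟩ := (hjet k).2 k le_rfl
    set e := (k : ℝ) / 2 - 3 / 4 with he
    refine ⟨|B| * max 1 ((1 + δ / γ) ^ e), fun h hh z hz => ?_⟩
    obtain ⟨hq, h1, h2, h3, -⟩ := hkey h hh z hz
    have hd0 := h1.trans_le h2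
    have h4 := le_rpow_mul_rpow hh hd0 (hB ⟨_, hq⟩)
    have hh' := Real.rpow_pos_of_pos hh (-(k : ℝ) + 1 / 2)
    have hs' := Real.rpow_pos_of_pos h1 e
    have h5 : W.dep z ^ e ≤ max 1 ((1 + δ / γ) ^ e) * bdDist g z ^ e := by
      -- The exponent `k/2 - 3/4` is negative for `k ≤ 1`, so its sign decides which side of the
      -- comparison between depth and distance is used.
      rcases le_total 0 e with h0 | h0
      · refine (Real.rpow_le_rpow hd0.le h3 h0).trans ?_
        rw [Real.mul_rpow (by positivity) h1.le]
        exact mul_le_mul_of_nonneg_right (le_max_right _ _) hs'.le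
      · refine (Real.rpow_le_rpow_of_nonpos h1 h2 h0).trans ?_
        exact le_mul_of_one_le_left hs'.le (le_max_left _ _)
    have hd' := Real.rpow_pos_of_pos hd0 e
    calc _ ≤ B * (W.dep z ^ e * h ^ (-(k : ℝ) + 1 / 2)) := h4
      _ ≤ |B| * ((max 1 ((1 + δ / γ) ^ e) * bdDist g z ^ e) * h ^ (-(k : ℝ) + 1 / 2)) := by
          refine mul_le_mul (le_abs_self B) (mul_le_mul_of_nonneg_right h5 hh'.le) (by positivity)
            (abs_nonneg B)
      _ = _ := by ring

/-- The potential `-g(-x)` of the reflected operator. -/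
def reflPot (g : S1 → ℂ) (x : S1) : ℂ := -g (-x)

/-! ### Reflection of the circle, exchanging energies above and below the mean. -/

section Reflection

variable {g : S1 → ℂ} {a b : ℝ}

theorem reflPot_reflPot (g : S1 → ℂ) : reflPot (reflPot g) = g := by
  ext x
  simp [reflPot]

theorem imLift_reflPot (g : S1 → ℂ) (x : ℝ) : imLift (reflPot g) x = -imLift g (-x) := by
  simp [imLift, reflPot]

theorem deriv_imLift_reflPot (g : S1 → ℂ) (x : ℝ) :
    deriv (imLift (reflPot g)) x = deriv (imLift g) (-x) := by
  rw [funext (imLift_reflPot g), deriv.fun_neg, deriv_comp_neg, neg_neg]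

theorem IsPotential.refl (hg : IsPotential g a b) : IsPotential (reflPot g) (-b) (-a) where
  smooth := by
    have h1 : ContDiff ℝ ∞ fun x : ℝ => -g ((-x : ℝ) : S1) := (hg.smooth.comp contDiff_neg).neg
    simpa [reflPot] using h1
  lt_ab := neg_lt_neg hg.lt_ab
  lt_ba := by linarith [hg.lt_ba]
  critical_iff x := by
    rw [deriv_imLift_reflPot, hg.critical_iff, or_comm, AddCircle.coe_neg, AddCircle.coe_neg,
      AddCircle.coe_neg, neg_eq_iff_eq_neg, neg_eq_iff_eq_neg]
  min_lt_max := by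
    rw [imLift_reflPot, imLift_reflPot, neg_neg, neg_neg]
    exact neg_lt_neg hg.min_lt_max
  nondegenerate_min := by
    rw [funext (deriv_imLift_reflPot g), deriv_comp_neg, neg_neg]
    exact neg_ne_zero.2 hg.nondegenerate_max
  nondegenerate_max := by
    rw [funext (deriv_imLift_reflPot g), deriv_comp_neg, neg_neg]
    exact neg_ne_zero.2 hg.nondegenerate_min

theorem integral_neg_period {E : Type*} [NormedAddCommGroup E] [NormedSpace ℝ E] {F : ℝ → E}
    (hF : Function.Periodic F (2 * Real.pi)) :
    ∫ x in (0 : ℝ)..(2 * Real.pi), F (-x) = ∫ x in (0 : ℝ)..(2 * Real.pi), F x := by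
  rw [intervalIntegral.integral_comp_neg, neg_zero]
  have := hF.intervalIntegral_add_eq (-(2 * Real.pi)) 0
  rwa [neg_add_cancel, zero_add] at this

theorem meanIm_reflPot (g : S1 → ℂ) : meanIm (reflPot g) = -meanIm g := by
  rw [meanIm, meanIm, funext (imLift_reflPot g), intervalIntegral.integral_neg,
    integral_neg_period (imLift_periodic g), mul_neg]

theorem mem_sigmaSet_reflPot (hg : IsPotential g a b) {z : ℂ} :
    -z ∈ sigmaSet (reflPot g) ↔ z ∈ sigmaSet g := by
  rw [hg.sigmaSet_eq, hg.refl.sigmaSet_eq, mem_preimage, mem_preimage, imLift_reflPot,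
    imLift_reflPot, neg_neg, neg_neg, Complex.neg_im, mem_Icc, mem_Icc, neg_le_neg_iff,
    neg_le_neg_iff, and_comm]

theorem bdDist_reflPot (hg : IsPotential g a b) {z : ℂ} (hz : z ∈ sigmaSet g) :
    bdDist (reflPot g) (-z) = bdDist g z := by
  rw [hg.bdDist_eq hz, hg.refl.bdDist_eq ((mem_sigmaSet_reflPot hg).2 hz), imLift_reflPot,
    imLift_reflPot, neg_neg, neg_neg, Complex.neg_im, min_comm]
  congr 1 <;> ring

/-- The derivative of the reflected imaginary part is `(Im g)'(-x)`, so each point keeps its role.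
The reflection reverses the order, which the shift of `x₋` by a period restores. -/
theorem isTurningPair_reflPot (hg : IsPotential g a b) {xp xm : ℂ → ℝ}
    (hx : ∀ z ∈ interior (sigmaSet g), IsTurningPair g z (xp z) (xm z)) {z : ℂ}
    (hz : z ∈ interior (sigmaSet (reflPot g))) :
    IsTurningPair (reflPot g) z (-xp (-z)) (-xm (-z) + 2 * Real.pi) := by
  have hz' : -z ∈ interior (sigmaSet g) := by
    rw [hg.refl.mem_interior_sigmaSet, imLift_reflPot, imLift_reflPot, neg_neg, neg_neg] at hz
    rw [hg.mem_interior_sigmaSet, Complex.neg_im]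
    exact ⟨by linarith [hz.2], by linarith [hz.1]⟩
  obtain ⟨h1, h2, h3, h4, h5, h6⟩ := hx _ hz'
  rw [Complex.neg_im] at h1 h2
  refine ⟨?_, ?_, ?_, ?_, by linarith, by linarith⟩
  · rw [imLift_reflPot, neg_neg, h1, neg_neg]
  · rw [imLift_periodic, imLift_reflPot, neg_neg, h2, neg_neg]
  · rwa [deriv_imLift_reflPot, neg_neg]
  · rwa [IsPotential.deriv_periodic, deriv_imLift_reflPot, neg_neg]

/-- The two paths from `x₊` are interchanged, so the minimum is unchanged. -/
theorem action_reflPot (g : S1 → ℂ) (xp xm : ℂ → ℝ) (z : ℂ) :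
    action (reflPot g) (fun w => -xp (-w)) (fun w => -xm (-w) + 2 * Real.pi) z
      = action g xp xm (-z) := by
  have key : ∀ x y : ℝ, ∫ s in (-x)..(-y), (z - reflPot g (s : S1))
      = ∫ s in x..y, (-z - g (s : S1)) := fun x y => by
    rw [← intervalIntegral.integral_comp_neg (fun s : ℝ => z - reflPot g (s : S1)),
      intervalIntegral.integral_symm, ← intervalIntegral.integral_neg]
    refine intervalIntegral.integral_congr fun s _ => ?_
    simp only [reflPot, AddCircle.coe_neg, neg_neg]
    ring
  rw [action, action, min_comm, add_sub_cancel_right, key,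
    show -xm (-z) + 2 * Real.pi = -(xm (-z) - 2 * Real.pi) by ring, key]

theorem leadingCoeff_reflPot (hg : IsPotential g a b) (xp xm : ℂ → ℝ) (h : ℝ) (z : ℂ) :
    leadingCoeff (reflPot g) (fun w => -xp (-w)) (fun w => -xm (-w) + 2 * Real.pi) h z
      = leadingCoeff g xp xm h (-z) := by
  have e1 : dImAction (reflPot g) (fun w => -xp (-w)) (fun w => -xm (-w) + 2 * Real.pi) z
      = -dImAction g xp xm (-z) := by
    rw [dImAction, dImAction, Complex.neg_im, ← deriv_comp_neg]
    congr 1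
    ext t
    rw [action_reflPot]
    congr 1
    push_cast
    simp
    ring
  have e2 : ∀ ζ : ℂ, (bracketProd (reflPot g) z (-xp ζ) (-xm ζ + 2 * Real.pi)).re
      = (bracketProd g ζ (xp ζ) (xm ζ)).re := fun ζ => by
    rw [bracketProd, bracketProd, (hg.refl.poisson_eq _ _).1, (hg.refl.poisson_eq _ _).2,
      (hg.poisson_eq _ _).1, (hg.poisson_eq _ _).2, IsPotential.deriv_periodic,
      deriv_imLift_reflPot, deriv_imLift_reflPot, neg_neg, neg_neg]
  rw [leadingCoeff, leadingCoeff, e1, abs_neg, e2]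

/-! ### The reflection on `L²` -/

theorem measurePreserving_neg_S1 : MeasurePreserving (fun x : S1 => -x) volume volume :=
  Measure.measurePreserving_neg _

/-- The reflection `u(x) ↦ u(-x)`. -/
def reflL2 : L2S1 →ₗᵢ[ℂ] L2S1 := Lp.compMeasurePreservingₗᵢ ℂ _ measurePreserving_neg_S1

theorem coeFn_reflL2 (u : L2S1) : ∀ᵐ x : S1, reflL2 u x = u (-x) :=
  Lp.coeFn_compMeasurePreserving u measurePreserving_neg_S1

theorem reflL2_reflL2 (u : L2S1) : reflL2 (reflL2 u) = u := by
  refine Lp.ext ?_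
  filter_upwards [coeFn_reflL2 (reflL2 u),
    measurePreserving_neg_S1.quasiMeasurePreserving.ae (coeFn_reflL2 u)] with x h1 h2
  rw [h1, h2, neg_neg]

theorem integral_reflL2_mul (u : L2S1) {φ : ℝ → ℂ} (hφ : Function.Periodic φ (2 * Real.pi)) :
    ∫ x in (0 : ℝ)..(2 * Real.pi), reflL2 u (x : S1) * φ x
      = ∫ x in (0 : ℝ)..(2 * Real.pi), u (x : S1) * φ (-x) := by
  have hp : Function.Periodic (fun x : ℝ => u (x : S1) * φ (-x)) (2 * Real.pi) := fun x => by
    have h1 : φ (-(x + 2 * Real.pi)) = φ (-x) := by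
      rw [← hφ (-(x + 2 * Real.pi))]
      congr 1
      ring
    simp only [h1, AddCircle.coe_add_period]
  rw [← integral_neg_period hp]
  refine intervalIntegral.integral_congr_ae_restrict ?_
  filter_upwards [ae_lift (coeFn_reflL2 u)] with x hx
  rw [hx, neg_neg, AddCircle.coe_neg]

theorem HasWeakDeriv.refl {u v : L2S1} (h : HasWeakDeriv u v) :
    HasWeakDeriv (reflL2 u) (-reflL2 v) := by
  intro φ hφ hp
  have hd : Function.Periodic (deriv φ) (2 * Real.pi) := fun x => by
    rw [← deriv_comp_add_const]
    congr 1
    exact funext hp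
  have h1 := h (fun x => φ (-x)) (hφ.comp contDiff_neg) fun x => by
    change φ (-(x + 2 * Real.pi)) = φ (-x)
    rw [← hp (-(x + 2 * Real.pi))]
    congr 1
    ring
  have h2 := integral_smul_mul (-1) (reflL2 v) φ
  rw [neg_one_smul] at h2
  rw [h2, integral_reflL2_mul u hd, integral_reflL2_mul v hp, neg_mul, one_mul, neg_neg]
  simp only [deriv_comp_neg, mul_neg, intervalIntegral.integral_neg, neg_inj] at h1
  exact h1

theorem graphP_refl {h : ℝ} {u w : L2S1} (huw : (u, w) ∈ graphP g h) :
    (reflL2 u, -reflL2 w) ∈ graphP (reflPot g) h := by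
  obtain ⟨v, hv, hw⟩ := huw
  refine ⟨-reflL2 v, hv.refl, ?_⟩
  filter_upwards [coeFn_reflL2 u, coeFn_reflL2 v, coeFn_reflL2 w, Lp.coeFn_neg (reflL2 v),
    Lp.coeFn_neg (reflL2 w), measurePreserving_neg_S1.quasiMeasurePreserving.ae hw]
    with x h1 h2 h3 h4 h5 h6
  rw [h4, h5, Pi.neg_apply, Pi.neg_apply, h1, h2, h3, h6, reflPot]
  ring

theorem graphP_refl_iff {h : ℝ} {u w : L2S1} :
    (reflL2 u, -reflL2 w) ∈ graphP (reflPot g) h ↔ (u, w) ∈ graphP g h := by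
  refine ⟨fun h1 => ?_, graphP_refl⟩
  have := graphP_refl h1
  rwa [reflPot_reflPot, map_neg, neg_neg, reflL2_reflL2, reflL2_reflL2] at this

/-- Conjugation by the reflection turns `P_h - z` into minus the operator with the reflected
potential at `-z`. The resolvents thus correspond up to a unitary and a sign, which leave norms,
pair bounds and the modulus of the overlap unchanged. -/
theorem HasOverlap.of_refl (hg : IsPotential g a b) {h c : ℝ} {z : ℂ}
    (ho : HasOverlap (reflPot g) h (-z) c) : HasOverlap g h z c := by
  obtain ⟨R, Λ, f, hR, hΛ, hΛ', h0, hf, hf', hc⟩ := ho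
  let U : L2S1 →L[ℂ] L2S1 := reflL2.toContinuousLinearMap
  have hU : ∀ u, U u = reflL2 u := fun _ => rfl
  set R' : L2S1 →L[ℂ] L2S1 := -(U ∘L R ∘L U) with hR'
  have hap : ∀ u, R' u = -reflL2 (R (reflL2 u)) := fun _ => rfl
  have hn : ∀ u, ‖R' u‖ = ‖R (reflL2 u)‖ := fun u => by
    rw [hap, norm_neg, reflL2.norm_map]
  have hnorm : ‖R'‖ = ‖R‖ := by
    refine le_antisymm (ContinuousLinearMap.opNorm_le_bound _ (norm_nonneg _) fun u => ?_)
      (ContinuousLinearMap.opNorm_le_bound _ (norm_nonneg _) fun u => ?_)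
    · rw [hn, ← reflL2.norm_map u]
      exact R.le_opNorm _
    · have := R'.le_opNorm (reflL2 u)
      rwa [hn, reflL2_reflL2, reflL2.norm_map] at this
  refine ⟨R', Λ, reflL2 f, ⟨dense_domain hg.smooth, fun u v => ?_⟩, fun p q hpq => ?_, ?_, ?_, ?_,
    ?_, ?_⟩
  · have h1 := hR.iff (reflL2 u) (-reflL2 v)
    rw [opPsub_apply_iff] at h1 ⊢
    have h2 : -reflL2 v + -z • reflL2 u = -reflL2 (v + z • u) := by
      rw [map_add, map_smul, neg_add, neg_smul]
    rw [h2, graphP_refl_iff] at h1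
    rw [h1, hap]
    constructor
    · intro h3
      rw [← reflL2_reflL2 u, h3, map_neg, map_neg]
    · intro h3
      rw [h3, map_neg, reflL2_reflL2, map_neg]
  · have := hΛ (reflL2 p) (reflL2 q) (by rw [reflL2.inner_map_map]; exact hpq)
    rw [hn, hn]
    rwa [reflL2.norm_map, reflL2.norm_map] at this
  · rwa [hnorm]
  · rwa [hnorm]
  · rwa [reflL2.norm_map]
  · rw [hn, reflL2_reflL2, hnorm, hf']
  · rw [hap, reflL2_reflL2, inner_neg_right, norm_neg, reflL2.inner_map_map, hnorm, hc]

end Reflection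

end Hager

end

/-! ### Gluing of the results below and above the mean. -/

theorem mainTheorem7
    (g : Hager.S1 → ℂ) (a b : ℝ) (hg : Hager.IsPotential g a b)
    (xp xm : ℂ → ℝ)
    (hx : ∀ z ∈ interior (Hager.sigmaSet g), Hager.IsTurningPair g z (xp z) (xm z))
    (Ω : Set ℂ) (hΩo : IsOpen Ω) (hΩb : Bornology.IsBounded Ω) (hΩ : Ω ⊆ Hager.sigmaSet g)
    (C : ℝ) (hC : 0 < C) :
    ∃ A > (0 : ℝ), ∃ h₀ > (0 : ℝ), ∃ K : ℝ → ℂ → ℝ,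
      (∀ h ∈ Set.Ioo 0 h₀,
        ContDiffOn ℝ (⊤ : ℕ∞) (K h) (Hager.region g Ω C A h) ∧
        ∀ z ∈ Hager.region g Ω C A h,
          (∃ e₀ f₀, Hager.IsLowestPair g h z e₀ f₀) ∧
          ∀ e₀ f₀, Hager.IsLowestPair g h z e₀ f₀ →
            ‖inner ℂ f₀ e₀‖
              = Hager.leadingCoeff g xp xm h z * (1 + K h z)
                * Real.exp (-(Hager.action g xp xm z) / h)) ∧
      ∀ m n : ℕ, ∃ B : ℝ, ∀ h ∈ Set.Ioo 0 h₀, ∀ z ∈ Hager.region g Ω C A h,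
        ‖Hager.wirtinger m n (fun w => ((K h w : ℝ) : ℂ)) z‖
          ≤ B * Hager.bdDist g z ^ (((m + n : ℕ) : ℝ) / 2 - 3 / 4)
              * h ^ (-((m + n : ℕ) : ℝ) + 1 / 2) := by
  have hg' := hg.refl
  have hκ : 0 < 1 / C := by positivity
  obtain ⟨A₁, hA₁, K₁, hK₁, hB₁⟩ := Hager.exists_lower hg hx hκ
  obtain ⟨A₂, -, K₂, hK₂, hB₂⟩ := Hager.exists_lower hg'
    (xp := fun w => -xp (-w)) (xm := fun w => -xm (-w) + 2 * Real.pi)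
    (fun z hz => Hager.isTurningPair_reflPot hg hx hz) hκ
  have hcases : ∀ h > 0, ∀ z ∈ Hager.region g Ω C (max A₁ A₂) h,
      (z.im < Hager.meanIm g ∧ z ∈ Hager.lowSet g (1 / C) A₁ h) ∨
      (Hager.meanIm g < z.im ∧ z ∈ Hager.sigmaSet g ∧
        -z ∈ Hager.lowSet (Hager.reflPot g) (1 / C) A₂ h) := by
    intro h hh z hz
    have hzs := hΩ hz.1
    have hh' := Real.rpow_pos_of_pos hh (2 / 3)
    rcases lt_abs.1 hz.2.2 with h1 | h1
    · refine Or.inr ⟨by linarith, hzs, (Hager.mem_sigmaSet_reflPot hg).2 hzs, ?_, ?_⟩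
      · rw [Hager.meanIm_reflPot, Complex.neg_im]
        linarith
      · rw [Hager.bdDist_reflPot hg hzs]
        exact (mul_le_mul_of_nonneg_right (le_max_right _ _) hh'.le).trans_lt hz.2.1
    · exact Or.inl ⟨by linarith, hzs, by linarith,
        (mul_le_mul_of_nonneg_right (le_max_left _ _) hh'.le).trans_lt hz.2.1⟩
  -- The region stays away from the line `Im z = ⟨Im g⟩`, so near each of its points `K` coincides
  -- with one of the two smooth pieces.
  let K : ℝ → ℂ → ℝ := fun h z => if z.im < Hager.meanIm g then K₁ h z else K₂ h (-z)
  have hlow : ∀ h z, z.im < Hager.meanIm g → K h =ᶠ[nhds z] K₁ h := fun h z hz => by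
    filter_upwards [Complex.continuous_im.continuousAt.eventually_lt_const hz] with w hw
    exact if_pos hw
  have hupp : ∀ h z, Hager.meanIm g < z.im → K h =ᶠ[nhds z] fun w => K₂ h (-w) :=
    fun h z hz => by
      filter_upwards [Complex.continuous_im.continuousAt.eventually_const_lt hz] with w hw
      exact if_neg hw.not_gt
  have hKs : ∀ h > 0, ∀ z ∈ Hager.region g Ω C (max A₁ A₂) h,
      ContDiffAt ℝ ∞ (K h) z ∧ Hager.HasOverlap g h z (Hager.leadingCoeff g xp xm h z
        * (1 + K h z) * Real.exp (-(Hager.action g xp xm z) / h)) := by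
    intro h hh z hz
    rcases hcases h hh z hz with ⟨h1, h2⟩ | ⟨h1, -, h2⟩
    · obtain ⟨r1, r2⟩ := hK₁ h hh z h2
      refine ⟨r1.congr_of_eventuallyEq (hlow h z h1), ?_⟩
      rw [(hlow h z h1).eq_of_nhds]
      exact r2
    · obtain ⟨r1, r2⟩ := hK₂ h hh (-z) h2
      refine ⟨(ContDiffAt.comp z r1 contDiff_neg.contDiffAt).congr_of_eventuallyEq
        (hupp h z h1), ?_⟩
      rw [(hupp h z h1).eq_of_nhds]
      rw [Hager.leadingCoeff_reflPot hg, Hager.action_reflPot, neg_neg] at r2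
      exact r2.of_refl hg
  -- All smallness of `h` is already contained in `d(z) > A h^{2/3}`, so any `h₀` serves.
  refine ⟨max A₁ A₂, lt_max_of_lt_left hA₁, 1, one_pos, K, fun h hh => ⟨fun z hz =>
    (hKs h hh.1 z hz).1.contDiffWithinAt, fun z hz => ?_⟩, fun m n => ?_⟩
  · obtain ⟨R, Λ, f, hR, hΛ, hΛ', h0, hf, hf', hc⟩ := (hKs h hh.1 z hz).2
    obtain ⟨r1, r2⟩ := Hager.isLowestPair_of_isResolvent hR hΛ hΛ' h0 hf hf'
    exact ⟨r1, fun e₀ f₀ hef => (r2 e₀ f₀ hef).trans hc⟩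
  · obtain ⟨B₁, hB₁⟩ := hB₁ (m + n)
    obtain ⟨B₂, hB₂⟩ := hB₂ (m + n)
    refine ⟨max B₁ B₂, fun h hh z hz => ?_⟩
    have hd : 0 ≤ Hager.bdDist g z := Metric.infDist_nonneg
    have hp := mul_nonneg (Real.rpow_nonneg hd (((m + n : ℕ) : ℝ) / 2 - 3 / 4))
      (Real.rpow_nonneg hh.1.le (-((m + n : ℕ) : ℝ) + 1 / 2))
    have e1 := (hKs h hh.1 z hz).1
    have e2 : ContDiffAt ℝ ∞ (fun w => ((K h w : ℝ) : ℂ)) z :=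
      Complex.ofRealCLM.contDiff.contDiffAt.comp z e1
    refine (Hager.norm_wirtinger_le e2 m n).trans ?_
    have e3 := Complex.ofRealCLM.norm_iteratedFDeriv_comp_left e1 (n := m + n)
      (by exact_mod_cast le_top)
    rw [Complex.ofRealCLM_norm, one_mul] at e3
    refine e3.trans ?_
    rw [mul_assoc]
    rcases hcases h hh.1 z hz with ⟨h1, h2⟩ | ⟨h1, h2, h3⟩
    · rw [((hlow h z h1).iteratedFDeriv ℝ (m + n)).eq_of_nhds]
      refine (hB₁ h hh.1 z h2).trans ?_
      rw [mul_assoc]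
      exact mul_le_mul_of_nonneg_right (le_max_left _ _) hp
    · rw [((hupp h z h1).iteratedFDeriv ℝ (m + n)).eq_of_nhds]
      have e4 := (LinearIsometryEquiv.neg ℝ (E := ℂ)).norm_iteratedFDeriv_comp_right (K₂ h) z
        (m + n)
      refine (e4.trans_le (hB₂ h hh.1 (-z) h3)).trans ?_
      rw [Hager.bdDist_reflPot hg h2, mul_assoc]
      exact mul_le_mul_of_nonneg_right (le_max_right _ _) hp
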